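/- Let $\mathbb R^n_s$ be $\mathbb R^n$ with $\langle x,x\rangle=\sum_{i\le n-s}x_i^2-\sum_{i>n-s}x_i^2$, and let $Q^4_1\subset\mathbb RP^5$ be the projectivized light cone of $\mathbb R^6_2$, on which $O(4,2)$ acts by conformal transformations. Embed $\mathbb R^4_1$ in $Q^4_1$ by $x\mapsto\varphi_0(x)=\big[\tfrac{-1+\langle x,x\rangle}{2},x,\tfrac{1+\langle x,x\rangle}{2}\big]$; the complement of the image is the light cone at infinity $C_\infty=\{[(a,u,a)]\}$. Let $y:S^2\to Q^4_1$ be a conformal spacelike immersion of the Riemann sphere. In a complex coordinate $z=u+iv$ let $Y$ be its canonical lift ($y=[Y]$, $\langle Y,Y\rangle=0$, $|dY|^2=|dz|^2$), let $N\in V=\mathrm{Span}\{Y,Y_u,Y_v,Y_{z\bar z}\}$ be given by $\langle N,Y_z\rangle=\langle N,N\rangle=0$, $\langle N,Y\rangle=-1$, and let $\kappa$ be the component of $Y_{zz}$ in $V^\perp\otimes\mathbb C$. The surface is null-umbilic if $\langle\kappa,\kappa\rangle\equiv0$, and totally umbilic if $\kappa\equiv0$. The Willmore functional is $W(y)=\frac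 i2\int_{S^2}\langle\kappa,\bar\kappa\rangle\,dz\wedge d\bar z$; it is defined for every spacelike immersion, using the complex structure that the immersion induces. The surface $y$ is Willmore if $\frac{d}{dt}\big|_{t=0}W(y_t)=0$ for every smooth variation $y_t$ of $y=y_0$ through spacelike immersions. The left and right polar surfaces of $y$ are $[L]$ and $[R]$, where $L,R\in V^\perp$ are null with $\langle L,R\rangle=-1$ and $(Y,Y_u,Y_v,N,R,L)$ is positively oriented. Consider two kinds of surfaces: (i) $y$ is a conformal spacelike immersion $S^2\to Q^4_1$ that is, up to a transformation in $O(4,2)$, the conformal compactification of a complete spacelike stationary surface in $\mathbb R^4_1$: there are a finite set $F\subset S^2$ and a complete spacelike immersion $x:S^2\setminus F\to\mathbb R^4_1$ with mean curvature vector $H=0$ such that, up to the transformation, $y=\varphi_0\circ x$ on $S^2\setminus F$ and $y(F)\subset C_\infty$; (ii) $y$ is the left or the right polar surface of a surface of kind (i). Theorem. Every conformal spacelike Willmore sphere $y:S^2\to Q^4_1$ is of kind (i) or of kind (ii). Such a $y$ is of kind (ii) if and only if it is null-umbilic and not totally umbilic. If $y$ is of kind (ii), or more generally null-umbilic, then $W(y)=0$.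 -/

import Mathlib

open scoped ContDiff LinearAlgebra.Projectivization

noncomputable section

namespace LorentzWillmore

/-! ### Pseudo-Euclidean spaces and the conformal space -/

/-- The symmetric bilinear form of `K^n_s`: the first `n - s` coordinates are positive, the last
`s` are negative.  Over `K = ℂ` it is the complex bilinear extension. -/
def psForm {K : Type*} [CommRing K] (s : ℕ) {n : ℕ} (x y : Fin n → K) : K :=
  ∑ i : Fin n, if (i : ℕ) + s < n then x i * y i else -(x i * y i)

/-- The projectivized light cone `Q⁴₁` of `ℝ⁶₂`. -/
def Q41 : Set (ℙ ℝ (Fin 6 → ℝ)) :=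
  {p | ∀ v ∈ p.submodule, psForm 2 v v = 0}

/-- `p = [v]`. -/
def Represents (v : Fin 6 → ℝ) (p : Q41) : Prop :=
  v ≠ 0 ∧ v ∈ (p : ℙ ℝ (Fin 6 → ℝ)).submodule

/-- The group `O(4,2)`. -/
def IsO42 (T : (Fin 6 → ℝ) ≃ₗ[ℝ] (Fin 6 → ℝ)) : Prop :=
  ∀ v w, psForm 2 (T v) (T w) = psForm 2 v w

/-- The light-cone vector `((-1 + ⟨x,x⟩)/2, x, (1 + ⟨x,x⟩)/2)` over a point `x` of `ℝ⁴₁`; its class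
is the image of `x` under the conformal embedding `ℝ⁴₁ → Q⁴₁`. -/
def phi0 (x : Fin 4 → ℝ) : Fin 6 → ℝ :=
  ![(-1 + psForm 1 x x) / 2, x 0, x 1, x 2, x 3, (1 + psForm 1 x x) / 2]

/-! ### The Riemann sphere and its two complex coordinates -/

/-- The two standard complex coordinates of `S² = ℂ ∪ {∞}`, as parametrizations:
`z ↦ z` and `z ↦ 1 / z`. -/
def chart (i : Fin 2) (z : ℂ) : OnePoint ℂ :=
  if i = 0 then (z : OnePoint ℂ) else if z = 0 then OnePoint.infty else ((z⁻¹ : ℂ) : OnePoint ℂ)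

/-! ### Differential calculus in a coordinate `z = u + i v` -/

/-- The partial derivatives `∂/∂u` (`i = 0`) and `∂/∂v` (`i = 1`). -/
def pd {E : Type*} [NormedAddCommGroup E] [NormedSpace ℝ E] (i : Fin 2) (X : ℂ → E) (z : ℂ) : E :=
  fderiv ℝ X z (if i = 0 then 1 else Complex.I)

/-- `X_uu + X_vv = 4 X_{z z̄}`. -/
def lap {E : Type*} [NormedAddCommGroup E] [NormedSpace ℝ E] (X : ℂ → E) (z : ℂ) : E :=
  pd 0 (pd 0 X) z + pd 1 (pd 1 X) z

/-- Complexification of real vectors. -/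
def toC {n : ℕ} (v : Fin n → ℝ) : Fin n → ℂ := fun k => (v k : ℂ)

/-- `F_z = (F_u - i F_v) / 2`. -/
def dz {n : ℕ} (F : ℂ → Fin n → ℂ) (z : ℂ) : Fin n → ℂ :=
  (1 / 2 : ℂ) • (pd 0 F z - Complex.I • pd 1 F z)

/-- `F_{z̄} = (F_u + i F_v) / 2`. -/
def dzbar {n : ℕ} (F : ℂ → Fin n → ℂ) (z : ℂ) : Fin n → ℂ :=
  (1 / 2 : ℂ) • (pd 0 F z + Complex.I • pd 1 F z)

/-- First fundamental form of `X : ℂ → ℝⁿ_s`. -/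
def firstForm (s : ℕ) {n : ℕ} (X : ℂ → Fin n → ℝ) (z : ℂ) : Matrix (Fin 2) (Fin 2) ℝ :=
  Matrix.of fun i j => psForm s (pd i X z) (pd j X z)

/-- Second fundamental form of `X : ℂ → ℝⁿ_s`: the component of `∂ᵢ∂ⱼX` orthogonal to the tangent
plane. -/
def secondForm (s : ℕ) {n : ℕ} (X : ℂ → Fin n → ℝ) (z : ℂ) (i j : Fin 2) : Fin n → ℝ :=
  pd i (pd j X) z -
    ∑ k : Fin 2, ∑ l : Fin 2,
      ((firstForm s X z)⁻¹ k l * psForm s (pd i (pd j X) z) (pd k X z)) • pd l X z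

/-- Mean curvature vector: half the trace of the second fundamental form. -/
def meanCurvature (s : ℕ) {n : ℕ} (X : ℂ → Fin n → ℝ) (z : ℂ) : Fin n → ℝ :=
  (1 / 2 : ℝ) • ∑ i : Fin 2, ∑ j : Fin 2, (firstForm s X z)⁻¹ i j • secondForm s X z i j

/-- Trace-free part of the second fundamental form. -/
def tracelessForm (s : ℕ) {n : ℕ} (X : ℂ → Fin n → ℝ) (z : ℂ) (i j : Fin 2) : Fin n → ℝ :=
  secondForm s X z i j - firstForm s X z i j • meanCurvature s X z

/-! ### Spacelike surfaces `S² → Q⁴₁` -/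

/-- `Y` is a smooth lift of `y` to the light cone over the `i`-th coordinate patch.  A patch is
a copy of the contractible space `ℂ`, so local smooth lifts patch to a lift over all of it. -/
def IsLift (i : Fin 2) (y : OnePoint ℂ → Q41) (Y : ℂ → Fin 6 → ℝ) : Prop :=
  ContDiff ℝ ∞ Y ∧ ∀ z, Represents (Y z) (y (chart i z))

/-- `y` is a smooth spacelike immersion (not necessarily conformal). -/
def IsSpacelikeImmersion (y : OnePoint ℂ → Q41) : Prop :=
  ∀ i, ∃ Y, IsLift i y Y ∧ ∀ z, (firstForm 2 Y z).PosDef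

/-- `y` is a conformal spacelike immersion of the Riemann sphere:
`⟨Y_z, Y_z⟩ = 0` and `⟨Y_z, Y_z̄⟩ > 0`. -/
def IsConformalSpacelike (y : OnePoint ℂ → Q41) : Prop :=
  ∀ i, ∃ Y, IsLift i y Y ∧ ∀ z,
    psForm 2 (dz (fun w => toC (Y w)) z) (dz (fun w => toC (Y w)) z) = 0 ∧
    0 < (psForm 2 (dz (fun w => toC (Y w)) z) (dzbar (fun w => toC (Y w)) z)).re

/-- Canonical lift with respect to the `i`-th coordinate: `|dY|² = |dz|²`. -/
def IsCanonicalLift (i : Fin 2) (y : OnePoint ℂ → Q41) (Y : ℂ → Fin 6 → ℝ) : Prop :=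
  IsLift i y Y ∧ ∀ z, firstForm 2 Y z = 1

/-- For a canonical lift `Y`, the vector `N` of the central sphere with
`⟨N, Y_z⟩ = ⟨N, N⟩ = 0` and `⟨N, Y⟩ = -1`; explicitly
`N = 2 Y_{z z̄} + 2 ⟨Y_{z z̄}, Y_{z z̄}⟩ Y`. -/
def frameN (Y : ℂ → Fin 6 → ℝ) (z : ℂ) : Fin 6 → ℝ :=
  (1 / 2 : ℝ) • lap Y z + (1 / 8 * psForm 2 (lap Y z) (lap Y z)) • Y z

/-- Conformal Hopf differential `κ` of a canonical lift: the component of `Y_zz` normal to the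
central sphere, `κ = Y_zz + (s/2) Y` with `s/2 = ⟨Y_zz, N⟩`. -/
def hopf (Y : ℂ → Fin 6 → ℝ) (z : ℂ) : Fin 6 → ℂ :=
  dz (dz fun w => toC (Y w)) z +
    psForm 2 (dz (dz fun w => toC (Y w)) z) (toC (frameN Y z)) • toC (Y z)

/-- `⟨κ, κ⟩ = 0` everywhere. -/
def IsNullUmbilic (y : OnePoint ℂ → Q41) : Prop :=
  ∀ i Y, IsCanonicalLift i y Y → ∀ z, psForm 2 (hopf Y z) (hopf Y z) = 0

/-- `κ = 0` everywhere. -/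
def IsTotallyUmbilic (y : OnePoint ℂ → Q41) : Prop :=
  ∀ i Y, IsCanonicalLift i y Y → ∀ z, hopf Y z = 0

/-! ### The Willmore functional -/

/-- Density, with respect to `du dv`, of the conformally invariant area form
`(i/2) ⟨κ, κ̄⟩ dz ∧ dz̄` of the surface `[Y]`.  It is written in an arbitrary, not necessarily
conformal, coordinate and for an arbitrary lift, as one eighth of the squared norm of the
trace-free second fundamental form of `Y` times the area density of `Y`; the
component of that form along `Y` is null and orthogonal to the rest.  When `Y` is a canonical
lift this is `⟨κ, κ̄⟩`. -/
def willmoreDensity (Y : ℂ → Fin 6 → ℝ) (z : ℂ) : ℝ :=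
  (1 / 8) * (∑ i : Fin 2, ∑ j : Fin 2, ∑ k : Fin 2, ∑ l : Fin 2,
    (firstForm 2 Y z)⁻¹ i k * (firstForm 2 Y z)⁻¹ j l *
      psForm 2 (tracelessForm 2 Y z i j) (tracelessForm 2 Y z k l)) *
    Real.sqrt (firstForm 2 Y z).det

/-- Some lift over the affine patch; the Willmore density does not depend on its choice. -/
def affineLift (y : OnePoint ℂ → Q41) : ℂ → Fin 6 → ℝ :=
  Classical.epsilon (IsLift 0 y)

/-- The Willmore functional of a spacelike immersion of `S²`; the point `∞` has measure zero. -/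
def willmore (y : OnePoint ℂ → Q41) : ℝ :=
  ∫ z : ℂ, willmoreDensity (affineLift y) z

/-- A smooth variation `y_t`, `|t| < ε`, of `y` through spacelike immersions. -/
structure IsVariation (y : OnePoint ℂ → Q41) (ε : ℝ) (Γ : ℝ → OnePoint ℂ → Q41) : Prop where
  pos : 0 < ε
  zero : Γ 0 = y
  spacelike : ∀ t ∈ Set.Ioo (-ε) ε, IsSpacelikeImmersion (Γ t)
  smooth : ∀ i, ∃ Z : ℝ × ℂ → Fin 6 → ℝ,
    ContDiffOn ℝ ∞ Z (Set.Ioo (-ε) ε ×ˢ Set.univ) ∧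
    ∀ t ∈ Set.Ioo (-ε) ε, ∀ z, Represents (Z (t, z)) (Γ t (chart i z))

/-- `y` is a critical point of the Willmore functional under all variations. -/
def IsWillmore (y : OnePoint ℂ → Q41) : Prop :=
  ∀ ε Γ, IsVariation y ε Γ → HasDerivAt (fun t => willmore (Γ t)) 0 0

/-! ### Complete stationary surfaces in `ℝ⁴₁` and their compactifications -/

/-- `x` is a smooth spacelike immersion of `S² \ F` into `ℝ⁴₁` with mean curvature vector zero. -/
def IsSpacelikeStationary (F : Set (OnePoint ℂ)) (x : OnePoint ℂ → Fin 4 → ℝ) : Prop :=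
  ∀ i, ContDiffOn ℝ ∞ (x ∘ chart i) {z | chart i z ∉ F} ∧
    ∀ z, chart i z ∉ F →
      (firstForm 1 (x ∘ chart i) z).PosDef ∧ meanCurvature 1 (x ∘ chart i) z = 0

/-- `γ` is a `C¹` curve in `S²`. -/
def IsC1Path (γ : ℝ → OnePoint ℂ) : Prop :=
  ∀ t, ∃ (i : Fin 2) (c : ℝ → ℂ), ContDiffAt ℝ 1 c t ∧ γ =ᶠ[nhds t] chart i ∘ c

/-- The metric induced by `x` on `S² \ F` is complete: every divergent path, that is every
path that eventually leaves each compact subset of `S² \ F`, has infinite length. -/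
def IsCompleteSurface (F : Set (OnePoint ℂ)) (x : OnePoint ℂ → Fin 4 → ℝ) : Prop :=
  ∀ γ : ℝ → OnePoint ℂ, IsC1Path γ → (∀ t, γ t ∉ F) →
    (∀ K : Set (OnePoint ℂ), IsCompact K → K ⊆ Fᶜ → ∀ᶠ t in Filter.atTop, γ t ∉ K) →
    ∫⁻ t in Set.Ioi (0 : ℝ),
      ENNReal.ofReal (Real.sqrt (psForm 1 (deriv (x ∘ γ) t) (deriv (x ∘ γ) t))) = ⊤

/-- `y` is, up to a conformal transformation of `Q⁴₁`, the conformal compactification of a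
complete spacelike stationary surface `x : S² \ F → ℝ⁴₁` with `F` finite: off `F` it is the image
of `x`, and the points of `F` go to the light cone at infinity `{[(a, u, a)]}`. -/
def IsCompactifiedStationary (y : OnePoint ℂ → Q41) : Prop :=
  IsConformalSpacelike y ∧
  ∃ (T : (Fin 6 → ℝ) ≃ₗ[ℝ] (Fin 6 → ℝ)) (F : Set (OnePoint ℂ)) (x : OnePoint ℂ → Fin 4 → ℝ),
    IsO42 T ∧ F.Finite ∧ IsSpacelikeStationary F x ∧ IsCompleteSurface F x ∧
    (∀ p ∉ F, Represents (T (phi0 (x p))) (y p)) ∧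
    (∀ p ∈ F, ∃ v, v 0 = v 5 ∧ Represents (T v) (y p))

/-! ### Polar surfaces -/

/-- `L, R` is the null frame of the normal plane of `[Y]` at `z` (with `Y` a canonical lift):
`⟨L,L⟩ = ⟨R,R⟩ = 0`, `⟨L,R⟩ = -1`, both are orthogonal to the central sphere, and
`(Y, Y_u, Y_v, N, R, L)` is positively oriented. -/
structure IsNullNormalFrame (Y : ℂ → Fin 6 → ℝ) (z : ℂ) (L R : Fin 6 → ℝ) : Prop where
  nullL : psForm 2 L L = 0
  nullR : psForm 2 R R = 0
  pairing : psForm 2 L R = -1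
  orthL : psForm 2 L (Y z) = 0 ∧ (∀ i, psForm 2 L (pd i Y z) = 0) ∧ psForm 2 L (frameN Y z) = 0
  orthR : psForm 2 R (Y z) = 0 ∧ (∀ i, psForm 2 R (pd i Y z) = 0) ∧ psForm 2 R (frameN Y z) = 0
  oriented : 0 < (Matrix.of ![Y z, pd 0 Y z, pd 1 Y z, frameN Y z, R, L]).det

/-- `y` is the left polar surface `[L]` of `x`. -/
def IsLeftPolar (x y : OnePoint ℂ → Q41) : Prop :=
  ∀ i Y, IsCanonicalLift i x Y → ∀ z, ∃ L R, IsNullNormalFrame Y z L R ∧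
    Represents L (y (chart i z))

/-- `y` is the right polar surface `[R]` of `x`. -/
def IsRightPolar (x y : OnePoint ℂ → Q41) : Prop :=
  ∀ i Y, IsCanonicalLift i x Y → ∀ z, ∃ L R, IsNullNormalFrame Y z L R ∧
    Represents R (y (chart i z))

/-- `y` is the left or the right polar surface of the conformal compactification of a complete
spacelike stationary surface. -/
def IsPolarOfStationary (y : OnePoint ℂ → Q41) : Prop :=
  ∃ x, IsCompactifiedStationary x ∧ (IsLeftPolar x y ∨ IsRightPolar x y)

end LorentzWillmore

end

/-! The proof gives more than the dichotomy: every Willmore sphere is of kind (i), every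
null-umbilic one is totally umbilic, and none is of kind (ii). Both sides of the stated equivalence
are therefore false for a Willmore sphere, and W vanishes in the null-umbilic case because κ does.

Take a null frame L, R of the normal bundle of a canonical lift. Then Y_zz = -(s/2) Y + κ with κ =
λ_R L + λ_L R, where λ_L is `lam Y L`, and `gam` gives the components γ_R, γ_L of D_z̄ κ. The
Codazzi equation reads D_z̄ λ = γ and the Willmore equation reads D_z̄ γ = -(s̄/2) λ. The latter is
obtained from the variations Y + t f L and Y + t f R alone: L and R are null and orthogonal to Y, so
these stay on the light cone exactly.

It follows that λ_R γ_L - λ_L γ_R, the coefficient of κ ∧ D_z̄ κ, is holomorphic, and once it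
vanishes a quartic coefficient is holomorphic as well. Between the two patches κ changes by the
factor z̄ z⁻³, so both coefficients decay at infinity and Liouville's theorem kills them
(`IsTransition.cubicForm_eq_zero`, `IsTransition.quarticForm_eq_zero`).

Where ⟨κ,κ⟩ = -2 λ_L λ_R is nonzero, the common ratio m = γ/λ satisfies m_z = -⟨κ,κ̄⟩ and m_z̄ =
-s̄/2 - m². These two equations say exactly that N - 2m Y_z - 2m̄ Y_z̄ + 2|m|² Y has a constant
direction C, a null vector lying in every central sphere over a disc. The data are only smooth, so
passing from a disc to the whole surface needs unique continuation for first-order systems |∂̄w| ≤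
M|w|, proved by a Carleman estimate (`unique_continuation`). If ⟨κ,κ⟩ ≡ 0, unique continuation makes
λ_L or λ_R vanish identically. Then one null normal has constant direction, Liouville applied to s,
κ_z̄ and κ gives κ = 0, and N is constant and serves as C (`IsFrame.null_umbilic`). So C always
exists (`IsFrame.exists_dual`).

Move C to the vertex of the light cone at infinity by O(4,2). The lift P = -Y/⟨Y,C⟩ has Laplacian
proportional to C, so its affine coordinate is conformal and harmonic, that is, stationary. The
zeros of ⟨Y,C⟩ are isolated, hence finite in number. The metric |dz|²/⟨Y,C⟩² is complete because the
logarithm of the distance to the cone of C has gradient bounded by a multiple of |dz|/|⟨Y,C⟩|.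

Finally, a polar surface of a stationary surface is orthogonal to the vector C of that surface,
hence null-umbilic. If it were Willmore it would have κ = 0 and N constant, and the tangent plane of
the stationary surface would then lie in a normal plane of signature (1,1), which contains no
spacelike plane (`IsFrame.not_polar`). -/

open scoped ContDiff LinearAlgebra.Projectivization

noncomputable section

namespace LorentzWillmore

section

/-! ### The bilinear form -/

section Form

variable {K : Type*} [CommRing K] {s n : ℕ}

/-- The signs of the diagonal form `psForm s` on `K^n`. -/
def psSign (K : Type*) [CommRing K] (s : ℕ) {n : ℕ} (i : Fin n) : K :=
  if (i : ℕ) + s < n then 1 else -1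

theorem psForm_eq_sum (x y : Fin n → K) :
    psForm s x y = ∑ i, psSign K s i * (x i * y i) := by
  unfold psForm psSign
  refine Finset.sum_congr rfl fun i _ => ?_
  split_ifs <;> ring

theorem psForm_comm (x y : Fin n → K) : psForm s x y = psForm s y x := by
  simp only [psForm_eq_sum, mul_comm (x _)]

theorem psForm_add_left (x y z : Fin n → K) :
    psForm s (x + y) z = psForm s x z + psForm s y z := by
  simp only [psForm_eq_sum, ← Finset.sum_add_distrib, Pi.add_apply]
  exact Finset.sum_congr rfl fun i _ => by ring

theorem psForm_smul_left (c : K) (x z : Fin n → K) :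
    psForm s (c • x) z = c * psForm s x z := by
  simp only [psForm_eq_sum, Finset.mul_sum, Pi.smul_apply, smul_eq_mul]
  exact Finset.sum_congr rfl fun i _ => by ring

theorem psForm_add_right (x y z : Fin n → K) :
    psForm s x (y + z) = psForm s x y + psForm s x z := by
  rw [psForm_comm, psForm_add_left, psForm_comm y, psForm_comm z]

theorem psForm_smul_right (c : K) (x z : Fin n → K) :
    psForm s x (c • z) = c * psForm s x z := by
  rw [psForm_comm, psForm_smul_left, psForm_comm z]

theorem psForm_neg_left (x z : Fin n → K) : psForm s (-x) z = -psForm s x z := by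
  simpa using psForm_smul_left (s := s) (-1) x z

theorem psForm_neg_right (x z : Fin n → K) : psForm s x (-z) = -psForm s x z := by
  simpa using psForm_smul_right (s := s) (-1) x z

theorem psForm_sub_left (x y z : Fin n → K) :
    psForm s (x - y) z = psForm s x z - psForm s y z := by
  rw [sub_eq_add_neg, psForm_add_left, psForm_neg_left, sub_eq_add_neg]

theorem psForm_sub_right (x y z : Fin n → K) :
    psForm s x (y - z) = psForm s x y - psForm s x z := by
  rw [sub_eq_add_neg, psForm_add_right, psForm_neg_right, sub_eq_add_neg]

theorem psForm_zero_left (z : Fin n → K) : psForm s 0 z = 0 := by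
  simpa using psForm_smul_left (s := s) 0 (0 : Fin n → K) z

theorem psForm_zero_right (z : Fin n → K) : psForm s z 0 = 0 := by
  rw [psForm_comm, psForm_zero_left]

end Form

theorem psForm_toC {s n : ℕ} (x y : Fin n → ℝ) :
    psForm s (toC x) (toC y) = ((psForm s x y : ℝ) : ℂ) := by
  simp only [psForm_eq_sum, toC, psSign]
  push_cast
  refine Finset.sum_congr rfl fun i _ => ?_
  split_ifs <;> simp

theorem psForm_star {s n : ℕ} (x y : Fin n → ℂ) :
    psForm s (star x) (star y) = star (psForm s x y) := by
  simp only [psForm_eq_sum, psSign, star_sum, Pi.star_apply]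
  refine Finset.sum_congr rfl fun i _ => ?_
  split_ifs <;> simp

theorem star_toC {n : ℕ} (x : Fin n → ℝ) : star (toC x) = toC x := by
  ext i; simp [toC]

/-! ### Partial and Wirtinger derivatives -/

section Calculus

variable {E : Type*} [NormedAddCommGroup E] [NormedSpace ℝ E]

theorem pd_zero (X : ℂ → E) (z : ℂ) : pd 0 X z = fderiv ℝ X z 1 := by simp [pd]

theorem pd_one (X : ℂ → E) (z : ℂ) : pd 1 X z = fderiv ℝ X z Complex.I := by simp [pd]

theorem contDiff_pd {X : ℂ → E} (h : ContDiff ℝ ∞ X) (i : Fin 2) : ContDiff ℝ ∞ (pd i X) := by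
  unfold pd
  exact (h.fderiv_right (m := ∞) (by simp)).clm_apply contDiff_const

theorem contDiffAt_pd {X : ℂ → E} {z : ℂ} (h : ContDiffAt ℝ ∞ X z) (i : Fin 2) :
    ContDiffAt ℝ ∞ (pd i X) z := by
  unfold pd
  exact (h.fderiv_right (m := ∞) (by simp)).clm_apply contDiffAt_const

theorem contDiff_lap {X : ℂ → E} (h : ContDiff ℝ ∞ X) : ContDiff ℝ ∞ (lap X) :=
  (contDiff_pd (contDiff_pd h 0) 0).add (contDiff_pd (contDiff_pd h 1) 1)

theorem smooth_differentiableAt {X : ℂ → E} (h : ContDiff ℝ ∞ X) (z : ℂ) :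
    DifferentiableAt ℝ X z :=
  (h.differentiable (by simp)) z

theorem smoothAt_differentiableAt {X : ℂ → E} {z : ℂ} (h : ContDiffAt ℝ ∞ X z) :
    DifferentiableAt ℝ X z :=
  h.differentiableAt (by simp)

theorem pd_pd_comm {X : ℂ → E} {z : ℂ} (h : ContDiffAt ℝ ∞ X z) (i j : Fin 2) :
    pd i (pd j X) z = pd j (pd i X) z := by
  have hd : DifferentiableAt ℝ (fderiv ℝ X) z :=
    (h.fderiv_right (m := ∞) (by simp)).differentiableAt (by simp)
  have hs : IsSymmSndFDerivAt ℝ X z := h.isSymmSndFDerivAt (by simp; exact WithTop.coe_le_coe.2 le_top)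
  have key : ∀ (a b : Fin 2), pd a (pd b X) z =
      fderiv ℝ (fderiv ℝ X) z (if a = 0 then 1 else Complex.I)
        (if b = 0 then 1 else Complex.I) := by
    intro a b
    unfold pd
    rw [fderiv_clm_apply hd (differentiableAt_const _)]
    simp
  rw [key, key]
  exact hs _ _

theorem pd_congr {X X' : ℂ → E} {z : ℂ} (h : X =ᶠ[nhds z] X') (i : Fin 2) :
    pd i X z = pd i X' z := by
  unfold pd; rw [h.fderiv_eq]

theorem pd_eventuallyEq {X X' : ℂ → E} {z : ℂ} (h : X =ᶠ[nhds z] X') (i : Fin 2) :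
    pd i X =ᶠ[nhds z] pd i X' := by
  filter_upwards [h.eventuallyEq_nhds] with w hw using pd_congr hw i

theorem pd_add {X X' : ℂ → E} {z : ℂ} (h : DifferentiableAt ℝ X z)
    (h' : DifferentiableAt ℝ X' z) (i : Fin 2) :
    pd i (fun w => X w + X' w) z = pd i X z + pd i X' z := by
  unfold pd; rw [fderiv_fun_add h h']; rfl

theorem pd_sub {X X' : ℂ → E} {z : ℂ} (h : DifferentiableAt ℝ X z)
    (h' : DifferentiableAt ℝ X' z) (i : Fin 2) :
    pd i (fun w => X w - X' w) z = pd i X z - pd i X' z := by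
  unfold pd; rw [fderiv_fun_sub h h']; rfl

theorem pd_const (c : E) (i : Fin 2) (z : ℂ) : pd i (fun _ => c) z = 0 := by
  simp [pd]

theorem pd_smul {K : Type*} [NormedField K] [NormedAlgebra ℝ K] [NormedSpace K E]
    [IsScalarTower ℝ K E] {f : ℂ → K} {X : ℂ → E} {z : ℂ}
    (hf : DifferentiableAt ℝ f z) (h : DifferentiableAt ℝ X z) (i : Fin 2) :
    pd i (fun w => f w • X w) z = pd i f z • X z + f z • pd i X z := by
  unfold pd; rw [fderiv_fun_smul hf h]
  simp [add_comm]

theorem pd_mul {K : Type*} [NormedField K] [NormedAlgebra ℝ K] {f g : ℂ → K} {z : ℂ}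
    (hf : DifferentiableAt ℝ f z) (hg : DifferentiableAt ℝ g z) (i : Fin 2) :
    pd i (fun w => f w * g w) z = pd i f z * g z + f z * pd i g z := by
  simpa using pd_smul hf hg i

theorem pd_clm {E' : Type*} [NormedAddCommGroup E'] [NormedSpace ℝ E'] (T : E →L[ℝ] E')
    {X : ℂ → E} {z : ℂ} (h : DifferentiableAt ℝ X z) (i : Fin 2) :
    pd i (fun w => T (X w)) z = T (pd i X z) := by
  unfold pd
  have := (T.hasFDerivAt.comp z h.hasFDerivAt).fderiv
  simp only [Function.comp_def] at this
  rw [this]; rfl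

section psForm

variable {K : Type*} [NormedField K] [NormedAlgebra ℝ K] {s n : ℕ}

theorem hasFDerivAt_psForm {F G : E → Fin n → K} {F' G' : E →L[ℝ] Fin n → K} {z : E}
    (hF : HasFDerivAt F F' z) (hG : HasFDerivAt G G' z) :
    ∃ D : E →L[ℝ] K, HasFDerivAt (fun w => psForm s (F w) (G w)) D z ∧
      ∀ v, D v = psForm s (F' v) (G z) + psForm s (F z) (G' v) := by
  have hFi := hasFDerivAt_pi'.1 hF
  have hGi := hasFDerivAt_pi'.1 hG
  have h : HasFDerivAt (fun w => ∑ i, psSign K s i * (F w i * G w i)) _ z :=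
    HasFDerivAt.fun_sum (u := Finset.univ) fun i _ => ((hFi i).mul (hGi i)).const_mul (psSign K s i)
  refine ⟨_, by simpa only [psForm_eq_sum] using h, fun v => ?_⟩
  simp only [psForm_eq_sum, ← Finset.sum_add_distrib, _root_.sum_apply]
  refine Finset.sum_congr rfl fun i _ => ?_
  simp
  ring

theorem contDiff_psForm {m : WithTop ℕ∞} {F G : E → Fin n → K}
    (hF : ContDiff ℝ m F) (hG : ContDiff ℝ m G) :
    ContDiff ℝ m fun w => psForm s (F w) (G w) := by
  simp only [psForm_eq_sum]
  have hFi := contDiff_pi.1 hF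
  have hGi := contDiff_pi.1 hG
  exact ContDiff.sum fun i _ => contDiff_const.mul ((hFi i).mul (hGi i))

theorem contDiffAt_psForm {m : WithTop ℕ∞} {F G : E → Fin n → K} {z : E}
    (hF : ContDiffAt ℝ m F z) (hG : ContDiffAt ℝ m G z) :
    ContDiffAt ℝ m (fun w => psForm s (F w) (G w)) z := by
  simp only [psForm_eq_sum]
  have hFi := contDiffAt_pi.1 hF
  have hGi := contDiffAt_pi.1 hG
  exact ContDiffAt.sum fun i _ => contDiffAt_const.mul ((hFi i).mul (hGi i))

theorem pd_psForm {F G : ℂ → Fin n → K} {z : ℂ} (hF : DifferentiableAt ℝ F z)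
    (hG : DifferentiableAt ℝ G z) (i : Fin 2) :
    pd i (fun w => psForm s (F w) (G w)) z = psForm s (pd i F z) (G z) + psForm s (F z) (pd i G z) := by
  obtain ⟨D, hD, h⟩ := hasFDerivAt_psForm (s := s) hF.hasFDerivAt hG.hasFDerivAt
  unfold pd
  rw [hD.fderiv, h]

end psForm

end Calculus

section Wirtinger

variable {E : Type*} [NormedAddCommGroup E] [NormedSpace ℂ E]

/-- `∂F/∂z` for a function with values in a complex normed space. -/
def wz (F : ℂ → E) (z : ℂ) : E := (1 / 2 : ℂ) • (pd 0 F z - Complex.I • pd 1 F z)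

/-- `∂F/∂z̄` for a function with values in a complex normed space. -/
def wzb (F : ℂ → E) (z : ℂ) : E := (1 / 2 : ℂ) • (pd 0 F z + Complex.I • pd 1 F z)

theorem pd_zero_eq (F : ℂ → E) (z : ℂ) : pd 0 F z = wz F z + wzb F z := by
  unfold wz wzb; module

theorem pd_one_eq (F : ℂ → E) (z : ℂ) : pd 1 F z = Complex.I • (wz F z - wzb F z) := by
  unfold wz wzb
  have : Complex.I • (Complex.I • pd 1 F z) = -pd 1 F z := by
    rw [smul_smul, Complex.I_mul_I, neg_one_smul]
  simp only [← smul_sub, smul_comm Complex.I]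
  rw [show pd 0 F z - Complex.I • pd 1 F z - (pd 0 F z + Complex.I • pd 1 F z) =
    (-2 : ℂ) • Complex.I • pd 1 F z by module, smul_comm Complex.I, this]
  module

theorem contDiff_wz {F : ℂ → E} (h : ContDiff ℝ ∞ F) : ContDiff ℝ ∞ (wz F) :=
  ((contDiff_pd h 0).sub ((contDiff_pd h 1).const_smul Complex.I)).const_smul (1 / 2 : ℂ)

theorem contDiff_wzb {F : ℂ → E} (h : ContDiff ℝ ∞ F) : ContDiff ℝ ∞ (wzb F) :=
  ((contDiff_pd h 0).add ((contDiff_pd h 1).const_smul Complex.I)).const_smul (1 / 2 : ℂ)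

theorem wz_congr {F G : ℂ → E} {z : ℂ} (h : F =ᶠ[nhds z] G) : wz F z = wz G z := by
  unfold wz; rw [pd_congr h, pd_congr h]

theorem wzb_congr {F G : ℂ → E} {z : ℂ} (h : F =ᶠ[nhds z] G) : wzb F z = wzb G z := by
  unfold wzb; rw [pd_congr h, pd_congr h]

theorem wz_const (c : E) (z : ℂ) : wz (fun _ => c) z = 0 := by simp [wz, pd_const]

theorem wzb_const (c : E) (z : ℂ) : wzb (fun _ => c) z = 0 := by simp [wzb, pd_const]

theorem wz_add {F G : ℂ → E} {z : ℂ} (hF : DifferentiableAt ℝ F z) (hG : DifferentiableAt ℝ G z) :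
    wz (fun w => F w + G w) z = wz F z + wz G z := by
  unfold wz; rw [pd_add hF hG, pd_add hF hG]; module

theorem wzb_add {F G : ℂ → E} {z : ℂ} (hF : DifferentiableAt ℝ F z)
    (hG : DifferentiableAt ℝ G z) : wzb (fun w => F w + G w) z = wzb F z + wzb G z := by
  unfold wzb; rw [pd_add hF hG, pd_add hF hG]; module

theorem wz_sub {F G : ℂ → E} {z : ℂ} (hF : DifferentiableAt ℝ F z) (hG : DifferentiableAt ℝ G z) :
    wz (fun w => F w - G w) z = wz F z - wz G z := by
  unfold wz; rw [pd_sub hF hG, pd_sub hF hG]; module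

theorem wzb_sub {F G : ℂ → E} {z : ℂ} (hF : DifferentiableAt ℝ F z)
    (hG : DifferentiableAt ℝ G z) : wzb (fun w => F w - G w) z = wzb F z - wzb G z := by
  unfold wzb; rw [pd_sub hF hG, pd_sub hF hG]; module

theorem wz_smul {f : ℂ → ℂ} {F : ℂ → E} {z : ℂ} (hf : DifferentiableAt ℝ f z)
    (hF : DifferentiableAt ℝ F z) :
    wz (fun w => f w • F w) z = wz f z • F z + f z • wz F z := by
  unfold wz; rw [pd_smul hf hF, pd_smul hf hF]
  simp only [smul_eq_mul]; module

theorem wzb_smul {f : ℂ → ℂ} {F : ℂ → E} {z : ℂ} (hf : DifferentiableAt ℝ f z)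
    (hF : DifferentiableAt ℝ F z) :
    wzb (fun w => f w • F w) z = wzb f z • F z + f z • wzb F z := by
  unfold wzb; rw [pd_smul hf hF, pd_smul hf hF]
  simp only [smul_eq_mul]; module

theorem wz_const_smul (c : ℂ) {F : ℂ → E} {z : ℂ} (hF : DifferentiableAt ℝ F z) :
    wz (fun w => c • F w) z = c • wz F z := by
  simpa [wz_const] using wz_smul (differentiableAt_const c) hF

theorem wzb_const_smul (c : ℂ) {F : ℂ → E} {z : ℂ} (hF : DifferentiableAt ℝ F z) :
    wzb (fun w => c • F w) z = c • wzb F z := by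
  simpa [wzb_const] using wzb_smul (differentiableAt_const c) hF

theorem wz_mul {f g : ℂ → ℂ} {z : ℂ} (hf : DifferentiableAt ℝ f z)
    (hg : DifferentiableAt ℝ g z) : wz (fun w => f w * g w) z = wz f z * g z + f z * wz g z := by
  simpa using wz_smul hf hg

theorem wzb_mul {f g : ℂ → ℂ} {z : ℂ} (hf : DifferentiableAt ℝ f z)
    (hg : DifferentiableAt ℝ g z) :
    wzb (fun w => f w * g w) z = wzb f z * g z + f z * wzb g z := by
  simpa using wzb_smul hf hg

theorem wz_psForm {s n : ℕ} {F G : ℂ → Fin n → ℂ} {z : ℂ} (hF : DifferentiableAt ℝ F z)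
    (hG : DifferentiableAt ℝ G z) :
    wz (fun w => psForm s (F w) (G w)) z = psForm s (wz F z) (G z) + psForm s (F z) (wz G z) := by
  unfold wz; rw [pd_psForm hF hG, pd_psForm hF hG]
  simp only [psForm_smul_left, psForm_smul_right, psForm_sub_left, psForm_sub_right, smul_eq_mul]
  ring

theorem wzb_psForm {s n : ℕ} {F G : ℂ → Fin n → ℂ} {z : ℂ} (hF : DifferentiableAt ℝ F z)
    (hG : DifferentiableAt ℝ G z) :
    wzb (fun w => psForm s (F w) (G w)) z =
      psForm s (wzb F z) (G z) + psForm s (F z) (wzb G z) := by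
  unfold wzb; rw [pd_psForm hF hG, pd_psForm hF hG]
  simp only [psForm_smul_left, psForm_smul_right, psForm_add_left, psForm_add_right, smul_eq_mul]
  ring

/-- `∂z ∂z̄ = ∂z̄ ∂z`. -/
theorem wzb_wz_comm {F : ℂ → E} {z : ℂ} (h : ContDiffAt ℝ ∞ F z) :
    wzb (wz F) z = wz (wzb F) z := by
  have h0 := smoothAt_differentiableAt (contDiffAt_pd h 0)
  have h1 := smoothAt_differentiableAt (contDiffAt_pd h 1)
  have a : ∀ i, pd i (wz F) z = (1 / 2 : ℂ) • (pd i (pd 0 F) z - Complex.I • pd i (pd 1 F) z) := by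
    intro i
    have := pd_smul (differentiableAt_const (1 / 2 : ℂ)) (h0.sub (h1.const_smul Complex.I)) i
    simp only [Pi.sub_apply, Pi.smul_apply, pd_const, zero_smul, zero_add] at this
    refine this.trans ?_
    congr 1
    refine (pd_sub h0 (h1.const_smul Complex.I) i).trans ?_
    congr 1
    have := pd_smul (differentiableAt_const Complex.I) h1 i
    simp only [pd_const, zero_smul, zero_add] at this
    exact this
  have b : ∀ i, pd i (wzb F) z = (1 / 2 : ℂ) • (pd i (pd 0 F) z + Complex.I • pd i (pd 1 F) z) := by
    intro i
    have := pd_smul (differentiableAt_const (1 / 2 : ℂ)) (h0.add (h1.const_smul Complex.I)) i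
    simp only [Pi.add_apply, Pi.smul_apply, pd_const, zero_smul, zero_add] at this
    refine this.trans ?_
    congr 1
    refine (pd_add h0 (h1.const_smul Complex.I) i).trans ?_
    congr 1
    have := pd_smul (differentiableAt_const Complex.I) h1 i
    simp only [pd_const, zero_smul, zero_add] at this
    exact this
  rw [wzb, a, a, wz, b, b, pd_pd_comm h 0 1]
  module

end Wirtinger

/-! ### Real functions -/

theorem differentiableAt_toC {n : ℕ} {X : ℂ → Fin n → ℝ} {z : ℂ} (h : DifferentiableAt ℝ X z) :
    DifferentiableAt ℝ (fun w => toC (X w)) z :=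
  differentiableAt_pi.2 fun i =>
    Complex.ofRealCLM.differentiableAt.comp z (differentiableAt_pi.1 h i)

theorem contDiff_toC {n : ℕ} {X : ℂ → Fin n → ℝ} (h : ContDiff ℝ ∞ X) :
    ContDiff ℝ ∞ (fun w => toC (X w)) :=
  contDiff_pi.2 fun i => Complex.ofRealCLM.contDiff.comp (contDiff_pi.1 h i)

/-- `toC` as a continuous linear map. -/
def toCL (n : ℕ) : (Fin n → ℝ) →L[ℝ] (Fin n → ℂ) :=
  ContinuousLinearMap.pi fun i => Complex.ofRealCLM.comp (ContinuousLinearMap.proj i)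

theorem pd_toC {n : ℕ} {X : ℂ → Fin n → ℝ} {z : ℂ} (h : DifferentiableAt ℝ X z) (i : Fin 2) :
    pd i (fun w => toC (X w)) z = toC (pd i X z) :=
  pd_clm (toCL n) h i

theorem pd_ofReal {f : ℂ → ℝ} {z : ℂ} (h : DifferentiableAt ℝ f z) (i : Fin 2) :
    pd i (fun w => (f w : ℂ)) z = ((pd i f z : ℝ) : ℂ) :=
  pd_clm Complex.ofRealCLM h i

theorem pd_star {E : Type*} [NormedAddCommGroup E] [NormedSpace ℂ E] [StarAddMonoid E]
    [NormedStarGroup E] [StarModule ℂ E] {F : ℂ → E} {z : ℂ} (h : DifferentiableAt ℝ F z)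
    (i : Fin 2) : pd i (fun w => star (F w)) z = star (pd i F z) :=
  pd_clm ((starL' ℝ : E ≃L[ℝ] E) : E →L[ℝ] E) h i

theorem wz_star {E : Type*} [NormedAddCommGroup E] [NormedSpace ℂ E] [StarAddMonoid E]
    [NormedStarGroup E] [StarModule ℂ E] {F : ℂ → E} {z : ℂ} (h : DifferentiableAt ℝ F z) :
    wz (fun w => star (F w)) z = star (wzb F z) := by
  unfold wz wzb
  rw [pd_star h, pd_star h]
  simp [star_smul, sub_eq_add_neg]

theorem wzb_star {E : Type*} [NormedAddCommGroup E] [NormedSpace ℂ E] [StarAddMonoid E]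
    [NormedStarGroup E] [StarModule ℂ E] {F : ℂ → E} {z : ℂ} (h : DifferentiableAt ℝ F z) :
    wzb (fun w => star (F w)) z = star (wz F z) := by
  unfold wz wzb
  rw [pd_star h, pd_star h]
  simp [star_smul, sub_eq_add_neg]

theorem wzb_toC {n : ℕ} {X : ℂ → Fin n → ℝ} {z : ℂ} (h : DifferentiableAt ℝ X z) :
    wzb (fun w => toC (X w)) z = star (wz (fun w => toC (X w)) z) := by
  rw [← wzb_star (differentiableAt_toC h)]
  simp only [star_toC]

/-- Cauchy–Riemann and Liouville: an entire solution of `∂f/∂z̄ = 0` vanishing at infinity is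
zero. -/
theorem eq_zero_of_wzb_eq_zero {f : ℂ → ℂ} (hf : ContDiff ℝ ∞ f) (h : ∀ z, wzb f z = 0)
    (hlim : Filter.Tendsto f (Filter.cocompact ℂ) (nhds 0)) (z : ℂ) : f z = 0 := by
  have hd : Differentiable ℂ f := by
    intro w
    refine differentiableAt_complex_iff_differentiableAt_real.2 ⟨smooth_differentiableAt hf w, ?_⟩
    have h1 := h w
    rw [wzb, pd_zero, pd_one] at h1
    have h2 : fderiv ℝ f w 1 + Complex.I • fderiv ℝ f w Complex.I = 0 := by
      simpa using h1
    have h3 : Complex.I • (fderiv ℝ f w 1 + Complex.I • fderiv ℝ f w Complex.I) = 0 := by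
      rw [h2, smul_zero]
    rw [smul_add, smul_smul, Complex.I_mul_I, neg_one_smul] at h3
    exact (eq_of_sub_eq_zero (by rw [← h3]; abel)).symm
  -- Liouville in the form: an entire function with a limit at infinity is equal to that limit.
  exact hd.apply_eq_of_tendsto_cocompact z hlim

end

section

/-! ### Integrals of derivatives of compactly supported functions -/

open MeasureTheory

theorem integrable_of_smooth_compact {f : ℂ → ℝ} (hf : Continuous f)
    (hc : HasCompactSupport f) : Integrable f :=
  hf.integrable_of_hasCompactSupport hc

theorem hasCompactSupport_pd {E : Type*} [NormedAddCommGroup E] [NormedSpace ℝ E] {f : ℂ → E}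
    (hc : HasCompactSupport f) (i : Fin 2) : HasCompactSupport (pd i f) :=
  hc.fderiv_apply (𝕜 := ℝ) _

theorem integral_pd_eq_zero {f : ℂ → ℝ} (hf : ContDiff ℝ ∞ f) (hc : HasCompactSupport f)
    (i : Fin 2) : ∫ z, pd i f z = 0 := by
  have h := integral_mul_fderiv_eq_neg_fderiv_mul_of_integrable (μ := volume)
    (f := fun _ : ℂ => (1 : ℝ)) (g := f) (v := if i = 0 then 1 else Complex.I)
    (by simp) (by
      simp only [one_mul]
      exact integrable_of_smooth_compact (contDiff_pd hf i).continuous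
        (hasCompactSupport_pd hc i))
    (by simpa using integrable_of_smooth_compact hf.continuous hc)
    (fun _ _ => differentiableAt_const _) (fun z _ => smooth_differentiableAt hf z)
  simpa [pd] using h

theorem contDiff_of_tsupport {E : Type*} [NormedAddCommGroup E] {v : ℂ → E} {f : ℂ → ℝ}
    (hf : ∀ z ∈ tsupport v, ContDiffAt ℝ ∞ f z) (h0 : ∀ z ∉ tsupport v, f z = 0) :
    ContDiff ℝ ∞ f := by
  refine contDiff_iff_contDiffAt.2 fun z => ?_
  by_cases hz : z ∈ tsupport v
  · exact hf z hz
  · refine (contDiffAt_const (c := (0 : ℝ))).congr_of_eventuallyEq ?_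
    filter_upwards [(isClosed_tsupport v).isOpen_compl.mem_nhds hz] with w hw using h0 w hw

theorem hasCompactSupport_of_tsupport {E : Type*} [NormedAddCommGroup E] {v : ℂ → E} {f : ℂ → ℝ}
    (hv : HasCompactSupport v) (h0 : ∀ z ∉ tsupport v, f z = 0) : HasCompactSupport f :=
  HasCompactSupport.intro hv h0

/-! ### A Carleman estimate and unique continuation for `∂̄` -/

-- With A = ∂̄ - (∂̄φ)/2 one has ‖Av‖² = ‖A*v‖² + ⟨[A*, A]v, v⟩ and [A*, A] = Δφ/4; dropping ‖A*v‖²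
-- leaves the estimate. In real terms, the integrands differ by a square and the divergence of (P,
-- Q). The weight need only be smooth on the support of v, so that it may be singular at the base
-- point of the unique continuation argument.
set_option maxHeartbeats 1000000 in
theorem carleman_estimate {v : ℂ → ℂ} (hv : ContDiff ℝ ∞ v) (hc : HasCompactSupport v)
    {φ : ℂ → ℝ} (hφ : ∀ z ∈ tsupport v, ContDiffAt ℝ ∞ φ z) :
    ∫ z, lap φ z / 4 * ‖v z‖ ^ 2 ≤
      ∫ z, ‖wzb v z - ((pd 0 φ z + Complex.I * pd 1 φ z) / 4) * v z‖ ^ 2 := by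
  have hv0 : ∀ z ∉ tsupport v, v z = 0 := fun z hz => image_eq_zero_of_notMem_tsupport hz
  have hpd0 : ∀ i, ∀ z ∉ tsupport v, pd i v z = 0 := fun i z hz => by
    have : pd i v z = pd i (fun _ => (0 : ℂ)) z := pd_congr (by
      filter_upwards [(isClosed_tsupport v).isOpen_compl.mem_nhds hz] with w hw using hv0 w hw) i
    rw [this, pd_const]
  have hva : ∀ z, ContDiffAt ℝ ∞ v z := fun z => hv.contDiffAt
  have hre : ContDiff ℝ ∞ fun z => (v z).re := Complex.reCLM.contDiff.comp hv
  have him : ContDiff ℝ ∞ fun z => (v z).im := Complex.imCLM.contDiff.comp hv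
  have hsq : ∀ z, ‖v z‖ ^ 2 = (v z).re ^ 2 + (v z).im ^ 2 := fun z => by
    rw [Complex.sq_norm, Complex.normSq_apply]; ring
  have hρ : ContDiff ℝ ∞ fun z => (v z).re ^ 2 + (v z).im ^ 2 := (hre.pow 2).add (him.pow 2)
  -- the two components of the divergence
  set P : ℂ → ℝ := fun z => (v z).re * pd 1 (fun w => (v w).im) z +
    1 / 4 * (((v z).re ^ 2 + (v z).im ^ 2) * pd 0 φ z) with hP
  set Q : ℂ → ℝ := fun z => 1 / 4 * (((v z).re ^ 2 + (v z).im ^ 2) * pd 1 φ z) -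
    (v z).re * pd 0 (fun w => (v w).im) z with hQ
  have hPs : ContDiff ℝ ∞ P := contDiff_of_tsupport (v := v)
    (fun z hz => (hre.contDiffAt.mul (contDiff_pd him 1).contDiffAt).add
      (contDiffAt_const.mul (hρ.contDiffAt.mul (contDiffAt_pd (hφ z hz) 0))))
    (fun z hz => by simp [hP, hv0 z hz])
  have hQs : ContDiff ℝ ∞ Q := contDiff_of_tsupport (v := v)
    (fun z hz => (contDiffAt_const.mul (hρ.contDiffAt.mul (contDiffAt_pd (hφ z hz) 1))).sub
      (hre.contDiffAt.mul (contDiff_pd him 0).contDiffAt))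
    (fun z hz => by simp [hQ, hv0 z hz])
  have hPc : HasCompactSupport P := hasCompactSupport_of_tsupport hc
    (fun z hz => by simp [hP, hv0 z hz])
  have hQc : HasCompactSupport Q := hasCompactSupport_of_tsupport hc
    (fun z hz => by simp [hQ, hv0 z hz])
  have hA0 : ∀ z ∉ tsupport v,
      ‖wzb v z - ((pd 0 φ z + Complex.I * pd 1 φ z) / 4) * v z‖ ^ 2 = 0 := fun z hz => by
    simp [wzb, hpd0 _ z hz, hv0 z hz]
  have hAs : ContDiff ℝ ∞
      (fun z => ‖wzb v z - ((pd 0 φ z + Complex.I * pd 1 φ z) / 4) * v z‖ ^ 2) :=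
    contDiff_of_tsupport (v := v) (fun z hz => by
      refine ContDiffAt.norm_sq ℂ ?_
      have h0 : ContDiffAt ℝ ∞ (fun w => ((pd 0 φ w : ℝ) : ℂ)) z :=
        Complex.ofRealCLM.contDiff.contDiffAt.comp z (contDiffAt_pd (hφ z hz) 0)
      have h1 : ContDiffAt ℝ ∞ (fun w => ((pd 1 φ w : ℝ) : ℂ)) z :=
        Complex.ofRealCLM.contDiff.contDiffAt.comp z (contDiffAt_pd (hφ z hz) 1)
      exact (contDiff_wzb hv).contDiffAt.sub
        (((h0.add (contDiffAt_const.mul h1)).div_const 4).mul hv.contDiffAt)) hA0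
  have hBs : ContDiff ℝ ∞ fun z => lap φ z / 4 * ‖v z‖ ^ 2 :=
    contDiff_of_tsupport (v := v) (fun z hz => by
      have h := (contDiffAt_pd (contDiffAt_pd (hφ z hz) 0) 0).add
        (contDiffAt_pd (contDiffAt_pd (hφ z hz) 1) 1)
      exact (h.div_const 4).mul (ContDiffAt.norm_sq ℂ hv.contDiffAt)) (fun z hz => by simp [hv0 z hz])
  have hAi := integrable_of_smooth_compact hAs.continuous (hasCompactSupport_of_tsupport hc hA0)
  have hBi := integrable_of_smooth_compact hBs.continuous
    (hasCompactSupport_of_tsupport hc (fun z hz => by simp [hv0 z hz]))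
  have hP1 := integrable_of_smooth_compact (contDiff_pd hPs 0).continuous
    (hasCompactSupport_pd hPc 0)
  have hQ1 := integrable_of_smooth_compact (contDiff_pd hQs 1).continuous
    (hasCompactSupport_pd hQc 1)
  have hdiff : ∀ z ∈ tsupport v, lap φ z / 4 * ‖v z‖ ^ 2 - pd 0 P z - pd 1 Q z ≤
      ‖wzb v z - ((pd 0 φ z + Complex.I * pd 1 φ z) / 4) * v z‖ ^ 2 := by
    intro z hz
    have da := smooth_differentiableAt hre z
    have db := smooth_differentiableAt him z
    have dρ := smooth_differentiableAt hρ z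
    have dφ := fun i => smoothAt_differentiableAt (contDiffAt_pd (hφ z hz) i)
    have ea : ∀ i, pd i (fun w => (v w).re) z = (pd i v z).re := fun i =>
      pd_clm Complex.reCLM (smooth_differentiableAt hv z) i
    have eb : ∀ i, pd i (fun w => (v w).im) z = (pd i v z).im := fun i =>
      pd_clm Complex.imCLM (smooth_differentiableAt hv z) i
    have eρ : ∀ i, pd i (fun w => (v w).re ^ 2 + (v w).im ^ 2) z =
        2 * (v z).re * (pd i v z).re + 2 * (v z).im * (pd i v z).im := fun i => by
      simp only [pow_two]
      rw [pd_add (da.fun_mul da) (db.fun_mul db), pd_mul da da, pd_mul db db, ea, eb]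
      ring
    have e0 : pd 0 P z = (pd 0 v z).re * (pd 1 v z).im +
        (v z).re * pd 0 (pd 1 (fun w => (v w).im)) z +
        1 / 4 * ((2 * (v z).re * (pd 0 v z).re + 2 * (v z).im * (pd 0 v z).im) * pd 0 φ z +
          ((v z).re ^ 2 + (v z).im ^ 2) * pd 0 (pd 0 φ) z) := by
      have d1 := smooth_differentiableAt (contDiff_pd him 1) z
      rw [hP, pd_add (da.fun_mul d1) ((dρ.fun_mul (dφ 0)).const_mul _), pd_mul da d1,
        pd_mul (differentiableAt_const _) (dρ.fun_mul (dφ 0)), pd_mul dρ (dφ 0), pd_const, ea, eb, eρ]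
      ring
    have e1 : pd 1 Q z = 1 / 4 * ((2 * (v z).re * (pd 1 v z).re +
          2 * (v z).im * (pd 1 v z).im) * pd 1 φ z +
          ((v z).re ^ 2 + (v z).im ^ 2) * pd 1 (pd 1 φ) z) -
        ((pd 1 v z).re * (pd 0 v z).im + (v z).re * pd 1 (pd 0 (fun w => (v w).im)) z) := by
      have d1 := smooth_differentiableAt (contDiff_pd him 0) z
      rw [hQ, pd_sub ((dρ.fun_mul (dφ 1)).const_mul _) (da.fun_mul d1), pd_mul da d1,
        pd_mul (differentiableAt_const _) (dρ.fun_mul (dφ 1)), pd_mul dρ (dφ 1), pd_const, ea, eb, eρ]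
      ring
    rw [e0, e1, pd_pd_comm him.contDiffAt 1 0, hsq, Complex.sq_norm, Complex.normSq_apply, lap, wzb]
    simp only [Complex.sub_re, Complex.mul_re, Complex.add_re, Complex.sub_im, Complex.mul_im,
      Complex.add_im, Complex.ofReal_re, Complex.ofReal_im, Complex.I_re, Complex.I_im,
      smul_eq_mul, Complex.div_ofNat_re, Complex.div_ofNat_im, Complex.one_re, Complex.one_im]
    -- The two squares are those of the real and imaginary parts of ∂v + (∂φ/2) v = -A*v.
    have h1 := sq_nonneg (((pd 0 v z).re + (pd 1 v z).im) / 2 +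
      (pd 0 φ z * (v z).re + pd 1 φ z * (v z).im) / 4)
    have h2 := sq_nonneg (((pd 0 v z).im - (pd 1 v z).re) / 2 +
      (pd 0 φ z * (v z).im - pd 1 φ z * (v z).re) / 4)
    linarith
  have hmain : ∀ z, lap φ z / 4 * ‖v z‖ ^ 2 - pd 0 P z - pd 1 Q z ≤
      ‖wzb v z - ((pd 0 φ z + Complex.I * pd 1 φ z) / 4) * v z‖ ^ 2 := by
    intro z
    by_cases hz : z ∈ tsupport v
    · exact hdiff z hz
    · have hn := (isClosed_tsupport v).isOpen_compl.mem_nhds hz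
      have e0 : pd 0 P z = 0 := by
        rw [pd_congr (X' := fun _ => (0 : ℝ)) (by
          filter_upwards [hn] with w hw
          simp [hP, hv0 w hw]), pd_const]
      have e1 : pd 1 Q z = 0 := by
        rw [pd_congr (X' := fun _ => (0 : ℝ)) (by
          filter_upwards [hn] with w hw
          simp [hQ, hv0 w hw]), pd_const]
      rw [e0, e1, hA0 z hz, hv0 z hz]
      simp
  have hint := integral_mono (μ := volume) ((hBi.sub hP1).sub hQ1) hAi
    hmain
  have : ∫ z, (lap φ z / 4 * ‖v z‖ ^ 2 - pd 0 P z - pd 1 Q z) = ∫ z, lap φ z / 4 * ‖v z‖ ^ 2 := by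
    have hBP : Integrable fun z => lap φ z / 4 * ‖v z‖ ^ 2 - pd 0 P z := hBi.sub hP1
    rw [integral_sub hBP hQ1, integral_sub hBi hP1, integral_pd_eq_zero hPs hPc,
      integral_pd_eq_zero hQs hQc]
    simp
  rw [← this]
  exact hint

end

/-! ### The radial weight and unique continuation for ∂̄-systems -/

section

open MeasureTheory

theorem pd_inv {f : ℂ → ℝ} {z : ℂ} (hf : DifferentiableAt ℝ f z) (h0 : f z ≠ 0) (i : Fin 2) :
    pd i (fun w => (f w)⁻¹) z = -pd i f z / f z ^ 2 := by
  unfold pd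
  have := ((hasDerivAt_inv h0).comp_hasFDerivAt z hf.hasFDerivAt).fderiv
  simp only [Function.comp_def] at this
  rw [this]
  simp
  ring

/-- The radial weight `‖z - z₀‖⁻²`. -/
def radialWeight (z₀ z : ℂ) : ℝ := (Complex.normSq (z - z₀))⁻¹

theorem normSq_sub_pd (z₀ z : ℂ) (i : Fin 2) :
    pd i (fun w => Complex.normSq (w - z₀)) z = 2 * if i = 0 then (z - z₀).re else (z - z₀).im := by
  have hd : DifferentiableAt ℝ (fun w : ℂ => w - z₀) z := by fun_prop
  have hre : DifferentiableAt ℝ (fun w : ℂ => (w - z₀).re) z :=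
    Complex.reCLM.differentiableAt.comp z hd
  have him : DifferentiableAt ℝ (fun w : ℂ => (w - z₀).im) z :=
    Complex.imCLM.differentiableAt.comp z hd
  have e : ∀ i, pd i (fun w : ℂ => w - z₀) z = if i = 0 then 1 else Complex.I := fun i => by
    unfold pd; rw [fderiv_sub_const]; simp
  have ea : ∀ i, pd i (fun w : ℂ => (w - z₀).re) z = (if i = 0 then 1 else Complex.I : ℂ).re :=
    fun i => by rw [← e]; exact pd_clm Complex.reCLM hd i
  have eb : ∀ i, pd i (fun w : ℂ => (w - z₀).im) z = (if i = 0 then 1 else Complex.I : ℂ).im :=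
    fun i => by rw [← e]; exact pd_clm Complex.imCLM hd i
  simp only [Complex.normSq_apply]
  rw [pd_add (hre.fun_mul hre) (him.fun_mul him), pd_mul hre hre, pd_mul him him, ea, eb]
  fin_cases i <;> simp <;> ring

theorem contDiff_normSq_sub (z₀ : ℂ) : ContDiff ℝ ∞ fun w => Complex.normSq (w - z₀) := by
  simp only [Complex.normSq_apply]
  have hd : ContDiff ℝ ∞ (fun w : ℂ => w - z₀) := contDiff_id.sub contDiff_const
  have hre := Complex.reCLM.contDiff.comp hd
  have him := Complex.imCLM.contDiff.comp hd
  exact (hre.mul hre).add (him.mul him)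

theorem contDiffAt_radialWeight {z₀ z : ℂ} (h : z ≠ z₀) :
    ContDiffAt ℝ ∞ (radialWeight z₀) z :=
  (contDiff_normSq_sub z₀).contDiffAt.inv (by simpa [sub_eq_zero] using h)

theorem eventually_differentiableAt {E : Type*} [NormedAddCommGroup E] [NormedSpace ℝ E]
    {f : ℂ → E} {z : ℂ} (hf : ContDiffAt ℝ ∞ f z) : ∀ᶠ w in nhds z, DifferentiableAt ℝ f w := by
  have h1 : ContDiffAt ℝ 1 f z := hf.of_le (by simp)
  filter_upwards [h1.eventually (by simp)] with w hw using hw.differentiableAt (by simp)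

theorem lap_const_mul {f : ℂ → ℝ} {z : ℂ} (c : ℝ) (hf : ContDiffAt ℝ ∞ f z) :
    lap (fun w => c * f w) z = c * lap f z := by
  have key : ∀ i, pd i (pd i (fun w => c * f w)) z = c * pd i (pd i f) z := by
    intro i
    have h1 : pd i (fun w => c * f w) =ᶠ[nhds z] fun w => c * pd i f w := by
      filter_upwards [eventually_differentiableAt hf] with w hw
      rw [pd_mul (differentiableAt_const _) hw, pd_const]
      simp
    rw [pd_congr h1, pd_mul (differentiableAt_const _)
      (smoothAt_differentiableAt (contDiffAt_pd hf i)), pd_const]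
    simp
  rw [lap, key, key, lap]; ring

/-- In polar coordinates Δ(r⁻²) = 4 r⁻⁴. The positivity of this Laplacian is what makes r⁻² usable
as a Carleman weight, and it is largest near the disc on which the solution is known to vanish. -/
theorem lap_radialWeight {z₀ z : ℂ} (h : z ≠ z₀) :
    lap (radialWeight z₀) z = 4 * (radialWeight z₀ z) ^ 2 := by
  have hN := contDiff_normSq_sub z₀
  have hne : Complex.normSq (z - z₀) ≠ 0 := by simpa [sub_eq_zero] using h
  have key : ∀ i, pd i (pd i (radialWeight z₀)) z =
      - (pd i (pd i (fun w => Complex.normSq (w - z₀))) z) / Complex.normSq (z - z₀) ^ 2 +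
      2 * (pd i (fun w => Complex.normSq (w - z₀)) z) ^ 2 / Complex.normSq (z - z₀) ^ 3 := by
    intro i
    have h1 : pd i (radialWeight z₀) =ᶠ[nhds z] fun w =>
        (-1) * (pd i (fun w => Complex.normSq (w - z₀)) w *
          ((Complex.normSq (w - z₀))⁻¹ * (Complex.normSq (w - z₀))⁻¹)) := by
      filter_upwards [isOpen_ne.mem_nhds h] with w hw
      have := pd_inv (smooth_differentiableAt hN w) (by simpa [sub_eq_zero] using hw) i
      rw [show radialWeight z₀ = fun w => (Complex.normSq (w - z₀))⁻¹ from rfl, this, div_eq_mul_inv,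
        pow_two, mul_inv]
      ring
    have d1 := smooth_differentiableAt (contDiff_pd hN i) z
    have d2 : DifferentiableAt ℝ (fun w => (Complex.normSq (w - z₀))⁻¹) z :=
      smoothAt_differentiableAt (contDiffAt_radialWeight h)
    rw [pd_congr h1, pd_mul (differentiableAt_const _) (d1.fun_mul (d2.fun_mul d2)), pd_const,
      pd_mul d1 (d2.fun_mul d2), pd_mul d2 d2, pd_inv (smooth_differentiableAt hN z) hne]
    field_simp
    ring
  have e2 : ∀ i, pd i (pd i (fun w => Complex.normSq (w - z₀))) z = 2 := by
    intro i
    have h1 : pd i (fun w => Complex.normSq (w - z₀)) =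
        fun w => 2 * if i = 0 then (w - z₀).re else (w - z₀).im :=
      funext fun w => normSq_sub_pd z₀ w i
    rw [h1]
    have hd : DifferentiableAt ℝ (fun w : ℂ => w - z₀) z := by fun_prop
    have e : ∀ i, pd i (fun w : ℂ => w - z₀) z = if i = 0 then 1 else Complex.I := fun i => by
      unfold pd; rw [fderiv_sub_const]; simp
    fin_cases i
    · have := pd_clm Complex.reCLM hd 0
      simp only [Complex.reCLM_apply, e] at this
      have hh : DifferentiableAt ℝ (fun w : ℂ => (w - z₀).re) z :=
        Complex.reCLM.differentiableAt.comp z hd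
      have h3 := pd_mul (differentiableAt_const (2 : ℝ)) hh 0
      simp only [this, pd_const] at h3
      simpa using h3
    · have := pd_clm Complex.imCLM hd 1
      simp only [Complex.imCLM_apply, e] at this
      have hh : DifferentiableAt ℝ (fun w : ℂ => (w - z₀).im) z :=
        Complex.imCLM.differentiableAt.comp z hd
      have h3 := pd_mul (differentiableAt_const (2 : ℝ)) hh 1
      simp only [this, pd_const] at h3
      simpa using h3
  rw [lap, key, key, e2, e2, normSq_sub_pd, normSq_sub_pd, radialWeight]
  have hx : (z - z₀).im ^ 2 = Complex.normSq (z - z₀) - (z - z₀).re ^ 2 := by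
    rw [Complex.normSq_apply]; ring
  simp only [if_true, one_ne_zero, if_false]
  field_simp
  rw [hx]
  ring

/-- The Carleman estimate with weight `exp (τ ‖z - z₀‖⁻²)`. -/
theorem carleman_radial {z₀ : ℂ} {f : ℂ → ℂ} (hf : ContDiff ℝ ∞ f) (hc : HasCompactSupport f)
    (h0 : z₀ ∉ tsupport f) (τ : ℝ) :
    ∫ z, τ * radialWeight z₀ z ^ 2 * (Real.exp (τ * radialWeight z₀ z) * ‖f z‖ ^ 2) ≤
      ∫ z, Real.exp (τ * radialWeight z₀ z) * ‖wzb f z‖ ^ 2 := by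
  set φ : ℂ → ℝ := fun z => τ * radialWeight z₀ z with hφ
  have hz0 : ∀ z ∈ tsupport f, z ≠ z₀ := fun z hz h => h0 (h ▸ hz)
  have hφs : ∀ z ∈ tsupport f, ContDiffAt ℝ ∞ φ z := fun z hz =>
    contDiffAt_const.mul (contDiffAt_radialWeight (hz0 z hz))
  have hE : ∀ z ∈ tsupport f, ContDiffAt ℝ ∞ (fun w => ((Real.exp (φ w / 2) : ℝ) : ℂ)) z :=
    fun z hz => Complex.ofRealCLM.contDiff.contDiffAt.comp z ((hφs z hz).div_const 2).exp
  -- Conjugation by the weight: ∂̄v - (∂̄φ/2) v = exp(φ/2) ∂̄f, so the unweighted estimate for v is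
  -- the weighted one for f.
  set v : ℂ → ℂ := fun z => ((Real.exp (φ z / 2) : ℝ) : ℂ) * f z with hv
  have hf0 : ∀ z ∉ tsupport f, f z = 0 := fun z hz => image_eq_zero_of_notMem_tsupport hz
  have hvs : ContDiff ℝ ∞ v := by
    refine contDiff_iff_contDiffAt.2 fun z => ?_
    by_cases hz : z ∈ tsupport f
    · exact (hE z hz).mul hf.contDiffAt
    · refine (contDiffAt_const (c := (0 : ℂ))).congr_of_eventuallyEq ?_
      filter_upwards [(isClosed_tsupport f).isOpen_compl.mem_nhds hz] with w hw
      simp [hv, hf0 w hw]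
  have htv : tsupport v ⊆ tsupport f := closure_mono fun z hz => by
    intro h
    exact hz (by simp [hv, h])
  have hvc : HasCompactSupport v := HasCompactSupport.intro hc (fun z hz => by simp [hv, hf0 z hz])
  have hwf0 : ∀ z ∉ tsupport f, wzb f z = 0 := fun z hz => by
    rw [wzb_congr (G := fun _ => (0 : ℂ)) (by
      filter_upwards [(isClosed_tsupport f).isOpen_compl.mem_nhds hz] with w hw using hf0 w hw),
      wzb_const]
  have hwv0 : ∀ z ∉ tsupport f, wzb v z = 0 := fun z hz => by
    rw [wzb_congr (G := fun _ => (0 : ℂ)) (by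
      filter_upwards [(isClosed_tsupport f).isOpen_compl.mem_nhds hz] with w hw
      simp [hv, hf0 w hw]), wzb_const]
  have hsq : ∀ z, Real.exp (φ z / 2) ^ 2 = Real.exp (φ z) := fun z => by
    rw [← Real.exp_nat_mul]; congr 1; push_cast; ring
  have hest := carleman_estimate hvs hvc (φ := φ) fun z hz => hφs z (htv hz)
  convert hest using 3 with z z
  · by_cases hz : z ∈ tsupport f
    · rw [hφ, lap_const_mul τ (contDiffAt_radialWeight (hz0 z hz)), lap_radialWeight (hz0 z hz), hv]
      simp only [norm_mul, mul_pow, Complex.norm_real, Real.norm_eq_abs, sq_abs, hsq]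
      simp only [hφ]
      ring
    · simp [hv, hf0 z hz]
  · by_cases hz : z ∈ tsupport f
    · have hφd := smoothAt_differentiableAt (hφs z hz)
      have hφ2 : DifferentiableAt ℝ (fun w => φ w / 2) z := by
        simpa only [div_eq_mul_inv] using hφd.mul_const (2⁻¹ : ℝ)
      have hed : DifferentiableAt ℝ (fun w => Real.exp (φ w / 2)) z := hφ2.exp
      have epd : ∀ i, pd i (fun w => ((Real.exp (φ w / 2) : ℝ) : ℂ)) z =
          ((Real.exp (φ z / 2) * (pd i φ z / 2) : ℝ) : ℂ) := by
        intro i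
        rw [pd_ofReal hed]
        congr 1
        unfold pd
        rw [fderiv_exp hφ2, show (fun w => φ w / 2) = fun w => (1 / 2 : ℝ) * φ w by
          ext w; ring, fderiv_const_mul hφd]
        simp
        ring
      have ew : wzb (fun w => ((Real.exp (φ w / 2) : ℝ) : ℂ)) z = (Real.exp (φ z / 2) : ℝ) *
          (((pd 0 φ z : ℝ) + Complex.I * (pd 1 φ z : ℝ)) / 4) := by
        rw [wzb, epd, epd]; push_cast; simp only [smul_eq_mul]; ring
      rw [hv, wzb_mul (smoothAt_differentiableAt (hE z hz)) (smooth_differentiableAt hf z), ew]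
      rw [show ∀ a b c d : ℂ, a * b * c + a * d - b * (a * c) = a * d by intros; ring]
      simp only [norm_mul, mul_pow, Complex.norm_real, Real.norm_eq_abs, sq_abs, hsq]
      rfl
    · rw [hwv0 z hz, hwf0 z hz]
      simp [hv, hf0 z hz]

set_option maxHeartbeats 1000000 in
/-- Unique continuation: a solution of `|∂̄w| ≤ M |w|` vanishing on a disc vanishes. -/
theorem unique_continuation {ι : Type*} [Fintype ι] {w : ι → ℂ → ℂ}
    (hw : ∀ i, ContDiff ℝ ∞ (w i)) {M : ℂ → ℝ} (hM : Continuous M)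
    (hbd : ∀ i z, ‖wzb (w i) z‖ ≤ M z * ∑ j, ‖w j z‖) {z₀ : ℂ} {r : ℝ} (hr : 0 < r)
    (h0 : ∀ z ∈ Metric.ball z₀ r, ∀ i, w i z = 0) (i : ι) (z : ℂ) : w i z = 0 := by
  by_contra hne
  -- The cutoff equals 1 on a disc containing z in its interior. Its derivative contributes only on
  -- the annulus R ≤ |x - z₀| ≤ R + 1, where the weight is at most exp(τ/R²).
  set R : ℝ := dist z z₀ + 1 with hR
  have hRpos : 0 < R := by positivity
  let χ : ContDiffBump z₀ := ⟨R, R + 1, hRpos, by linarith⟩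
  set f : ι → ℂ → ℂ := fun i z => ((χ z : ℝ) : ℂ) * w i z with hf
  have hχs : ContDiff ℝ ∞ fun z => ((χ z : ℝ) : ℂ) := Complex.ofRealCLM.contDiff.comp χ.contDiff
  have hfs : ∀ i, ContDiff ℝ ∞ (f i) := fun i => hχs.mul (hw i)
  have hfout : ∀ i, ∀ z ∉ Metric.closedBall z₀ (R + 1), f i z = 0 := fun i z hz => by
    have : χ z = 0 := χ.zero_of_le_dist (by
      simp only [Metric.mem_closedBall, not_le] at hz; exact hz.le)
    simp [hf, this]
  have hfc : ∀ i, HasCompactSupport (f i) := fun i =>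
    HasCompactSupport.intro (isCompact_closedBall z₀ (R + 1)) (hfout i)
  have hfts : ∀ i, tsupport (f i) ⊆ Metric.closedBall z₀ (R + 1) := fun i =>
    closure_minimal (fun z hz => by
      by_contra hz'
      exact hz (hfout i z hz')) Metric.isClosed_closedBall
  have hz0 : ∀ i, z₀ ∉ tsupport (f i) := fun i => by
    rw [notMem_tsupport_iff_eventuallyEq]
    filter_upwards [Metric.ball_mem_nhds z₀ hr] with z hz
    simp [hf, h0 z hz i]
  have hne0 : ∀ i, ∀ z ∈ tsupport (f i), z ≠ z₀ := fun i z hz h => hz0 i (h ▸ hz)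
  set ψ : ℂ → ℝ := radialWeight z₀ with hψ
  have hψnn : ∀ z, 0 ≤ ψ z := fun z => inv_nonneg.2 (Complex.normSq_nonneg _)
  have hψeq : ∀ z, ψ z = (dist z z₀ ^ 2)⁻¹ := fun z => by
    rw [hψ, radialWeight, Complex.dist_eq, Complex.sq_norm]
  have hwz0 : ∀ i, ∀ z ∉ tsupport (f i), wzb (f i) z = 0 := fun i z hz => by
    rw [wzb_congr (G := fun _ => (0 : ℂ)) (notMem_tsupport_iff_eventuallyEq.1 hz), wzb_const]
  -- constants
  obtain ⟨M₀, hM₀⟩ := (isCompact_closedBall z₀ (R + 1)).exists_bound_of_continuousOn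
    hM.continuousOn
  have hM₀' : ∀ z ∈ Metric.closedBall z₀ (R + 1), M z ≤ M₀ := fun z hz =>
    (le_abs_self _).trans (hM₀ z hz)
  have hM₀nn : 0 ≤ M₀ := (norm_nonneg _).trans
    (hM₀ z₀ (Metric.mem_closedBall_self (by linarith)))
  set k : ℝ := (Fintype.card ι : ℝ) with hk
  set G : ℂ → ℝ := fun z => ∑ i, ‖f i z‖ ^ 2 with hG
  set D : ℂ → ℝ := fun z => ∑ i, ‖wzb (f i) z‖ ^ 2 with hD
  have hDcont : Continuous D := continuous_finsetSum _ fun i _ =>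
    ((contDiff_wzb (hfs i)).continuous.norm.pow 2)
  have hGcont : Continuous G := continuous_finsetSum _ fun i _ => ((hfs i).continuous.norm.pow 2)
  obtain ⟨B, hB⟩ := (isCompact_closedBall z₀ (R + 1)).exists_bound_of_continuousOn
    hDcont.continuousOn
  have hBnn : 0 ≤ B := (norm_nonneg _).trans (hB z₀ (Metric.mem_closedBall_self (by linarith)))
  -- One factor k is the Cauchy–Schwarz constant for (∑ ‖w j‖)², the other counts the components
  -- summed in `D`.
  set M₁ : ℝ := k * (M₀ ^ 2 * k) with hM₁
  have hGnn : ∀ z, 0 ≤ G z := fun z => Finset.sum_nonneg fun i _ => by positivity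
  have hDin : ∀ z ∈ Metric.ball z₀ R, D z ≤ M₁ * G z := by
    intro z hz
    have hχ1 : ∀ᶠ w in nhds z, χ w = 1 := by
      filter_upwards [Metric.isOpen_ball.mem_nhds hz] with w hw
      exact χ.one_of_mem_closedBall (Metric.ball_subset_closedBall hw)
    have hfw : ∀ i, f i =ᶠ[nhds z] w i := fun i => by
      filter_upwards [hχ1] with w hw
      simp [hf, hw]
    have hzc : z ∈ Metric.closedBall z₀ (R + 1) :=
      Metric.closedBall_subset_closedBall (by linarith) (Metric.ball_subset_closedBall hz)
    have h1 : ∀ i, ‖wzb (f i) z‖ ^ 2 ≤ M₀ ^ 2 * (k * G z) := fun i => by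
      rw [wzb_congr (hfw i)]
      have h2 : ‖wzb (w i) z‖ ≤ M₀ * ∑ j, ‖w j z‖ := (hbd i z).trans
        (mul_le_mul_of_nonneg_right (hM₀' z hzc) (Finset.sum_nonneg fun _ _ => norm_nonneg _))
      have h3 : (∑ j, ‖w j z‖) ^ 2 ≤ k * G z := by
        have := sq_sum_le_card_mul_sum_sq (s := Finset.univ) (f := fun j => ‖w j z‖)
        simpa [hG, hk, fun i => (hfw i).self_of_nhds] using this
      calc ‖wzb (w i) z‖ ^ 2 ≤ (M₀ * ∑ j, ‖w j z‖) ^ 2 := by gcongr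
        _ = M₀ ^ 2 * (∑ j, ‖w j z‖) ^ 2 := by ring
        _ ≤ M₀ ^ 2 * (k * G z) := by gcongr
    calc D z ≤ ∑ _i : ι, M₀ ^ 2 * (k * G z) := Finset.sum_le_sum fun i _ => h1 i
      _ = M₁ * G z := by simp [hM₁, hk]; ring
  have hDout : ∀ z ∉ Metric.closedBall z₀ (R + 1), D z = 0 := fun z hz =>
    Finset.sum_eq_zero fun i _ => by rw [hwz0 i z fun h => hz (hfts i h)]; simp
  have hpt : ∀ τ, 0 ≤ τ → ∀ z, Real.exp (τ * ψ z) * D z ≤ M₁ * (Real.exp (τ * ψ z) * G z) +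
      (Metric.closedBall z₀ (R + 1)).indicator (fun _ => Real.exp (τ * (R ^ 2)⁻¹) * B) z := by
    intro τ hτ z
    have hM₁nn : 0 ≤ M₁ := by positivity
    by_cases hz : z ∈ Metric.closedBall z₀ (R + 1)
    · rw [Set.indicator_of_mem hz]
      by_cases hz' : z ∈ Metric.ball z₀ R
      · have := mul_le_mul_of_nonneg_left (hDin z hz') (Real.exp_pos (τ * ψ z)).le
        have h2 : 0 ≤ Real.exp (τ * (R ^ 2)⁻¹) * B := by positivity
        linarith
      · have h1 : ψ z ≤ (R ^ 2)⁻¹ := by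
          rw [hψeq]
          simp only [Metric.mem_ball, not_lt] at hz'
          gcongr
        have h2 : D z ≤ B := (le_abs_self _).trans (hB z hz)
        have h3 : 0 ≤ M₁ * (Real.exp (τ * ψ z) * G z) :=
          mul_nonneg hM₁nn (mul_nonneg (Real.exp_pos _).le (hGnn z))
        have h4 : Real.exp (τ * ψ z) * D z ≤ Real.exp (τ * (R ^ 2)⁻¹) * B := by
          have hDnn : 0 ≤ D z := Finset.sum_nonneg fun i _ => by positivity
          gcongr
        linarith
    · rw [Set.indicator_of_notMem hz, hDout z hz]
      have h3 : 0 ≤ M₁ * (Real.exp (τ * ψ z) * G z) :=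
        mul_nonneg hM₁nn (mul_nonneg (Real.exp_pos _).le (hGnn z))
      simpa using h3
  -- integrability
  have hExp : ∀ τ i, ∀ z ∈ tsupport (f i), ContDiffAt ℝ ∞ (fun z => Real.exp (τ * ψ z)) z :=
    fun τ i z hz => (contDiffAt_const.mul (contDiffAt_radialWeight (hne0 i z hz))).exp
  have hI1 : ∀ τ i, Integrable fun z => Real.exp (τ * ψ z) * ‖f i z‖ ^ 2 := fun τ i =>
    integrable_of_smooth_compact (contDiff_of_tsupport (v := f i)
      (fun z hz => (hExp τ i z hz).mul (ContDiffAt.norm_sq ℂ (hfs i).contDiffAt))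
      (fun z hz => by simp [image_eq_zero_of_notMem_tsupport hz])).continuous
      (hasCompactSupport_of_tsupport (hfc i)
        (fun z hz => by simp [image_eq_zero_of_notMem_tsupport hz]))
  have hI2 : ∀ τ i, Integrable fun z => Real.exp (τ * ψ z) * ‖wzb (f i) z‖ ^ 2 := fun τ i =>
    integrable_of_smooth_compact (contDiff_of_tsupport (v := f i)
      (fun z hz => (hExp τ i z hz).mul (ContDiffAt.norm_sq ℂ (contDiff_wzb (hfs i)).contDiffAt))
      (fun z hz => by simp [hwz0 i z hz])).continuous
      (hasCompactSupport_of_tsupport (hfc i) (fun z hz => by simp [hwz0 i z hz]))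
  have hI3 : ∀ τ i, Integrable fun z => τ * ψ z ^ 2 * (Real.exp (τ * ψ z) * ‖f i z‖ ^ 2) :=
    fun τ i =>
    integrable_of_smooth_compact (contDiff_of_tsupport (v := f i)
      (fun z hz => (contDiffAt_const.mul ((contDiffAt_radialWeight (hne0 i z hz)).pow 2)).mul
        ((hExp τ i z hz).mul (ContDiffAt.norm_sq ℂ (hfs i).contDiffAt)))
      (fun z hz => by simp [image_eq_zero_of_notMem_tsupport hz])).continuous
      (hasCompactSupport_of_tsupport (hfc i)
        (fun z hz => by simp [image_eq_zero_of_notMem_tsupport hz]))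
  have hIG : ∀ τ, Integrable fun z => Real.exp (τ * ψ z) * G z := fun τ => by
    simp only [hG, Finset.mul_sum]
    exact integrable_finsetSum _ fun i _ => hI1 τ i
  have hID : ∀ τ, Integrable fun z => Real.exp (τ * ψ z) * D z := fun τ => by
    simp only [hD, Finset.mul_sum]
    exact integrable_finsetSum _ fun i _ => hI2 τ i
  have hIind : ∀ c : ℝ, Integrable ((Metric.closedBall z₀ (R + 1)).indicator fun _ : ℂ => c) :=
    fun c => (integrable_indicator_iff Metric.isClosed_closedBall.measurableSet).2
      (integrableOn_const (isCompact_closedBall z₀ (R + 1)).measure_lt_top.ne)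
  -- A lower bound for ψ² on the supports, so the left side of the Carleman estimate dominates τc
  -- times the weighted mass, which beats M₁ for large τ.
  set c : ℝ := (((R + 1) ^ 2)⁻¹) ^ 2 with hc
  have hcpos : 0 < c := by positivity
  set V : ℝ := volume.real (Metric.closedBall z₀ (R + 1)) with hV
  -- the upper bound
  have hupper : ∀ τ, 0 ≤ τ → (τ * c) * ∫ z, Real.exp (τ * ψ z) * G z ≤
      M₁ * (∫ z, Real.exp (τ * ψ z) * G z) + V * (Real.exp (τ * (R ^ 2)⁻¹) * B) := by
    intro τ hτ
    calc (τ * c) * ∫ z, Real.exp (τ * ψ z) * G z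
        = ∑ i, ∫ z, (τ * c) * (Real.exp (τ * ψ z) * ‖f i z‖ ^ 2) := by
          rw [← integral_finsetSum _ fun i _ => (hI1 τ i).const_mul _, ← integral_const_mul]
          simp only [hG, Finset.mul_sum]
      _ ≤ ∑ i, ∫ z, τ * ψ z ^ 2 * (Real.exp (τ * ψ z) * ‖f i z‖ ^ 2) := by
          refine Finset.sum_le_sum fun i _ => integral_mono ((hI1 τ i).const_mul _) (hI3 τ i) ?_
          intro z
          by_cases hz : z ∈ tsupport (f i)
          · have h1 : ((R + 1) ^ 2)⁻¹ ≤ ψ z := by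
              rw [hψeq]
              have h2 : dist z z₀ ≤ R + 1 := hfts i hz
              have h3 : 0 < dist z z₀ := dist_pos.2 (hne0 i z hz)
              gcongr
            have : c ≤ ψ z ^ 2 := by rw [hc]; gcongr
            dsimp only
            gcongr
          · simp [image_eq_zero_of_notMem_tsupport hz]
      _ ≤ ∑ i, ∫ z, Real.exp (τ * ψ z) * ‖wzb (f i) z‖ ^ 2 :=
          Finset.sum_le_sum fun i _ => carleman_radial (hfs i) (hfc i) (hz0 i) τ
      _ = ∫ z, Real.exp (τ * ψ z) * D z := by
          rw [← integral_finsetSum _ fun i _ => hI2 τ i]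
          simp only [hD, Finset.mul_sum]
      _ ≤ ∫ z, (M₁ * (Real.exp (τ * ψ z) * G z) +
            (Metric.closedBall z₀ (R + 1)).indicator (fun _ => Real.exp (τ * (R ^ 2)⁻¹) * B) z) :=
          integral_mono (hID τ) (((hIG τ).const_mul _).add (hIind _)) (hpt τ hτ)
      _ = _ := by
          rw [integral_add ((hIG τ).const_mul _) (hIind _), integral_const_mul,
            integral_indicator_const _ Metric.isClosed_closedBall.measurableSet]
          simp [hV]
  -- the lower bound near the point
  have hGz : 0 < G z := by
    have hχ1 : χ z = 1 := χ.one_of_mem_closedBall (by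
      simp only [Metric.mem_closedBall]
      change dist z z₀ ≤ R
      linarith)
    refine Finset.sum_pos' (fun i _ => by positivity) ⟨i, Finset.mem_univ _, ?_⟩
    have : f i z = w i z := by simp [hf, hχ1]
    rw [this]
    positivity
  -- Near z the weight is at least exp(τ/R²), the very exponential that bounds the annulus term, so
  -- the exponentials cancel and only the factor τ remains.
  obtain ⟨ρ, hρ, hball⟩ : ∃ ρ > 0, ∀ x ∈ Metric.ball z ρ, G z / 2 < G x ∧ dist x z₀ < R := by
    have h1 : ∀ᶠ x in nhds z, G z / 2 < G x :=
      hGcont.continuousAt.eventually (lt_mem_nhds (by linarith))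
    have h2 : ∀ᶠ x in nhds z, dist x z₀ < R :=
      Metric.isOpen_ball.mem_nhds (show z ∈ Metric.ball z₀ R by simp [hR])
    exact Metric.eventually_nhds_iff_ball.1 (h1.and h2)
  set U : ℝ := volume.real (Metric.ball z ρ) with hU
  have hUpos : 0 < U := ENNReal.toReal_pos (Metric.measure_ball_pos _ _ hρ).ne'
    measure_ball_lt_top.ne
  have hlower : ∀ τ, 0 ≤ τ → U * (Real.exp (τ * (R ^ 2)⁻¹) * (G z / 2)) ≤
      ∫ z, Real.exp (τ * ψ z) * G z := by
    intro τ hτ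
    have h1 : Integrable ((Metric.ball z ρ).indicator
        fun _ => Real.exp (τ * (R ^ 2)⁻¹) * (G z / 2)) :=
      (integrable_indicator_iff Metric.isOpen_ball.measurableSet).2
        (integrableOn_const measure_ball_lt_top.ne)
    have h2 : U * (Real.exp (τ * (R ^ 2)⁻¹) * (G z / 2)) = ∫ x, (Metric.ball z ρ).indicator
        (fun _ => Real.exp (τ * (R ^ 2)⁻¹) * (G z / 2)) x := by
      rw [integral_indicator_const _ Metric.isOpen_ball.measurableSet]
      simp [hU]
    rw [h2]
    refine integral_mono h1 (hIG τ) fun x => ?_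
    by_cases hx : x ∈ Metric.ball z ρ
    · rw [Set.indicator_of_mem hx]
      have h3 : (R ^ 2)⁻¹ ≤ ψ x := by
        have hx0 : x ≠ z₀ := by
          rintro rfl
          have h4 := (hball x hx).1
          have h5 : G x = 0 := Finset.sum_eq_zero fun i _ => by
            rw [image_eq_zero_of_notMem_tsupport (hz0 i)]; simp
          linarith
        rw [hψeq]
        have h3 : 0 < dist x z₀ := dist_pos.2 hx0
        have := (hball x hx).2.le
        gcongr
      have := (hball x hx).1.le
      dsimp only
      gcongr
    · rw [Set.indicator_of_notMem hx]
      exact mul_nonneg (Real.exp_pos _).le (hGnn x)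
  have hM₁nn : 0 ≤ M₁ := by positivity
  have hVnn : 0 ≤ V := measureReal_nonneg
  have hfin : ∀ τ, 0 ≤ τ → M₁ ≤ τ * c → (τ * c - M₁) * (U * (G z / 2)) ≤ V * B := by
    intro τ hτ hτc
    have h1 := hupper τ hτ
    have h2 := mul_le_mul_of_nonneg_left (hlower τ hτ) (sub_nonneg.2 hτc)
    have h3 : Real.exp (τ * (R ^ 2)⁻¹) * ((τ * c - M₁) * (U * (G z / 2))) ≤
        Real.exp (τ * (R ^ 2)⁻¹) * (V * B) := by linarith
    exact le_of_mul_le_mul_left h3 (Real.exp_pos _)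
  have hK : 0 < U * (G z / 2) := by positivity
  -- This τ makes the left side of `hfin` equal to V * B + 1, one more than the right side.
  have := hfin ((M₁ + (V * B + 1) / (U * (G z / 2))) / c) (by positivity) (by
    rw [div_mul_cancel₀ _ hcpos.ne']
    have : 0 ≤ (V * B + 1) / (U * (G z / 2)) := by positivity
    linarith)
  rw [div_mul_cancel₀ _ hcpos.ne', add_sub_cancel_left, div_mul_cancel₀ _ hK.ne'] at this
  linarith

end

section

/-! ### Linear algebra of the form of signature `(4,2)` -/

section LinearAlgebra

variable {K : Type*} [Field K]

theorem psForm_eq_dotProduct {n s : ℕ} (x y : Fin n → K) :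
    psForm s x y = x ⬝ᵥ (Matrix.diagonal (psSign K s)).mulVec y := by
  rw [psForm_eq_sum]
  simp only [dotProduct, Matrix.mulVec_diagonal]
  exact Finset.sum_congr rfl fun i _ => by ring

theorem gram_apply {n s m : ℕ} (M : Matrix (Fin m) (Fin n) K) (i j : Fin m) :
    (M * ((Matrix.diagonal (psSign K s) : Matrix (Fin n) (Fin n) K) * M.transpose :
      Matrix (Fin n) (Fin m) K) : Matrix (Fin m) (Fin m) K) i j = psForm s (M i) (M j) := by
  rw [psForm_eq_sum, Matrix.mul_apply]
  refine Finset.sum_congr rfl fun k _ => ?_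
  simp only [Matrix.diagonal_mul, Matrix.transpose_apply]
  ring

theorem psSign_mul_self {n s : ℕ} (i : Fin n) : psSign K s i * psSign K s i = 1 := by
  unfold psSign; split_ifs <;> simp

theorem psSign_diagonal_sq {n s : ℕ} :
    Matrix.diagonal (psSign K s (n := n)) * Matrix.diagonal (psSign K s) = 1 := by
  rw [Matrix.diagonal_mul_diagonal]
  simp only [psSign_mul_self, Matrix.diagonal_one]

/-- The Gram relations of a frame `(Y, N, A, B, L, R)` made of two null pairs and an orthonormal
pair. -/
structure IsAdaptedFrame (Y N A B L R : Fin 6 → K) : Prop where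
  YY : psForm 2 Y Y = 0
  NN : psForm 2 N N = 0
  YN : psForm 2 Y N = -1
  AA : psForm 2 A A = 1
  BB : psForm 2 B B = 1
  AB : psForm 2 A B = 0
  YA : psForm 2 Y A = 0
  YB : psForm 2 Y B = 0
  NA : psForm 2 N A = 0
  NB : psForm 2 N B = 0
  LL : psForm 2 L L = 0
  RR : psForm 2 R R = 0
  LR : psForm 2 L R = -1
  LY : psForm 2 L Y = 0
  LN : psForm 2 L N = 0
  LA : psForm 2 L A = 0
  LB : psForm 2 L B = 0
  RY : psForm 2 R Y = 0
  RN : psForm 2 R N = 0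
  RA : psForm 2 R A = 0
  RB : psForm 2 R B = 0

/-- The Gram matrix of the frame is an involution, so the matrix with these rows is invertible. A
vector orthogonal to all rows therefore vanishes. -/
theorem IsAdaptedFrame.eq_zero {Y N A B L R v : Fin 6 → K} (h : IsAdaptedFrame Y N A B L R)
    (hY : psForm 2 v Y = 0) (hN : psForm 2 v N = 0) (hA : psForm 2 v A = 0)
    (hB : psForm 2 v B = 0) (hL : psForm 2 v L = 0) (hR : psForm 2 v R = 0) : v = 0 := by
  set M : Matrix (Fin 6) (Fin 6) K := Matrix.of ![Y, N, A, B, L, R] with hM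
  set D : Matrix (Fin 6) (Fin 6) K := Matrix.diagonal (psSign K 2) with hD
  set G : Matrix (Fin 6) (Fin 6) K := !![0, -1, 0, 0, 0, 0; -1, 0, 0, 0, 0, 0; 0, 0, 1, 0, 0, 0;
    0, 0, 0, 1, 0, 0; 0, 0, 0, 0, 0, -1; 0, 0, 0, 0, -1, 0] with hG
  have hgram : M * (D * M.transpose) = G := by
    ext i j
    rw [hD, gram_apply]
    change psForm 2 ((![Y, N, A, B, L, R] : Fin 6 → Fin 6 → K) i)
      ((![Y, N, A, B, L, R] : Fin 6 → Fin 6 → K) j) = G i j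
    have c := fun x y : Fin 6 → K => psForm_comm (s := 2) x y
    fin_cases i <;> fin_cases j <;>
      simp [hG, h.YY, h.NN, h.YN, h.AA, h.BB, h.AB, h.YA, h.YB, h.NA, h.NB, h.LL, h.RR, h.LR,
        h.LY, h.LN, h.LA, h.LB, h.RY, h.RN, h.RA, h.RB, c N Y, c A Y, c A N, c B Y, c B N, c B A,
        c Y L, c N L, c A L, c B L, c Y R, c N R, c A R, c B R, c R L]
  have hGG : G * G = 1 := by
    ext i j
    fin_cases i <;> fin_cases j <;> simp [hG, Matrix.mul_apply, Fin.sum_univ_six]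
  have hMinv : M * (D * M.transpose * G) = 1 := by rw [← mul_assoc, hgram, hGG]
  have hMinv' : (D * M.transpose * G) * M = 1 := mul_eq_one_comm.1 hMinv
  have hv : M.mulVec (D.mulVec v) = 0 := by
    ext i
    change M i ⬝ᵥ D.mulVec v = 0
    rw [← psForm_eq_dotProduct, psForm_comm]
    change psForm 2 v ((![Y, N, A, B, L, R] : Fin 6 → Fin 6 → K) i) = 0
    fin_cases i <;> simp [hY, hN, hA, hB, hL, hR]
  have h2 : D.mulVec v = 0 := by
    have := congrArg ((D * M.transpose * G).mulVec) hv
    rwa [Matrix.mulVec_mulVec, hMinv', Matrix.one_mulVec, Matrix.mulVec_zero] at this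
  have h3 := congrArg D.mulVec h2
  rwa [Matrix.mulVec_mulVec, hD, psSign_diagonal_sq, Matrix.one_mulVec, Matrix.mulVec_zero] at h3

/-- Expansion of a vector in an adapted frame. -/
theorem IsAdaptedFrame.expand {Y N A B L R : Fin 6 → K} (h : IsAdaptedFrame Y N A B L R)
    (v : Fin 6 → K) :
    v = (-psForm 2 v N) • Y + (-psForm 2 v Y) • N + psForm 2 v A • A + psForm 2 v B • B +
      (-psForm 2 v R) • L + (-psForm 2 v L) • R := by
  rw [← sub_eq_zero]
  have c := fun x y : Fin 6 → K => psForm_comm (s := 2) x y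
  apply h.eq_zero <;>
    simp only [psForm_sub_left, psForm_add_left, psForm_smul_left, h.YY, h.NN, h.YN, h.AA, h.BB,
      h.AB, h.YA, h.YB, h.NA, h.NB, h.LL, h.RR, h.LR, h.LY, h.LN, h.LA, h.LB, h.RY, h.RN, h.RA,
      h.RB, c N Y, c A Y, c A N, c B Y, c B N, c B A, c Y L, c N L, c A L, c B L, c Y R, c N R,
      c A R, c B R, c R L] <;>
    ring

theorem IsAdaptedFrame.toC {Y N A B L R : Fin 6 → ℝ} (h : IsAdaptedFrame Y N A B L R) :
    IsAdaptedFrame (toC Y) (toC N) (toC A) (toC B) (toC L) (toC R) := by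
  constructor <;>
    simp [psForm_toC, h.YY, h.NN, h.YN, h.AA, h.BB,
      h.AB, h.YA, h.YB, h.NA, h.NB, h.LL, h.RR, h.LR, h.LY, h.LN, h.LA, h.LB, h.RY, h.RN, h.RA,
      h.RB]

end LinearAlgebra

/-! ### A cross product in `ℝ⁶₂` -/

/-- The matrix with rows `e 0, …, e 4, ξ`. -/
def rowsMatrix (e : Fin 5 → Fin 6 → ℝ) (ξ : Fin 6 → ℝ) : Matrix (Fin 6) (Fin 6) ℝ :=
  Matrix.of ![e 0, e 1, e 2, e 3, e 4, ξ]

/-- The vector representing the functional `ξ ↦ det (e 0, …, e 4, ξ)`. -/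
def cross (e : Fin 5 → Fin 6 → ℝ) (k : Fin 6) : ℝ :=
  psSign ℝ 2 k * ((rowsMatrix e 0).updateRow 5 (Pi.single k 1)).det

/-- Laplace expansion along the last row; the signs built into `cross` cancel those of the form. -/
theorem psForm_cross (e : Fin 5 → Fin 6 → ℝ) (ξ : Fin 6 → ℝ) :
    psForm 2 (cross e) ξ = (rowsMatrix e ξ).det := by
  rw [Matrix.det_eq_sum_mul_adjugate_row _ 5, psForm_eq_sum]
  refine Finset.sum_congr rfl fun k _ => ?_
  rw [Matrix.adjugate_apply, cross]
  have h1 : (rowsMatrix e ξ).updateRow 5 (Pi.single k 1) =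
      (rowsMatrix e 0).updateRow 5 (Pi.single k 1) := by
    ext i j
    fin_cases i <;> simp [rowsMatrix, Matrix.updateRow_apply]
  have h2 : rowsMatrix e ξ 5 k = ξ k := by simp [rowsMatrix]
  rw [h1, h2]
  linear_combination (((rowsMatrix e 0).updateRow 5 (Pi.single k 1)).det * ξ k) *
    psSign_mul_self (K := ℝ) (s := 2) k

section Cross

/-- Five orthogonal vectors of squared lengths `-1, 1, 1, 1, -1`. -/
def IsOrthoFive (e : Fin 5 → Fin 6 → ℝ) : Prop :=
  ∀ i j, psForm 2 (e i) (e j) = if i = j then (![-1, 1, 1, 1, -1] : Fin 5 → ℝ) i else 0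

variable {e : Fin 5 → Fin 6 → ℝ}

/-- Take determinants in the Gram identity. The two minus signs of the five vectors cancel, and so
do those of the ambient form. -/
theorem det_rowsMatrix_sq (he : IsOrthoFive e) {ξ : Fin 6 → ℝ} (hξ : ∀ i, psForm 2 (e i) ξ = 0) :
    (rowsMatrix e ξ).det ^ 2 = psForm 2 ξ ξ := by
  have hgram : rowsMatrix e ξ * (Matrix.diagonal (psSign ℝ 2) * (rowsMatrix e ξ).transpose) =
      Matrix.diagonal ![-1, 1, 1, 1, -1, psForm 2 ξ ξ] := by
    ext i j
    rw [gram_apply]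
    have hξ' : ∀ i, psForm 2 ξ (e i) = 0 := fun i => by rw [psForm_comm, hξ]
    change psForm 2 ((![e 0, e 1, e 2, e 3, e 4, ξ] : Fin 6 → Fin 6 → ℝ) i)
      ((![e 0, e 1, e 2, e 3, e 4, ξ] : Fin 6 → Fin 6 → ℝ) j) = _
    fin_cases i <;> fin_cases j <;> simp [he _ _, hξ, hξ']
  have := congrArg Matrix.det hgram
  rw [Matrix.det_mul, Matrix.det_mul, Matrix.det_transpose, Matrix.det_diagonal,
    Matrix.det_diagonal] at this
  simp [Fin.prod_univ_six, psSign] at this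
  linarith [sq (rowsMatrix e ξ).det]

/-- The Gram determinant does not exclude a null ξ, so linear independence is proved directly by
pairing a relation with each of the five vectors. -/
theorem det_rowsMatrix_ne_zero (he : IsOrthoFive e) {ξ : Fin 6 → ℝ} (hξ : ∀ i, psForm 2 (e i) ξ = 0) (h0 : ξ ≠ 0) :
    (rowsMatrix e ξ).det ≠ 0 := by
  intro hdet
  obtain ⟨c, hc, hc0⟩ := Matrix.exists_vecMul_eq_zero_iff.2 hdet
  have hsum : c 0 • e 0 + c 1 • e 1 + c 2 • e 2 + c 3 • e 3 + c 4 • e 4 + c 5 • ξ = 0 := by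
    rw [← hc0]
    ext k
    simp [Matrix.vecMul, dotProduct, Fin.sum_univ_six, rowsMatrix]
  have hj : ∀ j, psForm 2 (c 0 • e 0 + c 1 • e 1 + c 2 • e 2 + c 3 • e 3 + c 4 • e 4 + c 5 • ξ)
      (e j) = 0 := fun j => by rw [hsum, psForm_zero_left]
  have hξ' : ∀ i, psForm 2 ξ (e i) = 0 := fun i => by rw [psForm_comm, hξ]
  simp only [psForm_add_left, psForm_smul_left, he _ _, hξ'] at hj
  have h0' := hj 0
  have h1' := hj 1
  have h2' := hj 2
  have h3' := hj 3
  have h4' := hj 4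
  simp at h0' h1' h2' h3' h4'
  rw [h0', h1', h2', h3', h4'] at hsum
  simp [h0] at hsum
  apply hc
  ext i
  fin_cases i <;> simp [*]

theorem cross_orth (i : Fin 5) : psForm 2 (e i) (cross e) = 0 := by
  rw [psForm_comm, psForm_cross]
  have : ∀ i : Fin 5, i.castSucc ≠ (5 : Fin 6) := by decide
  refine Matrix.det_zero_of_row_eq (this i) ?_
  fin_cases i <;> rfl

/-- Let q = ⟨σ,σ⟩ for σ = `cross e`. Then q is the determinant with last row σ, whose square is
again q, so q is 0 or 1. The value 0 is excluded by independence once σ ≠ 0 is known. -/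
theorem cross_cross (he : IsOrthoFive e) : psForm 2 (cross e) (cross e) = 1 := by
  have h1 : psForm 2 (cross e) (cross e) ^ 2 = psForm 2 (cross e) (cross e) := by
    conv_lhs => rw [psForm_cross]
    exact det_rowsMatrix_sq he cross_orth
  have hdet0 : (rowsMatrix e 0).det = 0 :=
    Matrix.det_eq_zero_of_row_eq_zero 5 fun j => by simp [rowsMatrix]
  -- Five vectors in dimension six leave a nonzero orthogonal vector ξ. The determinant with last
  -- row ξ is nonzero and equals ⟨σ,ξ⟩, so σ ≠ 0.
  obtain ⟨v, hv, hv0⟩ := Matrix.exists_mulVec_eq_zero_iff.2 hdet0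
  set ξ := (Matrix.diagonal (psSign ℝ 2)).mulVec v with hξdef
  have hvξ : v = (Matrix.diagonal (psSign ℝ 2)).mulVec ξ := by
    rw [hξdef, Matrix.mulVec_mulVec, psSign_diagonal_sq, Matrix.one_mulVec]
  have hξ : ∀ i, psForm 2 (e i) ξ = 0 := fun i => by
    rw [psForm_eq_dotProduct, ← hvξ]
    have := congrFun hv0 i.castSucc
    fin_cases i <;> simpa [rowsMatrix, Matrix.mulVec] using this
  have hξ0 : ξ ≠ 0 := fun h => hv (by rw [hvξ, h, Matrix.mulVec_zero])
  have h2 : cross e ≠ 0 := fun h => det_rowsMatrix_ne_zero he hξ hξ0 (by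
    rw [← psForm_cross, h, psForm_zero_left])
  have h3 := det_rowsMatrix_ne_zero he cross_orth h2
  rw [← psForm_cross] at h3
  have h4 : psForm 2 (cross e) (cross e) * (psForm 2 (cross e) (cross e) - 1) = 0 := by
    linear_combination h1
  rcases mul_eq_zero.1 h4 with h | h
  · exact absurd h h3
  · linarith

end Cross

theorem contDiff_det {n : ℕ} {A : ℂ → Matrix (Fin n) (Fin n) ℝ}
    (h : ∀ i j, ContDiff ℝ ∞ fun z => A z i j) : ContDiff ℝ ∞ fun z => (A z).det := by
  simp only [Matrix.det_apply']
  exact ContDiff.sum fun σ _ => contDiff_const.mul (contDiff_prod fun i _ => h _ _)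

theorem contDiff_cross {e : Fin 5 → ℂ → Fin 6 → ℝ} (h : ∀ i, ContDiff ℝ ∞ (e i)) :
    ContDiff ℝ ∞ fun z => cross fun i => e i z := by
  refine contDiff_pi.2 fun k => contDiff_const.mul (contDiff_det fun i j => ?_)
  have := fun i => contDiff_pi.1 (h i)
  fin_cases i <;> simp [rowsMatrix, Matrix.updateRow_apply, contDiff_const, this]

end

section

/-! ### Lifts -/

theorem Represents.null {v : Fin 6 → ℝ} {p : Q41} (h : Represents v p) : psForm 2 v v = 0 :=
  p.2 v h.2

theorem Represents.exists_smul {v w : Fin 6 → ℝ} {p : Q41} (hv : Represents v p)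
    (hw : Represents w p) : ∃ c : ℝ, c ≠ 0 ∧ w = c • v := by
  have h1 := hv.2
  have h2 := hw.2
  rw [Projectivization.submodule_eq, Submodule.mem_span_singleton] at h1 h2
  obtain ⟨a, ha⟩ := h1
  obtain ⟨b, hb⟩ := h2
  have ha0 : a ≠ 0 := by rintro rfl; exact hv.1 (by simpa using ha.symm)
  refine ⟨b * a⁻¹, ?_, ?_⟩
  · rintro h
    apply hw.1
    rcases mul_eq_zero.1 h with h | h
    · rw [← hb, h, zero_smul]
    · exact absurd h (inv_ne_zero ha0)
  · rw [← ha, ← hb, smul_smul, mul_assoc, inv_mul_cancel₀ ha0, mul_one]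

theorem Represents.smul {v : Fin 6 → ℝ} {p : Q41} (hv : Represents v p) {c : ℝ} (hc : c ≠ 0) :
    Represents (c • v) p :=
  ⟨smul_ne_zero hc hv.1, Submodule.smul_mem _ _ hv.2⟩

/-- The point of `Q⁴₁` spanned by a nonzero null vector. -/
def nullPoint (v : Fin 6 → ℝ) (hv : v ≠ 0) (h : psForm 2 v v = 0) : Q41 :=
  ⟨Projectivization.mk ℝ v hv, fun w hw => by
    rw [Projectivization.submodule_mk, Submodule.mem_span_singleton] at hw
    obtain ⟨a, rfl⟩ := hw
    rw [psForm_smul_left, psForm_smul_right, h]; ring⟩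

theorem represents_nullPoint (v : Fin 6 → ℝ) (hv : v ≠ 0) (h : psForm 2 v v = 0) :
    Represents v (nullPoint v hv h) :=
  ⟨hv, by simp [nullPoint, Projectivization.submodule_mk, Submodule.mem_span_singleton_self]⟩

theorem sum_sq_pos {n : ℕ} {v : Fin n → ℝ} (hv : v ≠ 0) : 0 < ∑ i, v i ^ 2 := by
  obtain ⟨i, hi⟩ := Function.ne_iff.1 hv
  exact Finset.sum_pos' (fun i _ => sq_nonneg _) ⟨i, Finset.mem_univ _, sq_pos_of_ne_zero hi⟩

/-- Two smooth nowhere zero maps that are pointwise proportional differ by a smooth factor. -/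
theorem exists_smooth_factor {n : ℕ} {A B : ℂ → Fin n → ℝ} {s : Set ℂ}
    (hA : ∀ z ∈ s, ContDiffAt ℝ ∞ A z) (hB : ∀ z ∈ s, ContDiffAt ℝ ∞ B z)
    (h0 : ∀ z ∈ s, B z ≠ 0) (h : ∀ z ∈ s, ∃ c : ℝ, c ≠ 0 ∧ A z = c • B z) :
    ∃ f : ℂ → ℝ, (∀ z ∈ s, ContDiffAt ℝ ∞ f z) ∧ ∀ z ∈ s, f z ≠ 0 ∧ A z = f z • B z := by
  -- The Euclidean quotient recovers the factor and is visibly smooth.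
  refine ⟨fun z => (∑ i, A z i * B z i) / ∑ i, B z i ^ 2, fun z hz => ?_, fun z hz => ?_⟩
  · have h1 := contDiffAt_pi.1 (hA z hz)
    have h2 := contDiffAt_pi.1 (hB z hz)
    exact (ContDiffAt.sum fun i _ => (h1 i).mul (h2 i)).div (ContDiffAt.sum fun i _ => (h2 i).pow 2)
      (sum_sq_pos (h0 z hz)).ne'
  · obtain ⟨c, hc, hAB⟩ := h z hz
    have : (∑ i, A z i * B z i) / ∑ i, B z i ^ 2 = c := by
      rw [div_eq_iff (sum_sq_pos (h0 z hz)).ne', hAB, Finset.mul_sum]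
      exact Finset.sum_congr rfl fun i _ => by simp; ring
    simp only [this]
    exact ⟨hc, hAB⟩

/-- All terms involving the derivative of f carry ⟨X,X⟩ or ⟨X,dX⟩, and both vanish on the light
cone. Hence a change of lift rescales the metric conformally. -/
theorem pd_smul_null {X : ℂ → Fin 6 → ℝ} {f : ℂ → ℝ} {z : ℂ} (hX : DifferentiableAt ℝ X z)
    (hf : DifferentiableAt ℝ f z) (hnull : ∀ᶠ w in nhds z, psForm 2 (X w) (X w) = 0) (i j : Fin 2) :
    psForm 2 (pd i (fun w => f w • X w) z) (pd j (fun w => f w • X w) z) =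
      f z ^ 2 * psForm 2 (pd i X z) (pd j X z) := by
  have h1 : ∀ i, psForm 2 (X z) (pd i X z) = 0 := fun i => by
    have h2 : pd i (fun w => psForm 2 (X w) (X w)) z = 0 := by
      rw [pd_congr (X' := fun _ => (0 : ℝ)) hnull, pd_const]
    rw [pd_psForm hX hX, psForm_comm (pd i X z)] at h2
    linarith
  have h0 := hnull.self_of_nhds
  rw [pd_smul hf hX, pd_smul hf hX]
  simp only [psForm_add_left, psForm_add_right, psForm_smul_left, psForm_smul_right, h1, h0,
    psForm_comm (pd i X z) (X z)]
  ring

theorem firstForm_smul {X : ℂ → Fin 6 → ℝ} {f : ℂ → ℝ} {z : ℂ} (hX : DifferentiableAt ℝ X z)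
    (hf : DifferentiableAt ℝ f z) (hnull : ∀ᶠ w in nhds z, psForm 2 (X w) (X w) = 0) :
    firstForm 2 (fun w => f w • X w) z = f z ^ 2 • firstForm 2 X z := by
  ext i j
  simp only [firstForm, Matrix.of_apply, Matrix.smul_apply, smul_eq_mul]
  exact pd_smul_null hX hf hnull i j

theorem firstForm_congr {s n : ℕ} {X X' : ℂ → Fin n → ℝ} {z : ℂ} (h : X =ᶠ[nhds z] X') :
    firstForm s X z = firstForm s X' z := by
  ext i j
  simp only [firstForm, Matrix.of_apply, pd_congr h]

/-- The relations of a canonical lift that do not refer to the surface. -/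
structure IsCanon (Y : ℂ → Fin 6 → ℝ) : Prop where
  smooth : ContDiff ℝ ∞ Y
  null : ∀ z, psForm 2 (Y z) (Y z) = 0
  unit : ∀ z, firstForm 2 Y z = 1

theorem IsCanonicalLift.isCanon {i : Fin 2} {y : OnePoint ℂ → Q41} {Y : ℂ → Fin 6 → ℝ}
    (h : IsCanonicalLift i y Y) : IsCanon Y :=
  ⟨h.1.1, fun z => (h.1.2 z).null, h.2⟩

/-- `⟨Y_z, Y_z⟩` in real terms. -/
theorem psForm_dz_dz {X : ℂ → Fin 6 → ℝ} {z : ℂ} (hX : DifferentiableAt ℝ X z) :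
    psForm 2 (dz (fun w => toC (X w)) z) (dz (fun w => toC (X w)) z) =
      (((psForm 2 (pd 0 X z) (pd 0 X z) - psForm 2 (pd 1 X z) (pd 1 X z)) / 4 : ℝ) : ℂ) -
        Complex.I * ((psForm 2 (pd 0 X z) (pd 1 X z) / 2 : ℝ) : ℂ) := by
  simp only [dz, pd_toC hX, psForm_smul_left, psForm_smul_right, psForm_sub_left, psForm_sub_right,
    psForm_toC, psForm_comm (pd 1 X z) (pd 0 X z)]
  push_cast
  linear_combination (1 / 4 * ((psForm 2 (pd 1 X z) (pd 1 X z) : ℝ) : ℂ)) * Complex.I_mul_I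

theorem psForm_dz_dzbar {X : ℂ → Fin 6 → ℝ} {z : ℂ} (hX : DifferentiableAt ℝ X z) :
    psForm 2 (dz (fun w => toC (X w)) z) (dzbar (fun w => toC (X w)) z) =
      (((psForm 2 (pd 0 X z) (pd 0 X z) + psForm 2 (pd 1 X z) (pd 1 X z)) / 4 : ℝ) : ℂ) := by
  simp only [dz, dzbar, pd_toC hX, psForm_smul_left, psForm_smul_right, psForm_sub_left,
    psForm_add_right, psForm_toC, psForm_comm (pd 1 X z) (pd 0 X z)]
  push_cast
  linear_combination (-1 / 4 * ((psForm 2 (pd 1 X z) (pd 1 X z) : ℝ) : ℂ)) * Complex.I_mul_I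

/-- Divide any conformal lift by the square root of its conformal factor. -/
theorem exists_canonicalLift {y : OnePoint ℂ → Q41} (hy : IsConformalSpacelike y) (i : Fin 2) :
    ∃ Y, IsCanonicalLift i y Y := by
  obtain ⟨X, hX, hc⟩ := hy i
  have hd := smooth_differentiableAt hX.1
  have hnull : ∀ z, psForm 2 (X z) (X z) = 0 := fun z => (hX.2 z).null
  have hF : ∀ z, psForm 2 (pd 0 X z) (pd 0 X z) = psForm 2 (pd 1 X z) (pd 1 X z) ∧
      psForm 2 (pd 0 X z) (pd 1 X z) = 0 ∧ 0 < psForm 2 (pd 0 X z) (pd 0 X z) := by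
    intro z
    obtain ⟨h1, h2⟩ := hc z
    rw [psForm_dz_dz (hd z)] at h1
    rw [psForm_dz_dzbar (hd z), Complex.ofReal_re] at h2
    have hre := congrArg Complex.re h1
    have him := congrArg Complex.im h1
    simp at hre him
    refine ⟨by linarith, him, by linarith⟩
  have hE : ContDiff ℝ ∞ fun z => psForm 2 (pd 0 X z) (pd 0 X z) :=
    contDiff_psForm (contDiff_pd hX.1 0) (contDiff_pd hX.1 0)
  have hf : ContDiff ℝ ∞ fun z => (Real.sqrt (psForm 2 (pd 0 X z) (pd 0 X z)))⁻¹ :=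
    (hE.sqrt fun z => (hF z).2.2.ne').inv fun z => (Real.sqrt_pos.2 (hF z).2.2).ne'
  refine ⟨fun z => (Real.sqrt (psForm 2 (pd 0 X z) (pd 0 X z)))⁻¹ • X z,
    ⟨hf.smul hX.1, fun z => (hX.2 z).smul (inv_ne_zero (Real.sqrt_pos.2 (hF z).2.2).ne')⟩,
    fun z => ?_⟩
  rw [firstForm_smul (hd z) (smooth_differentiableAt hf z) (.of_forall hnull)]
  have h3 : (Real.sqrt (psForm 2 (pd 0 X z) (pd 0 X z)))⁻¹ ^ 2 * psForm 2 (pd 0 X z) (pd 0 X z) =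
      1 := by
    rw [inv_pow, Real.sq_sqrt (hF z).2.2.le, inv_mul_cancel₀ (hF z).2.2.ne']
  ext a b
  simp only [firstForm, Matrix.smul_apply, Matrix.of_apply, smul_eq_mul]
  fin_cases a <;> fin_cases b
  · simpa using h3
  · simp [(hF z).2.1]
  · simp [psForm_comm (pd 1 X z) (pd 0 X z), (hF z).2.1]
  · simpa [← (hF z).1] using h3

namespace IsCanon

variable {Y : ℂ → Fin 6 → ℝ}

theorem pd_smooth (hY : IsCanon Y) (i : Fin 2) : ContDiff ℝ ∞ (pd i Y) := contDiff_pd hY.smooth i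

theorem pdpd_smooth (hY : IsCanon Y) (i j : Fin 2) : ContDiff ℝ ∞ (pd i (pd j Y)) :=
  contDiff_pd (hY.pd_smooth j) i

theorem form_pd_pd (hY : IsCanon Y) (z : ℂ) (i j : Fin 2) :
    psForm 2 (pd i Y z) (pd j Y z) = if i = j then 1 else 0 := by
  have := congrFun (congrFun (hY.unit z) i) j
  simpa [firstForm, Matrix.one_apply] using this

theorem form_self_pd (hY : IsCanon Y) (z : ℂ) (i : Fin 2) : psForm 2 (Y z) (pd i Y z) = 0 := by
  have h : pd i (fun w => psForm 2 (Y w) (Y w)) z = 0 := by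
    simp only [hY.null, pd_const]
  have hd := smooth_differentiableAt hY.smooth z
  rw [pd_psForm hd hd, psForm_comm (pd i Y z)] at h
  linarith

theorem form_self_pdpd (hY : IsCanon Y) (z : ℂ) (i j : Fin 2) :
    psForm 2 (Y z) (pd i (pd j Y) z) = if i = j then -1 else 0 := by
  have h : pd i (fun w => psForm 2 (Y w) (pd j Y w)) z = 0 := by
    simp only [hY.form_self_pd, pd_const]
  rw [pd_psForm (smooth_differentiableAt hY.smooth z) (smooth_differentiableAt (hY.pd_smooth j) z),
    hY.form_pd_pd] at h
  split_ifs at h ⊢ <;> linarith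

/-- The metric |dz|² is flat in this coordinate, so its Christoffel symbols vanish: the expression
is symmetric in i, j and skew in j, k. -/
theorem form_pdpd_pd (hY : IsCanon Y) (z : ℂ) (i j k : Fin 2) :
    psForm 2 (pd i (pd j Y) z) (pd k Y z) = 0 := by
  have key : ∀ i j k, psForm 2 (pd i (pd j Y) z) (pd k Y z) =
      -psForm 2 (pd i (pd k Y) z) (pd j Y z) := by
    intro i j k
    have h : pd i (fun w => psForm 2 (pd j Y w) (pd k Y w)) z = 0 := by
      simp only [hY.form_pd_pd, pd_const]
    rw [pd_psForm (smooth_differentiableAt (hY.pd_smooth j) z)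
      (smooth_differentiableAt (hY.pd_smooth k) z), psForm_comm (pd j Y z)] at h
    linarith
  have sw : ∀ i j, pd i (pd j Y) z = pd j (pd i Y) z := fun i j =>
    pd_pd_comm hY.smooth.contDiffAt i j
  have h1 := key i j k
  have h2 := key k i j
  have h3 := key j k i
  rw [sw k i] at h2
  rw [sw j k, sw j i] at h3
  rw [sw k j] at h2 h3
  rw [sw j k] at h2 h3
  linarith

theorem form_self_lap (hY : IsCanon Y) (z : ℂ) : psForm 2 (Y z) (lap Y z) = -2 := by
  rw [lap, psForm_add_right, hY.form_self_pdpd, hY.form_self_pdpd]; norm_num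

theorem form_lap_pd (hY : IsCanon Y) (z : ℂ) (k : Fin 2) : psForm 2 (lap Y z) (pd k Y z) = 0 := by
  rw [lap, psForm_add_left, hY.form_pdpd_pd, hY.form_pdpd_pd]; norm_num

theorem ne_zero (hY : IsCanon Y) (z : ℂ) : Y z ≠ 0 := fun h => by
  have := hY.form_self_lap z
  rw [h, psForm_zero_left] at this
  norm_num at this

theorem form_self_frameN (hY : IsCanon Y) (z : ℂ) : psForm 2 (Y z) (frameN Y z) = -1 := by
  rw [frameN, psForm_add_right, psForm_smul_right, psForm_smul_right, hY.null, hY.form_self_lap]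
  ring

theorem form_frameN_pd (hY : IsCanon Y) (z : ℂ) (k : Fin 2) :
    psForm 2 (frameN Y z) (pd k Y z) = 0 := by
  rw [frameN, psForm_add_left, psForm_smul_left, psForm_smul_left, hY.form_self_pd, hY.form_lap_pd]
  ring

theorem form_frameN_frameN (hY : IsCanon Y) (z : ℂ) : psForm 2 (frameN Y z) (frameN Y z) = 0 := by
  have h := hY.form_self_frameN z
  have h2 : psForm 2 (lap Y z) (frameN Y z) = psForm 2 (lap Y z) (lap Y z) / 4 := by
    rw [frameN, psForm_add_right, psForm_smul_right, psForm_smul_right, psForm_comm _ (Y z),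
      hY.form_self_lap]
    ring
  conv_lhs => arg 2; rw [frameN]
  rw [psForm_add_left, psForm_smul_left, psForm_smul_left, h, h2]
  ring

theorem frameN_smooth (hY : IsCanon Y) : ContDiff ℝ ∞ (frameN Y) := by
  have hl := contDiff_lap hY.smooth
  exact (hl.const_smul (1 / 2 : ℝ)).add
    ((contDiff_const.mul (contDiff_psForm hl hl)).smul hY.smooth)

end IsCanon

/-! ### Null normal frames -/

/-- `L, R` is a smooth null frame of the normal bundle of the canonical lift `Y`. -/
structure IsFrame (Y L R : ℂ → Fin 6 → ℝ) : Prop where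
  smoothL : ContDiff ℝ ∞ L
  smoothR : ContDiff ℝ ∞ R
  LL : ∀ z, psForm 2 (L z) (L z) = 0
  RR : ∀ z, psForm 2 (R z) (R z) = 0
  LR : ∀ z, psForm 2 (L z) (R z) = -1
  LY : ∀ z, psForm 2 (L z) (Y z) = 0
  Lpd : ∀ z i, psForm 2 (L z) (pd i Y z) = 0
  Llap : ∀ z, psForm 2 (L z) (lap Y z) = 0
  RY : ∀ z, psForm 2 (R z) (Y z) = 0
  Rpd : ∀ z i, psForm 2 (R z) (pd i Y z) = 0
  Rlap : ∀ z, psForm 2 (R z) (lap Y z) = 0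

theorem IsFrame.symm {Y L R : ℂ → Fin 6 → ℝ} (h : IsFrame Y L R) : IsFrame Y R L :=
  ⟨h.smoothR, h.smoothL, h.RR, h.LL, fun z => by rw [psForm_comm, h.LR], h.RY, h.Rpd, h.Rlap, h.LY,
    h.Lpd, h.Llap⟩

theorem IsFrame.LN {Y L R : ℂ → Fin 6 → ℝ} (h : IsFrame Y L R) (z : ℂ) :
    psForm 2 (L z) (frameN Y z) = 0 := by
  rw [frameN, psForm_add_right, psForm_smul_right, psForm_smul_right, h.LY, h.Llap]; ring

theorem IsFrame.adapted {Y L R : ℂ → Fin 6 → ℝ} (h : IsFrame Y L R) (hY : IsCanon Y) (z : ℂ) :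
    IsAdaptedFrame (Y z) (frameN Y z) (pd 0 Y z) (pd 1 Y z) (L z) (R z) where
  YY := hY.null z
  NN := hY.form_frameN_frameN z
  YN := hY.form_self_frameN z
  AA := by simpa using hY.form_pd_pd z 0 0
  BB := by simpa using hY.form_pd_pd z 1 1
  AB := by simpa using hY.form_pd_pd z 0 1
  YA := hY.form_self_pd z 0
  YB := hY.form_self_pd z 1
  NA := hY.form_frameN_pd z 0
  NB := hY.form_frameN_pd z 1
  LL := h.LL z
  RR := h.RR z
  LR := h.LR z
  LY := h.LY z
  LN := h.LN z
  LA := h.Lpd z 0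
  LB := h.Lpd z 1
  RY := h.RY z
  RN := h.symm.LN z
  RA := h.Rpd z 0
  RB := h.Rpd z 1

theorem psForm_two_six (x y : Fin 6 → ℝ) : psForm 2 x y =
    x 0 * y 0 + x 1 * y 1 + x 2 * y 2 + x 3 * y 3 - x 4 * y 4 - x 5 * y 5 := by
  simp [psForm, Fin.sum_univ_six]
  ring

/-- The normal planes have signature (1,1). A global timelike section τ comes from the two negative
coordinates, a cross product supplies the unit spacelike normal σ, and the null frame is (τ ± σ)/√2.
-/
theorem exists_frame {Y : ℂ → Fin 6 → ℝ} (hY : IsCanon Y) : ∃ L R, IsFrame Y L R := by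
  have hYi := contDiff_pi.1 hY.smooth
  -- The negative plane rotated by a right angle: this vector is orthogonal to Y, and timelike
  -- because a nonzero null vector has a nonzero negative part.
  set om : ℂ → Fin 6 → ℝ := fun z => ![0, 0, 0, 0, Y z 5, -Y z 4] with hom
  have homs : ContDiff ℝ ∞ om := by
    refine contDiff_pi.2 fun k => ?_
    fin_cases k <;> simp [hom, contDiff_const, hYi, (hYi 4).neg]
  have homY : ∀ z, psForm 2 (om z) (Y z) = 0 := fun z => by
    rw [psForm_two_six]; simp [hom]; ring
  have homom : ∀ z, psForm 2 (om z) (om z) < 0 := fun z => by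
    have h1 : psForm 2 (om z) (om z) = -(Y z 4 ^ 2 + Y z 5 ^ 2) := by
      rw [psForm_two_six]; simp [hom]; ring
    have h2 := hY.null z
    rw [psForm_two_six] at h2
    have h3 := sum_sq_pos (hY.ne_zero z)
    rw [Fin.sum_univ_six] at h3
    rw [h1]
    nlinarith
  -- projection to the normal bundle
  set T : ℂ → Fin 6 → ℝ := fun z => om z + psForm 2 (om z) (frameN Y z) • Y z -
    psForm 2 (om z) (pd 0 Y z) • pd 0 Y z - psForm 2 (om z) (pd 1 Y z) • pd 1 Y z with hT
  have hTs : ContDiff ℝ ∞ T :=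
    ((homs.add ((contDiff_psForm homs hY.frameN_smooth).smul hY.smooth)).sub
      ((contDiff_psForm homs (hY.pd_smooth 0)).smul (hY.pd_smooth 0))).sub
      ((contDiff_psForm homs (hY.pd_smooth 1)).smul (hY.pd_smooth 1))
  have c := fun x y : Fin 6 → ℝ => psForm_comm (s := 2) x y
  have hTY : ∀ z, psForm 2 (T z) (Y z) = 0 := fun z => by
    simp [hT, psForm_add_left, psForm_sub_left, psForm_smul_left, homY, hY.null,
      c (pd _ Y z) (Y z), hY.form_self_pd]
  have hTp : ∀ z k, psForm 2 (T z) (pd k Y z) = 0 := fun z k => by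
    simp only [hT, psForm_add_left, psForm_sub_left, psForm_smul_left, hY.form_self_pd,
      hY.form_pd_pd]
    fin_cases k <;> simp
  have hTN : ∀ z, psForm 2 (T z) (frameN Y z) = 0 := fun z => by
    simp [hT, psForm_add_left, psForm_sub_left, psForm_smul_left, hY.form_self_frameN,
      c (pd _ Y z) (frameN Y z), hY.form_frameN_pd]
  -- Orthogonality to Y makes the Y-component harmless, and the removed tangential components are
  -- spacelike, so the projection remains timelike.
  have hTT : ∀ z, psForm 2 (T z) (T z) < 0 := fun z => by
    have : psForm 2 (T z) (T z) = psForm 2 (om z) (om z) - psForm 2 (om z) (pd 0 Y z) ^ 2 -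
        psForm 2 (om z) (pd 1 Y z) ^ 2 := by
      conv_lhs => arg 3; rw [hT]
      simp only [psForm_add_right, psForm_sub_right, psForm_smul_right, hTY, hTp]
      rw [hT]
      simp only [psForm_add_left, psForm_sub_left, psForm_smul_left, c (Y z) (om z), homY,
        c (pd _ Y z) (om z)]
      ring
    rw [this]
    nlinarith [homom z, sq_nonneg (psForm 2 (om z) (pd 0 Y z)), sq_nonneg (psForm 2 (om z) (pd 1 Y z))]
  set q : ℂ → ℝ := fun z => (Real.sqrt (-psForm 2 (T z) (T z)))⁻¹ with hq
  have hpos : ∀ z, 0 < Real.sqrt (-psForm 2 (T z) (T z)) := fun z =>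
    Real.sqrt_pos.2 (by linarith [hTT z])
  have hqs : ContDiff ℝ ∞ q :=
    ((contDiff_psForm hTs hTs).neg.sqrt fun z => by linarith [hTT z]).inv fun z => (hpos z).ne'
  have hqT : ∀ z, q z * (q z * psForm 2 (T z) (T z)) = -1 := fun z => by
    have h1 := Real.sq_sqrt (show 0 ≤ -psForm 2 (T z) (T z) by linarith [hTT z])
    have h2 : q z * Real.sqrt (-psForm 2 (T z) (T z)) = 1 := inv_mul_cancel₀ (hpos z).ne'
    linear_combination q z ^ 2 * h1 - (q z * Real.sqrt (-psForm 2 (T z) (T z)) + 1) * h2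
  set κ : ℝ := (Real.sqrt 2)⁻¹ with hκ
  have hκ2 : κ * κ = 1 / 2 := by
    rw [hκ, ← mul_inv, Real.mul_self_sqrt (by norm_num)]; norm_num
  -- Since ⟨Y,N⟩ = -1, the vectors (Y ± N)/√2 have squares -1 and 1; with the tangent vectors and
  -- the unit timelike normal this is the pattern of `IsOrthoFive`.
  set e : Fin 5 → ℂ → Fin 6 → ℝ := ![fun z => κ • (Y z + frameN Y z), fun z => κ • (Y z - frameN Y z),
    pd 0 Y, pd 1 Y, fun z => q z • T z] with he
  have hes : ∀ i, ContDiff ℝ ∞ (e i) := by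
    intro i
    fin_cases i
    · exact (hY.smooth.add hY.frameN_smooth).const_smul κ
    · exact (hY.smooth.sub hY.frameN_smooth).const_smul κ
    · exact hY.pd_smooth 0
    · exact hY.pd_smooth 1
    · exact hqs.smul hTs
  have hortho : ∀ z, IsOrthoFive fun i => e i z := by
    intro z i j
    fin_cases i <;> fin_cases j <;>
      simp [he, psForm_add_left, psForm_sub_left, psForm_smul_left, psForm_add_right,
        psForm_sub_right, psForm_smul_right, hY.null, hY.form_self_frameN, hY.form_frameN_frameN,
        c (frameN Y z) (Y z), hY.form_self_pd, hY.form_frameN_pd, c (pd _ Y z) (Y z),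
        c (pd _ Y z) (frameN Y z), hY.form_pd_pd, hTY, hTp, hTN, c (Y z) (T z),
        c (frameN Y z) (T z), c (pd _ Y z) (T z), hqT] <;>
      linarith
  set σ : ℂ → Fin 6 → ℝ := fun z => cross fun i => e i z with hσ
  have hσs : ContDiff ℝ ∞ σ := contDiff_cross hes
  have hσσ : ∀ z, psForm 2 (σ z) (σ z) = 1 := fun z => cross_cross (hortho z)
  have hσe : ∀ z i, psForm 2 (e i z) (σ z) = 0 := fun z i => cross_orth (e := fun i => e i z) i
  have hκ0 : κ ≠ 0 := fun h => by rw [h] at hκ2; norm_num at hκ2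
  have hσYN : ∀ z, psForm 2 (σ z) (Y z) = 0 ∧ psForm 2 (σ z) (frameN Y z) = 0 := fun z => by
    have h0 : psForm 2 (κ • (Y z + frameN Y z)) (σ z) = 0 := hσe z 0
    have h1 : psForm 2 (κ • (Y z - frameN Y z)) (σ z) = 0 := hσe z 1
    rw [psForm_smul_left, mul_eq_zero, or_iff_right hκ0] at h0 h1
    rw [psForm_add_left] at h0
    rw [psForm_sub_left] at h1
    rw [c (σ z), c (σ z)]
    constructor <;> linarith
  have hσp : ∀ z k, psForm 2 (σ z) (pd k Y z) = 0 := fun z k => by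
    rw [c]
    fin_cases k
    · exact hσe z 2
    · exact hσe z 3
  have hτσ : ∀ z, psForm 2 (q z • T z) (σ z) = 0 := fun z => hσe z 4
  have hlap : ∀ z v, psForm 2 v (Y z) = 0 → psForm 2 v (frameN Y z) = 0 →
      psForm 2 v (lap Y z) = 0 := fun z v h1 h2 => by
    rw [frameN, psForm_add_right, psForm_smul_right, psForm_smul_right, h1] at h2
    linarith
  have hττ : ∀ z, psForm 2 (q z • T z) (q z • T z) = -1 := fun z => by
    rw [psForm_smul_left, psForm_smul_right]; exact hqT z
  refine ⟨fun z => κ • (q z • T z + σ z), fun z => κ • (q z • T z - σ z),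
    ((hqs.smul hTs).add hσs).const_smul κ, ((hqs.smul hTs).sub hσs).const_smul κ,
    fun z => ?_, fun z => ?_, fun z => ?_, fun z => ?_, fun z i => ?_, fun z => ?_, fun z => ?_,
    fun z i => ?_, fun z => ?_⟩
  · simp only [psForm_smul_left κ, psForm_smul_right κ, psForm_add_left, psForm_add_right, hττ, hσσ,
      hτσ, c (σ z) (q z • T z)]; ring
  · simp only [psForm_smul_left κ, psForm_smul_right κ, psForm_sub_left, psForm_sub_right, hττ, hσσ,
      hτσ, c (σ z) (q z • T z)]; ring
  · simp only [psForm_smul_left κ, psForm_smul_right κ, psForm_sub_right, psForm_add_left, hττ, hσσ,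
      hτσ, c (σ z) (q z • T z)]; linear_combination (-2) * hκ2
  · simp [psForm_smul_left, psForm_add_left, hTY, hσYN]
  · simp [psForm_smul_left, psForm_add_left, hTp, hσp]
  · simp [psForm_smul_left, psForm_add_left, hlap z _ (hTY z) (hTN z),
      hlap z _ (hσYN z).1 (hσYN z).2]
  · simp [psForm_smul_left, psForm_sub_left, hTY, hσYN]
  · simp [psForm_smul_left, psForm_sub_left, hTp, hσp]
  · simp [psForm_smul_left, psForm_sub_left, hlap z _ (hTY z) (hTN z),
      hlap z _ (hσYN z).1 (hσYN z).2]

end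

section

/-! ### Structure equations -/

/-- Complexification of a map. -/
def cx {n : ℕ} (X : ℂ → Fin n → ℝ) : ℂ → Fin n → ℂ := fun w => toC (X w)

theorem cx_smooth {n : ℕ} {X : ℂ → Fin n → ℝ} (h : ContDiff ℝ ∞ X) : ContDiff ℝ ∞ (cx X) :=
  contDiff_toC h

theorem wz_cx {n : ℕ} {X : ℂ → Fin n → ℝ} {z : ℂ} (h : DifferentiableAt ℝ X z) :
    wz (cx X) z = (1 / 2 : ℂ) • (toC (pd 0 X z) - Complex.I • toC (pd 1 X z)) := by
  unfold wz cx; rw [pd_toC h, pd_toC h]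

theorem wzb_cx {n : ℕ} {X : ℂ → Fin n → ℝ} {z : ℂ} (h : DifferentiableAt ℝ X z) :
    wzb (cx X) z = star (wz (cx X) z) := wzb_toC h

theorem toC_add {n : ℕ} (x y : Fin n → ℝ) : toC (x + y) = toC x + toC y := by
  ext i; simp [toC]

theorem toC_sub {n : ℕ} (x y : Fin n → ℝ) : toC (x - y) = toC x - toC y := by
  ext i; simp [toC]

theorem toC_smul {n : ℕ} (c : ℝ) (x : Fin n → ℝ) : toC (c • x) = (c : ℂ) • toC x := by
  ext i; simp [toC]

theorem pd_wz_cx {n : ℕ} {X : ℂ → Fin n → ℝ} (h : ContDiff ℝ ∞ X) (z : ℂ) (i : Fin 2) :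
    pd i (wz (cx X)) z =
      (1 / 2 : ℂ) • (toC (pd i (pd 0 X) z) - Complex.I • toC (pd i (pd 1 X) z)) := by
  have h0 : ContDiff ℝ ∞ (cx (pd 0 X)) := cx_smooth (contDiff_pd h 0)
  have h1 : ContDiff ℝ ∞ (cx (pd 1 X)) := cx_smooth (contDiff_pd h 1)
  have e : wz (cx X) = fun w => (1 / 2 : ℂ) • (cx (pd 0 X) w - Complex.I • cx (pd 1 X) w) :=
    funext fun w => wz_cx (smooth_differentiableAt h w)
  have d0 := smooth_differentiableAt h0 z
  have d1 := smooth_differentiableAt h1 z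
  have d1' : DifferentiableAt ℝ (fun w => Complex.I • cx (pd 1 X) w) z := d1.const_smul Complex.I
  have p0 : pd i (cx (pd 0 X)) z = toC (pd i (pd 0 X) z) :=
    pd_toC (smooth_differentiableAt (contDiff_pd h 0) z) i
  have p1 : pd i (cx (pd 1 X)) z = toC (pd i (pd 1 X) z) :=
    pd_toC (smooth_differentiableAt (contDiff_pd h 1) z) i
  rw [e, pd_smul (differentiableAt_const _) (d0.fun_sub d1'), pd_sub d0 d1',
    pd_smul (differentiableAt_const _) d1, pd_const, pd_const, p0, p1]
  simp

theorem wzb_wz_cx {n : ℕ} {X : ℂ → Fin n → ℝ} (h : ContDiff ℝ ∞ X) (z : ℂ) :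
    wzb (wz (cx X)) z = (1 / 4 : ℂ) • toC (lap X z) := by
  rw [wzb, pd_wz_cx h, pd_wz_cx h, lap, pd_pd_comm h.contDiffAt 0 1, toC_add]
  have : Complex.I • Complex.I • toC (pd 1 (pd 1 X) z) = -toC (pd 1 (pd 1 X) z) := by
    rw [smul_smul, Complex.I_mul_I, neg_one_smul]
  ext k
  have h3 := congrFun this k
  simp only [Pi.smul_apply, Pi.add_apply, Pi.sub_apply, Pi.neg_apply, smul_eq_mul] at h3 ⊢
  linear_combination (-1 / 4 : ℂ) * h3

theorem wz_wz_cx {n : ℕ} {X : ℂ → Fin n → ℝ} (h : ContDiff ℝ ∞ X) (z : ℂ) :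
    wz (wz (cx X)) z = (1 / 4 : ℂ) • (toC (pd 0 (pd 0 X) z) - toC (pd 1 (pd 1 X) z)) -
      (Complex.I / 2) • toC (pd 0 (pd 1 X) z) := by
  rw [wz, pd_wz_cx h, pd_wz_cx h, pd_pd_comm h.contDiffAt 1 0]
  ext k
  simp only [Pi.smul_apply, Pi.sub_apply, smul_eq_mul]
  linear_combination (1 / 4 * toC (pd 1 (pd 1 X) z) k) * Complex.I_mul_I

/-- `s = 2 ⟨Y_zz, N⟩`. -/
def schw (Y : ℂ → Fin 6 → ℝ) (z : ℂ) : ℂ := 2 * psForm 2 (wz (wz (cx Y)) z) (cx (frameN Y) z)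

/-- `-⟨Y_zz, L⟩`. -/
def lam (Y L : ℂ → Fin 6 → ℝ) (z : ℂ) : ℂ := -psForm 2 (wz (wz (cx Y)) z) (cx L z)

/-- `⟨L_z, N⟩ / 2`. -/
def gam (Y L : ℂ → Fin 6 → ℝ) (z : ℂ) : ℂ := psForm 2 (wz (cx L) z) (cx (frameN Y) z) / 2

/-- The connection coefficient `-⟨L_z, R⟩`. -/
def alp (L R : ℂ → Fin 6 → ℝ) (z : ℂ) : ℂ := -psForm 2 (wz (cx L) z) (cx R z)

/-- `⟨Y_{z z̄}, Y_{z z̄}⟩`. -/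
def gauss (Y : ℂ → Fin 6 → ℝ) (z : ℂ) : ℂ :=
  psForm 2 (wzb (wz (cx Y)) z) (wzb (wz (cx Y)) z)

theorem wz_eq_zero_of_const {f : ℂ → ℂ} {c : ℂ} (h : ∀ w, f w = c) (z : ℂ) : wz f z = 0 := by
  rw [show f = fun _ => c from funext h, wz_const]

theorem wzb_eq_zero_of_const {f : ℂ → ℂ} {c : ℂ} (h : ∀ w, f w = c) (z : ℂ) : wzb f z = 0 := by
  rw [show f = fun _ => c from funext h, wzb_const]

section Canon

variable {Y : ℂ → Fin 6 → ℝ} (hY : IsCanon Y)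

namespace IsCanon

theorem wz_eq (hY : IsCanon Y) (z : ℂ) :
    wz (cx Y) z = (1 / 2 : ℂ) • (toC (pd 0 Y z) - Complex.I • toC (pd 1 Y z)) :=
  wz_cx (smooth_differentiableAt hY.smooth z)

theorem wzb_eq (hY : IsCanon Y) (z : ℂ) :
    wzb (cx Y) z = (1 / 2 : ℂ) • (toC (pd 0 Y z) + Complex.I • toC (pd 1 Y z)) := by
  unfold wzb cx
  rw [pd_toC (smooth_differentiableAt hY.smooth z), pd_toC (smooth_differentiableAt hY.smooth z)]

theorem orth_wz (hY : IsCanon Y) {z : ℂ} {v : Fin 6 → ℂ} (h0 : psForm 2 v (toC (pd 0 Y z)) = 0)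
    (h1 : psForm 2 v (toC (pd 1 Y z)) = 0) :
    psForm 2 v (wz (cx Y) z) = 0 ∧ psForm 2 v (wzb (cx Y) z) = 0 := by
  rw [hY.wz_eq, hY.wzb_eq]
  simp [psForm_smul_right, psForm_sub_right, psForm_add_right, h0, h1]

theorem c_self (hY : IsCanon Y) (z : ℂ) : psForm 2 (cx Y z) (cx Y z) = 0 := by
  simp [cx, psForm_toC, hY.null]

theorem c_self_wz (hY : IsCanon Y) (z : ℂ) : psForm 2 (cx Y z) (wz (cx Y) z) = 0 :=
  (hY.orth_wz (by simp [cx, psForm_toC, hY.form_self_pd])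
    (by simp [cx, psForm_toC, hY.form_self_pd])).1

theorem c_self_wzb (hY : IsCanon Y) (z : ℂ) : psForm 2 (cx Y z) (wzb (cx Y) z) = 0 :=
  (hY.orth_wz (by simp [cx, psForm_toC, hY.form_self_pd])
    (by simp [cx, psForm_toC, hY.form_self_pd])).2

theorem c_wz_wz (hY : IsCanon Y) (z : ℂ) : psForm 2 (wz (cx Y) z) (wz (cx Y) z) = 0 := by
  have h := psForm_dz_dz (smooth_differentiableAt hY.smooth z)
  rw [hY.form_pd_pd, hY.form_pd_pd, hY.form_pd_pd] at h
  refine h.trans ?_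
  simp

theorem c_wz_wzb (hY : IsCanon Y) (z : ℂ) : psForm 2 (wz (cx Y) z) (wzb (cx Y) z) = 1 / 2 := by
  have h := psForm_dz_dzbar (smooth_differentiableAt hY.smooth z)
  rw [hY.form_pd_pd, hY.form_pd_pd] at h
  refine h.trans ?_
  norm_num

theorem c_wzb_wzb (hY : IsCanon Y) (z : ℂ) : psForm 2 (wzb (cx Y) z) (wzb (cx Y) z) = 0 := by
  rw [wzb_cx (smooth_differentiableAt hY.smooth z), psForm_star, hY.c_wz_wz, star_zero]

theorem c_N_N (hY : IsCanon Y) (z : ℂ) :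
    psForm 2 (cx (frameN Y) z) (cx (frameN Y) z) = 0 := by
  simp [cx, psForm_toC, hY.form_frameN_frameN]

theorem c_self_N (hY : IsCanon Y) (z : ℂ) : psForm 2 (cx Y z) (cx (frameN Y) z) = -1 := by
  simp [cx, psForm_toC, hY.form_self_frameN]

theorem c_N_wz (hY : IsCanon Y) (z : ℂ) : psForm 2 (cx (frameN Y) z) (wz (cx Y) z) = 0 :=
  (hY.orth_wz (by simp [cx, psForm_toC, hY.form_frameN_pd])
    (by simp [cx, psForm_toC, hY.form_frameN_pd])).1

theorem c_N_wzb (hY : IsCanon Y) (z : ℂ) : psForm 2 (cx (frameN Y) z) (wzb (cx Y) z) = 0 :=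
  (hY.orth_wz (by simp [cx, psForm_toC, hY.form_frameN_pd])
    (by simp [cx, psForm_toC, hY.form_frameN_pd])).2

/-- This is the definition of N solved for the mixed derivative, so Y_{z z̄} has no tangential and
no normal component. -/
theorem wzbwz_eq (hY : IsCanon Y) (z : ℂ) :
    wzb (wz (cx Y)) z = (1 / 2 : ℂ) • cx (frameN Y) z - gauss Y z • cx Y z := by
  have h1 := wzb_wz_cx hY.smooth z
  have h2 : gauss Y z = 1 / 16 * ((psForm 2 (lap Y z) (lap Y z) : ℝ) : ℂ) := by
    rw [gauss, h1, psForm_smul_left, psForm_smul_right, psForm_toC]; ring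
  rw [h2, h1]
  simp only [cx, frameN, toC_add, toC_smul]
  push_cast
  module

theorem gauss_real (hY : IsCanon Y) (z : ℂ) : star (gauss Y z) = gauss Y z := by
  have h1 := wzb_wz_cx hY.smooth z
  have h2 : gauss Y z = 1 / 16 * ((psForm 2 (lap Y z) (lap Y z) : ℝ) : ℂ) := by
    rw [gauss, h1, psForm_smul_left, psForm_smul_right, psForm_toC]; ring
  rw [h2]
  simp

theorem cxs (hY : IsCanon Y) : ContDiff ℝ ∞ (cx Y) := cx_smooth hY.smooth

theorem cNs (hY : IsCanon Y) : ContDiff ℝ ∞ (cx (frameN Y)) := cx_smooth hY.frameN_smooth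

theorem gauss_smooth (hY : IsCanon Y) : ContDiff ℝ ∞ (gauss Y) :=
  contDiff_psForm (contDiff_wzb (contDiff_wz hY.cxs)) (contDiff_wzb (contDiff_wz hY.cxs))

theorem schw_smooth (hY : IsCanon Y) : ContDiff ℝ ∞ (schw Y) :=
  contDiff_const.mul (contDiff_psForm (contDiff_wz (contDiff_wz hY.cxs)) hY.cNs)

theorem lam_smooth (hY : IsCanon Y) {L : ℂ → Fin 6 → ℝ} (hL : ContDiff ℝ ∞ L) :
    ContDiff ℝ ∞ (lam Y L) :=
  (contDiff_psForm (contDiff_wz (contDiff_wz hY.cxs)) (cx_smooth hL)).neg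

theorem gam_smooth (hY : IsCanon Y) {L : ℂ → Fin 6 → ℝ} (hL : ContDiff ℝ ∞ L) :
    ContDiff ℝ ∞ (gam Y L) :=
  (contDiff_psForm (contDiff_wz (cx_smooth hL)) hY.cNs).div_const 2

theorem wzwz_self (hY : IsCanon Y) (z : ℂ) : psForm 2 (wz (wz (cx Y)) z) (cx Y z) = 0 := by
  have h := wz_eq_zero_of_const hY.c_self_wz z
  rw [wz_psForm (smooth_differentiableAt hY.cxs z)
    (smooth_differentiableAt (contDiff_wz hY.cxs) z), hY.c_wz_wz, zero_add] at h
  rw [psForm_comm, h]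

theorem wzwz_wz (hY : IsCanon Y) (z : ℂ) : psForm 2 (wz (wz (cx Y)) z) (wz (cx Y) z) = 0 := by
  have h := wz_eq_zero_of_const hY.c_wz_wz z
  have d := smooth_differentiableAt (contDiff_wz hY.cxs) z
  rw [wz_psForm d d, psForm_comm (wz (cx Y) z)] at h
  linear_combination h / 2

theorem wzwz_wzb (hY : IsCanon Y) (z : ℂ) : psForm 2 (wz (wz (cx Y)) z) (wzb (cx Y) z) = 0 := by
  have h := wz_eq_zero_of_const hY.c_wz_wzb z
  rw [wz_psForm (smooth_differentiableAt (contDiff_wz hY.cxs) z)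
    (smooth_differentiableAt (contDiff_wzb hY.cxs) z), ← wzb_wz_comm hY.cxs.contDiffAt,
    hY.wzbwz_eq, psForm_sub_right, psForm_smul_right, psForm_smul_right,
    psForm_comm _ (cx (frameN Y) z), psForm_comm _ (cx Y z), hY.c_N_wz, hY.c_self_wz] at h
  simpa using h

end IsCanon

namespace IsFrame

variable {L R : ℂ → Fin 6 → ℝ}

theorem cLs (hF : IsFrame Y L R) : ContDiff ℝ ∞ (cx L) := cx_smooth hF.smoothL

theorem c_L_L (hF : IsFrame Y L R) (z : ℂ) : psForm 2 (cx L z) (cx L z) = 0 := by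
  simp [cx, psForm_toC, hF.LL]

theorem c_L_R (hF : IsFrame Y L R) (z : ℂ) : psForm 2 (cx L z) (cx R z) = -1 := by
  simp [cx, psForm_toC, hF.LR]

theorem c_L_Y (hF : IsFrame Y L R) (z : ℂ) : psForm 2 (cx L z) (cx Y z) = 0 := by
  simp [cx, psForm_toC, hF.LY]

theorem c_L_N (hF : IsFrame Y L R) (z : ℂ) : psForm 2 (cx L z) (cx (frameN Y) z) = 0 := by
  simp [cx, psForm_toC, hF.LN]

theorem c_L_wz (hF : IsFrame Y L R) (hY : IsCanon Y) (z : ℂ) :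
    psForm 2 (cx L z) (wz (cx Y) z) = 0 :=
  (hY.orth_wz (by simp [cx, psForm_toC, hF.Lpd]) (by simp [cx, psForm_toC, hF.Lpd])).1

theorem c_L_wzb (hF : IsFrame Y L R) (hY : IsCanon Y) (z : ℂ) :
    psForm 2 (cx L z) (wzb (cx Y) z) = 0 :=
  (hY.orth_wz (by simp [cx, psForm_toC, hF.Lpd]) (by simp [cx, psForm_toC, hF.Lpd])).2

/-- Expansion in the complex frame `(Y, N, Y_z, Y_z̄, L, R)`. -/
theorem expand (hF : IsFrame Y L R) (hY : IsCanon Y) (z : ℂ) (v : Fin 6 → ℂ) :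
    v = (-psForm 2 v (cx (frameN Y) z)) • cx Y z + (-psForm 2 v (cx Y z)) • cx (frameN Y) z +
      (2 * psForm 2 v (wzb (cx Y) z)) • wz (cx Y) z +
      (2 * psForm 2 v (wz (cx Y) z)) • wzb (cx Y) z +
      (-psForm 2 v (cx R z)) • cx L z + (-psForm 2 v (cx L z)) • cx R z := by
  have h := (hF.adapted hY z).toC.expand v
  refine h.trans ?_
  have e : psForm 2 v (toC (pd 0 Y z)) • toC (pd 0 Y z) + psForm 2 v (toC (pd 1 Y z)) •
      toC (pd 1 Y z) = (2 * psForm 2 v (wzb (cx Y) z)) • wz (cx Y) z +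
      (2 * psForm 2 v (wz (cx Y) z)) • wzb (cx Y) z := by
    rw [hY.wz_eq, hY.wzb_eq]
    simp only [psForm_smul_right, psForm_sub_right, psForm_add_right]
    ext k
    simp only [Pi.smul_apply, Pi.sub_apply, Pi.add_apply, smul_eq_mul]
    linear_combination (psForm 2 v (toC (pd 1 Y z)) * toC (pd 1 Y z) k) * Complex.I_mul_I
  simp only [cx] at e ⊢
  rw [add_assoc (_ + _) (_ • toC (pd 0 Y z)), e]
  module

theorem wzwz_eq (hF : IsFrame Y L R) (hY : IsCanon Y) (z : ℂ) :
    wz (wz (cx Y)) z = (-(schw Y z / 2)) • cx Y z + lam Y R z • cx L z + lam Y L z • cx R z := by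
  have h := hF.expand hY z (wz (wz (cx Y)) z)
  rw [hY.wzwz_self, hY.wzwz_wz, hY.wzwz_wzb] at h
  refine h.trans ?_
  rw [schw, lam, lam]
  simp only [mul_zero, zero_smul, add_zero, neg_zero]
  congr 3
  ring

/-- The Weingarten equation. Differentiating the frame relations turns each coefficient into a
second derivative of Y; the Y_z term is absent because L is orthogonal to Y_{z z̄}. -/
theorem wz_L (hF : IsFrame Y L R) (hY : IsCanon Y) (z : ℂ) :
    wz (cx L) z = (-(2 * gam Y L z)) • cx Y z + (2 * lam Y L z) • wzb (cx Y) z +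
      alp L R z • cx L z := by
  have dL := smooth_differentiableAt hF.cLs z
  have dY := smooth_differentiableAt hY.cxs z
  have h1 : psForm 2 (wz (cx L) z) (cx Y z) = 0 := by
    have h := wz_eq_zero_of_const hF.c_L_Y z
    rw [wz_psForm dL dY, hF.c_L_wz hY] at h
    simpa using h
  have h2 : psForm 2 (wz (cx L) z) (cx L z) = 0 := by
    have h := wz_eq_zero_of_const hF.c_L_L z
    rw [wz_psForm dL dL, psForm_comm (cx L z)] at h
    linear_combination h / 2
  have h3 : psForm 2 (wz (cx L) z) (wz (cx Y) z) = lam Y L z := by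
    have h := wz_eq_zero_of_const (hF.c_L_wz hY) z
    rw [wz_psForm dL (smooth_differentiableAt (contDiff_wz hY.cxs) z), psForm_comm (cx L z)] at h
    rw [lam]; linear_combination h
  have h4 : psForm 2 (wz (cx L) z) (wzb (cx Y) z) = 0 := by
    have h := wz_eq_zero_of_const (hF.c_L_wzb hY) z
    rw [wz_psForm dL (smooth_differentiableAt (contDiff_wzb hY.cxs) z),
      ← wzb_wz_comm hY.cxs.contDiffAt, hY.wzbwz_eq, psForm_sub_right, psForm_smul_right,
      psForm_smul_right, hF.c_L_N, hF.c_L_Y] at h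
    simpa using h
  refine (hF.expand hY z (wz (cx L) z)).trans ?_
  rw [h1, h2, h3, h4, gam, alp]
  simp only [mul_zero, zero_smul, add_zero, neg_zero]
  congr 3
  ring

theorem alp_symm (hF : IsFrame Y L R) (z : ℂ) : alp R L z = -alp L R z := by
  have h := wz_eq_zero_of_const hF.c_L_R z
  rw [wz_psForm (smooth_differentiableAt hF.cLs z) (smooth_differentiableAt hF.symm.cLs z),
    psForm_comm (cx L z)] at h
  rw [alp, alp]; linear_combination -h

theorem wz_R (hF : IsFrame Y L R) (hY : IsCanon Y) (z : ℂ) :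
    wz (cx R) z = (-(2 * gam Y R z)) • cx Y z + (2 * lam Y R z) • wzb (cx Y) z +
      (-alp L R z) • cx R z := by
  rw [hF.symm.wz_L hY, hF.alp_symm]

theorem wz_N (hF : IsFrame Y L R) (hY : IsCanon Y) (z : ℂ) :
    wz (cx (frameN Y)) z = (-(2 * gauss Y z)) • wz (cx Y) z + (-schw Y z) • wzb (cx Y) z +
      (2 * gam Y R z) • cx L z + (2 * gam Y L z) • cx R z := by
  have dN := smooth_differentiableAt hY.cNs z
  have dY := smooth_differentiableAt hY.cxs z
  have h1 : psForm 2 (wz (cx (frameN Y)) z) (cx (frameN Y) z) = 0 := by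
    have h := wz_eq_zero_of_const hY.c_N_N z
    rw [wz_psForm dN dN, psForm_comm (cx (frameN Y) z)] at h
    linear_combination h / 2
  have h2 : psForm 2 (wz (cx (frameN Y)) z) (cx Y z) = 0 := by
    have h := wz_eq_zero_of_const hY.c_self_N z
    rw [wz_psForm dY dN, psForm_comm (wz (cx Y) z), hY.c_N_wz, psForm_comm (cx Y z)] at h
    simpa using h
  have h3 : psForm 2 (wz (cx (frameN Y)) z) (wz (cx Y) z) = -(schw Y z / 2) := by
    have h := wz_eq_zero_of_const hY.c_N_wz z
    rw [wz_psForm dN (smooth_differentiableAt (contDiff_wz hY.cxs) z),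
      psForm_comm (cx (frameN Y) z)] at h
    rw [schw]; linear_combination h
  have h4 : psForm 2 (wz (cx (frameN Y)) z) (wzb (cx Y) z) = -gauss Y z := by
    have h := wz_eq_zero_of_const hY.c_N_wzb z
    rw [wz_psForm dN (smooth_differentiableAt (contDiff_wzb hY.cxs) z),
      ← wzb_wz_comm hY.cxs.contDiffAt, hY.wzbwz_eq, psForm_sub_right, psForm_smul_right,
      psForm_smul_right, hY.c_N_N, psForm_comm _ (cx Y z), hY.c_self_N] at h
    linear_combination h
  have h5 : ∀ {L R : ℂ → Fin 6 → ℝ}, IsFrame Y L R →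
      psForm 2 (wz (cx (frameN Y)) z) (cx L z) = -(2 * gam Y L z) := by
    intro L R hF
    have h := wz_eq_zero_of_const hF.c_L_N z
    rw [wz_psForm (smooth_differentiableAt hF.cLs z) dN, psForm_comm (cx L z)] at h
    rw [gam]; linear_combination h
  refine (hF.expand hY z (wz (cx (frameN Y)) z)).trans ?_
  rw [h1, h2, h3, h4, h5 hF, h5 hF.symm]
  module

/-- Flatness of |dz|² in the form of the Gauss equation: the right side is ⟨κ, κ̄⟩. -/
theorem gauss_eq (hF : IsFrame Y L R) (hY : IsCanon Y) (z : ℂ) :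
    gauss Y z = -(lam Y R z * star (lam Y L z) + star (lam Y R z) * lam Y L z) := by
  -- compare the two expressions of `⟨Y_{zz z̄}, Y_z̄⟩`
  have e1 := wzb_eq_zero_of_const hY.wzwz_wzb z
  have d1 := smooth_differentiableAt (contDiff_wz (contDiff_wz hY.cxs)) z
  have d2 := smooth_differentiableAt (contDiff_wzb hY.cxs) z
  rw [wzb_psForm d1 d2] at e1
  have c0 : ∀ w, psForm 2 (wzb (wz (cx Y)) w) (wzb (cx Y) w) = 0 := fun w => by
    rw [hY.wzbwz_eq, psForm_sub_left, psForm_smul_left, psForm_smul_left, hY.c_N_wzb, hY.c_self_wzb]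
    ring
  have e2 := wz_eq_zero_of_const c0 z
  rw [wz_psForm (smooth_differentiableAt (contDiff_wzb (contDiff_wz hY.cxs)) z) d2,
    ← wzb_wz_comm (contDiff_wz hY.cxs).contDiffAt, ← wzb_wz_comm hY.cxs.contDiffAt] at e2
  have e3 : gauss Y z = psForm 2 (wz (wz (cx Y)) z) (wzb (wzb (cx Y)) z) := by
    rw [gauss]; linear_combination e2 - e1
  have e4 : wzb (wzb (cx Y)) z = star (wz (wz (cx Y)) z) := by
    have : wzb (cx Y) = fun w => star (wz (cx Y) w) :=
      funext fun w => wzb_cx (smooth_differentiableAt hY.smooth w)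
    rw [this, wzb_star (smooth_differentiableAt (contDiff_wz hY.cxs) z)]
  have sL : star (cx L z) = cx L z := star_toC _
  have sR : star (cx R z) = cx R z := star_toC _
  have sY : star (cx Y z) = cx Y z := star_toC _
  rw [e3, e4, hF.wzwz_eq hY]
  simp only [star_add, star_smul, sL, sR, sY, psForm_add_left, psForm_add_right, psForm_smul_left,
    psForm_smul_right, hY.c_self, hF.c_L_Y, hF.symm.c_L_Y, hF.c_L_L, hF.symm.c_L_L, hF.c_L_R,
    hF.symm.c_L_R, psForm_comm (cx Y z) (cx L z), psForm_comm (cx Y z) (cx R z)]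
  ring

theorem wzb_L (hF : IsFrame Y L R) (hY : IsCanon Y) (z : ℂ) :
    wzb (cx L) z = (-(2 * star (gam Y L z))) • cx Y z + (2 * star (lam Y L z)) • wz (cx Y) z +
      star (alp L R z) • cx L z := by
  rw [wzb_cx (smooth_differentiableAt hF.smoothL z), hF.wz_L hY]
  have sL : star (cx L z) = cx L z := star_toC _
  have sY : star (cx Y z) = cx Y z := star_toC _
  simp only [star_add, star_smul, sL, sY, wzb_cx (smooth_differentiableAt hY.smooth z), star_star]
  simp

/-- The Codazzi equation. From (Y_zz)_z̄ = (Y_{z z̄})_z = N_z/2 - (gY)_z with g = ⟨Y_{z z̄}, Y_{z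
z̄}⟩, the normal components of D_z̄ κ are those of N_z/2, namely the `gam` coefficients. -/
theorem wzb_lam (hF : IsFrame Y L R) (hY : IsCanon Y) (z : ℂ) :
    wzb (lam Y L) z = gam Y L z + star (alp L R z) * lam Y L z := by
  have d1 := smooth_differentiableAt (contDiff_wz (contDiff_wz hY.cxs)) z
  have dL := smooth_differentiableAt hF.cLs z
  have e0 : lam Y L = fun w => (-1 : ℂ) • psForm 2 (wz (wz (cx Y)) w) (cx L w) :=
    funext fun w => by simp [lam]
  have e1 : wz (wzb (wz (cx Y))) z = (1 / 2 : ℂ) • wz (cx (frameN Y)) z -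
      (wz (gauss Y) z • cx Y z + gauss Y z • wz (cx Y) z) := by
    rw [show wzb (wz (cx Y)) = fun w => (1 / 2 : ℂ) • cx (frameN Y) w - gauss Y w • cx Y w from
      funext hY.wzbwz_eq, wz_sub ((smooth_differentiableAt hY.cNs z).fun_const_smul _)
      ((smooth_differentiableAt hY.gauss_smooth z).fun_smul (smooth_differentiableAt hY.cxs z)),
      wz_const_smul _ (smooth_differentiableAt hY.cNs z),
      wz_smul (smooth_differentiableAt hY.gauss_smooth z) (smooth_differentiableAt hY.cxs z)]
  conv_lhs => rw [e0]
  rw [wzb_const_smul _ (smooth_differentiableAt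
    (contDiff_psForm (contDiff_wz (contDiff_wz hY.cxs)) hF.cLs) z), wzb_psForm d1 dL,
    wzb_wz_comm (contDiff_wz hY.cxs).contDiffAt, e1, hF.wz_N hY, hF.wzb_L hY, hF.wzwz_eq hY]
  simp only [psForm_add_left, psForm_add_right, psForm_smul_left, psForm_sub_left,
    psForm_smul_right, hY.c_self, hF.c_L_Y, hF.symm.c_L_Y, hF.c_L_L, hF.symm.c_L_L, hF.c_L_R,
    hF.symm.c_L_R, psForm_comm (cx Y z) (cx L z), psForm_comm (cx Y z) (cx R z), hY.c_self_wz,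
    psForm_comm (wz (cx Y) z) (cx L z), psForm_comm (wzb (cx Y) z) (cx L z), hF.c_L_wz hY,
    hF.c_L_wzb hY, hF.symm.c_L_wz hY, smul_eq_mul]
  ring

end IsFrame

end Canon

end

/-! ### The Gauss and Willmore equations in the complex frame -/

section

variable {Y L R : ℂ → Fin 6 → ℝ}

theorem IsFrame.alp_smooth (hF : IsFrame Y L R) : ContDiff ℝ ∞ (alp L R) :=
  (contDiff_psForm (contDiff_wz hF.cLs) hF.symm.cLs).neg

theorem IsCanon.wz_wzbwz (hY : IsCanon Y) (z : ℂ) :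
    wz (wzb (wz (cx Y))) z = (1 / 2 : ℂ) • wz (cx (frameN Y)) z -
      (wz (gauss Y) z • cx Y z + gauss Y z • wz (cx Y) z) := by
  rw [show wzb (wz (cx Y)) = fun w => (1 / 2 : ℂ) • cx (frameN Y) w - gauss Y w • cx Y w from
    funext hY.wzbwz_eq, wz_sub ((smooth_differentiableAt hY.cNs z).fun_const_smul _)
    ((smooth_differentiableAt hY.gauss_smooth z).fun_smul (smooth_differentiableAt hY.cxs z)),
    wz_const_smul _ (smooth_differentiableAt hY.cNs z),
    wz_smul (smooth_differentiableAt hY.gauss_smooth z) (smooth_differentiableAt hY.cxs z)]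

theorem IsFrame.wzb_wzwz (hF : IsFrame Y L R) (hY : IsCanon Y) (z : ℂ) :
    wzb (wz (wz (cx Y))) z = (-(2 * gauss Y z)) • wz (cx Y) z + (-(schw Y z / 2)) • wzb (cx Y) z +
      gam Y R z • cx L z + gam Y L z • cx R z - wz (gauss Y) z • cx Y z := by
  rw [wzb_wz_comm (contDiff_wz hY.cxs).contDiffAt, hY.wz_wzbwz, hF.wz_N hY]
  module

theorem IsFrame.wzb_N (hF : IsFrame Y L R) (hY : IsCanon Y) (z : ℂ) :
    wzb (cx (frameN Y)) z = (-(2 * gauss Y z)) • wzb (cx Y) z + (-star (schw Y z)) • wz (cx Y) z +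
      (2 * star (gam Y R z)) • cx L z + (2 * star (gam Y L z)) • cx R z := by
  rw [wzb_cx (smooth_differentiableAt hY.frameN_smooth z), hF.wz_N hY]
  have sL : star (cx L z) = cx L z := star_toC _
  have sR : star (cx R z) = cx R z := star_toC _
  simp only [star_add, star_smul, sL, sR, wzb_cx (smooth_differentiableAt hY.smooth z), star_star,
    star_neg, star_mul', hY.gauss_real]
  simp

/-- The Gauss equation. -/
theorem IsFrame.wzb_schw (hF : IsFrame Y L R) (hY : IsCanon Y) (z : ℂ) :
    wzb (schw Y) z = 2 * wz (gauss Y) z -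
      4 * (star (gam Y L z) * lam Y R z + star (gam Y R z) * lam Y L z) := by
  have e0 : schw Y = fun w => (2 : ℂ) • psForm 2 (wz (wz (cx Y)) w) (cx (frameN Y) w) :=
    funext fun w => by simp [schw]
  have c := fun x y : Fin 6 → ℂ => psForm_comm (s := 2) x y
  conv_lhs => rw [e0]
  rw [wzb_const_smul _ (smooth_differentiableAt
    (contDiff_psForm (contDiff_wz (contDiff_wz hY.cxs)) hY.cNs) z),
    wzb_psForm (smooth_differentiableAt (contDiff_wz (contDiff_wz hY.cxs)) z)
      (smooth_differentiableAt hY.cNs z), hF.wzb_wzwz hY, hF.wzb_N hY, hF.wzwz_eq hY]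
  simp only [psForm_add_left, psForm_add_right, psForm_smul_left, psForm_sub_left,
    psForm_smul_right, hF.c_L_L, hF.symm.c_L_L, hF.c_L_R,
    hF.symm.c_L_R, hF.c_L_N, hF.symm.c_L_N, c (wz (cx Y) z) (cx (frameN Y) z), hY.c_N_wz,
    c (wzb (cx Y) z) (cx (frameN Y) z), hY.c_N_wzb, hY.c_self_N, hY.c_self_wz, hY.c_self_wzb,
    c (cx Y z) (cx L z), c (cx Y z) (cx R z), hF.c_L_Y, hF.symm.c_L_Y, hF.c_L_wz hY,
    hF.symm.c_L_wz hY, hF.c_L_wzb hY, hF.symm.c_L_wzb hY, smul_eq_mul]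
  ring

/-- Differentiate ⟨Y_{z z̄ z}, L⟩ = -γ_L once more in z̄. This expresses the fourth-order term of
the Euler–Lagrange equation through the derivative of `gam`. -/
theorem IsFrame.form_bilaplacian (hF : IsFrame Y L R) (hY : IsCanon Y) (z : ℂ) :
    psForm 2 (wzb (wz (wzb (wz (cx Y)))) z) (cx L z) =
      -wzb (gam Y L) z + star (alp L R z) * gam Y L z + schw Y z * star (lam Y L z) / 2 := by
  have c := fun x y : Fin 6 → ℂ => psForm_comm (s := 2) x y
  have hG : ContDiff ℝ ∞ (wz (wzb (wz (cx Y)))) := contDiff_wz (contDiff_wzb (contDiff_wz hY.cxs))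
  have hcomm : ∀ w, wz (wzb (wz (cx Y))) w = wzb (wz (wz (cx Y))) w := fun w =>
    (wzb_wz_comm (contDiff_wz hY.cxs).contDiffAt).symm
  have e0 : ∀ w, psForm 2 (wz (wzb (wz (cx Y))) w) (cx L w) = (-1 : ℂ) • gam Y L w := by
    intro w
    rw [hcomm, hF.wzb_wzwz hY]
    simp only [psForm_add_left, psForm_smul_left, psForm_sub_left, hF.c_L_L, hF.symm.c_L_R,
      c (wz (cx Y) w) (cx L w), c (wzb (cx Y) w) (cx L w), hF.c_L_wz hY, hF.c_L_wzb hY,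
      c (cx Y w) (cx L w), hF.c_L_Y, smul_eq_mul]
    ring
  have e1 : wzb (fun w => psForm 2 (wz (wzb (wz (cx Y))) w) (cx L w)) z = -wzb (gam Y L) z := by
    rw [show (fun w => psForm 2 (wz (wzb (wz (cx Y))) w) (cx L w)) = fun w => (-1 : ℂ) • gam Y L w
      from funext e0, wzb_const_smul _ (smooth_differentiableAt (hY.gam_smooth hF.smoothL) z)]
    simp
  rw [wzb_psForm (smooth_differentiableAt hG z) (smooth_differentiableAt hF.cLs z),
    hF.wzb_L hY, hcomm z, hF.wzb_wzwz hY] at e1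
  simp only [psForm_add_left, psForm_add_right, psForm_smul_left, psForm_sub_left,
    psForm_smul_right, hF.c_L_L, hF.symm.c_L_R,
    c (wz (cx Y) z) (cx L z), c (wzb (cx Y) z) (cx L z), c (wz (cx Y) z) (cx Y z),
    c (wzb (cx Y) z) (cx Y z), c (wzb (cx Y) z) (wz (cx Y) z), hY.c_wz_wz, hY.c_wz_wzb,
    hY.c_self, hY.c_self_wz, hY.c_self_wzb,
    c (cx Y z) (cx L z), hF.c_L_Y, hF.symm.c_L_Y, hF.c_L_wz hY,
    hF.symm.c_L_wz hY, hF.c_L_wzb hY] at e1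
  linear_combination e1

/-- The Euler–Lagrange equation of the Willmore functional in the direction `L`. -/
def IsEulerLagrange (Y L : ℂ → Fin 6 → ℝ) : Prop :=
  ∀ z, psForm 2 (lap (lap Y) z) (L z) +
    2 * psForm 2 (pd 0 (pd 0 Y) z) (L z) *
      psForm 2 (lap Y z) (pd 0 (pd 0 Y) z - pd 1 (pd 1 Y) z) +
    4 * psForm 2 (pd 0 (pd 1 Y) z) (L z) * psForm 2 (lap Y z) (pd 0 (pd 1 Y) z) = 0

theorem IsCanon.wzwz_wzbwz (hY : IsCanon Y) (z : ℂ) :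
    psForm 2 (wz (wz (cx Y)) z) (wzb (wz (cx Y)) z) = schw Y z / 4 := by
  rw [hY.wzbwz_eq, psForm_sub_right, psForm_smul_right, psForm_smul_right, hY.wzwz_self, schw]
  ring

/-- The Willmore equation D_z̄ D_z̄ κ + (s̄/2) κ = 0, one null component at a time. The quadratic
terms of the real equation are, up to a factor, the real part of s times the conjugate of λ_L. -/
theorem IsFrame.wzb_gam (hF : IsFrame Y L R) (hY : IsCanon Y) (hE : IsEulerLagrange Y L) (z : ℂ) :
    wzb (gam Y L) z = star (alp L R z) * gam Y L z - star (schw Y z) / 2 * lam Y L z := by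
  have h1 := hF.form_bilaplacian hY z
  have e : wzb (wz (wzb (wz (cx Y)))) z = (1 / 16 : ℂ) • toC (lap (lap Y) z) := by
    have e1 : wzb (wz (cx Y)) = fun w => (1 / 4 : ℂ) • cx (lap Y) w :=
      funext fun w => wzb_wz_cx hY.smooth w
    have hl := contDiff_lap hY.smooth
    have e2 : wz (wzb (wz (cx Y))) = fun w => (1 / 4 : ℂ) • wz (cx (lap Y)) w := by
      rw [e1]
      exact funext fun w => wz_const_smul _ (smooth_differentiableAt (cx_smooth hl) w)
    rw [e2, wzb_const_smul _ (smooth_differentiableAt (contDiff_wz (cx_smooth hl)) z),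
      wzb_wz_cx hl, smul_smul]
    norm_num
  have hlam : lam Y L z = -((((psForm 2 (pd 0 (pd 0 Y) z) (L z) - psForm 2 (pd 1 (pd 1 Y) z) (L z) : ℝ)
      : ℂ)) / 4) + Complex.I / 2 * ((psForm 2 (pd 0 (pd 1 Y) z) (L z) : ℝ) : ℂ) := by
    rw [lam, wz_wz_cx hY.smooth]
    simp only [cx, psForm_sub_left, psForm_smul_left, psForm_toC]
    push_cast
    ring
  have hs : schw Y z = (((psForm 2 (lap Y z) (pd 0 (pd 0 Y) z - pd 1 (pd 1 Y) z) : ℝ) : ℂ)) / 4 -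
      Complex.I / 2 * ((psForm 2 (lap Y z) (pd 0 (pd 1 Y) z) : ℝ) : ℂ) := by
    have h2 := hY.wzwz_wzbwz z
    rw [wzb_wz_cx hY.smooth, wz_wz_cx hY.smooth] at h2
    simp only [psForm_sub_left, psForm_smul_left, psForm_smul_right, psForm_toC] at h2
    rw [psForm_sub_right, psForm_comm (lap Y z), psForm_comm (lap Y z), psForm_comm (lap Y z)]
    push_cast
    linear_combination -4 * h2
  -- L is orthogonal to ΔY, so the second fundamental form in the direction L is trace-free and has
  -- just two real components a and b.
  have htr : psForm 2 (pd 1 (pd 1 Y) z) (L z) = -psForm 2 (pd 0 (pd 0 Y) z) (L z) := by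
    have h2 := hF.Llap z
    rw [lap, psForm_add_right, psForm_comm (L z), psForm_comm (L z)] at h2
    linarith
  rw [htr] at hlam
  have hEz := congrArg (fun x : ℝ => (x : ℂ)) (hE z)
  push_cast at hEz
  rw [e, psForm_smul_left, cx, psForm_toC] at h1
  set a := psForm 2 (pd 0 (pd 0 Y) z) (L z)
  set b := psForm 2 (pd 0 (pd 1 Y) z) (L z)
  set u := psForm 2 (lap Y z) (pd 0 (pd 0 Y) z - pd 1 (pd 1 Y) z)
  set v := psForm 2 (lap Y z) (pd 0 (pd 1 Y) z)
  have hl' : lam Y L z = -(a : ℂ) / 2 + Complex.I / 2 * b := by rw [hlam]; push_cast; ring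
  have hls : star (lam Y L z) = -(a : ℂ) / 2 - Complex.I / 2 * b := by
    rw [hl']; simp; ring
  have hss : star (schw Y z) = (u : ℂ) / 4 + Complex.I / 2 * v := by
    rw [hs]; simp; ring
  have key : schw Y z * star (lam Y L z) + star (schw Y z) * lam Y L z = -(a * u) / 4 - b * v / 2 := by
    rw [hls, hss, hs, hl']
    linear_combination ((b : ℂ) * v / 2) * Complex.I_mul_I
  linear_combination h1 - (1 / 16 : ℂ) * hEz + key / 2

/-! ### The conformal Hopf differential -/

theorem hopf_eq_wz (Y : ℂ → Fin 6 → ℝ) (z : ℂ) :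
    hopf Y z = wz (wz (cx Y)) z + (schw Y z / 2) • cx Y z := by
  rw [schw, mul_div_cancel_left₀ _ two_ne_zero]
  rfl

theorem IsFrame.hopf_eq (hF : IsFrame Y L R) (hY : IsCanon Y) (z : ℂ) :
    hopf Y z = lam Y R z • cx L z + lam Y L z • cx R z := by
  rw [hopf_eq_wz, hF.wzwz_eq hY]; module

theorem IsCanon.hopf_smooth (hY : IsCanon Y) : ContDiff ℝ ∞ (hopf Y) := by
  rw [show hopf Y = fun z => wz (wz (cx Y)) z + (schw Y z / 2) • cx Y z from
    funext (hopf_eq_wz Y)]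
  exact (contDiff_wz (contDiff_wz hY.cxs)).add ((hY.schw_smooth.div_const 2).smul hY.cxs)

theorem IsFrame.form_hopf_hopf (hF : IsFrame Y L R) (hY : IsCanon Y) (z : ℂ) :
    psForm 2 (hopf Y z) (hopf Y z) = -2 * (lam Y R z * lam Y L z) := by
  rw [hF.hopf_eq hY]
  simp only [psForm_add_left, psForm_add_right, psForm_smul_left, psForm_smul_right, hF.c_L_L,
    hF.symm.c_L_L, hF.c_L_R, hF.symm.c_L_R]
  ring

theorem IsFrame.wzb_hopf (hF : IsFrame Y L R) (hY : IsCanon Y) (z : ℂ) :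
    wzb (hopf Y) z = gam Y R z • cx L z + gam Y L z • cx R z + (-(2 * gauss Y z)) • wz (cx Y) z +
      (wzb (schw Y) z / 2 - wz (gauss Y) z) • cx Y z := by
  have ds : DifferentiableAt ℝ (fun w => schw Y w / 2) z :=
    smooth_differentiableAt (hY.schw_smooth.div_const 2) z
  have e : wzb (fun w => schw Y w / 2) z = wzb (schw Y) z / 2 := by
    have := wzb_const_smul (1 / 2 : ℂ) (smooth_differentiableAt hY.schw_smooth z)
    simp only [smul_eq_mul] at this
    rw [show (fun w => schw Y w / 2) = fun w => 1 / 2 * schw Y w by ext w; ring, this]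
    ring
  rw [show hopf Y = fun z => wz (wz (cx Y)) z + (schw Y z / 2) • cx Y z from
    funext (hopf_eq_wz Y), wzb_add (smooth_differentiableAt (contDiff_wz (contDiff_wz hY.cxs)) z)
    (ds.fun_smul (smooth_differentiableAt hY.cxs z)),
    wzb_smul ds (smooth_differentiableAt hY.cxs z), e, hF.wzb_wzwz hY]
  module

theorem IsFrame.wz_hopf (hF : IsFrame Y L R) (hY : IsCanon Y) (z : ℂ) :
    wz (hopf Y) z = (wz (lam Y R) z + alp L R z * lam Y R z) • cx L z +
      (wz (lam Y L) z - alp L R z * lam Y L z) • cx R z +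
      (-(2 * (lam Y R z * gam Y L z + lam Y L z * gam Y R z))) • cx Y z +
      (4 * (lam Y R z * lam Y L z)) • wzb (cx Y) z := by
  have d1 := smooth_differentiableAt (hY.lam_smooth hF.smoothL) z
  have d2 := smooth_differentiableAt (hY.lam_smooth hF.smoothR) z
  have dL := smooth_differentiableAt hF.cLs z
  have dR := smooth_differentiableAt hF.symm.cLs z
  rw [show hopf Y = fun z => lam Y R z • cx L z + lam Y L z • cx R z from funext (hF.hopf_eq hY),
    wz_add (d2.fun_smul dL) (d1.fun_smul dR), wz_smul d2 dL, wz_smul d1 dR, hF.wz_L hY, hF.wz_R hY]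
  module

theorem IsFrame.form_hopf_wzb (hF : IsFrame Y L R) (hY : IsCanon Y) (z : ℂ) :
    psForm 2 (hopf Y z) (wzb (hopf Y) z) =
      -(lam Y R z * gam Y L z + lam Y L z * gam Y R z) := by
  have c := fun x y : Fin 6 → ℂ => psForm_comm (s := 2) x y
  rw [hF.hopf_eq hY, hF.wzb_hopf hY]
  simp only [psForm_add_left, psForm_add_right, psForm_smul_left, psForm_smul_right, hF.c_L_L,
    hF.symm.c_L_L, hF.c_L_R, hF.symm.c_L_R, hF.c_L_wz hY, hF.symm.c_L_wz hY, hF.c_L_Y,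
    hF.symm.c_L_Y]
  ring

theorem IsFrame.form_wzb_hopf (hF : IsFrame Y L R) (hY : IsCanon Y) (z : ℂ) :
    psForm 2 (wzb (hopf Y) z) (wzb (hopf Y) z) = -2 * (gam Y R z * gam Y L z) := by
  have c := fun x y : Fin 6 → ℂ => psForm_comm (s := 2) x y
  rw [hF.wzb_hopf hY]
  simp only [psForm_add_left, psForm_add_right, psForm_smul_left, psForm_smul_right, hF.c_L_L,
    hF.symm.c_L_L, hF.c_L_R, hF.symm.c_L_R, hF.c_L_wz hY, hF.symm.c_L_wz hY, hF.c_L_Y,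
    hF.symm.c_L_Y, c (wz (cx Y) z) (cx L z), c (wz (cx Y) z) (cx R z), c (wz (cx Y) z) (cx Y z),
    c (cx Y z) (cx L z), c (cx Y z) (cx R z), hY.c_self, hY.c_self_wz, hY.c_wz_wz]
  ring

theorem IsFrame.form_wz_hopf_wzb_hopf (hF : IsFrame Y L R) (hY : IsCanon Y) (z : ℂ) :
    psForm 2 (wz (hopf Y) z) (wzb (hopf Y) z) =
      -((wz (lam Y R) z + alp L R z * lam Y R z) * gam Y L z +
        (wz (lam Y L) z - alp L R z * lam Y L z) * gam Y R z) -
      4 * gauss Y z * (lam Y R z * lam Y L z) := by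
  have c := fun x y : Fin 6 → ℂ => psForm_comm (s := 2) x y
  rw [hF.wzb_hopf hY, hF.wz_hopf hY]
  simp only [psForm_add_left, psForm_add_right, psForm_smul_left, psForm_smul_right, hF.c_L_L,
    hF.symm.c_L_L, hF.c_L_R, hF.symm.c_L_R, hF.c_L_wz hY, hF.symm.c_L_wz hY, hF.c_L_Y,
    hF.symm.c_L_Y, c (wz (cx Y) z) (cx L z), c (wz (cx Y) z) (cx R z), c (wz (cx Y) z) (cx Y z),
    c (wzb (cx Y) z) (cx L z), c (wzb (cx Y) z) (cx R z), c (wzb (cx Y) z) (cx Y z),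
    c (wzb (cx Y) z) (wz (cx Y) z), hF.c_L_wzb hY, hF.symm.c_L_wzb hY, hY.c_self_wzb,
    c (cx Y z) (cx L z), c (cx Y z) (cx R z), hY.c_self, hY.c_self_wz, hY.c_wz_wz, hY.c_wz_wzb]
  ring

/-! ### The two holomorphic differentials -/

/-- The coefficient of the cubic differential measuring whether `κ` and `D_z̄ κ` are parallel. -/
def cubicForm (Y L R : ℂ → Fin 6 → ℝ) (z : ℂ) : ℂ := lam Y R z * gam Y L z - lam Y L z * gam Y R z

/-- The coefficient of the quartic differential. -/
def quarticForm (Y L R : ℂ → Fin 6 → ℝ) (z : ℂ) : ℂ :=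
  lam Y L z * wz (gam Y R) z - gam Y L z * wz (lam Y R) z + lam Y R z * lam Y L z * gauss Y z

theorem IsFrame.cubicForm_smooth (hF : IsFrame Y L R) (hY : IsCanon Y) :
    ContDiff ℝ ∞ (cubicForm Y L R) :=
  ((hY.lam_smooth hF.smoothR).mul (hY.gam_smooth hF.smoothL)).sub
    ((hY.lam_smooth hF.smoothL).mul (hY.gam_smooth hF.smoothR))

theorem IsFrame.quarticForm_smooth (hF : IsFrame Y L R) (hY : IsCanon Y) :
    ContDiff ℝ ∞ (quarticForm Y L R) :=
  (((hY.lam_smooth hF.smoothL).mul (contDiff_wz (hY.gam_smooth hF.smoothR))).sub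
    ((hY.gam_smooth hF.smoothL).mul (contDiff_wz (hY.lam_smooth hF.smoothR)))).add
    (((hY.lam_smooth hF.smoothR).mul (hY.lam_smooth hF.smoothL)).mul hY.gauss_smooth)

/-- By Codazzi and Willmore, differentiating κ ∧ D_z̄ κ gives D_z̄ κ ∧ D_z̄ κ plus a multiple of κ ∧
κ. The connection terms cancel because those of L and R are opposite. -/
theorem IsFrame.wzb_cubicForm (hF : IsFrame Y L R) (hY : IsCanon Y) (hL : IsEulerLagrange Y L)
    (hR : IsEulerLagrange Y R) (z : ℂ) : wzb (cubicForm Y L R) z = 0 := by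
  have d1 := smooth_differentiableAt (hY.lam_smooth hF.smoothL) z
  have d2 := smooth_differentiableAt (hY.lam_smooth hF.smoothR) z
  have d3 := smooth_differentiableAt (hY.gam_smooth hF.smoothL) z
  have d4 := smooth_differentiableAt (hY.gam_smooth hF.smoothR) z
  rw [show cubicForm Y L R = fun z => lam Y R z * gam Y L z - lam Y L z * gam Y R z from rfl,
    wzb_sub (d2.fun_mul d3) (d1.fun_mul d4), wzb_mul d2 d3, wzb_mul d1 d4, hF.wzb_lam hY,
    hF.symm.wzb_lam hY, hF.wzb_gam hY hL, hF.symm.wzb_gam hY hR, hF.alp_symm, star_neg]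
  ring

/-- The Gram determinant of κ and κ_z̄. The right side involves no frame, so its behaviour at
infinity can be read off from that of κ. -/
theorem IsFrame.cubicForm_sq (hF : IsFrame Y L R) (hY : IsCanon Y) (z : ℂ) :
    cubicForm Y L R z ^ 2 = psForm 2 (hopf Y z) (wzb (hopf Y) z) ^ 2 -
      psForm 2 (hopf Y z) (hopf Y z) * psForm 2 (wzb (hopf Y) z) (wzb (hopf Y) z) := by
  rw [hF.form_hopf_wzb hY, hF.form_hopf_hopf hY, hF.form_wzb_hopf hY, cubicForm]
  ring

/-- After Codazzi, Willmore and Gauss have been inserted, the ∂̄-derivative is a multiple of the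
cubic coefficient. -/
theorem IsFrame.wzb_quarticForm (hF : IsFrame Y L R) (hY : IsCanon Y) (hL : IsEulerLagrange Y L)
    (hR : IsEulerLagrange Y R) (h0 : ∀ z, cubicForm Y L R z = 0) (z : ℂ) :
    wzb (quarticForm Y L R) z = 0 := by
  have s1 := hY.lam_smooth hF.smoothL
  have s2 := hY.lam_smooth hF.smoothR
  have s3 := hY.gam_smooth hF.smoothL
  have s4 := hY.gam_smooth hF.smoothR
  have sα := hF.alp_smooth
  have d1 := smooth_differentiableAt s1 z
  have d2 := smooth_differentiableAt s2 z
  have d3 := smooth_differentiableAt s3 z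
  have d4 := smooth_differentiableAt s4 z
  have d5 := smooth_differentiableAt (contDiff_wz s4) z
  have d6 := smooth_differentiableAt (contDiff_wz s2) z
  have dp := smooth_differentiableAt hY.gauss_smooth z
  have sαb : ContDiff ℝ ∞ fun w => star (alp L R w) :=
    (starL' ℝ : ℂ ≃L[ℝ] ℂ).contDiff.comp sα
  have ssb : ContDiff ℝ ∞ fun w => star (schw Y w) :=
    (starL' ℝ : ℂ ≃L[ℝ] ℂ).contDiff.comp hY.schw_smooth
  have dα := smooth_differentiableAt sαb z
  have ds := smooth_differentiableAt ssb z
  have m1 : wzb (wz (lam Y R)) z = wz (gam Y R) z - (wz (fun w => star (alp L R w)) z * lam Y R z +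
      star (alp L R z) * wz (lam Y R) z) := by
    rw [wzb_wz_comm s2.contDiffAt, show wzb (lam Y R) = fun w => gam Y R w -
      star (alp L R w) * lam Y R w from funext fun w => by
        rw [hF.symm.wzb_lam hY, hF.alp_symm, star_neg]; ring,
      wz_sub d4 (dα.fun_mul d2), wz_mul dα d2]
  have m2 : wzb (wz (gam Y R)) z = -(wz (fun w => star (alp L R w)) z * gam Y R z +
      star (alp L R z) * wz (gam Y R) z) - (wz (fun w => star (schw Y w)) z * lam Y R z +
      star (schw Y z) * wz (lam Y R) z) / 2 := by
    rw [wzb_wz_comm s4.contDiffAt, show wzb (gam Y R) = fun w => (-1 : ℂ) • (star (alp L R w) *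
      gam Y R w) - (1 / 2 : ℂ) • (star (schw Y w) * lam Y R w) from funext fun w => by
        rw [hF.symm.wzb_gam hY hR, hF.alp_symm, star_neg]; simp only [smul_eq_mul]; ring,
      wz_sub ((dα.fun_mul d4).fun_const_smul _) ((ds.fun_mul d2).fun_const_smul _),
      wz_const_smul _ (dα.fun_mul d4), wz_const_smul _ (ds.fun_mul d2), wz_mul dα d4, wz_mul ds d2]
    simp only [smul_eq_mul]; ring
  -- The conjugate of the Gauss equation for s; ⟨Y_{z z̄}, Y_{z z̄}⟩ is real.
  have m3 : wz (fun w => star (schw Y w)) z = 2 * wzb (gauss Y) z -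
      4 * (gam Y L z * star (lam Y R z) + gam Y R z * star (lam Y L z)) := by
    have e : wz (gauss Y) z = star (wzb (gauss Y) z) := by
      rw [← wz_star (smooth_differentiableAt hY.gauss_smooth z)]
      simp only [hY.gauss_real]
    rw [wz_star (smooth_differentiableAt hY.schw_smooth z), hF.wzb_schw hY, e]
    simp
  have h0z := h0 z
  rw [cubicForm] at h0z
  rw [show quarticForm Y L R = fun z => lam Y L z * wz (gam Y R) z - gam Y L z * wz (lam Y R) z +
    lam Y R z * lam Y L z * gauss Y z from rfl,
    wzb_add ((d1.fun_mul d5).fun_sub (d3.fun_mul d6)) ((d2.fun_mul d1).fun_mul dp),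
    wzb_sub (d1.fun_mul d5) (d3.fun_mul d6), wzb_mul d1 d5, wzb_mul d3 d6,
    wzb_mul (d2.fun_mul d1) dp, wzb_mul d2 d1, m1, m2, m3, hF.wzb_lam hY,
    hF.symm.wzb_lam hY, hF.wzb_gam hY hL, hF.alp_symm, star_neg, hF.gauss_eq hY]
  linear_combination (wz (fun w => star (alp L R w)) z +
    star (lam Y R z) * lam Y L z - star (lam Y L z) * lam Y R z) * h0z

/-- A frame-free expression, needed to see decay at infinity. When the cubic coefficient vanishes,
⟨κ, κ_z̄⟩ is the single product -2 λ_L γ_R, which is then differentiated in z. -/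
theorem IsFrame.quarticForm_eq (hF : IsFrame Y L R) (hY : IsCanon Y)
    (h0 : ∀ z, cubicForm Y L R z = 0) (z : ℂ) :
    2 * quarticForm Y L R z = psForm 2 (wz (hopf Y) z) (wzb (hopf Y) z) -
      psForm 2 (hopf Y z) (wz (wzb (hopf Y)) z) -
      5 * psForm 2 (hopf Y z) (hopf Y z) * gauss Y z := by
  have d1 := smooth_differentiableAt (hY.lam_smooth hF.smoothL) z
  have d4 := smooth_differentiableAt (hY.gam_smooth hF.smoothR) z
  have e : ∀ w, psForm 2 (hopf Y w) (wzb (hopf Y) w) = (-2 : ℂ) • (lam Y L w * gam Y R w) := by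
    intro w
    have := h0 w
    rw [cubicForm] at this
    rw [hF.form_hopf_wzb hY, smul_eq_mul]
    linear_combination -this
  have e1 : wz (fun w => psForm 2 (hopf Y w) (wzb (hopf Y) w)) z =
      -2 * (wz (lam Y L) z * gam Y R z + lam Y L z * wz (gam Y R) z) := by
    rw [show (fun w => psForm 2 (hopf Y w) (wzb (hopf Y) w)) =
      fun w => (-2 : ℂ) • (lam Y L w * gam Y R w) from funext e, wz_const_smul _ (d1.fun_mul d4),
      wz_mul d1 d4, smul_eq_mul]
  rw [wz_psForm (smooth_differentiableAt hY.hopf_smooth z)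
    (smooth_differentiableAt (contDiff_wzb hY.hopf_smooth) z)] at e1
  have h0z := h0 z
  rw [cubicForm] at h0z
  rw [hF.form_hopf_hopf hY, quarticForm]
  have e2 := hF.form_wz_hopf_wzb_hopf hY z
  linear_combination e1 - 2 * e2 + 2 * alp L R z * h0z

end

section

/-! ### The change of coordinate `z ↦ 1 / z` -/

theorem fderiv_apply_eq_pd {E : Type*} [NormedAddCommGroup E] [NormedSpace ℝ E] (F : ℂ → E)
    (z v : ℂ) : fderiv ℝ F z v = v.re • pd 0 F z + v.im • pd 1 F z := by
  conv_lhs => rw [show v = v.re • (1 : ℂ) + v.im • Complex.I by simp]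
  rw [map_add, map_smul, map_smul, pd_zero, pd_one]

theorem pd_comp {E : Type*} [NormedAddCommGroup E] [NormedSpace ℝ E] {F : ℂ → E} {h : ℂ → ℂ}
    {h' z : ℂ} (hF : DifferentiableAt ℝ F (h z)) (hh : HasDerivAt h h' z) (i : Fin 2) :
    pd i (fun w => F (h w)) z =
      fderiv ℝ F (h z) (h' * (if i = 0 then 1 else Complex.I)) := by
  have h1 : HasFDerivAt h _ z := hh.hasFDerivAt.restrictScalars ℝ
  have h2 := hF.hasFDerivAt.comp z h1
  rw [pd, show (fun w => F (h w)) = F ∘ h from rfl, h2.fderiv]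
  simp [mul_comm]

section Chain

variable {E : Type*} [NormedAddCommGroup E] [NormedSpace ℂ E] {F : ℂ → E} {h : ℂ → ℂ} {h' z : ℂ}

theorem wz_comp (hF : DifferentiableAt ℝ F (h z)) (hh : HasDerivAt h h' z) :
    wz (fun w => F (h w)) z = h' • wz F (h z) := by
  simp only [wz, pd_comp hF hh, fderiv_apply_eq_pd]
  simp only [if_true, one_ne_zero, if_false, mul_one, Complex.mul_re, Complex.mul_im,
    Complex.I_re, Complex.I_im, mul_zero, zero_sub, zero_add, add_zero]
  simp only [← Complex.coe_smul]
  conv_rhs => rw [← Complex.re_add_im h']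
  push_cast
  match_scalars <;> (ring_nf; try simp; try ring)

theorem wzb_comp (hF : DifferentiableAt ℝ F (h z)) (hh : HasDerivAt h h' z) :
    wzb (fun w => F (h w)) z = star h' • wzb F (h z) := by
  simp only [wzb, pd_comp hF hh, fderiv_apply_eq_pd]
  simp only [if_true, one_ne_zero, if_false, mul_one, Complex.mul_re, Complex.mul_im,
    Complex.I_re, Complex.I_im, mul_zero, zero_sub, zero_add, add_zero]
  simp only [← Complex.coe_smul]
  have e : star h' = (h'.re : ℂ) - h'.im * Complex.I := by
    apply Complex.ext <;> simp
  rw [e]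
  push_cast
  match_scalars <;> (ring_nf; try simp; try ring)

end Chain

theorem wz_of_hasDerivAt {f : ℂ → ℂ} {f' z : ℂ} (h : HasDerivAt f f' z) : wz f z = f' := by
  have h1 : HasFDerivAt f _ z := h.hasFDerivAt.restrictScalars ℝ
  rw [wz, pd_zero, pd_one, h1.fderiv]
  simp
  linear_combination (-f' / 2) * Complex.I_mul_I

theorem wzb_of_hasDerivAt {f : ℂ → ℂ} {f' z : ℂ} (h : HasDerivAt f f' z) : wzb f z = 0 := by
  have h1 : HasFDerivAt f _ z := h.hasFDerivAt.restrictScalars ℝ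
  rw [wzb, pd_zero, pd_one, h1.fderiv]
  simp
  linear_combination (f') * Complex.I_mul_I

theorem wz_star_of_hasDerivAt {f : ℂ → ℂ} {f' z : ℂ} (h : HasDerivAt f f' z) :
    wz (fun w => star (f w)) z = 0 := by
  rw [wz_star (h.differentiableAt.restrictScalars ℝ), wzb_of_hasDerivAt h, star_zero]

theorem wzb_star_of_hasDerivAt {f : ℂ → ℂ} {f' z : ℂ} (h : HasDerivAt f f' z) :
    wzb (fun w => star (f w)) z = star f' := by
  rw [wzb_star (h.differentiableAt.restrictScalars ℝ), wz_of_hasDerivAt h]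

theorem differentiableAt_inv' {z : ℂ} (hz : z ≠ 0) : DifferentiableAt ℝ (fun w : ℂ => w⁻¹) z :=
  (hasDerivAt_inv hz).differentiableAt.restrictScalars ℝ

theorem differentiableAt_star_pow (a : ℕ) (z : ℂ) :
    DifferentiableAt ℝ (fun w : ℂ => star w ^ a) z :=
  ((starL' ℝ : ℂ ≃L[ℝ] ℂ).differentiableAt).pow a

theorem differentiableAt_inv_pow (b : ℕ) {z : ℂ} (hz : z ≠ 0) :
    DifferentiableAt ℝ (fun w : ℂ => w⁻¹ ^ b) z :=
  (differentiableAt_inv' hz).pow b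

theorem wz_star_pow (a : ℕ) (z : ℂ) : wz (fun w : ℂ => star w ^ a) z = 0 := by
  have := wz_star_of_hasDerivAt (hasDerivAt_pow a z)
  simpa only [star_pow] using this

theorem hasDerivAt_inv_pow (b : ℕ) {z : ℂ} (hz : z ≠ 0) :
    HasDerivAt (fun w : ℂ => w⁻¹ ^ b) (-(b * z⁻¹ ^ (b + 1))) z := by
  have := (hasDerivAt_inv hz).pow b
  refine this.congr_deriv ?_
  rcases b with _ | b
  · simp
  · simp only [Nat.cast_add, Nat.cast_one, Nat.add_sub_cancel]
    rw [← inv_pow]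
    ring

/-- Behaviour at infinity of the form `z̄ᵃ z⁻ᵇ K(1/z)` with `K` smooth. -/
def HasTail {E : Type*} [NormedAddCommGroup E] [NormedSpace ℂ E] (a b : ℕ) (F : ℂ → E) : Prop :=
  ∃ K : ℂ → E, ContDiff ℝ ∞ K ∧ ∀ z ≠ 0, F z = (star z ^ a * z⁻¹ ^ b) • K z⁻¹

section Tail

variable {E : Type*} [NormedAddCommGroup E] [NormedSpace ℂ E] {F : ℂ → E} {a b : ℕ}

theorem eventually_ne_zero {z : ℂ} (hz : z ≠ 0) : ∀ᶠ w in nhds z, w ≠ 0 :=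
  isOpen_compl_singleton.mem_nhds hz

theorem smooth_star : ContDiff ℝ ∞ (fun w : ℂ => star w) := (starL' ℝ : ℂ ≃L[ℝ] ℂ).contDiff

/-- Since ∂(1/z) = -z⁻², every term gains at least one factor z⁻¹, while z̄ᵃ is constant for ∂. -/
theorem HasTail.wz (h : HasTail a b F) : HasTail a (b + 1) (wz F) := by
  obtain ⟨K, hK, hF⟩ := h
  refine ⟨fun w => (-(b : ℂ)) • K w - w • LorentzWillmore.wz K w,
    (contDiff_const.smul hK).sub (contDiff_id.smul (contDiff_wz hK)), fun z hz => ?_⟩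
  have hd := smooth_differentiableAt hK z⁻¹
  have hinv := hasDerivAt_inv hz
  have d1 : DifferentiableAt ℝ (fun w : ℂ => star w ^ a * w⁻¹ ^ b) z :=
    (differentiableAt_star_pow a z).fun_mul (differentiableAt_inv_pow b hz)
  have d2 : DifferentiableAt ℝ (fun w : ℂ => K w⁻¹) z :=
    hd.comp z (differentiableAt_inv' hz)
  rw [wz_congr (G := fun z => (star z ^ a * z⁻¹ ^ b) • K z⁻¹)
    ((eventually_ne_zero hz).mono fun w hw => hF w hw), wz_smul d1 d2,
    wz_mul (differentiableAt_star_pow a z) (differentiableAt_inv_pow b hz), wz_star_pow,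
    wz_of_hasDerivAt (hasDerivAt_inv_pow b hz), wz_comp hd hinv, ← inv_pow]
  match_scalars <;> ring

/-- Applying ∂̄ removes the factor z̄, and differentiating K(1/z) yields z̄⁻², which absorbs it too.
This is the case used for κ. -/
theorem HasTail.wzb (h : HasTail 1 b F) : HasTail 0 b (wzb F) := by
  obtain ⟨K, hK, hF⟩ := h
  refine ⟨fun w => K w - star w • LorentzWillmore.wzb K w,
    hK.sub (smooth_star.smul (contDiff_wzb hK)), fun z hz => ?_⟩
  have hd := smooth_differentiableAt hK z⁻¹
  have hinv := hasDerivAt_inv hz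
  have d0 : DifferentiableAt ℝ (fun w : ℂ => star w) z := smooth_differentiableAt smooth_star z
  have d1 : DifferentiableAt ℝ (fun w : ℂ => star w * w⁻¹ ^ b) z :=
    d0.fun_mul (differentiableAt_inv_pow b hz)
  have d2 : DifferentiableAt ℝ (fun w : ℂ => K w⁻¹) z :=
    hd.comp z (differentiableAt_inv' hz)
  have hs : star z ≠ 0 := star_ne_zero.2 hz
  rw [wzb_congr (G := fun z => (star z * z⁻¹ ^ b) • K z⁻¹)
    ((eventually_ne_zero hz).mono fun w hw => by simpa using hF w hw), wzb_smul d1 d2,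
    wzb_mul d0 (differentiableAt_inv_pow b hz), wzb_star_of_hasDerivAt (hasDerivAt_id' z),
    wzb_of_hasDerivAt (hasDerivAt_inv_pow b hz), wzb_comp hd hinv]
  simp only [star_neg, star_inv₀, star_pow, star_one, pow_zero, mul_zero, add_zero]
  match_scalars <;> field_simp

theorem HasTail.tendsto (h : HasTail a b F) (hab : a < b) :
    Filter.Tendsto F (Filter.cocompact ℂ) (nhds 0) := by
  obtain ⟨K, hK, hF⟩ := h
  have h0 : ∀ᶠ z in Filter.cocompact ℂ, z ≠ 0 :=
    (Filter.hasBasis_cocompact.mem_of_mem (i := {(0 : ℂ)}) isCompact_singleton)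
  have hinv : Filter.Tendsto (fun z : ℂ => z⁻¹) (Filter.cocompact ℂ) (nhds 0) :=
    Filter.tendsto_inv₀_cobounded.comp (by rw [Metric.cobounded_eq_cocompact]; exact Filter.tendsto_id)
  have h1 : Filter.Tendsto (fun z : ℂ => K z⁻¹) (Filter.cocompact ℂ) (nhds (K 0)) :=
    (hK.continuous.tendsto 0).comp hinv
  have h2 : Filter.Tendsto (fun z : ℂ => star z ^ a * z⁻¹ ^ b) (Filter.cocompact ℂ) (nhds 0) := by
    rw [tendsto_zero_iff_norm_tendsto_zero]
    have h3 : Filter.Tendsto (fun z : ℂ => ‖z⁻¹‖ ^ (b - a)) (Filter.cocompact ℂ) (nhds 0) := by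
      have := (hinv.norm).pow (b - a)
      simpa [Nat.sub_ne_zero_of_lt hab] using this
    refine h3.congr' (h0.mono fun z hz => ?_)
    have hn : ‖z‖ ≠ 0 := norm_ne_zero_iff.2 hz
    obtain ⟨c, rfl⟩ := Nat.exists_eq_add_of_lt hab
    change _ = ‖star z ^ a * z⁻¹ ^ (a + c + 1)‖
    rw [norm_mul, norm_pow, norm_pow, norm_star, norm_inv, show a + c + 1 - a = c + 1 by omega]
    have h5 : ‖z‖ ^ a * ‖z‖⁻¹ ^ a = 1 := by rw [← mul_pow, mul_inv_cancel₀ hn, one_pow]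
    rw [add_assoc, pow_add _ a, ← mul_assoc, h5, one_mul]
  have h4 := h2.smul h1
  rw [zero_smul] at h4
  exact h4.congr' (h0.mono fun z hz => (hF z hz).symm)

end Tail

/-! ### Canonical lifts over the two coordinate patches -/

/-- The relation between the canonical lifts of a surface over the two coordinate patches. -/
structure IsTransition (Y Yt : ℂ → Fin 6 → ℝ) : Prop where
  canon : IsCanon Y
  canon' : IsCanon Yt
  eq : ∀ z ≠ 0, Y z = ‖z‖ ^ 2 • Yt z⁻¹

theorem IsTransition.symm {Y Yt : ℂ → Fin 6 → ℝ} (h : IsTransition Y Yt) : IsTransition Yt Y :=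
  ⟨h.canon', h.canon, fun z hz => by
    rw [h.eq _ (inv_ne_zero hz), smul_smul, inv_inv, norm_inv, inv_pow, mul_inv_cancel₀, one_smul]
    exact pow_ne_zero 2 (norm_ne_zero_iff.2 hz)⟩

theorem chart_one_inv {z : ℂ} (hz : z ≠ 0) : chart 1 z⁻¹ = chart 0 z := by
  simp [chart, hz]

theorem IsCanon.neg {Y : ℂ → Fin 6 → ℝ} (h : IsCanon Y) : IsCanon fun z => -Y z := by
  have hp : ∀ i z, pd i (fun z => -Y z) z = -pd i Y z := fun i z => by
    simp only [pd, fderiv_fun_neg, neg_apply]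
  refine ⟨h.smooth.neg, fun z => by rw [psForm_neg_left, psForm_neg_right, h.null]; simp,
    fun z => ?_⟩
  rw [← h.unit z]
  ext i j
  simp only [firstForm, Matrix.of_apply, hp, psForm_neg_left, psForm_neg_right, neg_neg]

theorem IsCanonicalLift.neg {i : Fin 2} {y : OnePoint ℂ → Q41} {Y : ℂ → Fin 6 → ℝ}
    (h : IsCanonicalLift i y Y) : IsCanonicalLift i y fun z => -Y z :=
  ⟨⟨h.1.1.neg, fun z => by simpa using (h.1.2 z).smul (c := -1) (by norm_num)⟩, h.isCanon.neg.unit⟩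

theorem firstForm_comp_inv {X : ℂ → Fin 6 → ℝ} (hX : IsCanon X) {z : ℂ} (hz : z ≠ 0) :
    firstForm 2 (fun w => X w⁻¹) z = (‖z‖ ^ 2)⁻¹ ^ 2 • (1 : Matrix (Fin 2) (Fin 2) ℝ) := by
  have hd := smooth_differentiableAt hX.smooth z⁻¹
  have h1 : ∀ a b : ℂ, psForm 2 (fderiv ℝ X z⁻¹ a) (fderiv ℝ X z⁻¹ b) = a.re * b.re + a.im * b.im := by
    intro a b
    rw [fderiv_apply_eq_pd, fderiv_apply_eq_pd]
    simp only [psForm_add_left, psForm_add_right, psForm_smul_left, psForm_smul_right,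
      hX.form_pd_pd]
    simp
    ring
  have h2 : (‖z‖ ^ 2)⁻¹ ^ 2 = Complex.normSq (-(z ^ 2)⁻¹) := by
    rw [Complex.normSq_eq_norm_sq, norm_neg, norm_inv, norm_pow]
  rw [h2, Complex.normSq_apply]
  ext i j
  simp only [firstForm, Matrix.of_apply, pd_comp hd (hasDerivAt_inv hz), h1]
  fin_cases i <;> fin_cases j <;> simp <;> ring

/-- Both lifts are normalized, so the factor f between them satisfies f² = |z|⁴. On the connected
set ℂ \ {0} it is therefore |z|² or -|z|² throughout. -/
theorem transition_or_neg {y : OnePoint ℂ → Q41} {Y X : ℂ → Fin 6 → ℝ}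
    (hY : IsCanonicalLift 0 y Y) (hX : IsCanonicalLift 1 y X) :
    IsTransition Y X ∨ IsTransition Y fun z => -X z := by
  have hXi : ∀ z ∈ ({0}ᶜ : Set ℂ), ContDiffAt ℝ ∞ (fun w => X w⁻¹) z := fun z hz =>
    hX.1.1.contDiffAt.comp z (contDiffAt_inv ℝ hz)
  obtain ⟨f, hfs, hf⟩ := exists_smooth_factor (A := Y) (B := fun z => X z⁻¹) (s := {0}ᶜ)
    (fun z _ => hY.1.1.contDiffAt) hXi (fun z _ => hX.isCanon.ne_zero _) fun z hz =>
      (chart_one_inv hz ▸ hX.1.2 z⁻¹ : Represents (X z⁻¹) (y (chart 0 z))).exists_smul (hY.1.2 z)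
  have hsq : Set.EqOn (f ^ 2) ((fun z => ‖z‖ ^ 2) ^ 2) {0}ᶜ := by
    intro z hz
    have hz' : z ≠ 0 := hz
    have h1 : Y =ᶠ[nhds z] fun w => f w • X w⁻¹ :=
      (eventually_ne_zero hz').mono fun w hw => (hf w hw).2
    have h2 := firstForm_congr (s := 2) h1
    rw [hY.2, firstForm_smul (smoothAt_differentiableAt (hXi z hz))
      (smoothAt_differentiableAt (hfs z hz)) (.of_forall fun w => hX.isCanon.null _),
      firstForm_comp_inv hX.isCanon hz', smul_smul] at h2
    have h3 := congrFun (congrFun h2 0) 0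
    simp at h3
    have hn : ‖z‖ ≠ 0 := norm_ne_zero_iff.2 hz'
    simp only [Pi.pow_apply]
    field_simp at h3
    linarith
  have hconn : IsPreconnected ({0}ᶜ : Set ℂ) :=
    (isConnected_compl_singleton_of_one_lt_rank (by simp) 0).isPreconnected
  have := hconn.eq_or_eq_neg_of_sq_eq
    (fun z hz => (hfs z hz).continuousAt.continuousWithinAt) (by fun_prop) hsq
    (fun hz => pow_ne_zero 2 (norm_ne_zero_iff.2 hz))
  refine this.imp (fun h => ⟨hY.isCanon, hX.isCanon, fun z hz => by rw [(hf z hz).2, h hz]⟩)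
    fun h => ⟨hY.isCanon, hX.isCanon.neg, fun z hz => ?_⟩
  rw [(hf z hz).2, h hz]
  simp

theorem exists_transition {y : OnePoint ℂ → Q41} (hy : IsConformalSpacelike y)
    {Y : ℂ → Fin 6 → ℝ} (hY : IsCanonicalLift 0 y Y) :
    ∃ Yt, IsCanonicalLift 1 y Yt ∧ IsTransition Y Yt := by
  obtain ⟨X, hX⟩ := exists_canonicalLift hy 1
  rcases transition_or_neg hY hX with h | h
  · exact ⟨X, hX, h⟩
  · exact ⟨_, hX.neg, h⟩

theorem exists_transition' {y : OnePoint ℂ → Q41} (hy : IsConformalSpacelike y)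
    {X : ℂ → Fin 6 → ℝ} (hX : IsCanonicalLift 1 y X) :
    ∃ Y, IsCanonicalLift 0 y Y ∧ IsTransition Y X := by
  obtain ⟨Y, hY⟩ := exists_canonicalLift hy 0
  rcases transition_or_neg hY hX with h | h
  · exact ⟨Y, hY, h⟩
  · exact ⟨_, hY.neg, hY.neg.isCanon, hX.isCanon, fun z hz => by rw [h.eq z hz]; simp⟩

namespace IsTransition

variable {Y Yt : ℂ → Fin 6 → ℝ}

theorem cx_eq (h : IsTransition Y Yt) {z : ℂ} (hz : z ≠ 0) :
    cx Y z = (z * star z) • cx Yt z⁻¹ := by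
  rw [cx, h.eq z hz, toC_smul, cx]
  congr 1
  rw [Complex.star_def, Complex.mul_conj, Complex.normSq_eq_norm_sq]

theorem wz_eq (h : IsTransition Y Yt) {z : ℂ} (hz : z ≠ 0) :
    wz (cx Y) z = star z • cx Yt z⁻¹ - (star z * z⁻¹) • wz (cx Yt) z⁻¹ := by
  have hd := smooth_differentiableAt h.canon'.cxs z⁻¹
  have d0 : DifferentiableAt ℝ (fun w : ℂ => star w) z := smooth_differentiableAt smooth_star z
  have d1 : DifferentiableAt ℝ (fun w : ℂ => w) z := differentiableAt_id
  have d2 : DifferentiableAt ℝ (fun w : ℂ => cx Yt w⁻¹) z :=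
    hd.comp z (differentiableAt_inv' hz)
  rw [wz_congr ((eventually_ne_zero hz).mono fun w hw => h.cx_eq hw), wz_smul (d1.fun_mul d0) d2,
    wz_mul d1 d0, wz_of_hasDerivAt (hasDerivAt_id' z), wz_star_of_hasDerivAt (hasDerivAt_id' z),
    wz_comp hd (hasDerivAt_inv hz)]
  match_scalars <;> field_simp <;> ring

/-- The factor |z|² is |dz/dw| for w = 1/z, and inversion is a Möbius map: all terms of lower order
cancel and no Schwarzian derivative appears. -/
theorem wzwz_eq (h : IsTransition Y Yt) {z : ℂ} (hz : z ≠ 0) :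
    wz (wz (cx Y)) z = (star z * z⁻¹ ^ 3) • wz (wz (cx Yt)) z⁻¹ := by
  have hd := smooth_differentiableAt h.canon'.cxs z⁻¹
  have hd' := smooth_differentiableAt (contDiff_wz h.canon'.cxs) z⁻¹
  have di := differentiableAt_inv' hz
  have d0 : DifferentiableAt ℝ (fun w : ℂ => star w) z := smooth_differentiableAt smooth_star z
  have d2 : DifferentiableAt ℝ (fun w : ℂ => cx Yt w⁻¹) z := hd.comp z di
  have d3 : DifferentiableAt ℝ (fun w : ℂ => wz (cx Yt) w⁻¹) z := hd'.comp z di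
  rw [wz_congr ((eventually_ne_zero hz).mono fun w hw => h.wz_eq hw),
    wz_sub (d0.fun_smul d2) ((d0.fun_mul di).fun_smul d3), wz_smul d0 d2,
    wz_smul (d0.fun_mul di) d3, wz_mul d0 di, wz_of_hasDerivAt (hasDerivAt_inv hz),
    wz_star_of_hasDerivAt (hasDerivAt_id' z),
    wz_comp hd (hasDerivAt_inv hz), wz_comp hd' (hasDerivAt_inv hz)]
  match_scalars <;> field_simp <;> ring

theorem wzbwz_eq (h : IsTransition Y Yt) {z : ℂ} (hz : z ≠ 0) :
    wzb (wz (cx Y)) z = cx Yt z⁻¹ - star z⁻¹ • wzb (cx Yt) z⁻¹ - z⁻¹ • wz (cx Yt) z⁻¹ +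
      (z⁻¹ * star z⁻¹) • wzb (wz (cx Yt)) z⁻¹ := by
  have hd := smooth_differentiableAt h.canon'.cxs z⁻¹
  have hd' := smooth_differentiableAt (contDiff_wz h.canon'.cxs) z⁻¹
  have di := differentiableAt_inv' hz
  have d0 : DifferentiableAt ℝ (fun w : ℂ => star w) z := smooth_differentiableAt smooth_star z
  have d2 : DifferentiableAt ℝ (fun w : ℂ => cx Yt w⁻¹) z := hd.comp z di
  have d3 : DifferentiableAt ℝ (fun w : ℂ => wz (cx Yt) w⁻¹) z := hd'.comp z di
  have hs : star z ≠ 0 := star_ne_zero.2 hz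
  rw [wzb_congr ((eventually_ne_zero hz).mono fun w hw => h.wz_eq hw),
    wzb_sub (d0.fun_smul d2) ((d0.fun_mul di).fun_smul d3), wzb_smul d0 d2,
    wzb_smul (d0.fun_mul di) d3, wzb_mul d0 di, wzb_of_hasDerivAt (hasDerivAt_inv hz),
    wzb_star_of_hasDerivAt (hasDerivAt_id' z),
    wzb_comp hd (hasDerivAt_inv hz), wzb_comp hd' (hasDerivAt_inv hz)]
  simp only [star_neg, star_inv₀, star_pow, star_one, mul_zero, add_zero]
  match_scalars <;> field_simp

/-- The identity s/4 = ⟨Y_zz, Y_{z z̄}⟩ avoids transforming N. In Y_{z z̄} only the last term pairs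
nontrivially with the second derivative of the other lift. -/
theorem schw_eq (h : IsTransition Y Yt) {z : ℂ} (hz : z ≠ 0) :
    schw Y z = z⁻¹ ^ 4 * schw Yt z⁻¹ := by
  have h1 := h.canon.wzwz_wzbwz z
  have h2 := h.canon'.wzwz_wzbwz z⁻¹
  rw [h.wzwz_eq hz, h.wzbwz_eq hz] at h1
  simp only [psForm_smul_left, psForm_add_right, psForm_sub_right, psForm_smul_right,
    h.canon'.wzwz_self, h.canon'.wzwz_wz, h.canon'.wzwz_wzb, h2] at h1
  have hs : star z ≠ 0 := star_ne_zero.2 hz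
  rw [star_inv₀] at h1
  field_simp at h1
  field_simp
  linear_combination -h1

theorem hopf_eq (h : IsTransition Y Yt) {z : ℂ} (hz : z ≠ 0) :
    hopf Y z = (star z * z⁻¹ ^ 3) • hopf Yt z⁻¹ := by
  rw [hopf_eq_wz, hopf_eq_wz, h.wzwz_eq hz, h.schw_eq hz, h.cx_eq hz]
  match_scalars <;> field_simp

theorem hasTail_hopf (h : IsTransition Y Yt) : HasTail 1 3 (hopf Y) :=
  ⟨hopf Yt, h.canon'.hopf_smooth, fun z hz => by rw [h.hopf_eq hz, pow_one]⟩

theorem hasTail_schw (h : IsTransition Y Yt) : HasTail 0 4 (schw Y) :=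
  ⟨schw Yt, h.canon'.schw_smooth, fun z hz => by rw [h.schw_eq hz, pow_zero, one_mul, smul_eq_mul]⟩

end IsTransition

/-! ### Vanishing of the two differentials on the sphere -/

theorem IsFrame.gauss_eq_hopf {Y L R : ℂ → Fin 6 → ℝ} (hF : IsFrame Y L R) (hY : IsCanon Y) (z : ℂ) :
    gauss Y z = psForm 2 (hopf Y z) (star (hopf Y z)) := by
  have sL : star (cx L z) = cx L z := star_toC _
  have sR : star (cx R z) = cx R z := star_toC _
  rw [hF.gauss_eq hY, hF.hopf_eq hY]
  simp only [star_add, star_smul, sL, sR, psForm_add_left, psForm_add_right, psForm_smul_left,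
    psForm_smul_right, hF.c_L_L, hF.symm.c_L_L, hF.c_L_R, hF.symm.c_L_R]
  ring

theorem tendsto_psForm_zero {n : ℕ} {A B : ℂ → Fin n → ℂ} {l : Filter ℂ} (s : ℕ)
    (hA : Filter.Tendsto A l (nhds 0)) (hB : Filter.Tendsto B l (nhds 0)) :
    Filter.Tendsto (fun z => psForm s (A z) (B z)) l (nhds 0) := by
  have hc : Continuous fun p : (Fin n → ℂ) × (Fin n → ℂ) => psForm s p.1 p.2 := by
    simp only [psForm_eq_sum]
    fun_prop
  have := (hc.tendsto (0, 0)).comp (hA.prodMk_nhds hB)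
  rw [psForm_zero_left] at this
  exact this

/-- The coefficient is entire. Its square is a Gram determinant of κ and κ_z̄, both of which tend to
0 at infinity, so the coefficient does as well and Liouville applies. -/
theorem IsTransition.cubicForm_eq_zero {Y Yt L R : ℂ → Fin 6 → ℝ} (h : IsTransition Y Yt)
    (hF : IsFrame Y L R) (hL : IsEulerLagrange Y L) (hR : IsEulerLagrange Y R) (z : ℂ) :
    cubicForm Y L R z = 0 := by
  have t1 := h.hasTail_hopf.tendsto (by norm_num)
  have t2 := h.hasTail_hopf.wzb.tendsto (by norm_num)
  refine eq_zero_of_wzb_eq_zero (hF.cubicForm_smooth h.canon) (hF.wzb_cubicForm h.canon hL hR) ?_ z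
  have t3 := ((tendsto_psForm_zero 2 t1 t2).pow 2).sub
    ((tendsto_psForm_zero 2 t1 t1).mul (tendsto_psForm_zero 2 t2 t2))
  simp only [← hF.cubicForm_sq h.canon] at t3
  rw [tendsto_zero_iff_norm_tendsto_zero]
  have t4 := t3.norm.sqrt
  simpa [norm_pow] using t4

/-- Every factor in the frame-free expression is κ, its conjugate or one of its derivatives, and all
of these tend to 0 at infinity. -/
theorem IsTransition.quarticForm_eq_zero {Y Yt L R : ℂ → Fin 6 → ℝ} (h : IsTransition Y Yt)
    (hF : IsFrame Y L R) (hL : IsEulerLagrange Y L) (hR : IsEulerLagrange Y R) (z : ℂ) :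
    quarticForm Y L R z = 0 := by
  have h0 := h.cubicForm_eq_zero hF hL hR
  have t1 := h.hasTail_hopf.tendsto (by norm_num)
  have t2 := h.hasTail_hopf.wzb.tendsto (by norm_num)
  have t3 := h.hasTail_hopf.wz.tendsto (by norm_num)
  have t4 := h.hasTail_hopf.wzb.wz.tendsto (by norm_num)
  have t5 : Filter.Tendsto (fun z => star (hopf Y z)) (Filter.cocompact ℂ) (nhds 0) := by
    simpa using t1.star
  refine eq_zero_of_wzb_eq_zero (hF.quarticForm_smooth h.canon)
    (hF.wzb_quarticForm h.canon hL hR h0) ?_ z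
  have t6 := ((tendsto_psForm_zero 2 t3 t2).sub (tendsto_psForm_zero 2 t1 t4)).sub
    (((tendsto_psForm_zero 2 t1 t1).const_mul 5).mul (tendsto_psForm_zero 2 t1 t5))
  simp only [← hF.gauss_eq_hopf h.canon, ← hF.quarticForm_eq h.canon h0] at t6
  have t7 := t6.const_mul (1 / 2 : ℂ)
  simpa using t7

end

section

/-! ### An explicit formula for the Willmore density -/

/-- `EG - F²` for the plane spanned by `a, b`. -/
def gramDet (a b : Fin 6 → ℝ) : ℝ := psForm 2 a a * psForm 2 b b - psForm 2 a b ^ 2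

/-- `EG - F²` times the inner product of the components of `p, q` orthogonal to `a, b`. -/
def bracket (a b p q : Fin 6 → ℝ) : ℝ :=
  gramDet a b * psForm 2 p q - (psForm 2 b b * (psForm 2 p a * psForm 2 q a) -
    psForm 2 a b * (psForm 2 p a * psForm 2 q b + psForm 2 p b * psForm 2 q a) +
    psForm 2 a a * (psForm 2 p b * psForm 2 q b))

/-- Numerator of the Willmore density in terms of the first derivatives `a, b` and the second
derivatives `p, q, r`. -/
def densNum (a b p q r : Fin 6 → ℝ) : ℝ :=
  1 / 2 * (psForm 2 b b ^ 2 * bracket a b p p + 4 * psForm 2 a b ^ 2 * bracket a b q q +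
    psForm 2 a a ^ 2 * bracket a b r r - 4 * psForm 2 a b * psForm 2 b b * bracket a b p q +
    2 * psForm 2 a a * psForm 2 b b * bracket a b p r -
    4 * psForm 2 a a * psForm 2 a b * bracket a b q r) -
  2 * gramDet a b * (bracket a b p r - bracket a b q q)

/-- The Willmore density as a function of the first and second derivatives. -/
def jetDensity (a b p q r : Fin 6 → ℝ) : ℝ :=
  densNum a b p q r * Real.sqrt (gramDet a b) / (8 * gramDet a b ^ 3)

theorem det_firstForm (X : ℂ → Fin 6 → ℝ) (z : ℂ) :
    (firstForm 2 X z).det = gramDet (pd 0 X z) (pd 1 X z) := by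
  rw [Matrix.det_fin_two]
  simp only [firstForm, Matrix.of_apply, gramDet, psForm_comm (pd 1 X z) (pd 0 X z)]
  ring

theorem inv_firstForm {X : ℂ → Fin 6 → ℝ} {z : ℂ} :
    (firstForm 2 X z)⁻¹ = Matrix.of
      ![![psForm 2 (pd 1 X z) (pd 1 X z) / gramDet (pd 0 X z) (pd 1 X z),
        -(psForm 2 (pd 0 X z) (pd 1 X z) / gramDet (pd 0 X z) (pd 1 X z))],
      ![-(psForm 2 (pd 0 X z) (pd 1 X z) / gramDet (pd 0 X z) (pd 1 X z)),
        psForm 2 (pd 0 X z) (pd 0 X z) / gramDet (pd 0 X z) (pd 1 X z)]] := by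
  rw [Matrix.inv_def, Ring.inverse_eq_inv', det_firstForm, Matrix.adjugate_fin_two]
  ext i j
  fin_cases i <;> fin_cases j <;>
    simp [firstForm, psForm_comm (pd 1 X z) (pd 0 X z), div_eq_inv_mul]

/-- `bracket` clears the denominators of the orthogonal projection, which makes the density a
polynomial over a power of EG - F². -/
theorem form_secondForm {X : ℂ → Fin 6 → ℝ} {z : ℂ}
    (hd : gramDet (pd 0 X z) (pd 1 X z) ≠ 0) (i j k l : Fin 2) :
    psForm 2 (secondForm 2 X z i j) (secondForm 2 X z k l) =
      bracket (pd 0 X z) (pd 1 X z) (pd i (pd j X) z) (pd k (pd l X) z) /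
        gramDet (pd 0 X z) (pd 1 X z) := by
  simp only [secondForm, inv_firstForm, Fin.sum_univ_two, Matrix.of_apply, Matrix.cons_val_zero,
    Matrix.cons_val_one, bracket, psForm_sub_left, psForm_sub_right, psForm_add_left,
    psForm_add_right, psForm_smul_left, psForm_smul_right, psForm_comm (pd 0 X z) (pd k (pd l X) z),
    psForm_comm (pd 1 X z) (pd k (pd l X) z), psForm_comm (pd 1 X z) (pd 0 X z)]
  generalize psForm 2 (pd i (pd j X) z) (pd k (pd l X) z) = pq
  generalize psForm 2 (pd i (pd j X) z) (pd 0 X z) = p0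
  generalize psForm 2 (pd i (pd j X) z) (pd 1 X z) = p1
  generalize psForm 2 (pd k (pd l X) z) (pd 0 X z) = q0
  generalize psForm 2 (pd k (pd l X) z) (pd 1 X z) = q1
  have hdd : gramDet (pd 0 X z) (pd 1 X z) = psForm 2 (pd 0 X z) (pd 0 X z) *
    psForm 2 (pd 1 X z) (pd 1 X z) - psForm 2 (pd 0 X z) (pd 1 X z) ^ 2 := rfl
  generalize gramDet (pd 0 X z) (pd 1 X z) = d at *
  generalize psForm 2 (pd 0 X z) (pd 0 X z) = E at *
  generalize psForm 2 (pd 0 X z) (pd 1 X z) = F at *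
  generalize psForm 2 (pd 1 X z) (pd 1 X z) = G at *
  field_simp
  subst hdd
  ring

/-- For a symmetric form in two variables the trace-free part has squared norm |tr|²/2 - 2 det.
These are the two groups of terms in `densNum`. -/
theorem willmoreDensity_eq {X : ℂ → Fin 6 → ℝ} {z : ℂ} (hX : ContDiffAt ℝ ∞ X z)
    (hd : 0 < gramDet (pd 0 X z) (pd 1 X z)) :
    willmoreDensity X z = jetDensity (pd 0 X z) (pd 1 X z) (pd 0 (pd 0 X) z) (pd 0 (pd 1 X) z)
      (pd 1 (pd 1 X) z) := by
  have hc : secondForm 2 X z 1 0 = secondForm 2 X z 0 1 := by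
    rw [secondForm, secondForm, pd_pd_comm hX]
  have h0 := form_secondForm (X := X) (z := z) hd.ne' 0 0 0 0
  have h1 := form_secondForm (X := X) (z := z) hd.ne' 0 0 0 1
  have h2 := form_secondForm (X := X) (z := z) hd.ne' 0 0 1 1
  have h3 := form_secondForm (X := X) (z := z) hd.ne' 0 1 0 1
  have h4 := form_secondForm (X := X) (z := z) hd.ne' 0 1 1 1
  have h5 := form_secondForm (X := X) (z := z) hd.ne' 1 1 1 1
  have c := fun x y : Fin 6 → ℝ => psForm_comm (s := 2) x y
  simp only [willmoreDensity, det_firstForm, Fin.sum_univ_two, tracelessForm, meanCurvature, hc,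
    psForm_sub_left, psForm_sub_right, psForm_add_left, psForm_add_right, psForm_smul_left,
    psForm_smul_right, h0, h1, h2, h3, h4, h5, c (secondForm 2 X z 0 1) (secondForm 2 X z 0 0),
    c (secondForm 2 X z 1 1) (secondForm 2 X z 0 0), c (secondForm 2 X z 1 1) (secondForm 2 X z 0 1),
    inv_firstForm, jetDensity, densNum, Matrix.of_apply, Matrix.cons_val_zero, Matrix.cons_val_one]
  simp only [firstForm, Matrix.of_apply, c (pd 1 X z) (pd 0 X z)]
  have hdd : gramDet (pd 0 X z) (pd 1 X z) = psForm 2 (pd 0 X z) (pd 0 X z) *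
    psForm 2 (pd 1 X z) (pd 1 X z) - psForm 2 (pd 0 X z) (pd 1 X z) ^ 2 := rfl
  generalize bracket (pd 0 X z) (pd 1 X z) (pd 0 (pd 0 X) z) (pd 0 (pd 0 X) z) = b0
  generalize bracket (pd 0 X z) (pd 1 X z) (pd 0 (pd 0 X) z) (pd 0 (pd 1 X) z) = b1
  generalize bracket (pd 0 X z) (pd 1 X z) (pd 0 (pd 0 X) z) (pd 1 (pd 1 X) z) = b2
  generalize bracket (pd 0 X z) (pd 1 X z) (pd 0 (pd 1 X) z) (pd 0 (pd 1 X) z) = b3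
  generalize bracket (pd 0 X z) (pd 1 X z) (pd 0 (pd 1 X) z) (pd 1 (pd 1 X) z) = b4
  generalize bracket (pd 0 X z) (pd 1 X z) (pd 1 (pd 1 X) z) (pd 1 (pd 1 X) z) = b5
  generalize Real.sqrt (gramDet (pd 0 X z) (pd 1 X z)) = r at *
  generalize gramDet (pd 0 X z) (pd 1 X z) = d at *
  generalize psForm 2 (pd 0 X z) (pd 0 X z) = E at *
  generalize psForm 2 (pd 0 X z) (pd 1 X z) = F at *
  generalize psForm 2 (pd 1 X z) (pd 1 X z) = G at *
  have hd' := hd.ne'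
  field_simp
  subst hdd
  ring

end

/-! ### Independence of the lift -/

section

/-- The arguments are the derivatives of hX for a null lift X. Derivatives of h change the second
fundamental form only along X and by multiples of the metric, which the trace-free part ignores. The
exponent counts six factors from `bracket` and four from the coefficients. -/
theorem densNum_smul {X a b p q r : Fin 6 → ℝ} (h h1 h2 h11 h12 h22 : ℝ)
    (hX : psForm 2 X X = 0) (ha : psForm 2 X a = 0) (hb : psForm 2 X b = 0)
    (hp : psForm 2 X p = -psForm 2 a a) (hq : psForm 2 X q = -psForm 2 a b)
    (hr : psForm 2 X r = -psForm 2 b b) :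
    densNum (h • a + h1 • X) (h • b + h2 • X) (h • p + (2 * h1) • a + h11 • X)
      (h • q + h1 • b + h2 • a + h12 • X) (h • r + (2 * h2) • b + h22 • X) =
    h ^ 10 * densNum a b p q r := by
  have c := fun x y : Fin 6 → ℝ => psForm_comm (s := 2) x y
  simp only [densNum, bracket, gramDet, psForm_add_left, psForm_add_right, psForm_smul_left,
    psForm_smul_right, hX, ha, hb, hp, hq, hr, c a X, c b X, c p X, c q X, c r X, c b a, c a p,
    c a q, c a r, c b p, c b q, c b r, c q p, c r p, c r q]
  generalize psForm 2 a a = E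
  generalize psForm 2 a b = F
  generalize psForm 2 b b = G
  generalize psForm 2 p a = pa
  generalize psForm 2 p b = pb
  generalize psForm 2 q a = qa
  generalize psForm 2 q b = qb
  generalize psForm 2 r a = ra
  generalize psForm 2 r b = rb
  ring

theorem null_form_pd {X : ℂ → Fin 6 → ℝ} (hX : ContDiff ℝ ∞ X)
    (hn : ∀ z, psForm 2 (X z) (X z) = 0) (z : ℂ) (i : Fin 2) : psForm 2 (X z) (pd i X z) = 0 := by
  have hd := smooth_differentiableAt hX z
  have h : pd i (fun w => psForm 2 (X w) (X w)) z = 0 := by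
    simp only [hn, pd_const]
  rw [pd_psForm hd hd, psForm_comm (pd i X z)] at h
  linarith

theorem null_form_pdpd {X : ℂ → Fin 6 → ℝ} (hX : ContDiff ℝ ∞ X)
    (hn : ∀ z, psForm 2 (X z) (X z) = 0) (z : ℂ) (i j : Fin 2) :
    psForm 2 (X z) (pd i (pd j X) z) = -psForm 2 (pd i X z) (pd j X z) := by
  have h : pd i (fun w => psForm 2 (X w) (pd j X w)) z = 0 := by
    simp only [null_form_pd hX hn, pd_const]
  rw [pd_psForm (smooth_differentiableAt hX z) (smooth_differentiableAt (contDiff_pd hX j) z)] at h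
  linarith

theorem pd_pd_smul {X : ℂ → Fin 6 → ℝ} {f : ℂ → ℝ} (hX : ContDiff ℝ ∞ X) (hf : ContDiff ℝ ∞ f)
    (z : ℂ) (i j : Fin 2) :
    pd i (pd j fun w => f w • X w) z = f z • pd i (pd j X) z + pd j f z • pd i X z +
      pd i f z • pd j X z + pd i (pd j f) z • X z := by
  have e : pd j (fun w => f w • X w) = fun w => pd j f w • X w + f w • pd j X w :=
    funext fun w => by
      rw [pd_smul (smooth_differentiableAt hf w) (smooth_differentiableAt hX w)]
  have d1 := smooth_differentiableAt hX z
  have d2 := smooth_differentiableAt hf z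
  have d3 := smooth_differentiableAt (contDiff_pd hX j) z
  have d4 := smooth_differentiableAt (contDiff_pd hf j) z
  rw [e, pd_add (d4.fun_smul d1) (d2.fun_smul d3), pd_smul d4 d1, pd_smul d2 d3]
  module

/-- The Willmore density does not depend on the lift. -/
theorem willmoreDensity_smul {X : ℂ → Fin 6 → ℝ} {f : ℂ → ℝ} (hX : ContDiff ℝ ∞ X)
    (hf : ContDiff ℝ ∞ f) (hn : ∀ z, psForm 2 (X z) (X z) = 0) {z : ℂ} (hz : f z ≠ 0)
    (hd : 0 < gramDet (pd 0 X z) (pd 1 X z)) :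
    willmoreDensity (fun w => f w • X w) z = willmoreDensity X z := by
  have e : ∀ i, pd i (fun w => f w • X w) z = f z • pd i X z + pd i f z • X z := fun i => by
    rw [pd_smul (smooth_differentiableAt hf z) (smooth_differentiableAt hX z)]
    module
  have hg : gramDet (pd 0 (fun w => f w • X w) z) (pd 1 (fun w => f w • X w) z) =
      f z ^ 4 * gramDet (pd 0 X z) (pd 1 X z) := by
    simp only [gramDet, pd_smul_null (smooth_differentiableAt hX z) (smooth_differentiableAt hf z)
      (.of_forall hn)]
    ring
  have hd' : 0 < gramDet (pd 0 (fun w => f w • X w) z) (pd 1 (fun w => f w • X w) z) := by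
    rw [hg]; positivity
  have hn1 := null_form_pd hX hn z
  have hn2 := null_form_pdpd hX hn z
  rw [willmoreDensity_eq (X := fun w => f w • X w) (hf.smul hX).contDiffAt hd', willmoreDensity_eq hX.contDiffAt hd,
    jetDensity, jetDensity, hg, pd_pd_smul hX hf, pd_pd_smul hX hf, pd_pd_smul hX hf, e, e]
  rw [show f z • pd 0 (pd 0 X) z + pd 0 f z • pd 0 X z + pd 0 f z • pd 0 X z +
      pd 0 (pd 0 f) z • X z = f z • pd 0 (pd 0 X) z + (2 * pd 0 f z) • pd 0 X z +
      pd 0 (pd 0 f) z • X z by module,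
    show f z • pd 1 (pd 1 X) z + pd 1 f z • pd 1 X z + pd 1 f z • pd 1 X z +
      pd 1 (pd 1 f) z • X z = f z • pd 1 (pd 1 X) z + (2 * pd 1 f z) • pd 1 X z +
      pd 1 (pd 1 f) z • X z by module,
    show f z • pd 0 (pd 1 X) z + pd 1 f z • pd 0 X z + pd 0 f z • pd 1 X z +
      pd 0 (pd 1 f) z • X z = f z • pd 0 (pd 1 X) z + pd 0 f z • pd 1 X z + pd 1 f z • pd 0 X z +
      pd 0 (pd 1 f) z • X z by module,
    densNum_smul _ _ _ _ _ _ (hn z) (hn1 0) (hn1 1) (hn2 0 0) (hn2 0 1) (hn2 1 1)]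
  -- The root contributes f² and the denominator f¹², which balances the f¹⁰ of the numerator.
  have hs : Real.sqrt (f z ^ 4 * gramDet (pd 0 X z) (pd 1 X z)) =
      f z ^ 2 * Real.sqrt (gramDet (pd 0 X z) (pd 1 X z)) := by
    rw [show f z ^ 4 = (f z ^ 2) ^ 2 by ring, Real.sqrt_mul (by positivity),
      Real.sqrt_sq (by positivity)]
  rw [hs]
  field_simp

/-- The existence of X makes the chosen lift a genuine one; it differs from X by a smooth nowhere
zero factor. -/
theorem willmoreDensity_affineLift {y : OnePoint ℂ → Q41} {X : ℂ → Fin 6 → ℝ} (hX : IsLift 0 y X)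
    (hd : ∀ z, 0 < gramDet (pd 0 X z) (pd 1 X z)) (z : ℂ) :
    willmoreDensity (affineLift y) z = willmoreDensity X z := by
  have hA : IsLift 0 y (affineLift y) := Classical.epsilon_spec ⟨X, hX⟩
  obtain ⟨f, hf, h⟩ := exists_smooth_factor (A := affineLift y) (B := X) (s := Set.univ)
    (fun z _ => hA.1.contDiffAt) (fun z _ => hX.1.contDiffAt) (fun z _ => (hX.2 z).1)
    (fun z _ => (hX.2 z).exists_smul (hA.2 z))
  have hf' : ContDiff ℝ ∞ f := contDiff_iff_contDiffAt.2 fun z => hf z trivial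
  rw [show affineLift y = fun w => f w • X w from funext fun w => (h w trivial).2]
  exact willmoreDensity_smul hX.1 hf' (fun z => (hX.2 z).null) (h z trivial).1 (hd z)

theorem willmore_eq {y : OnePoint ℂ → Q41} {X : ℂ → Fin 6 → ℝ} (hX : IsLift 0 y X)
    (hd : ∀ z, 0 < gramDet (pd 0 X z) (pd 1 X z)) :
    willmore y = ∫ z, jetDensity (pd 0 X z) (pd 1 X z) (pd 0 (pd 0 X) z) (pd 0 (pd 1 X) z)
      (pd 1 (pd 1 X) z) :=
  MeasureTheory.integral_congr_ae (.of_forall fun z => by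
    simp only [willmoreDensity_affineLift hX hd, willmoreDensity_eq hX.1.contDiffAt (hd z)])

/-! ### The density of a canonical lift -/

theorem IsCanon.gramDet_eq {Y : ℂ → Fin 6 → ℝ} (hY : IsCanon Y) (z : ℂ) :
    gramDet (pd 0 Y z) (pd 1 Y z) = 1 := by
  simp [gramDet, hY.form_pd_pd]

/-- The metric is the identity and second derivatives are orthogonal to first ones, so each bracket
is a plain inner product. -/
theorem IsCanon.jetDensity_eq {Y : ℂ → Fin 6 → ℝ} (hY : IsCanon Y) (z : ℂ) :
    ((jetDensity (pd 0 Y z) (pd 1 Y z) (pd 0 (pd 0 Y) z) (pd 0 (pd 1 Y) z)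
      (pd 1 (pd 1 Y) z) : ℝ) : ℂ) =
      psForm 2 (wz (wz (cx Y)) z) (star (wz (wz (cx Y)) z)) := by
  have c := fun x y : Fin 6 → ℝ => psForm_comm (s := 2) x y
  rw [wz_wz_cx hY.smooth]
  simp only [jetDensity, densNum, hY.gramDet_eq, bracket, hY.form_pd_pd, hY.form_pdpd_pd, star_sub,
    star_smul, star_toC, psForm_sub_left, psForm_sub_right, psForm_smul_left, psForm_smul_right,
    psForm_toC, c (pd 1 (pd 1 Y) z) (pd 0 (pd 0 Y) z), c (pd 0 (pd 1 Y) z) (pd 0 (pd 0 Y) z),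
    c (pd 0 (pd 1 Y) z) (pd 1 (pd 1 Y) z)]
  simp
  ring_nf
  simp
  ring

theorem IsCanon.jetDensity_eq_hopf {Y : ℂ → Fin 6 → ℝ} (hY : IsCanon Y) (z : ℂ) :
    ((jetDensity (pd 0 Y z) (pd 1 Y z) (pd 0 (pd 0 Y) z) (pd 0 (pd 1 Y) z)
      (pd 1 (pd 1 Y) z) : ℝ) : ℂ) = psForm 2 (hopf Y z) (star (hopf Y z)) := by
  have sY : star (cx Y z) = cx Y z := star_toC _
  have h1 : psForm 2 (star (wz (wz (cx Y)) z)) (cx Y z) = 0 := by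
    rw [← sY, psForm_star, hY.wzwz_self, star_zero]
  rw [hY.jetDensity_eq, hopf_eq_wz]
  simp only [star_add, star_smul, sY, psForm_add_left, psForm_add_right, psForm_smul_left,
    psForm_smul_right, hY.wzwz_self, hY.c_self, psForm_comm (cx Y z) (star _), h1]
  ring

end

section

open MeasureTheory

/-! ### Smoothness and integrability of the Willmore density -/

section Smooth

variable {V : Type*} [NormedAddCommGroup V] [NormedSpace ℝ V] {a b p q r : V → Fin 6 → ℝ} {v : V}

theorem contDiffAt_gramDet (ha : ContDiffAt ℝ ∞ a v) (hb : ContDiffAt ℝ ∞ b v) :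
    ContDiffAt ℝ ∞ (fun x => gramDet (a x) (b x)) v :=
  ((contDiffAt_psForm ha ha).mul (contDiffAt_psForm hb hb)).sub ((contDiffAt_psForm ha hb).pow 2)

theorem contDiffAt_bracket (ha : ContDiffAt ℝ ∞ a v) (hb : ContDiffAt ℝ ∞ b v)
    (hp : ContDiffAt ℝ ∞ p v) (hq : ContDiffAt ℝ ∞ q v) :
    ContDiffAt ℝ ∞ (fun x => bracket (a x) (b x) (p x) (q x)) v :=
  ((contDiffAt_gramDet ha hb).mul (contDiffAt_psForm hp hq)).sub
    ((((contDiffAt_psForm hb hb).mul ((contDiffAt_psForm hp ha).mul (contDiffAt_psForm hq ha))).sub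
      ((contDiffAt_psForm ha hb).mul (((contDiffAt_psForm hp ha).mul (contDiffAt_psForm hq hb)).add
        ((contDiffAt_psForm hp hb).mul (contDiffAt_psForm hq ha))))).add
      ((contDiffAt_psForm ha ha).mul ((contDiffAt_psForm hp hb).mul (contDiffAt_psForm hq hb))))

theorem contDiffAt_jetDensity (ha : ContDiffAt ℝ ∞ a v) (hb : ContDiffAt ℝ ∞ b v)
    (hp : ContDiffAt ℝ ∞ p v) (hq : ContDiffAt ℝ ∞ q v) (hr : ContDiffAt ℝ ∞ r v)
    (hd : 0 < gramDet (a v) (b v)) :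
    ContDiffAt ℝ ∞ (fun x => jetDensity (a x) (b x) (p x) (q x) (r x)) v := by
  have hE : ContDiffAt ℝ ∞ (fun x => psForm 2 (a x) (a x)) v := contDiffAt_psForm ha ha
  have hF : ContDiffAt ℝ ∞ (fun x => psForm 2 (a x) (b x)) v := contDiffAt_psForm ha hb
  have hG : ContDiffAt ℝ ∞ (fun x => psForm 2 (b x) (b x)) v := contDiffAt_psForm hb hb
  have hD := contDiffAt_gramDet ha hb
  have b1 := contDiffAt_bracket ha hb hp hp
  have b2 := contDiffAt_bracket ha hb hq hq
  have b3 := contDiffAt_bracket ha hb hr hr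
  have b4 := contDiffAt_bracket ha hb hp hq
  have b5 := contDiffAt_bracket ha hb hp hr
  have b6 := contDiffAt_bracket ha hb hq hr
  have hN : ContDiffAt ℝ ∞ (fun x => densNum (a x) (b x) (p x) (q x) (r x)) v :=
    (contDiffAt_const.mul ((((((((hG.pow 2).mul b1).add ((contDiffAt_const.mul (hF.pow 2)).mul b2)).add
      ((hE.pow 2).mul b3)).sub (((contDiffAt_const.mul hF).mul hG).mul b4)).add
      (((contDiffAt_const.mul hE).mul hG).mul b5)).sub
      (((contDiffAt_const.mul hE).mul hF).mul b6)))).sub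
      ((contDiffAt_const.mul hD).mul (b5.sub b2))
  exact (hN.mul (hD.sqrt hd.ne')).div (contDiffAt_const.mul (hD.pow 3)) (by positivity)

end Smooth

/-- The factor |z|⁻⁴ is the area Jacobian of 1/z, so g dA extends continuously over infinity. -/
theorem integrable_of_tail {g ψ : ℂ → ℝ} (hg : Continuous g) (hψ : Continuous ψ)
    (h : ∀ z ≠ 0, g z = ‖z‖⁻¹ ^ 4 * ψ z⁻¹) : Integrable g := by
  obtain ⟨M, hM⟩ := (isCompact_closedBall (0 : ℂ) 1).exists_bound_of_continuousOn hψ.continuousOn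
  obtain ⟨M', hM'⟩ := (isCompact_closedBall (0 : ℂ) 1).exists_bound_of_continuousOn hg.continuousOn
  have hM0 : 0 ≤ M := (norm_nonneg _).trans (hM 0 (by simp))
  have hM0' : 0 ≤ M' := (norm_nonneg _).trans (hM' 0 (by simp))
  -- The constant 16 is 2⁴, from 1 + |z| ≤ 2 inside the unit disc and 1 + |z| ≤ 2|z| outside it.
  have hi : Integrable fun z : ℂ => 16 * (M + M') * (1 + ‖z‖) ^ (-(4 : ℝ)) :=
    (integrable_one_add_norm (by rw [Complex.finrank_real_complex]; norm_num)).const_mul _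
  refine hi.mono' hg.aestronglyMeasurable (.of_forall fun z => ?_)
  have e : (1 + ‖z‖) ^ (-(4 : ℝ)) = ((1 + ‖z‖) ^ 4)⁻¹ := by
    rw [Real.rpow_neg (by positivity), show (4 : ℝ) = ((4 : ℕ) : ℝ) by norm_num, Real.rpow_natCast]
  rw [e, ← div_eq_mul_inv, le_div_iff₀ (by positivity)]
  have hz := norm_nonneg z
  by_cases hz1 : ‖z‖ ≤ 1
  · have h1 := hM' z (by simpa using hz1)
    have h2 : (1 + ‖z‖) ^ 4 ≤ (1 + 1) ^ 4 := by gcongr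
    calc ‖g z‖ * (1 + ‖z‖) ^ 4 ≤ M' * (1 + 1) ^ 4 := by gcongr
      _ ≤ _ := by linarith
  · have hz1 : 1 < ‖z‖ := not_le.1 hz1
    have hz0 : z ≠ 0 := by rintro rfl; simp at hz1; linarith
    have h1 := hM z⁻¹ (by simpa using inv_le_one_of_one_le₀ hz1.le)
    have h2 : (1 + ‖z‖) ^ 4 ≤ (‖z‖ + ‖z‖) ^ 4 := by gcongr
    rw [h z hz0, norm_mul, norm_pow, norm_inv, norm_norm]
    calc ‖z‖⁻¹ ^ 4 * ‖ψ z⁻¹‖ * (1 + ‖z‖) ^ 4 ≤ ‖z‖⁻¹ ^ 4 * M * (‖z‖ + ‖z‖) ^ 4 := by gcongr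
      _ = 16 * M := by field_simp; ring
      _ ≤ _ := by linarith

/-- The Willmore density of a canonical lift. -/
def canonDensity (Y : ℂ → Fin 6 → ℝ) (z : ℂ) : ℝ :=
  jetDensity (pd 0 Y z) (pd 1 Y z) (pd 0 (pd 0 Y) z) (pd 0 (pd 1 Y) z) (pd 1 (pd 1 Y) z)

theorem IsCanon.canonDensity_smooth {Y : ℂ → Fin 6 → ℝ} (hY : IsCanon Y) :
    ContDiff ℝ ∞ (canonDensity Y) :=
  contDiff_iff_contDiffAt.2 fun z => contDiffAt_jetDensity (hY.pd_smooth 0).contDiffAt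
    (hY.pd_smooth 1).contDiffAt (hY.pdpd_smooth 0 0).contDiffAt (hY.pdpd_smooth 0 1).contDiffAt
    (hY.pdpd_smooth 1 1).contDiffAt (by rw [hY.gramDet_eq]; norm_num)

theorem IsTransition.integrable_canonDensity {Y Yt : ℂ → Fin 6 → ℝ} (h : IsTransition Y Yt) :
    Integrable (canonDensity Y) := by
  refine integrable_of_tail h.canon.canonDensity_smooth.continuous
    h.canon'.canonDensity_smooth.continuous fun z hz => ?_
  have h1 := h.canon.jetDensity_eq z
  have h2 := h.canon'.jetDensity_eq z⁻¹
  rw [h.wzwz_eq hz, star_smul, psForm_smul_left, psForm_smul_right, ← h2, ← mul_assoc] at h1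
  have h3 : star z * z⁻¹ ^ 3 * star (star z * z⁻¹ ^ 3) = ((‖z‖⁻¹ ^ 4 : ℝ) : ℂ) := by
    rw [Complex.star_def, Complex.mul_conj, Complex.normSq_eq_norm_sq, norm_mul, norm_pow,
      RCLike.norm_conj, norm_inv]
    congr 1
    have hn : ‖z‖ ≠ 0 := norm_ne_zero_iff.2 hz
    field_simp
  rw [h3] at h1
  exact_mod_cast h1

/-! ### Normal variations -/

/-- A compactly supported direction in which the lift `Y` may be moved along the light cone. -/
structure IsDirection (Y W : ℂ → Fin 6 → ℝ) : Prop where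
  smooth : ContDiff ℝ ∞ W
  compact : HasCompactSupport W
  form_self : ∀ z, psForm 2 (Y z) (W z) = 0
  null : ∀ z, psForm 2 (W z) (W z) = 0

theorem hasCompactSupport_psForm {n : ℕ} (s : ℕ) (A : ℂ → Fin n → ℝ) {B : ℂ → Fin n → ℝ}
    (hB : HasCompactSupport B) : HasCompactSupport fun z => psForm s (A z) (B z) :=
  hB.mono fun z hz => by
    rw [Function.mem_support] at hz ⊢
    rintro h
    exact hz (by rw [h, psForm_zero_right])

theorem posDef_firstForm_of_near {X : ℂ → Fin 6 → ℝ} {z : ℂ}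
    (h : ∀ i j, |psForm 2 (pd i X z) (pd j X z) - (1 : Matrix (Fin 2) (Fin 2) ℝ) i j| ≤ 1 / 4) :
    (firstForm 2 X z).PosDef := by
  have h00 := abs_le.1 (h 0 0)
  have h01 := abs_le.1 (h 0 1)
  have h11 := abs_le.1 (h 1 1)
  simp only [Matrix.one_apply_eq, Matrix.one_apply_ne (show (0 : Fin 2) ≠ 1 by decide)] at h00 h01 h11
  refine Matrix.PosDef.of_dotProduct_mulVec_pos ?_ fun x hx => ?_
  · ext i j
    simp [firstForm, psForm_comm (pd i X z)]
  · have hx' := sum_sq_pos hx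
    rw [Fin.sum_univ_two] at hx'
    simp only [firstForm, dotProduct, Matrix.mulVec, Fin.sum_univ_two, Matrix.of_apply,
      Pi.star_apply, star_trivial, psForm_comm (pd 1 X z) (pd 0 X z)]
    nlinarith [sq_nonneg (x 0 + x 1), sq_nonneg (x 0 - x 1), mul_nonneg (sq_nonneg (x 0)) (by linarith : (0:ℝ) ≤ psForm 2 (pd 0 X z) (pd 0 X z) - 3 / 4),
      mul_nonneg (sq_nonneg (x 1)) (by linarith : (0:ℝ) ≤ psForm 2 (pd 1 X z) (pd 1 X z) - 3 / 4),
      mul_nonneg (sq_nonneg (x 0 + x 1)) (by linarith : (0:ℝ) ≤ psForm 2 (pd 0 X z) (pd 1 X z) + 1 / 4),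
      mul_nonneg (sq_nonneg (x 0 - x 1)) (by linarith : (0:ℝ) ≤ 1 / 4 - psForm 2 (pd 0 X z) (pd 1 X z))]

section Variation

variable {Y W : ℂ → Fin 6 → ℝ}

theorem pd_add_smul (hY : ContDiff ℝ ∞ Y) (hW : ContDiff ℝ ∞ W) (t : ℝ) (i : Fin 2) :
    pd i (fun w => Y w + t • W w) = fun w => pd i Y w + t • pd i W w :=
  funext fun z => by
    have dW := smooth_differentiableAt hW z
    rw [pd_add (smooth_differentiableAt hY z) (dW.fun_const_smul t),
      pd_smul (f := fun _ => t) (differentiableAt_const t) dW, pd_const, zero_smul, zero_add]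

/-- The coefficients of the metric of Y + tW differ from δ_ij by t times quantities bounded by
compactness of the support. -/
theorem IsDirection.exists_posDef (h : IsDirection Y W) (hY : IsCanon Y) :
    ∃ ε > 0, ∀ t : ℝ, |t| < ε → ∀ z, (firstForm 2 (fun w => Y w + t • W w) z).PosDef := by
  have hb1 : ∀ i j, ∃ C, ∀ z, |psForm 2 (pd i Y z) (pd j W z)| ≤ C := fun i j =>
    (hasCompactSupport_psForm 2 _ (hasCompactSupport_pd h.compact j)).exists_bound_of_continuous
      (contDiff_psForm (hY.pd_smooth i) (contDiff_pd h.smooth j)).continuous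
  have hb2 : ∀ i j, ∃ C, ∀ z, |psForm 2 (pd i W z) (pd j W z)| ≤ C := fun i j =>
    (hasCompactSupport_psForm 2 _ (hasCompactSupport_pd h.compact j)).exists_bound_of_continuous
      (contDiff_psForm (contDiff_pd h.smooth i) (contDiff_pd h.smooth j)).continuous
  choose C1 hC1 using hb1
  choose C2 hC2 using hb2
  set M := ∑ i, ∑ j, (|C1 i j| + |C2 i j|) with hM
  have hle : ∀ i j, |C1 i j| + |C2 i j| ≤ M := fun i j =>
    (Finset.single_le_sum (f := fun j => |C1 i j| + |C2 i j|) (fun _ _ => by positivity)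
      (Finset.mem_univ j)).trans (Finset.single_le_sum (f := fun i => ∑ j, (|C1 i j| + |C2 i j|))
        (fun _ _ => Finset.sum_nonneg fun _ _ => by positivity) (Finset.mem_univ i))
  have hM0 : 0 ≤ M := (by positivity : (0:ℝ) ≤ |C1 0 0| + |C2 0 0|).trans (hle 0 0)
  -- Each entry changes by at most |t| · 3M when |t| ≤ 1, and 12 = 3 · 4 brings this below 1/4.
  refine ⟨min 1 (1 / (12 * (M + 1))), by positivity, fun t ht z => posDef_firstForm_of_near fun i j => ?_⟩
  have ht1 : |t| ≤ 1 := (ht.trans_le (min_le_left _ _)).le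
  have ht2 : |t| * (12 * (M + 1)) ≤ 1 := by
    have := (ht.trans_le (min_le_right _ _)).le
    rwa [le_div_iff₀ (by positivity)] at this
  rw [pd_add_smul hY.smooth h.smooth, pd_add_smul hY.smooth h.smooth]
  simp only [psForm_add_left, psForm_add_right, psForm_smul_left, psForm_smul_right, hY.form_pd_pd]
  have e1 := (hC1 i j z).trans (le_abs_self _)
  have e2 := (hC1 j i z).trans (le_abs_self _)
  have e3 := (hC2 i j z).trans (le_abs_self _)
  rw [psForm_comm] at e2
  have f1 := hle i j
  have f2 := hle j i
  have g1 : |psForm 2 (pd i Y z) (pd j W z)| ≤ M := by linarith [abs_nonneg (C2 i j)]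
  have g2 : |psForm 2 (pd i W z) (pd j Y z)| ≤ M := by linarith [abs_nonneg (C2 j i)]
  have g3 : |psForm 2 (pd i W z) (pd j W z)| ≤ M := by linarith [abs_nonneg (C1 i j)]
  have k : ∀ a b c : ℝ, |a| ≤ M → |b| ≤ M → |c| ≤ M → |t * (a + b + t * c)| ≤ 1 / 4 := by
    intro a b c ha hb hc
    rw [abs_mul]
    have : |a + b + t * c| ≤ 3 * M := by
      calc |a + b + t * c| ≤ |a| + |b| + |t| * |c| := by
            rw [← abs_mul]; exact (abs_add_le _ _).trans (add_le_add_left (abs_add_le _ _) _)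
        _ ≤ M + M + 1 * M := by gcongr
        _ = 3 * M := by ring
    calc |t| * |a + b + t * c| ≤ |t| * (3 * M) := by gcongr
      _ ≤ 1 / 4 := by nlinarith [abs_nonneg t]
  convert k _ _ _ g2 g1 g3 using 2
  rw [Matrix.one_apply]
  ring

theorem pd_eq_zero_of_notMem_tsupport {z : ℂ} (hz : z ∉ tsupport W) (i : Fin 2) :
    pd i W z = 0 := by
  have : pd i W z = pd i (fun _ => (0 : Fin 6 → ℝ)) z := pd_congr
    (notMem_tsupport_iff_eventuallyEq.1 hz) i
  rw [this, pd_const]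

theorem pdpd_eq_zero_of_notMem_tsupport {z : ℂ} (hz : z ∉ tsupport W)
    (i j : Fin 2) : pd i (pd j W) z = 0 := by
  have : pd i (pd j W) z = pd i (fun _ => (0 : Fin 6 → ℝ)) z := pd_congr (by
    filter_upwards [(isClosed_tsupport W).isOpen_compl.mem_nhds hz] with w hw
    exact pd_eq_zero_of_notMem_tsupport hw j) i
  rw [this, pd_const]

/-- The Willmore density of the lift `Y + t W`. -/
def varDensity (Y W : ℂ → Fin 6 → ℝ) (x : ℝ × ℂ) : ℝ :=
  jetDensity (pd 0 Y x.2 + x.1 • pd 0 W x.2) (pd 1 Y x.2 + x.1 • pd 1 W x.2)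
    (pd 0 (pd 0 Y) x.2 + x.1 • pd 0 (pd 0 W) x.2) (pd 0 (pd 1 Y) x.2 + x.1 • pd 0 (pd 1 W) x.2)
    (pd 1 (pd 1 Y) x.2 + x.1 • pd 1 (pd 1 W) x.2)

theorem contDiff_add_smul {A B : ℂ → Fin 6 → ℝ} (hA : ContDiff ℝ ∞ A) (hB : ContDiff ℝ ∞ B) :
    ContDiff ℝ ∞ fun x : ℝ × ℂ => A x.2 + x.1 • B x.2 :=
  (hA.comp contDiff_snd).add (contDiff_fst.smul (hB.comp contDiff_snd))

theorem IsDirection.contDiffAt_varDensity (h : IsDirection Y W) (hY : IsCanon Y) {x : ℝ × ℂ}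
    (hd : 0 < gramDet (pd 0 Y x.2 + x.1 • pd 0 W x.2) (pd 1 Y x.2 + x.1 • pd 1 W x.2)) :
    ContDiffAt ℝ ∞ (varDensity Y W) x := by
  have k : ∀ i, ContDiff ℝ ∞ fun x : ℝ × ℂ => pd i Y x.2 + x.1 • pd i W x.2 := fun i =>
    contDiff_add_smul (hY.pd_smooth i) (contDiff_pd h.smooth i)
  have k2 : ∀ i j, ContDiff ℝ ∞ fun x : ℝ × ℂ => pd i (pd j Y) x.2 + x.1 • pd i (pd j W) x.2 :=
    fun i j => contDiff_add_smul (hY.pdpd_smooth i j) (contDiff_pd (contDiff_pd h.smooth j) i)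
  exact contDiffAt_jetDensity (k 0).contDiffAt (k 1).contDiffAt (k2 0 0).contDiffAt
    (k2 0 1).contDiffAt (k2 1 1).contDiffAt hd

/-- Differentiation under the integral sign for the Willmore energy of `Y + t W`. -/
theorem IsDirection.hasDerivAt_integral (h : IsDirection Y W) (hY : IsCanon Y)
    (hi : Integrable (canonDensity Y)) {ε : ℝ} (hε : 0 < ε)
    (hd : ∀ t : ℝ, |t| < ε → ∀ z, 0 < gramDet (pd 0 Y z + t • pd 0 W z) (pd 1 Y z + t • pd 1 W z)) :
    HasDerivAt (fun t => ∫ z, varDensity Y W (t, z))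
      (∫ z, fderiv ℝ (varDensity Y W) (0, z) (1, 0)) 0 := by
  set S : Set (ℝ × ℂ) := {x | |x.1| < ε} with hS
  have hSo : IsOpen S := isOpen_lt (by fun_prop) continuous_const
  have hsm : ∀ x ∈ S, ContDiffAt ℝ ∞ (varDensity Y W) x := fun x hx =>
    h.contDiffAt_varDensity hY (hd x.1 hx x.2)
  have hcf : ContinuousOn (fun x => fderiv ℝ (varDensity Y W) x (1, 0)) S :=
    (ContDiffOn.continuousOn_fderiv_of_isOpen (n := ∞)
      (fun x hx => (hsm x hx).contDiffWithinAt) hSo (by simp)).clm_apply continuousOn_const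
  have hder : ∀ t z, |t| < ε → HasDerivAt (fun s => varDensity Y W (s, z))
      (fderiv ℝ (varDensity Y W) (t, z) (1, 0)) t := fun t z ht => by
    have h1 := (ContDiffAt.differentiableAt (n := ∞) (hsm (t, z) ht) (by simp)).hasFDerivAt
    have h2 : HasDerivAt (fun s : ℝ => (s, z)) ((1 : ℝ), (0 : ℂ)) t :=
      (hasDerivAt_id t).prodMk (hasDerivAt_const t z)
    exact h1.comp_hasDerivAt t h2
  -- Off the support the density does not depend on t, so the dominating function is a constant on
  -- the compact support. The density itself is integrable by its decay, not by compact support.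
  have hout : ∀ t z, |t| < ε → z ∉ tsupport W → fderiv ℝ (varDensity Y W) (t, z) (1, 0) = 0 := by
    intro t z ht hz
    refine (hder t z ht).unique ?_
    have : (fun s => varDensity Y W (s, z)) = fun _ => canonDensity Y z := funext fun s => by
      simp only [varDensity, pd_eq_zero_of_notMem_tsupport hz, pdpd_eq_zero_of_notMem_tsupport hz, smul_zero, add_zero, canonDensity]
    rw [this]
    exact hasDerivAt_const t _
  have hKc : IsCompact (Set.Icc (-(ε / 2)) (ε / 2) ×ˢ tsupport W) := isCompact_Icc.prod h.compact
  have hsub : Set.Icc (-(ε / 2)) (ε / 2) ×ˢ tsupport W ⊆ S := fun x hx => by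
    have := abs_le.2 hx.1
    simp only [hS, Set.mem_ofPred_eq]
    linarith
  obtain ⟨C, hC⟩ := hKc.exists_bound_of_continuousOn (hcf.mono hsub)
  have hcont : ∀ t, |t| < ε → Continuous fun z => varDensity Y W (t, z) := fun t ht =>
    continuous_iff_continuousAt.2 fun z =>
      ContinuousAt.comp (f := fun z : ℂ => (t, z)) (hsm (t, z) ht).continuousAt (by fun_prop)
  have hs : Set.Ioo (-(ε / 2)) (ε / 2) ∈ nhds (0 : ℝ) := Ioo_mem_nhds (by linarith) (by linarith)
  have habs : ∀ t ∈ Set.Ioo (-(ε / 2)) (ε / 2), |t| < ε := fun t ht => by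
    have := abs_lt.2 ht; linarith
  refine (hasDerivAt_integral_of_dominated_loc_of_deriv_le (μ := volume)
    (F := fun t z => varDensity Y W (t, z))
    (F' := fun t z => fderiv ℝ (varDensity Y W) (t, z) (1, 0))
    (bound := (tsupport W).indicator fun _ => C) hs ?_ ?_ ?_ ?_ ?_ ?_).2
  · filter_upwards [hs] with t ht using (hcont t (habs t ht)).aestronglyMeasurable
  · refine hi.congr (.of_forall fun z => ?_)
    simp [varDensity, canonDensity]
  · exact (continuous_iff_continuousAt.2 fun z => ContinuousAt.comp (f := fun z : ℂ => ((0 : ℝ), z))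
      (hcf.continuousAt (hSo.mem_nhds (by simpa [hS] using hε)))
      (by fun_prop)).aestronglyMeasurable
  · refine .of_forall fun z t ht => ?_
    by_cases hz : z ∈ tsupport W
    · rw [Set.indicator_of_mem hz]
      exact hC (t, z) ⟨⟨ht.1.le, ht.2.le⟩, hz⟩
    · rw [Set.indicator_of_notMem hz, hout t z (habs t ht) hz, norm_zero]
  · exact (integrable_indicator_iff (isClosed_tsupport W).measurableSet).2
      (integrableOn_const h.compact.measure_lt_top.ne)
  · exact .of_forall fun z t ht => hder t z (habs t ht)

end Variation

end

section

open MeasureTheory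

/-! ### The first variation of the Willmore energy -/

theorem hasDerivAt_form (a a' b b' : Fin 6 → ℝ) :
    HasDerivAt (fun t : ℝ => psForm 2 (a + t • a') (b + t • b')) (psForm 2 a' b + psForm 2 a b') 0 := by
  have e : (fun t : ℝ => psForm 2 (a + t • a') (b + t • b')) = fun t =>
      psForm 2 a b + t * (psForm 2 a' b + psForm 2 a b') + t ^ 2 * psForm 2 a' b' := by
    ext t
    simp only [psForm_add_left, psForm_add_right, psForm_smul_left, psForm_smul_right]
    ring
  rw [e]
  have h := (((hasDerivAt_id (0 : ℝ)).mul_const (psForm 2 a' b + psForm 2 a b')).const_add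
    (psForm 2 a b)).add (((hasDerivAt_id (0 : ℝ)).pow 2).mul_const (psForm 2 a' b'))
  refine h.congr_deriv ?_
  simp

/-- At an orthonormal pair the derivative of EG - F² is the trace of the variation of the metric.
For normal variations this trace is zero, so the area density drops out to first order. -/
theorem hasDerivAt_gramDet {a b : Fin 6 → ℝ} (a' b' : Fin 6 → ℝ) (haa : psForm 2 a a = 1)
    (hbb : psForm 2 b b = 1) (hab : psForm 2 a b = 0) (htr : psForm 2 a a' + psForm 2 b b' = 0) :
    HasDerivAt (fun t : ℝ => gramDet (a + t • a') (b + t • b')) 0 0 := by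
  refine (((hasDerivAt_form a a' a a').mul (hasDerivAt_form b b' b b')).sub
    ((hasDerivAt_form a a' b b').pow 2)).congr_deriv ?_
  simp only [zero_smul, add_zero, haa, hbb, hab, psForm_comm a' a, psForm_comm b' b]
  push_cast
  linear_combination 2 * htr

/-- The projection terms are quadratic in pairings that vanish at t = 0, so they do not affect the
derivative. -/
theorem hasDerivAt_bracket {a b p q : Fin 6 → ℝ} (a' b' p' q' : Fin 6 → ℝ) (haa : psForm 2 a a = 1)
    (hbb : psForm 2 b b = 1) (hab : psForm 2 a b = 0) (htr : psForm 2 a a' + psForm 2 b b' = 0)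
    (hpa : psForm 2 p a = 0) (hpb : psForm 2 p b = 0) (hqa : psForm 2 q a = 0)
    (hqb : psForm 2 q b = 0) :
    HasDerivAt (fun t : ℝ => bracket (a + t • a') (b + t • b') (p + t • p') (q + t • q'))
      (psForm 2 p' q + psForm 2 p q') 0 := by
  have fp := hasDerivAt_form p p' a a'
  have fq := hasDerivAt_form q q' a a'
  have gp := hasDerivAt_form p p' b b'
  have gq := hasDerivAt_form q q' b b'
  refine (((hasDerivAt_gramDet a' b' haa hbb hab htr).mul (hasDerivAt_form p p' q q')).sub
    ((((hasDerivAt_form b b' b b').mul (fp.mul fq)).sub ((hasDerivAt_form a a' b b').mul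
      ((fp.mul gq).add (gp.mul fq)))).add ((hasDerivAt_form a a' a a').mul (gp.mul gq)))).congr_deriv ?_
  simp only [zero_smul, add_zero, haa, hbb, hab, hpa, hpb, hqa, hqb, gramDet]
  simp [hpa, hpb, hqa, hqb]

theorem hasDerivAt_jetDensity {a b p q r : Fin 6 → ℝ} (a' b' p' q' r' : Fin 6 → ℝ)
    (haa : psForm 2 a a = 1)
    (hbb : psForm 2 b b = 1) (hab : psForm 2 a b = 0) (htr : psForm 2 a a' + psForm 2 b b' = 0)
    (hpa : psForm 2 p a = 0) (hpb : psForm 2 p b = 0) (hqa : psForm 2 q a = 0)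
    (hqb : psForm 2 q b = 0) (hra : psForm 2 r a = 0) (hrb : psForm 2 r b = 0) :
    HasDerivAt (fun t : ℝ => jetDensity (a + t • a') (b + t • b') (p + t • p') (q + t • q')
      (r + t • r')) (1 / 8 * (psForm 2 (p + r) (p' + r') -
        2 * psForm 2 a a' * psForm 2 (p + r) (p - r) -
        2 * (psForm 2 a' b + psForm 2 a b') * psForm 2 (p + r) q - 2 * psForm 2 p r' -
        2 * psForm 2 p' r + 4 * psForm 2 q q')) 0 := by
  have hE := hasDerivAt_form a a' a a'
  have hF := hasDerivAt_form a a' b b'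
  have hG := hasDerivAt_form b b' b b'
  have hD := hasDerivAt_gramDet a' b' haa hbb hab htr
  have b1 := hasDerivAt_bracket a' b' p' p' haa hbb hab htr hpa hpb hpa hpb
  have b2 := hasDerivAt_bracket a' b' q' q' haa hbb hab htr hqa hqb hqa hqb
  have b3 := hasDerivAt_bracket a' b' r' r' haa hbb hab htr hra hrb hra hrb
  have b4 := hasDerivAt_bracket a' b' p' q' haa hbb hab htr hpa hpb hqa hqb
  have b5 := hasDerivAt_bracket a' b' p' r' haa hbb hab htr hpa hpb hra hrb
  have b6 := hasDerivAt_bracket a' b' q' r' haa hbb hab htr hqa hqb hra hrb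
  have hN : HasDerivAt (fun t : ℝ => densNum (a + t • a') (b + t • b') (p + t • p') (q + t • q')
      (r + t • r')) _ 0 :=
    (((((((((hG.pow 2).mul b1).add (((hF.pow 2).const_mul 4).mul b2)).add
      ((hE.pow 2).mul b3)).sub (((hF.const_mul 4).mul hG).mul b4)).add
      (((hE.const_mul 2).mul hG).mul b5)).sub
      (((hE.const_mul 4).mul hF).mul b6))).const_mul (1 / 2)).sub
      ((hD.const_mul 2).mul (b5.sub b2))
  have hd0 : gramDet a b = 1 := by simp [gramDet, haa, hbb, hab]
  have hd0' : gramDet (a + (0 : ℝ) • a') (b + (0 : ℝ) • b') = 1 := by simpa using hd0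
  have hq : HasDerivAt (fun t : ℝ => jetDensity (a + t • a') (b + t • b') (p + t • p') (q + t • q')
      (r + t • r')) _ 0 :=
    (hN.mul (hD.sqrt (by rw [hd0']; norm_num))).div ((hD.pow 3).const_mul 8)
      (by rw [hd0']; norm_num)
  refine hq.congr_deriv ?_
  have hbr : ∀ x y : Fin 6 → ℝ, psForm 2 x a = 0 → psForm 2 x b = 0 → psForm 2 y a = 0 →
      psForm 2 y b = 0 → bracket a b x y = psForm 2 x y := fun x y h1 h2 h3 h4 => by
    simp [bracket, hd0, h1, h2, h3, h4]
  simp only [Pi.mul_apply, Pi.pow_apply, Pi.add_apply, Pi.sub_apply, zero_smul, add_zero, hd0, haa,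
    hbb, hab, hbr p p hpa hpb hpa hpb, hbr q q hqa hqb hqa hqb, hbr r r hra hrb hra hrb,
    hbr p q hpa hpb hqa hqb, hbr p r hpa hpb hra hrb, hbr q r hqa hqb hra hrb, psForm_add_left,
    psForm_add_right, psForm_sub_right, psForm_comm a' a, psForm_comm b' b, psForm_comm p' p,
    psForm_comm q' q, psForm_comm r' r, psForm_comm r p, psForm_comm r q, Real.sqrt_one,
    psForm_zero_left, psForm_zero_right]
  rw [psForm_comm r p', show psForm 2 b b' = -psForm 2 a a' by linarith]
  norm_num
  ring

section Variation

variable {Y W : ℂ → Fin 6 → ℝ}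

/-- A direction of variation that is normal to the central spheres. -/
structure IsNormalDirection (Y W : ℂ → Fin 6 → ℝ) : Prop extends IsDirection Y W where
  form_pd : ∀ z i, psForm 2 (W z) (pd i Y z) = 0
  form_lap : ∀ z, psForm 2 (W z) (lap Y z) = 0

/-- Differentiate the orthogonality of W and Y_i. Summed over i = j the right side is -⟨ΔY,W⟩ = 0,
so the variation of the metric is trace-free. -/
theorem IsNormalDirection.form_pd_pd (h : IsNormalDirection Y W) (hY : IsCanon Y) (z : ℂ)
    (i j : Fin 2) : psForm 2 (pd i Y z) (pd j W z) = -psForm 2 (pd j (pd i Y) z) (W z) := by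
  have e : pd j (fun w => psForm 2 (W w) (pd i Y w)) z = 0 := by
    simp only [h.form_pd, pd_const]
  rw [pd_psForm (smooth_differentiableAt h.smooth z) (smooth_differentiableAt (hY.pd_smooth i) z),
    psForm_comm, psForm_comm (W z)] at e
  linarith

/-- The Euler–Lagrange expression paired with the vector `w`. -/
def elForm (Y : ℂ → Fin 6 → ℝ) (z : ℂ) (w : Fin 6 → ℝ) : ℝ :=
  psForm 2 (lap (lap Y) z) w +
    2 * psForm 2 (pd 0 (pd 0 Y) z) w * psForm 2 (lap Y z) (pd 0 (pd 0 Y) z - pd 1 (pd 1 Y) z) +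
    4 * psForm 2 (pd 0 (pd 1 Y) z) w * psForm 2 (lap Y z) (pd 0 (pd 1 Y) z)

/-- The defect of integrating by parts twice. -/
def partsDefect (W A : ℂ → Fin 6 → ℝ) (i j : Fin 2) (z : ℂ) : ℝ :=
  psForm 2 (A z) (pd i (pd j W) z) - psForm 2 (pd j (pd i A) z) (W z)

/-- A sum of derivatives of compactly supported functions, which therefore integrates to zero. -/
theorem partsDefect_eq {A : ℂ → Fin 6 → ℝ} (hA : ContDiff ℝ ∞ A) (hW : ContDiff ℝ ∞ W)
    (i j : Fin 2) (z : ℂ) : partsDefect W A i j z =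
      pd i (fun w => psForm 2 (A w) (pd j W w)) z - pd j (fun w => psForm 2 (pd i A w) (W w)) z := by
  rw [pd_psForm (smooth_differentiableAt hA z) (smooth_differentiableAt (contDiff_pd hW j) z),
    pd_psForm (smooth_differentiableAt (contDiff_pd hA i) z) (smooth_differentiableAt hW z),
    partsDefect]
  ring

theorem integral_partsDefect {A : ℂ → Fin 6 → ℝ} (hA : ContDiff ℝ ∞ A) (hW : ContDiff ℝ ∞ W)
    (hc : HasCompactSupport W) (i j : Fin 2) :
    Integrable (partsDefect W A i j) ∧ ∫ z, partsDefect W A i j z = 0 := by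
  have s1 : ContDiff ℝ ∞ fun w => psForm 2 (A w) (pd j W w) := contDiff_psForm hA (contDiff_pd hW j)
  have s2 : ContDiff ℝ ∞ fun w => psForm 2 (pd i A w) (W w) := contDiff_psForm (contDiff_pd hA i) hW
  have c1 := hasCompactSupport_psForm 2 A (hasCompactSupport_pd hc j)
  have c2 := hasCompactSupport_psForm 2 (pd i A) hc
  have i1 := integrable_of_smooth_compact (contDiff_pd s1 i).continuous (hasCompactSupport_pd c1 i)
  have i2 := integrable_of_smooth_compact (contDiff_pd s2 j).continuous (hasCompactSupport_pd c2 j)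
  rw [show partsDefect W A i j = fun z => _ from funext (partsDefect_eq hA hW i j)]
  exact ⟨i1.sub i2, by rw [integral_sub i1 i2, integral_pd_eq_zero s1 c1, integral_pd_eq_zero s2 c2,
    sub_zero]⟩

/-- Both derivatives are moved off W. The determinant part of the density is a null Lagrangian: its
fourth-order terms occur with coefficients -2, -2, 4 and the same mixed derivative of Y, and cancel.
-/
theorem IsNormalDirection.fderiv_varDensity (h : IsNormalDirection Y W) (hY : IsCanon Y) (z : ℂ) :
    fderiv ℝ (varDensity Y W) (0, z) (1, 0) = 1 / 8 * (elForm Y z (W z) +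
      partsDefect W (lap Y) 0 0 z + partsDefect W (lap Y) 1 1 z -
      2 * partsDefect W (pd 0 (pd 0 Y)) 1 1 z - 2 * partsDefect W (pd 1 (pd 1 Y)) 0 0 z +
      4 * partsDefect W (pd 0 (pd 1 Y)) 0 1 z) := by
  have hs := h.contDiffAt_varDensity hY (x := (0, z)) (by
    simp only [zero_smul, add_zero, hY.gramDet_eq]; norm_num)
  have h1 := (hs.differentiableAt (by simp)).hasFDerivAt
  have h2 : HasDerivAt (fun s : ℝ => (s, z)) ((1 : ℝ), (0 : ℂ)) 0 :=
    (hasDerivAt_id 0).prodMk (hasDerivAt_const 0 z)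
  have h3 := h1.comp_hasDerivAt (0 : ℝ) h2
  have f := h.form_pd_pd hY z
  have htr : psForm 2 (pd 0 Y z) (pd 0 W z) + psForm 2 (pd 1 Y z) (pd 1 W z) = 0 := by
    rw [f, f, ← neg_add, ← psForm_add_left, psForm_comm]
    exact neg_eq_zero.2 (h.form_lap z)
  have k1 : ∀ i, psForm 2 (pd i Y z) (pd i Y z) = 1 := fun i => by simp [hY.form_pd_pd]
  have k2 : psForm 2 (pd 0 Y z) (pd 1 Y z) = 0 := by simp [hY.form_pd_pd]
  have h4 := hasDerivAt_jetDensity (pd 0 W z) (pd 1 W z) (pd 0 (pd 0 W) z) (pd 0 (pd 1 W) z)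
    (pd 1 (pd 1 W) z) (k1 0) (k1 1) k2 htr (hY.form_pdpd_pd z 0 0 0) (hY.form_pdpd_pd z 0 0 1)
    (hY.form_pdpd_pd z 0 1 0) (hY.form_pdpd_pd z 0 1 1) (hY.form_pdpd_pd z 1 1 0)
    (hY.form_pdpd_pd z 1 1 1)
  rw [h3.unique h4]
  have g1 : psForm 2 (pd 0 W z) (pd 1 Y z) = -psForm 2 (pd 0 (pd 1 Y) z) (W z) := by
    rw [psForm_comm, f]
  have g2 : psForm 2 (pd 0 Y z) (pd 1 W z) = -psForm 2 (pd 0 (pd 1 Y) z) (W z) := by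
    rw [f, pd_pd_comm hY.smooth.contDiffAt]
  -- The symmetry of mixed derivatives brings all these fourth-order terms to one form.
  have q1 : pd 1 (pd 0 (pd 0 (pd 1 Y))) z = pd 0 (pd 0 (pd 1 (pd 1 Y))) z := by
    rw [pd_pd_comm (contDiff_pd (hY.pd_smooth 1) 0).contDiffAt]
    have : pd 1 (pd 0 (pd 1 Y)) = pd 0 (pd 1 (pd 1 Y)) :=
      funext fun w => pd_pd_comm (hY.pd_smooth 1).contDiffAt _ _
    rw [this]
  have q2 : pd 1 (pd 1 (pd 0 (pd 0 Y))) z = pd 0 (pd 0 (pd 1 (pd 1 Y))) z := by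
    have t1 : pd 1 (pd 0 (pd 0 Y)) = pd 0 (pd 0 (pd 1 Y)) := funext fun w => by
      rw [pd_pd_comm (hY.pd_smooth 0).contDiffAt]
      have : pd 1 (pd 0 Y) = pd 0 (pd 1 Y) := funext fun w => pd_pd_comm hY.smooth.contDiffAt _ _
      rw [this]
    rw [t1, q1]
  simp only [g1, g2, f, partsDefect, elForm, q1, q2]
  have l : psForm 2 (lap (lap Y) z) (W z) = psForm 2 (pd 0 (pd 0 (lap Y)) z) (W z) +
      psForm 2 (pd 1 (pd 1 (lap Y)) z) (W z) := by rw [← psForm_add_left]; rfl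
  rw [l]
  have l2 : ∀ x, psForm 2 (lap Y z) x = psForm 2 (pd 0 (pd 0 Y) z) x + psForm 2 (pd 1 (pd 1 Y) z) x :=
    fun x => by rw [← psForm_add_left]; rfl
  simp only [l2, psForm_add_left, psForm_add_right, psForm_sub_right,
    psForm_comm (pd 0 (pd 0 W) z)]
  ring

theorem IsNormalDirection.integral_fderiv (h : IsNormalDirection Y W) (hY : IsCanon Y) :
    ∫ z, fderiv ℝ (varDensity Y W) (0, z) (1, 0) = 1 / 8 * ∫ z, elForm Y z (W z) := by
  have hl := contDiff_lap hY.smooth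
  have p := fun i j => hY.pdpd_smooth i j
  obtain ⟨i1, e1⟩ := integral_partsDefect hl h.smooth h.compact 0 0
  obtain ⟨i2, e2⟩ := integral_partsDefect hl h.smooth h.compact 1 1
  obtain ⟨i3, e3⟩ := integral_partsDefect (p 0 0) h.smooth h.compact 1 1
  obtain ⟨i4, e4⟩ := integral_partsDefect (p 1 1) h.smooth h.compact 0 0
  obtain ⟨i5, e5⟩ := integral_partsDefect (p 0 1) h.smooth h.compact 0 1
  have cs : Continuous fun z => elForm Y z (W z) := by
    have t : ∀ {A B : ℂ → Fin 6 → ℝ}, ContDiff ℝ ∞ A → ContDiff ℝ ∞ B →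
      Continuous fun z => psForm 2 (A z) (B z) := fun hA hB => (contDiff_psForm hA hB).continuous
    exact ((t (contDiff_lap hl) h.smooth).add (((t (p 0 0) h.smooth).const_mul 2).mul
      (t hl ((p 0 0).sub (p 1 1))))).add (((t (p 0 1) h.smooth).const_mul 4).mul (t hl (p 0 1)))
  have i0 : Integrable fun z => elForm Y z (W z) :=
    integrable_of_smooth_compact cs (h.compact.mono fun z hz => by
      rw [Function.mem_support] at hz ⊢
      rintro e
      exact hz (by simp [elForm, e, psForm_zero_right]))
  have j1 : Integrable fun z => elForm Y z (W z) + partsDefect W (lap Y) 0 0 z := i0.add i1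
  have j2 : Integrable fun z => elForm Y z (W z) + partsDefect W (lap Y) 0 0 z +
    partsDefect W (lap Y) 1 1 z := j1.add i2
  have j3 : Integrable fun z => elForm Y z (W z) + partsDefect W (lap Y) 0 0 z +
    partsDefect W (lap Y) 1 1 z - 2 * partsDefect W (pd 0 (pd 0 Y)) 1 1 z :=
    j2.sub (i3.const_mul 2)
  have j4 : Integrable fun z => elForm Y z (W z) + partsDefect W (lap Y) 0 0 z +
    partsDefect W (lap Y) 1 1 z - 2 * partsDefect W (pd 0 (pd 0 Y)) 1 1 z -
    2 * partsDefect W (pd 1 (pd 1 Y)) 0 0 z := j3.sub (i4.const_mul 2)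
  simp only [h.fderiv_varDensity hY]
  rw [integral_const_mul, integral_add j4 (i5.const_mul 4), integral_sub j3 (i4.const_mul 2),
    integral_sub j2 (i3.const_mul 2), integral_add j1 i2, integral_add i0 i1, integral_const_mul,
    integral_const_mul, integral_const_mul, e1, e2, e3, e4, e5]
  ring

end Variation

end

section

open MeasureTheory

/-! ### Normal variations of a surface and the Euler–Lagrange equation -/

theorem Represents.unique {v : Fin 6 → ℝ} {p q : Q41} (hp : Represents v p) (hq : Represents v q) :
    p = q := by
  have key : ∀ {p : Q41}, Represents v p → (p : ℙ ℝ (Fin 6 → ℝ)).submodule = Submodule.span ℝ {v} := by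
    intro p h
    have h2 := h.2
    rw [Projectivization.submodule_eq] at h2 ⊢
    rw [Submodule.mem_span_singleton] at h2
    obtain ⟨c, hc⟩ := h2
    have hc0 : c ≠ 0 := by rintro rfl; exact h.1 (by simpa using hc.symm)
    rw [← hc, Submodule.span_singleton_smul_eq (IsUnit.mk0 c hc0)]
  exact Subtype.ext (Projectivization.submodule_injective ((key hp).trans (key hq).symm))

section FirstVariation

variable {Y Yt W : ℂ → Fin 6 → ℝ}

theorem IsDirection.null_add (h : IsDirection Y W) (hY : IsCanon Y) (t : ℝ) (z : ℂ) :
    psForm 2 (Y z + t • W z) (Y z + t • W z) = 0 := by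
  simp only [psForm_add_left, psForm_add_right, psForm_smul_left, psForm_smul_right, hY.null,
    h.null, h.form_self, psForm_comm (W z) (Y z)]
  ring

/-- The pairing with ΔY remains -2 along the variation, because W is orthogonal to ΔY. -/
theorem IsNormalDirection.add_ne_zero (h : IsNormalDirection Y W) (hY : IsCanon Y) (t : ℝ) (z : ℂ) :
    Y z + t • W z ≠ 0 := fun e => by
  have h1 := congrArg (fun v => psForm 2 v (lap Y z)) e
  simp only [psForm_add_left, psForm_smul_left, hY.form_self_lap, h.form_lap, psForm_zero_left] at h1
  norm_num at h1

/-- The direction `W` seen in the other coordinate patch. -/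
def flipDirection (W : ℂ → Fin 6 → ℝ) (w : ℂ) : Fin 6 → ℝ := ‖w‖ ^ 2 • W w⁻¹

/-- Inversion maps the support of W to a compact set avoiding 0: compactness of the image needs 0
outside the support, and smoothness at 0 comes from the support being bounded. -/
theorem IsDirection.flip (h : IsDirection Y W) (hT : IsTransition Y Yt) (h0 : 0 ∉ tsupport W) :
    IsDirection Yt (flipDirection W) := by
  set K : Set ℂ := (fun w : ℂ => w⁻¹) '' tsupport W with hK
  have hKc : IsCompact K := h.compact.image_of_continuousOn
    (continuousOn_inv₀.mono fun z hz => by rintro rfl; exact h0 hz)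
  have hK0 : (0 : ℂ) ∉ K := by
    rintro ⟨z, hz, e⟩
    exact h0 (by rwa [inv_eq_zero.1 e] at hz)
  have hout : ∀ w ∉ K, flipDirection W w = 0 := fun w hw => by
    have : w⁻¹ ∉ tsupport W := fun hm => hw ⟨w⁻¹, hm, inv_inv w⟩
    rw [flipDirection, image_eq_zero_of_notMem_tsupport this, smul_zero]
  refine ⟨contDiff_iff_contDiffAt.2 fun w => ?_, HasCompactSupport.intro hKc hout, fun w => ?_,
    fun w => ?_⟩
  · by_cases hw : w = 0
    · subst hw
      refine (contDiffAt_const (c := (0 : Fin 6 → ℝ))).congr_of_eventuallyEq ?_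
      filter_upwards [hKc.isClosed.isOpen_compl.mem_nhds hK0] with w hw using hout w hw
    · exact (contDiff_norm_sq ℝ).contDiffAt.smul
        (h.smooth.contDiffAt.comp w (contDiffAt_inv ℝ hw))
  · by_cases hw : w = 0
    · simp [hw, flipDirection, psForm_zero_right]
    · rw [hT.symm.eq w hw, flipDirection, psForm_smul_left, psForm_smul_right, h.form_self]
      simp
  · rw [flipDirection, psForm_smul_left, psForm_smul_right, h.null]
    simp

/-- The variation `[Y + t W]` of the surface `y = [Y]`. -/
def liftVariation (y : OnePoint ℂ → Q41) (h : IsNormalDirection Y W) (hY : IsCanon Y) (t : ℝ) :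
    OnePoint ℂ → Q41 :=
  fun p => p.elim (y OnePoint.infty)
    (fun z => nullPoint (Y z + t • W z) (h.add_ne_zero hY t z) (h.null_add hY t z))

variable {y : OnePoint ℂ → Q41}

theorem liftVariation_zero (h : IsNormalDirection Y W) (hY : IsCanonicalLift 0 y Y) :
    liftVariation y h hY.isCanon 0 = y := by
  funext p
  induction p using OnePoint.rec with
  | infty => rfl
  | coe z =>
    have h1 := represents_nullPoint _ (h.add_ne_zero hY.isCanon 0 z) (h.null_add hY.isCanon 0 z)
    have h2 : Represents (Y z + (0 : ℝ) • W z) (y z) := by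
      rw [zero_smul, add_zero]; exact hY.1.2 z
    exact h1.unique h2

theorem represents_liftVariation (h : IsNormalDirection Y W) (hY : IsCanonicalLift 0 y Y)
    (t : ℝ) (z : ℂ) : Represents (Y z + t • W z) (liftVariation y h hY.isCanon t (chart 0 z)) :=
  represents_nullPoint _ (h.add_ne_zero hY.isCanon t z) (h.null_add hY.isCanon t z)

theorem represents_liftVariation' (h : IsNormalDirection Y W) (hY : IsCanonicalLift 0 y Y)
    (hYt : IsCanonicalLift 1 y Yt) (hT : IsTransition Y Yt) (t : ℝ) (w : ℂ) :
    Represents (Yt w + t • flipDirection W w) (liftVariation y h hY.isCanon t (chart 1 w)) := by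
  by_cases hw : w = 0
  · subst hw
    have := hYt.1.2 0
    simpa [flipDirection, chart, liftVariation] using this
  · have h1 := represents_liftVariation h hY t w⁻¹
    have h2 := h1.smul (c := ‖w‖ ^ 2) (pow_ne_zero 2 (norm_ne_zero_iff.2 hw))
    have e : chart 1 w = chart 0 w⁻¹ := by
      conv_lhs => rw [← inv_inv w]
      exact chart_one_inv (inv_ne_zero hw)
    rw [e, hT.symm.eq w hw, flipDirection]
    rwa [smul_add, smul_comm _ t] at h2

/-- Over the second patch the variation is the linear one with the flipped direction, so
spacelikeness for small t is the same estimate in both patches. -/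
theorem isVariation_liftVariation (h : IsNormalDirection Y W) (hY : IsCanonicalLift 0 y Y)
    (hYt : IsCanonicalLift 1 y Yt) (hT : IsTransition Y Yt) (h0 : 0 ∉ tsupport W) :
    ∃ ε, IsVariation y ε (liftVariation y h hY.isCanon) ∧
      ∀ t : ℝ, |t| < ε → ∀ z, (firstForm 2 (fun w => Y w + t • W w) z).PosDef := by
  have hf := h.toIsDirection.flip hT h0
  obtain ⟨ε₁, hε₁, h1⟩ := h.exists_posDef hY.isCanon
  obtain ⟨ε₂, hε₂, h2⟩ := hf.exists_posDef hYt.isCanon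
  have l0 : ∀ t : ℝ, IsLift 0 (liftVariation y h hY.isCanon t) fun w => Y w + t • W w := fun t =>
    ⟨hY.1.1.add (h.smooth.const_smul t), represents_liftVariation h hY t⟩
  have l1 : ∀ t : ℝ, IsLift 1 (liftVariation y h hY.isCanon t)
      fun w => Yt w + t • flipDirection W w := fun t =>
    ⟨hYt.1.1.add (hf.smooth.const_smul t), represents_liftVariation' h hY hYt hT t⟩
  refine ⟨min ε₁ ε₂, ⟨lt_min hε₁ hε₂, liftVariation_zero h hY, fun t ht i => ?_, fun i => ?_⟩,
    fun t ht => h1 t (ht.trans_le (min_le_left _ _))⟩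
  · have ht' := abs_lt.2 ht
    fin_cases i
    · exact ⟨_, l0 t, h1 t (ht'.trans_le (min_le_left _ _))⟩
    · exact ⟨_, l1 t, h2 t (ht'.trans_le (min_le_right _ _))⟩
  · fin_cases i
    · exact ⟨_, (contDiff_add_smul hY.1.1 h.smooth).contDiffOn, fun t _ z => (l0 t).2 z⟩
    · exact ⟨_, (contDiff_add_smul hYt.1.1 hf.smooth).contDiffOn, fun t _ z => (l1 t).2 z⟩

/-- The variation is affine in t at the level of lifts, so the energy is the integral of
`varDensity` for small t, and its derivative is computed twice. -/
theorem integral_elForm_eq_zero (hW : IsWillmore y) (h : IsNormalDirection Y W)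
    (hY : IsCanonicalLift 0 y Y) (hYt : IsCanonicalLift 1 y Yt) (hT : IsTransition Y Yt)
    (h0 : 0 ∉ tsupport W) : ∫ z, elForm Y z (W z) = 0 := by
  obtain ⟨ε, hv, hpos⟩ := isVariation_liftVariation h hY hYt hT h0
  have hd : ∀ t : ℝ, |t| < ε → ∀ z,
      0 < gramDet (pd 0 Y z + t • pd 0 W z) (pd 1 Y z + t • pd 1 W z) := fun t ht z => by
    have := (hpos t ht z).det_pos
    rwa [det_firstForm, pd_add_smul hY.1.1 h.smooth, pd_add_smul hY.1.1 h.smooth] at this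
  have h1 := h.hasDerivAt_integral hY.isCanon hT.integrable_canonDensity hv.pos hd
  have h2 := hW ε _ hv
  have h3 : (fun t => willmore (liftVariation y h hY.isCanon t)) =ᶠ[nhds 0]
      fun t => ∫ z, varDensity Y W (t, z) := by
    filter_upwards [Ioo_mem_nhds (neg_lt_zero.2 hv.pos) hv.pos] with t ht
    have p1 : ∀ i, pd i (fun w => Y w + t • W w) = fun w => pd i Y w + t • pd i W w :=
      pd_add_smul hY.1.1 h.smooth t
    rw [willmore_eq (X := fun w => Y w + t • W w)
      ⟨hY.1.1.add (h.smooth.const_smul t), represents_liftVariation h hY t⟩ fun z => by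
        rw [p1, p1]; exact hd t (abs_lt.2 ht) z]
    simp only [p1, pd_add_smul (hY.isCanon.pd_smooth _) (contDiff_pd h.smooth _)]
    rfl
  have h4 := (h2.congr_of_eventuallyEq h3.symm).unique h1
  rw [h.integral_fderiv hY.isCanon] at h4
  linarith

end FirstVariation

theorem elForm_smul (Y : ℂ → Fin 6 → ℝ) (z : ℂ) (c : ℝ) (w : Fin 6 → ℝ) :
    elForm Y z (c • w) = c * elForm Y z w := by
  simp only [elForm, psForm_smul_right]
  ring

/-- The Euler–Lagrange equation of a Willmore sphere. -/
theorem isEulerLagrange_of_isWillmore {y : OnePoint ℂ → Q41} {Y Yt L R : ℂ → Fin 6 → ℝ}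
    (hW : IsWillmore y) (hY : IsCanonicalLift 0 y Y) (hYt : IsCanonicalLift 1 y Yt)
    (hT : IsTransition Y Yt) (hF : IsFrame Y L R) : IsEulerLagrange Y L := by
  have hl := contDiff_lap hT.canon.smooth
  have p := fun i j => hT.canon.pdpd_smooth i j
  have cs : Continuous fun z => elForm Y z (L z) := by
    have t : ∀ {A B : ℂ → Fin 6 → ℝ}, ContDiff ℝ ∞ A → ContDiff ℝ ∞ B →
      Continuous fun z => psForm 2 (A z) (B z) := fun hA hB => (contDiff_psForm hA hB).continuous
    exact ((t (contDiff_lap hl) hF.smoothL).add (((t (p 0 0) hF.smoothL).const_mul 2).mul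
      (t hl ((p 0 0).sub (p 1 1))))).add (((t (p 0 1) hF.smoothL).const_mul 4).mul (t hl (p 0 1)))
  -- The test functions are supported away from 0 so that the variation passes to the other patch;
  -- continuity then recovers the equation at 0.
  have hae := (isOpen_compl_singleton (x := (0 : ℂ))).ae_eq_zero_of_integral_contDiff_smul_eq_zero
    (μ := volume) (f := fun z => elForm Y z (L z)) (cs.locallyIntegrable.locallyIntegrableOn _)
    fun f hf hc hsub => by
      have hsupp : tsupport (fun z => f z • L z) ⊆ tsupport f :=
        closure_mono fun z hz => by
          rw [Function.mem_support] at hz ⊢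
          rintro e
          exact hz (by rw [e, zero_smul])
      have hN : IsNormalDirection Y fun z => f z • L z :=
        { smooth := hf.smul hF.smoothL
          compact := hc.mono fun z hz => by
            rw [Function.mem_support] at hz ⊢
            rintro e
            exact hz (by rw [e, zero_smul])
          form_self := fun z => by
            rw [psForm_smul_right, psForm_comm, hF.LY, mul_zero]
          null := fun z => by rw [psForm_smul_right, psForm_smul_left, hF.LL]; simp
          form_pd := fun z i => by rw [psForm_smul_left, hF.Lpd, mul_zero]
          form_lap := fun z => by rw [psForm_smul_left, hF.Llap, mul_zero] }
      have := integral_elForm_eq_zero hW hN hY hYt hT fun h => hsub (hsupp h) rfl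
      simpa only [elForm_smul, smul_eq_mul] using this
  have h0 : (fun z => elForm Y z (L z)) =ᵐ[volume] fun _ => 0 := by
    have hz : ∀ᵐ z : ℂ, z ≠ 0 := by simp [ae_iff]
    filter_upwards [hae, hz] with z h1 h2 using h1 h2
  exact congrFun ((cs.ae_eq_iff_eq volume continuous_const).1 h0)

end

section

/-! ### Maps of constant direction -/

/-- X is real, so conjugation turns X_z = βX into X_z̄ = β̄X. The real partial derivatives are then
real multiples of X. -/
theorem pd_of_wz_smul {X : ℂ → Fin 6 → ℝ} {z β : ℂ} (hX : DifferentiableAt ℝ X z)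
    (h : wz (cx X) z = β • cx X z) (i : Fin 2) : ∃ a : ℝ, pd i X z = a • X z := by
  have h2 : wzb (cx X) z = star β • cx X z := by
    rw [wzb_cx hX, h, star_smul]
    congr 1
    exact star_toC _
  have hk : ∀ c : ℂ, ∀ a : ℝ, (a : ℂ) = c → pd i (cx X) z = c • cx X z → pd i X z = a • X z := by
    intro c a hc hp
    have hp' : toC (pd i X z) = c • cx X z := by rw [← pd_toC hX]; exact hp
    rw [← hc] at hp'
    funext k
    have := congrFun hp' k
    simp only [toC, cx, Pi.smul_apply, smul_eq_mul] at this
    simp only [Pi.smul_apply, smul_eq_mul]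
    exact_mod_cast this
  fin_cases i
  · refine ⟨_, hk _ (2 * β.re) ?_ (?_ : pd 0 (cx X) z = (β + star β) • cx X z)⟩
    · rw [Complex.star_def, Complex.add_conj]
    · rw [pd_zero_eq, h, h2, add_smul]
  · refine ⟨_, hk _ (-(2 * β.im)) ?_ (?_ : pd 1 (cx X) z = (Complex.I * (β - star β)) • cx X z)⟩
    · rw [Complex.star_def, Complex.sub_conj]; push_cast
      linear_combination (-(2 * (β.im : ℂ))) * Complex.I_mul_I
    · rw [pd_one_eq, h, h2, mul_smul, sub_smul]

/-- The Euclidean length of a vector. -/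
def euclLen (v : Fin 6 → ℝ) : ℝ := Real.sqrt (∑ k, v k ^ 2)

theorem euclLen_pos {v : Fin 6 → ℝ} (hv : v ≠ 0) : 0 < euclLen v := Real.sqrt_pos.2 (sum_sq_pos hv)

theorem contDiffAt_euclLen {X : ℂ → Fin 6 → ℝ} {z : ℂ} (hX : ContDiffAt ℝ ∞ X z) (h0 : X z ≠ 0) :
    ContDiffAt ℝ ∞ (fun w => euclLen (X w)) z :=
  (ContDiffAt.sum fun k _ => ((contDiffAt_pi.1 hX) k).pow 2).sqrt (sum_sq_pos h0).ne'

/-- The length has the same logarithmic derivative as X, so the unit vector in the direction of X is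
locally constant. The indefinite form would not do for this, since the vectors in question are null.
-/
theorem pd_euclLen {X : ℂ → Fin 6 → ℝ} {z : ℂ} (hX : ContDiffAt ℝ ∞ X z) (h0 : X z ≠ 0) {i : Fin 2}
    {a : ℝ} (ha : pd i X z = a • X z) : pd i (fun w => euclLen (X w)) z = a * euclLen (X z) := by
  have hp := euclLen_pos h0
  have d1 := smoothAt_differentiableAt (contDiffAt_euclLen hX h0)
  have d2 := smoothAt_differentiableAt hX
  -- Index 0 gives the Euclidean form, so the product rule for `psForm` applies.
  have e1 : (fun w => euclLen (X w) * euclLen (X w)) = fun w => psForm 0 (X w) (X w) := by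
    funext w
    rw [euclLen, Real.mul_self_sqrt (Finset.sum_nonneg fun _ _ => sq_nonneg _)]
    simp [psForm, sq]
  have e2 := congrArg (fun F => pd i F z) e1
  have e3 := congrFun e1 z
  beta_reduce at e2 e3
  rw [pd_mul d1 d1, pd_psForm d2 d2, ha, psForm_smul_left, psForm_smul_right, ← e3] at e2
  have : euclLen (X z) * (pd i (fun w => euclLen (X w)) z - a * euclLen (X z)) = 0 := by
    linear_combination e2 / 2
  rcases mul_eq_zero.1 this with h | h
  · exact absurd h hp.ne'
  · linarith

theorem fderiv_eq_zero_of_pd {E : Type*} [NormedAddCommGroup E] [NormedSpace ℝ E] {F : ℂ → E}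
    {z : ℂ} (h : ∀ i, pd i F z = 0) : fderiv ℝ F z = 0 := by
  ext v
  rw [fderiv_apply_eq_pd, h, h]
  simp

/-- A nowhere zero map with `X_z` proportional to `X` has constant direction. -/
theorem exists_constant_direction {X : ℂ → Fin 6 → ℝ} {s : Set ℂ} (hs : IsOpen s)
    (hc : IsPreconnected s) (hX : ∀ z ∈ s, ContDiffAt ℝ ∞ X z) (h0 : ∀ z ∈ s, X z ≠ 0)
    {β : ℂ → ℂ} (h : ∀ z ∈ s, wz (cx X) z = β z • cx X z) :
    ∃ C, ∀ z ∈ s, X z = euclLen (X z) • C := by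
  rcases s.eq_empty_or_nonempty with rfl | ⟨z₀, hz₀⟩
  · exact ⟨0, fun z hz => hz.elim⟩
  have hd : ∀ z ∈ s, ContDiffAt ℝ ∞ (fun w => (euclLen (X w))⁻¹ • X w) z := fun z hz =>
    ((contDiffAt_euclLen (hX z hz) (h0 z hz)).inv (euclLen_pos (h0 z hz)).ne').smul (hX z hz)
  have hconst : ∀ z ∈ s, fderiv ℝ (fun w => (euclLen (X w))⁻¹ • X w) z = 0 := fun z hz =>
    fderiv_eq_zero_of_pd fun i => by
      obtain ⟨a, ha⟩ := pd_of_wz_smul (smoothAt_differentiableAt (hX z hz)) (h z hz) i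
      have hp := euclLen_pos (h0 z hz)
      have d := smoothAt_differentiableAt (contDiffAt_euclLen (hX z hz) (h0 z hz))
      rw [pd_smul (d.fun_inv hp.ne') (smoothAt_differentiableAt (hX z hz)), pd_inv d hp.ne',
        pd_euclLen (hX z hz) (h0 z hz) ha, ha, smul_smul, ← add_smul]
      convert zero_smul ℝ (X z)
      field_simp
      ring
  refine ⟨(euclLen (X z₀))⁻¹ • X z₀, fun z hz => ?_⟩
  rw [← hs.is_const_of_fderiv_eq_zero hc
    (fun w hw => (smoothAt_differentiableAt (hd w hw)).differentiableWithinAt) hconst hz hz₀,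
    smul_smul, mul_inv_cancel₀ (euclLen_pos (h0 z hz)).ne', one_smul]

/-! ### Surfaces with `⟨κ, κ⟩ = 0` -/

section Null

variable {Y Yt L R : ℂ → Fin 6 → ℝ}

/-- Codazzi and Willmore make (λ_L, γ_L) a closed linear system for ∂̄, and γ_L vanishes wherever
λ_L does on an open set. -/
theorem IsFrame.lam_eq_zero_of_ball (hF : IsFrame Y L R) (hY : IsCanon Y)
    (hL : IsEulerLagrange Y L) {z₀ : ℂ} {r : ℝ} (hr : 0 < r)
    (h0 : ∀ z ∈ Metric.ball z₀ r, lam Y L z = 0) (z : ℂ) : lam Y L z = 0 := by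
  have s1 := hY.lam_smooth hF.smoothL
  have s2 := hY.gam_smooth hF.smoothL
  have hg : ∀ z ∈ Metric.ball z₀ r, gam Y L z = 0 := fun z hz => by
    have h1 := hF.wzb_lam hY z
    rw [wzb_congr (G := fun _ => (0 : ℂ)) (Filter.eventually_of_mem
      (Metric.isOpen_ball.mem_nhds hz) h0), wzb_const, h0 z hz] at h1
    simpa using h1.symm
  refine unique_continuation (ι := Fin 2) (z₀ := z₀) (w := ![lam Y L, gam Y L])
    (M := fun z => 1 + ‖alp L R z‖ + ‖schw Y z‖) (fun i => by fin_cases i <;> assumption) ?_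
    (fun i z => ?_) hr (fun z hz i => ?_) 0 z
  · exact (continuous_const.add hF.alp_smooth.continuous.norm).add hY.schw_smooth.continuous.norm
  · have n1 := norm_nonneg (lam Y L z)
    have n2 := norm_nonneg (gam Y L z)
    have n3 := norm_nonneg (alp L R z)
    have n4 := norm_nonneg (schw Y z)
    fin_cases i
    · simp only [Fin.zero_eta, Matrix.cons_val_zero, Fin.sum_univ_two, Matrix.cons_val_one]
      rw [hF.wzb_lam hY]
      refine (norm_add_le _ _).trans ?_
      rw [norm_mul, norm_star]
      nlinarith [mul_nonneg n3 n2, mul_nonneg n4 n1, mul_nonneg n4 n2]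
    · simp only [Fin.mk_one, Matrix.cons_val_zero, Fin.sum_univ_two, Matrix.cons_val_one]
      rw [hF.wzb_gam hY hL]
      refine (norm_sub_le _ _).trans ?_
      rw [norm_mul, norm_mul, norm_div, norm_star, norm_star, Complex.norm_ofNat]
      nlinarith [mul_nonneg n3 n1, mul_nonneg n4 n1, mul_nonneg n4 n2]
  · fin_cases i
    · exact h0 z hz
    · exact hg z hz

/-- If λ_L vanishes then so does γ_L, hence L_z = αL and L has constant direction C. Now κ is a
function times C, and repeated use of Liouville's theorem removes s, then κ_z̄, then κ. -/
theorem IsFrame.null_umbilic_of_lam (hF : IsFrame Y L R) (hT : IsTransition Y Yt)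
    (hR : IsEulerLagrange Y R) (h0 : ∀ z, lam Y L z = 0) :
    (∀ z, hopf Y z = 0) ∧ ∀ z, wz (cx (frameN Y)) z = 0 := by
  have hY := hT.canon
  have g0 : ∀ z, gam Y L z = 0 := fun z => by
    have h1 := hF.wzb_lam hY z
    rw [wzb_eq_zero_of_const h0, h0] at h1
    simpa using h1.symm
  have hLne : ∀ z, L z ≠ 0 := fun z e => by
    have := hF.LR z
    rw [e, psForm_zero_left] at this
    norm_num at this
  obtain ⟨C, hC⟩ := exists_constant_direction (s := Set.univ) (X := L) isOpen_univ
    isPreconnected_univ (fun z _ => hF.smoothL.contDiffAt) (fun z _ => hLne z) (β := alp L R)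
    (fun z _ => by rw [hF.wz_L hY, g0, h0]; simp)
  have hκ : ∀ z, hopf Y z = (lam Y R z * euclLen (L z)) • toC C := fun z => by
    rw [hF.hopf_eq hY, h0, zero_smul, add_zero, cx, hC z trivial, toC_smul, smul_smul,
      ← hC z trivial]
  have hC0 : toC C ≠ 0 := fun e => by
    apply hLne 0
    rw [hC 0 trivial]
    have : C = 0 := funext fun k => by
      have := congrFun e k
      simpa [toC] using this
    rw [this, smul_zero]
  -- Since κ is a multiple of the constant vector C, one coordinate with C_k ≠ 0 decides whether it
  -- vanishes.
  obtain ⟨k, hk⟩ := Function.ne_iff.1 hC0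
  set u : ℂ → ℂ := fun z => hopf Y z k with hu
  have hus : ContDiff ℝ ∞ u := contDiff_pi.1 hY.hopf_smooth k
  have hpk : ∀ (F : ℂ → Fin 6 → ℂ) (z : ℂ), ContDiff ℝ ∞ F →
      wzb (fun w => F w k) z = wzb F z k := fun F z hFs => by
    have : ∀ i, pd i (fun w => F w k) z = pd i F z k := fun i =>
      pd_clm (ContinuousLinearMap.proj (R := ℝ) k) (smooth_differentiableAt hFs z) i
    simp [wzb, this]
  have hgauss : ∀ z, gauss Y z = 0 := fun z => by rw [hF.gauss_eq hY, h0]; simp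
  -- Here ⟨κ, κ̄⟩ = 0, so the Gauss equation says that s is holomorphic, and it decays like z⁻⁴.
  have hs : ∀ z, schw Y z = 0 := fun z => eq_zero_of_wzb_eq_zero hY.schw_smooth
    (fun z => by
      rw [hF.wzb_schw hY, wz_eq_zero_of_const hgauss, h0, g0]; simp)
    (hT.hasTail_schw.tendsto (by norm_num)) z
  have hwk : ∀ z, wzb (hopf Y) z = gam Y R z • cx L z := fun z => by
    rw [hF.wzb_hopf hY, g0, hgauss, wzb_eq_zero_of_const hs, wz_eq_zero_of_const hgauss]
    simp
  -- The Willmore equation with s = 0; the connection terms of γ_R and L cancel.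
  have hwz : ∀ z, wzb (wzb (hopf Y)) z = 0 := fun z => by
    rw [show wzb (hopf Y) = fun z => gam Y R z • cx L z from funext hwk,
      wzb_smul (smooth_differentiableAt (hY.gam_smooth hF.smoothR) z)
        (smooth_differentiableAt hF.cLs z), hF.symm.wzb_gam hY hR, hF.wzb_L hY, hs, h0, g0,
        hF.alp_symm]
    simp only [star_neg, star_zero, zero_div, zero_mul, sub_zero, mul_zero, neg_zero, zero_smul,
      zero_add, add_zero]
    module
  have hv0 : ∀ z, wzb (hopf Y) z k = 0 := fun z => by
    refine eq_zero_of_wzb_eq_zero (f := fun z => wzb (hopf Y) z k)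
      (contDiff_pi.1 (contDiff_wzb hY.hopf_smooth) k) (fun z => ?_) ?_ z
    · rw [hpk _ z (contDiff_wzb hY.hopf_smooth), hwz]; rfl
    · have := (tendsto_pi_nhds.1 (hT.hasTail_hopf.wzb.tendsto (by norm_num))) k
      simpa using this
  have hu0 : ∀ z, u z = 0 := fun z => by
    refine eq_zero_of_wzb_eq_zero hus (fun z => ?_) ?_ z
    · rw [hu, hpk _ z hY.hopf_smooth, hv0]
    · have := (tendsto_pi_nhds.1 (hT.hasTail_hopf.tendsto (by norm_num))) k
      simpa using this
  have hlR : ∀ z, lam Y R z = 0 := fun z => by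
    have := hu0 z
    simp only [hu, hκ, Pi.smul_apply, smul_eq_mul] at this
    rcases mul_eq_zero.1 this with h | h
    · rcases mul_eq_zero.1 h with h | h
      · exact h
      · exact absurd (Complex.ofReal_eq_zero.1 h) (euclLen_pos (hLne z)).ne'
    · exact absurd h hk
  have gR : ∀ z, gam Y R z = 0 := fun z => by
    have h1 := hF.symm.wzb_lam hY z
    rw [wzb_eq_zero_of_const hlR, hlR] at h1
    simpa using h1.symm
  refine ⟨fun z => by rw [hF.hopf_eq hY, h0, hlR]; simp, fun z => ?_⟩
  rw [hF.wz_N hY, hgauss, hs, g0, gR]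
  simp

/-- A null-umbilic Willmore sphere is totally umbilic, and its `N` is constant. -/
theorem IsFrame.null_umbilic (hF : IsFrame Y L R) (hT : IsTransition Y Yt)
    (hL : IsEulerLagrange Y L) (hR : IsEulerLagrange Y R)
    (h0 : ∀ z, psForm 2 (hopf Y z) (hopf Y z) = 0) :
    (∀ z, hopf Y z = 0) ∧ ∀ z, wz (cx (frameN Y)) z = 0 := by
  have hY := hT.canon
  by_cases hR0 : ∀ z, lam Y R z = 0
  · exact hF.symm.null_umbilic_of_lam hT hL hR0
  · push Not at hR0
    obtain ⟨z₀, hz₀⟩ := hR0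
    -- The product λ_L λ_R vanishes identically, so λ_L is zero on a disc where λ_R is not, and
    -- unique continuation spreads this.
    obtain ⟨r, hr, hball⟩ := Metric.isOpen_iff.1
      (isOpen_ne_fun (hY.lam_smooth hF.smoothR).continuous continuous_const) z₀ hz₀
    refine hF.null_umbilic_of_lam hT hR (hF.lam_eq_zero_of_ball (z₀ := z₀) hY hL hr fun z hz => ?_)
    have h1 := h0 z
    rw [hF.form_hopf_hopf hY] at h1
    have h2 : lam Y R z ≠ 0 := hball hz
    simpa [h2] using h1

end Null

end

section

/-! ### The dual surface of a surface with `⟨κ, κ⟩ ≠ 0` -/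

section Dual

variable {Y Yt L R : ℂ → Fin 6 → ℝ}

/-- The second point of the central sphere determined by `m`:
`N - 2 m Y_z - 2 m̄ Y_z̄ + 2 |m|² Y`. -/
def dualLift (Y : ℂ → Fin 6 → ℝ) (m : ℂ → ℂ) (z : ℂ) : Fin 6 → ℝ :=
  frameN Y z - (2 * (m z).re) • pd 0 Y z - (2 * (m z).im) • pd 1 Y z +
    (2 * Complex.normSq (m z)) • Y z

theorem IsCanon.cx_dualLift (hY : IsCanon Y) (m : ℂ → ℂ) (z : ℂ) :
    cx (dualLift Y m) z = cx (frameN Y) z - (2 * m z) • wz (cx Y) z -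
      (2 * star (m z)) • wzb (cx Y) z + (2 * (m z * star (m z))) • cx Y z := by
  rw [hY.wz_eq, hY.wzb_eq, Complex.star_def, Complex.mul_conj]
  simp only [cx, dualLift, toC_add, toC_sub, toC_smul]
  conv_rhs => rw [← Complex.re_add_im (m z)]
  simp only [map_add, map_mul, Complex.conj_ofReal, Complex.conj_I]
  ext k
  simp only [Pi.add_apply, Pi.sub_apply, Pi.smul_apply, smul_eq_mul, Complex.normSq_add_mul_I]
  simp only [Complex.normSq_apply]
  push_cast
  linear_combination (-(2 * ((m z).im : ℂ) * toC (pd 1 Y z) k)) * Complex.I_mul_I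

theorem IsCanon.contDiffAt_dualLift (hY : IsCanon Y) {m : ℂ → ℂ} {z : ℂ} (hm : ContDiffAt ℝ ∞ m z) :
    ContDiffAt ℝ ∞ (dualLift Y m) z := by
  have h1 : ContDiffAt ℝ ∞ (fun w => (m w).re) z := Complex.reCLM.contDiff.contDiffAt.comp z hm
  have h2 : ContDiffAt ℝ ∞ (fun w => (m w).im) z := Complex.imCLM.contDiff.contDiffAt.comp z hm
  have h3 : ContDiffAt ℝ ∞ (fun w => Complex.normSq (m w)) z := by
    simp only [Complex.normSq_apply]
    exact (h1.mul h1).add (h2.mul h2)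
  exact ((hY.frameN_smooth.contDiffAt.sub ((contDiffAt_const.mul h1).smul
    (hY.pd_smooth 0).contDiffAt)).sub ((contDiffAt_const.mul h2).smul
    (hY.pd_smooth 1).contDiffAt)).add ((contDiffAt_const.mul h3).smul hY.smooth.contDiffAt)

/-- The conditions γ = mλ cancel the components along L and R, and the two equations for m cancel
what is left besides a multiple of the vector itself. -/
theorem IsFrame.wz_dualLift (hF : IsFrame Y L R) (hY : IsCanon Y) {m : ℂ → ℂ} {z : ℂ}
    (hm : ContDiffAt ℝ ∞ m z) (h1 : wz m z = -gauss Y z)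
    (h2 : wzb m z = -(star (schw Y z) / 2) - m z ^ 2)
    (hR : gam Y R z = m z * lam Y R z) (hL : gam Y L z = m z * lam Y L z) :
    wz (cx (dualLift Y m)) z = (-star (m z)) • cx (dualLift Y m) z := by
  have dm := smoothAt_differentiableAt hm
  have dms : DifferentiableAt ℝ (fun w => star (m w)) z :=
    (starL' ℝ : ℂ ≃L[ℝ] ℂ).differentiableAt.comp z dm
  have dN := smooth_differentiableAt hY.cNs z
  have dY := smooth_differentiableAt hY.cxs z
  have dz := smooth_differentiableAt (contDiff_wz hY.cxs) z
  have dzb := smooth_differentiableAt (contDiff_wzb hY.cxs) z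
  have c2 : DifferentiableAt ℝ (fun _ : ℂ => (2 : ℂ)) z := differentiableAt_const _
  have e : cx (dualLift Y m) = fun z => cx (frameN Y) z - (2 * m z) • wz (cx Y) z -
      (2 * star (m z)) • wzb (cx Y) z + (2 * (m z * star (m z))) • cx Y z :=
    funext (hY.cx_dualLift m)
  have h3 : wz (fun w => star (m w)) z = -(schw Y z / 2) - star (m z) ^ 2 := by
    rw [wz_star dm, h2]
    simp
  have a1 := (c2.fun_mul dm).fun_smul dz
  have a2 := (c2.fun_mul dms).fun_smul dzb
  have a3 := (c2.fun_mul (dm.fun_mul dms)).fun_smul dY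
  rw [hY.cx_dualLift, e, wz_add ((dN.fun_sub a1).fun_sub a2) a3, wz_sub (dN.fun_sub a1) a2,
    wz_sub dN a1, wz_smul (c2.fun_mul dm) dz, wz_smul (c2.fun_mul dms) dzb,
    wz_smul (c2.fun_mul (dm.fun_mul dms)) dY, wz_mul c2 dm, wz_mul c2 dms,
    wz_mul c2 (dm.fun_mul dms), wz_mul dm dms, wz_const, h3, h1, hF.wz_N hY, hF.wzwz_eq hY,
    ← wzb_wz_comm hY.cxs.contDiffAt, hY.wzbwz_eq, hR, hL]
  module

/-- The term 2|m|² Y makes the vector null. The first two pairings recover m from the vector up to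
scale, so that its relation to `lam` and `gam` can be restated for a fixed C. -/
theorem IsCanon.form_dualLift (hY : IsCanon Y) (m : ℂ → ℂ) (z : ℂ) :
    psForm 2 (cx (dualLift Y m) z) (cx Y z) = -1 ∧
    psForm 2 (cx (dualLift Y m) z) (wzb (cx Y) z) = -m z ∧
    psForm 2 (cx (dualLift Y m) z) (cx (dualLift Y m) z) = 0 := by
  have c := fun x y : Fin 6 → ℂ => psForm_comm (s := 2) x y
  rw [hY.cx_dualLift]
  simp only [psForm_add_left, psForm_sub_left, psForm_smul_left, psForm_add_right, psForm_sub_right,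
    psForm_smul_right, c (cx (frameN Y) z) (cx Y z), c (wz (cx Y) z) (cx Y z),
    c (wzb (cx Y) z) (cx Y z), c (wz (cx Y) z) (cx (frameN Y) z),
    c (wzb (cx Y) z) (cx (frameN Y) z), c (wzb (cx Y) z) (wz (cx Y) z), hY.c_self, hY.c_self_N,
    hY.c_self_wz, hY.c_self_wzb, hY.c_N_N, hY.c_N_wz, hY.c_N_wzb, hY.c_wz_wz, hY.c_wz_wzb,
    hY.c_wzb_wzb]
  refine ⟨by ring, by ring, by ring⟩

theorem IsFrame.form_dualLift (hF : IsFrame Y L R) (hY : IsCanon Y) (m : ℂ → ℂ) (z : ℂ) :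
    psForm 2 (cx (dualLift Y m) z) (cx L z) = 0 := by
  rw [psForm_comm, hY.cx_dualLift]
  simp only [psForm_add_right, psForm_sub_right, psForm_smul_right, hF.c_L_N, hF.c_L_wz hY,
    hF.c_L_wzb hY, hF.c_L_Y]
  ring

/-- Where `⟨κ, κ⟩ ≠ 0`, a Willmore sphere has a locally constant dual point. -/
theorem IsFrame.exists_local_dual (hF : IsFrame Y L R) (hT : IsTransition Y Yt)
    (hL : IsEulerLagrange Y L) (hR : IsEulerLagrange Y R) {z₀ : ℂ} {r : ℝ} (hr : 0 < r)
    (hl : ∀ z ∈ Metric.ball z₀ r, lam Y L z ≠ 0 ∧ lam Y R z ≠ 0) :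
    ∃ C : Fin 6 → ℝ, C ≠ 0 ∧ psForm 2 C C = 0 ∧ ∀ z ∈ Metric.ball z₀ r,
      psForm 2 (toC C) (cx L z) = 0 ∧ psForm 2 (toC C) (cx R z) = 0 ∧
      lam Y L z * psForm 2 (toC C) (wzb (cx Y) z) = gam Y L z * psForm 2 (toC C) (cx Y z) ∧
      lam Y R z * psForm 2 (toC C) (wzb (cx Y) z) = gam Y R z * psForm 2 (toC C) (cx Y z) := by
  have hY := hT.canon
  set m : ℂ → ℂ := fun z => gam Y R z / lam Y R z with hm
  have hms : ∀ z ∈ Metric.ball z₀ r, ContDiffAt ℝ ∞ m z := fun z hz => by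
    simp only [hm, div_eq_mul_inv]
    exact (hY.gam_smooth hF.smoothR).contDiffAt.mul
      ((hY.lam_smooth hF.smoothR).contDiffAt.inv (hl z hz).2)
  have hmR : ∀ z ∈ Metric.ball z₀ r, gam Y R z = m z * lam Y R z := fun z hz => by
    rw [hm, div_mul_cancel₀ _ (hl z hz).2]
  -- The vanishing of the cubic coefficient says that m is also the ratio γ_L/λ_L.
  have hmL : ∀ z ∈ Metric.ball z₀ r, gam Y L z = m z * lam Y L z := fun z hz => by
    have h1 := hT.cubicForm_eq_zero hF hL hR z
    rw [cubicForm, hmR z hz] at h1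
    exact mul_left_cancel₀ (hl z hz).2 (by linear_combination h1)
  -- With γ = mλ the quartic coefficient becomes λ_L λ_R (m_z + ⟨κ, κ̄⟩).
  have hmw : ∀ z ∈ Metric.ball z₀ r, wz m z = -gauss Y z := fun z hz => by
    have h1 := hT.quarticForm_eq_zero hF hL hR z
    have dm := smoothAt_differentiableAt (hms z hz)
    have dl := smooth_differentiableAt (hY.lam_smooth hF.smoothR) z
    rw [quarticForm, wz_congr (G := fun z => m z * lam Y R z) (Filter.eventually_of_mem
      (Metric.isOpen_ball.mem_nhds hz) hmR), wz_mul dm dl, hmL z hz] at h1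
    have h2 : lam Y L z * lam Y R z * (wz m z + gauss Y z) = 0 := by linear_combination h1
    rcases mul_eq_zero.1 h2 with h | h
    · exact absurd h (mul_ne_zero (hl z hz).1 (hl z hz).2)
    · linear_combination h
  -- This is the Willmore equation for γ_R = mλ_R after division by λ_R; the square comes from
  -- Codazzi.
  have hmb : ∀ z ∈ Metric.ball z₀ r, wzb m z = -(star (schw Y z) / 2) - m z ^ 2 := fun z hz => by
    have dm := smoothAt_differentiableAt (hms z hz)
    have dl := smooth_differentiableAt (hY.lam_smooth hF.smoothR) z
    have h1 := hF.symm.wzb_gam hY hR z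
    rw [wzb_congr (G := fun z => m z * lam Y R z) (Filter.eventually_of_mem
      (Metric.isOpen_ball.mem_nhds hz) hmR), wzb_mul dm dl, hF.symm.wzb_lam hY, hmR z hz] at h1
    refine mul_right_cancel₀ (hl z hz).2 ?_
    linear_combination h1
  have hre : ∀ z, psForm 2 (dualLift Y m z) (Y z) = -1 := fun z => by
    have := (hY.form_dualLift m z).1
    rw [cx, cx, psForm_toC] at this
    exact_mod_cast this
  have hne : ∀ z, dualLift Y m z ≠ 0 := fun z e => by
    have := hre z
    rw [e, psForm_zero_left] at this
    norm_num at this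
  obtain ⟨C, hC⟩ := exists_constant_direction (s := Metric.ball z₀ r) (X := dualLift Y m)
    Metric.isOpen_ball (convex_ball z₀ r).isPreconnected
    (fun z hz => hY.contDiffAt_dualLift (hms z hz)) (fun z _ => hne z) (β := fun z => -star (m z))
    (fun z hz => hF.wz_dualLift hY (hms z hz) (hmw z hz) (hmb z hz) (hmR z hz) (hmL z hz))
  have hcan : ∀ z ∈ Metric.ball z₀ r, ∀ v : Fin 6 → ℂ,
      psForm 2 (cx (dualLift Y m) z) v = euclLen (dualLift Y m z) * psForm 2 (toC C) v := by
    intro z hz v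
    rw [cx, hC z hz, toC_smul, psForm_smul_left, ← hC z hz]
  have hlen : ∀ z, ((euclLen (dualLift Y m z) : ℝ) : ℂ) ≠ 0 := fun z =>
    Complex.ofReal_ne_zero.2 (euclLen_pos (hne z)).ne'
  have hz₀ : z₀ ∈ Metric.ball z₀ r := Metric.mem_ball_self hr
  refine ⟨C, ?_, ?_, fun z hz => ?_⟩
  · rintro rfl
    exact hne z₀ (by rw [hC z₀ hz₀, smul_zero])
  · have h1 := (hY.form_dualLift m z₀).2.2
    rw [hcan z₀ hz₀, psForm_comm, hcan z₀ hz₀, psForm_toC] at h1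
    have h2 := (mul_eq_zero.1 ((mul_eq_zero.1 h1).resolve_left (hlen z₀))).resolve_left (hlen z₀)
    exact_mod_cast h2
  · have e1 := hF.form_dualLift hY m z
    have e2 := hF.symm.form_dualLift hY m z
    have e3 := (hY.form_dualLift m z).1
    have e4 := (hY.form_dualLift m z).2.1
    rw [hcan z hz] at e1 e2 e3 e4
    refine ⟨(mul_eq_zero.1 e1).resolve_left (hlen z), (mul_eq_zero.1 e2).resolve_left (hlen z), ?_, ?_⟩
    · refine mul_left_cancel₀ (hlen z) ?_
      rw [hmL z hz]
      linear_combination lam Y L z * e4 - m z * lam Y L z * e3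
    · refine mul_left_cancel₀ (hlen z) ?_
      rw [hmR z hz]
      linear_combination lam Y R z * e4 - m z * lam Y R z * e3

/-- The defect of `C` being the dual point, in the direction `L`. -/
def dualDefect (Y L : ℂ → Fin 6 → ℝ) (C : Fin 6 → ℝ) (z : ℂ) : ℂ :=
  lam Y L z * psForm 2 (toC C) (wzb (cx Y) z) - gam Y L z * psForm 2 (toC C) (cx Y z)

theorem IsFrame.dualDefect_smooth (hF : IsFrame Y L R) (hY : IsCanon Y) (C : Fin 6 → ℝ) :
    ContDiff ℝ ∞ (dualDefect Y L C) :=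
  ((hY.lam_smooth hF.smoothL).mul (contDiff_psForm contDiff_const (contDiff_wzb hY.cxs))).sub
    ((hY.gam_smooth hF.smoothL).mul (contDiff_psForm contDiff_const hY.cxs))

theorem wzb_psForm_const (C : Fin 6 → ℂ) {F : ℂ → Fin 6 → ℂ} (hF : ContDiff ℝ ∞ F) (z : ℂ) :
    wzb (fun w => psForm 2 C (F w)) z = psForm 2 C (wzb F z) := by
  rw [wzb_psForm (F := fun _ => C) (differentiableAt_const _) (smooth_differentiableAt hF z),
    wzb_const, psForm_zero_left, zero_add]

theorem IsFrame.wzb_form_const (hF : IsFrame Y L R) (hY : IsCanon Y) (C : Fin 6 → ℝ) (z : ℂ) :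
    wzb (fun w => psForm 2 (toC C) (cx L w)) z =
      2 * star (dualDefect Y L C z) + star (alp L R z) * psForm 2 (toC C) (cx L z) := by
  rw [wzb_psForm_const _ hF.cLs, hF.wzb_L hY, dualDefect]
  simp only [psForm_add_right, psForm_smul_right, star_sub, star_mul', ← psForm_star, star_toC,
    wzb_cx (smooth_differentiableAt hY.smooth z), star_star,
    show star (cx Y z) = cx Y z from star_toC _]
  ring

/-- Clearing the denominator of m gives a quantity defined everywhere, umbilic points included.
Codazzi and Willmore express its ∂̄-derivative by itself and the pairings of C with L and R. -/
theorem IsFrame.wzb_dualDefect (hF : IsFrame Y L R) (hY : IsCanon Y) (hL : IsEulerLagrange Y L)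
    (C : Fin 6 → ℝ) (z : ℂ) :
    wzb (dualDefect Y L C) z = star (alp L R z) * dualDefect Y L C z +
      lam Y L z * (star (lam Y R z) * psForm 2 (toC C) (cx L z) +
        star (lam Y L z) * psForm 2 (toC C) (cx R z)) := by
  have d1 := smooth_differentiableAt (hY.lam_smooth hF.smoothL) z
  have d2 := smooth_differentiableAt (hY.gam_smooth hF.smoothL) z
  have d3 : DifferentiableAt ℝ (fun w => psForm 2 (toC C) (wzb (cx Y) w)) z :=
    smooth_differentiableAt (contDiff_psForm contDiff_const (contDiff_wzb hY.cxs)) z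
  have d4 : DifferentiableAt ℝ (fun w => psForm 2 (toC C) (cx Y w)) z :=
    smooth_differentiableAt (contDiff_psForm contDiff_const hY.cxs) z
  have e : wzb (wzb (cx Y)) z = star (wz (wz (cx Y)) z) := by
    rw [show wzb (cx Y) = fun w => star (wz (cx Y) w) from
      funext fun w => wzb_cx (smooth_differentiableAt hY.smooth w),
      wzb_star (smooth_differentiableAt (contDiff_wz hY.cxs) z)]
  have sL : star (cx L z) = cx L z := star_toC _
  have sR : star (cx R z) = cx R z := star_toC _
  have sY : star (cx Y z) = cx Y z := star_toC _
  rw [show dualDefect Y L C = fun z => lam Y L z * psForm 2 (toC C) (wzb (cx Y) z) -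
    gam Y L z * psForm 2 (toC C) (cx Y z) from rfl, wzb_sub (d1.fun_mul d3) (d2.fun_mul d4),
    wzb_mul d1 d3, wzb_mul d2 d4, wzb_psForm_const _ (contDiff_wzb hY.cxs),
    wzb_psForm_const _ hY.cxs, hF.wzb_lam hY, hF.wzb_gam hY hL, e, hF.wzwz_eq hY]
  simp only [star_add, star_smul, sL, sR, sY, psForm_add_right, psForm_smul_right, star_neg,
    star_div₀, star_ofNat]
  ring

/-- The two normal components of C and the two defects form a closed system for ∂̄, linear over ℝ,
so unique continuation applies to the four functions together. -/
theorem IsFrame.dual_eq_zero_of_ball (hF : IsFrame Y L R) (hY : IsCanon Y)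
    (hL : IsEulerLagrange Y L) (hR : IsEulerLagrange Y R) (C : Fin 6 → ℝ) {z₀ : ℂ} {r : ℝ}
    (hr : 0 < r) (h0 : ∀ z ∈ Metric.ball z₀ r,
      psForm 2 (toC C) (cx L z) = 0 ∧ psForm 2 (toC C) (cx R z) = 0 ∧
      dualDefect Y L C z = 0 ∧ dualDefect Y R C z = 0) (z : ℂ) :
    psForm 2 (toC C) (cx L z) = 0 ∧ psForm 2 (toC C) (cx R z) = 0 := by
  have s1 : ContDiff ℝ ∞ fun z => psForm 2 (toC C) (cx L z) := contDiff_psForm contDiff_const hF.cLs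
  have s2 : ContDiff ℝ ∞ fun z => psForm 2 (toC C) (cx R z) :=
    contDiff_psForm contDiff_const hF.symm.cLs
  have s3 := hF.dualDefect_smooth hY C
  have s4 := hF.symm.dualDefect_smooth hY C
  have hb : ∀ {L R : ℂ → Fin 6 → ℝ}, IsFrame Y L R → IsEulerLagrange Y L → ∀ z,
      ‖wzb (fun w => psForm 2 (toC C) (cx L w)) z‖ ≤
        2 * ‖dualDefect Y L C z‖ + ‖alp L R z‖ * ‖psForm 2 (toC C) (cx L z)‖ ∧
      ‖wzb (dualDefect Y L C) z‖ ≤ ‖alp L R z‖ * ‖dualDefect Y L C z‖ +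
        ‖lam Y L z‖ * (‖lam Y R z‖ * ‖psForm 2 (toC C) (cx L z)‖ +
          ‖lam Y L z‖ * ‖psForm 2 (toC C) (cx R z)‖) := by
    intro L R hF hL z
    rw [hF.wzb_form_const hY, hF.wzb_dualDefect hY hL]
    constructor
    · refine (norm_add_le _ _).trans (le_of_eq ?_)
      rw [norm_mul, norm_mul, norm_star, norm_star, Complex.norm_ofNat]
    · refine (norm_add_le _ _).trans ?_
      rw [norm_mul, norm_mul, norm_star]
      gcongr
      refine (norm_add_le _ _).trans (le_of_eq ?_)
      rw [norm_mul, norm_mul, norm_star, norm_star]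
  have key := unique_continuation (ι := Fin 4) (z₀ := z₀) (r := r)
    (w := ![fun z => psForm 2 (toC C) (cx L z), fun z => psForm 2 (toC C) (cx R z),
      dualDefect Y L C, dualDefect Y R C])
    -- The summands bound in turn the factor 2 before the conjugate defect, the connection, and the
    -- products of two `lam` coefficients.
    (M := fun z => 2 + ‖alp L R z‖ + (‖lam Y L z‖ + ‖lam Y R z‖) ^ 2)
    (fun i => by fin_cases i <;> assumption)
    ((continuous_const.add hF.alp_smooth.continuous.norm).add
      (((hY.lam_smooth hF.smoothL).continuous.norm.add
        (hY.lam_smooth hF.smoothR).continuous.norm).pow 2))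
    (fun i z => by
      obtain ⟨b1, b2⟩ := hb hF hL z
      obtain ⟨b3, b4⟩ := hb hF.symm hR z
      rw [hF.alp_symm, norm_neg] at b3 b4
      have n1 := norm_nonneg (lam Y L z)
      have n2 := norm_nonneg (lam Y R z)
      have n3 := norm_nonneg (alp L R z)
      have n4 := norm_nonneg (psForm 2 (toC C) (cx L z))
      have n5 := norm_nonneg (psForm 2 (toC C) (cx R z))
      have n6 := norm_nonneg (dualDefect Y L C z)
      have n7 := norm_nonneg (dualDefect Y R C z)
      generalize ‖lam Y L z‖ = a at *
      generalize ‖lam Y R z‖ = b at *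
      generalize ‖alp L R z‖ = c at *
      have hsum : ∀ x1 x2 x3 x4 : ℝ, 0 ≤ x1 → 0 ≤ x2 → 0 ≤ x3 → 0 ≤ x4 →
          2 * x3 + c * x1 ≤ (2 + c + (a + b) ^ 2) * (x1 + x2 + x3 + x4) ∧
          c * x3 + a * (b * x1 + a * x2) ≤ (2 + c + (a + b) ^ 2) * (x1 + x2 + x3 + x4) := by
        intro x1 x2 x3 x4 h1 h2 h3 h4
        constructor
        · nlinarith [mul_nonneg n3 h2, mul_nonneg n3 h3, mul_nonneg n3 h4,
            mul_nonneg (sq_nonneg (a + b)) (add_nonneg (add_nonneg h1 h2) (add_nonneg h3 h4))]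
        · have k1 : a * b ≤ (a + b) ^ 2 := by nlinarith [mul_nonneg n1 n2]
          have k2 : a * a ≤ (a + b) ^ 2 := by nlinarith [mul_nonneg n1 n2]
          nlinarith [mul_nonneg n3 h1, mul_nonneg n3 h2, mul_nonneg n3 h4,
            mul_le_mul_of_nonneg_right k1 h1, mul_le_mul_of_nonneg_right k2 h2,
            mul_nonneg (sq_nonneg (a + b)) (add_nonneg h3 h4)]
      have hs1 := hsum _ _ _ _ n4 n5 n6 n7
      have hs2 := hsum _ _ _ _ n5 n4 n7 n6
      have hs3 : ∀ x1 x2 x3 x4 : ℝ, 0 ≤ x1 → 0 ≤ x2 → 0 ≤ x3 → 0 ≤ x4 →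
          c * x4 + b * (a * x2 + b * x1) ≤ (2 + c + (a + b) ^ 2) * (x1 + x2 + x3 + x4) := by
        intro x1 x2 x3 x4 h1 h2 h3 h4
        have k1 : a * b ≤ (a + b) ^ 2 := by nlinarith [mul_nonneg n1 n2]
        have k2 : b * b ≤ (a + b) ^ 2 := by nlinarith [mul_nonneg n1 n2]
        nlinarith [mul_nonneg n3 h1, mul_nonneg n3 h2, mul_nonneg n3 h3,
          mul_le_mul_of_nonneg_right k1 h2, mul_le_mul_of_nonneg_right k2 h1,
          mul_nonneg (sq_nonneg (a + b)) (add_nonneg h3 h4)]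
      have hs4 := hs3 _ _ _ _ n4 n5 n6 n7
      fin_cases i <;> simp only [Fin.sum_univ_four, Fin.isValue, Fin.zero_eta, Fin.mk_one,
        Fin.reduceFinMk, Matrix.cons_val]
      · linarith
      · linarith
      · linarith
      · linarith)
    hr
    (fun z hz i => by
      obtain ⟨h1, h2, h3, h4⟩ := h0 z hz
      fin_cases i <;> assumption)
  exact ⟨key 0 z, key 1 z⟩

/-- Every Willmore sphere has a constant null vector in all its central spheres. -/
theorem IsFrame.exists_dual (hF : IsFrame Y L R) (hT : IsTransition Y Yt)
    (hL : IsEulerLagrange Y L) (hR : IsEulerLagrange Y R) :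
    ∃ C : Fin 6 → ℝ, C ≠ 0 ∧ psForm 2 C C = 0 ∧
      ∀ z, psForm 2 C (L z) = 0 ∧ psForm 2 C (R z) = 0 := by
  have hY := hT.canon
  by_cases h0 : ∀ z, psForm 2 (hopf Y z) (hopf Y z) = 0
  · obtain ⟨-, hN⟩ := hF.null_umbilic hT hL hR h0
    -- In the null-umbilic case N itself is constant, null and in every central sphere, so it is the
    -- required vector.
    have hconst : ∀ z, frameN Y z = frameN Y 0 := fun z => by
      have hf : ∀ w, fderiv ℝ (frameN Y) w = 0 := fun w => fderiv_eq_zero_of_pd fun i => by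
        have dN := smooth_differentiableAt hY.frameN_smooth w
        have h2 : wzb (cx (frameN Y)) w = 0 := by rw [wzb_cx dN, hN, star_zero]
        have h3 : toC (pd i (frameN Y) w) = 0 := by
          rw [← pd_toC dN]
          change pd i (cx (frameN Y)) w = 0
          fin_cases i
          · change pd 0 (cx (frameN Y)) w = 0
            rw [pd_zero_eq, hN, h2, add_zero]
          · change pd 1 (cx (frameN Y)) w = 0
            rw [pd_one_eq, hN, h2, sub_zero, smul_zero]
        funext k
        simpa [toC] using congrFun h3 k
      exact is_const_of_fderiv_eq_zero (hY.frameN_smooth.differentiable (by simp)) hf z 0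
    refine ⟨frameN Y 0, fun e => ?_, hY.form_frameN_frameN 0, fun z => ?_⟩
    · have := hY.form_self_frameN 0
      rw [e, psForm_zero_right] at this
      norm_num at this
    · rw [← hconst z, psForm_comm, hF.LN, psForm_comm, hF.symm.LN]
      exact ⟨rfl, rfl⟩
  · push Not at h0
    obtain ⟨z₀, hz₀⟩ := h0
    rw [hF.form_hopf_hopf hY] at hz₀
    have hz₀' : lam Y R z₀ * lam Y L z₀ ≠ 0 := fun e => hz₀ (by rw [e, mul_zero])
    obtain ⟨r, hr, hball⟩ := Metric.isOpen_iff.1 (isOpen_ne_fun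
      ((hY.lam_smooth hF.smoothR).mul (hY.lam_smooth hF.smoothL)).continuous
      continuous_const) z₀ hz₀'
    -- Otherwise the dual point is constructed near one point with ⟨κ,κ⟩ ≠ 0, and the resulting
    -- vector works over the whole patch.
    obtain ⟨C, hC0, hCC, hC⟩ := hF.exists_local_dual (z₀ := z₀) hT hL hR hr fun z hz =>
      ⟨right_ne_zero_of_mul (hball hz), left_ne_zero_of_mul (hball hz)⟩
    refine ⟨C, hC0, hCC, fun z => ?_⟩
    obtain ⟨h1, h2⟩ := hF.dual_eq_zero_of_ball (z₀ := z₀) hY hL hR C hr (fun z hz => by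
      obtain ⟨h1, h2, h3, h4⟩ := hC z hz
      exact ⟨h1, h2, sub_eq_zero.2 h3, sub_eq_zero.2 h4⟩) z
    rw [cx, psForm_toC] at h1 h2
    exact ⟨by exact_mod_cast h1, by exact_mod_cast h2⟩

end Dual

end

section

/-! ### The affine chart `ℝ⁴₁` of the conformal space -/

/-- The vertex of the light cone at infinity. -/
def infVec : Fin 6 → ℝ := ![1, 0, 0, 0, 0, 1]

/-- The inclusion of `ℝ⁴₁` as the four middle coordinates. -/
def incl : (Fin 4 → ℝ) →L[ℝ] (Fin 6 → ℝ) :=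
  LinearMap.toContinuousLinearMap
    { toFun := fun x => ![0, x 0, x 1, x 2, x 3, 0]
      map_add' := fun x y => by ext i; fin_cases i <;> simp
      map_smul' := fun c x => by ext i; fin_cases i <;> simp }

theorem incl_apply (x : Fin 4 → ℝ) : incl x = ![0, x 0, x 1, x 2, x 3, 0] := rfl

theorem psForm_one_four (x y : Fin 4 → ℝ) :
    psForm 1 x y = x 0 * y 0 + x 1 * y 1 + x 2 * y 2 - x 3 * y 3 := by
  simp [psForm, Fin.sum_univ_four]
  ring

theorem phi0_eq (x : Fin 4 → ℝ) :
    phi0 x = incl x + (psForm 1 x x / 2) • infVec + ![-1 / 2, 0, 0, 0, 0, 1 / 2] := by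
  rw [phi0, incl_apply, infVec]
  ext i
  fin_cases i <;> simp <;> ring

theorem psForm_incl (x y : Fin 4 → ℝ) : psForm 2 (incl x) (incl y) = psForm 1 x y := by
  rw [psForm_two_six, psForm_one_four, incl_apply, incl_apply]
  simp

theorem psForm_incl_infVec (x : Fin 4 → ℝ) : psForm 2 (incl x) infVec = 0 := by
  rw [psForm_two_six, incl_apply, infVec]
  simp

theorem psForm_infVec_infVec : psForm 2 infVec infVec = 0 := by
  rw [psForm_two_six, infVec]
  simp

theorem infVec_ne_zero : infVec ≠ 0 := fun h => by
  have := congrFun h 0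
  simp [infVec] at this

/-! ### Mean curvature in conformal coordinates -/

/-- In conformal coordinates the trace of the second derivatives is the Laplacian divided by ρ, so
stationary means that ΔX is tangent. -/
theorem meanCurvature_eq {s n : ℕ} {X : ℂ → Fin n → ℝ} {z : ℂ} {ρ : ℝ}
    (h : firstForm s X z = ρ • (1 : Matrix (Fin 2) (Fin 2) ℝ)) :
    meanCurvature s X z = (1 / 2 * ρ⁻¹) • (lap X z -
      ((ρ⁻¹ * psForm s (lap X z) (pd 0 X z)) • pd 0 X z +
        (ρ⁻¹ * psForm s (lap X z) (pd 1 X z)) • pd 1 X z)) := by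
  have hi : (firstForm s X z)⁻¹ = ρ⁻¹ • (1 : Matrix (Fin 2) (Fin 2) ℝ) := by
    rw [h]
    by_cases hρ : ρ = 0
    · simp [hρ]
    · refine Matrix.inv_eq_right_inv ?_
      rw [smul_mul_smul_comm, one_mul, mul_inv_cancel₀ hρ, one_smul]
  simp only [meanCurvature, secondForm, hi, Fin.sum_univ_two, Matrix.smul_apply, Matrix.one_apply_eq,
    Matrix.one_apply_ne (show (0 : Fin 2) ≠ 1 by decide),
    Matrix.one_apply_ne (show (1 : Fin 2) ≠ 0 by decide), smul_eq_mul, mul_one, mul_zero, zero_mul,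
    zero_smul, add_zero, zero_add, lap, psForm_add_left]
  module

/-! ### Polar surfaces of stationary surfaces -/

section Stationary

variable {x : ℂ → Fin 4 → ℝ} {z : ℂ} {T : (Fin 6 → ℝ) ≃ₗ[ℝ] (Fin 6 → ℝ)}

theorem pd_phi0 (T : (Fin 6 → ℝ) ≃ₗ[ℝ] (Fin 6 → ℝ)) (hx : DifferentiableAt ℝ x z) (i : Fin 2) :
    pd i (fun w => T (phi0 (x w))) z =
      T (incl (pd i x z)) + psForm 1 (x z) (pd i x z) • T infVec := by
  have hq : DifferentiableAt ℝ (fun w => psForm 1 (x w) (x w)) z := by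
    obtain ⟨D, hD, -⟩ := hasFDerivAt_psForm (s := 1) hx.hasFDerivAt hx.hasFDerivAt
    exact hD.differentiableAt
  have hA : DifferentiableAt ℝ (fun w => incl (x w)) z := incl.differentiableAt.comp z hx
  have hq2 : DifferentiableAt ℝ (fun w => psForm 1 (x w) (x w) / (2 : ℝ)) z := by
    simpa only [div_eq_mul_inv] using hq.mul_const (2⁻¹ : ℝ)
  have hb : DifferentiableAt ℝ (fun w => (psForm 1 (x w) (x w) / 2) • infVec) z :=
    hq2.smul_const _
  have h1 : pd i (fun w => phi0 (x w)) z = incl (pd i x z) +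
      psForm 1 (x z) (pd i x z) • infVec := by
    simp only [phi0_eq]
    have e2 : pd i (fun w => psForm 1 (x w) (x w) / 2) z = psForm 1 (x z) (pd i x z) := by
      have : (fun w => psForm 1 (x w) (x w) / 2) = fun w => (1 / 2 : ℝ) * psForm 1 (x w) (x w) := by
        ext w; ring
      rw [this, pd_mul (differentiableAt_const _) hq, pd_const, pd_psForm hx hx,
        psForm_comm (pd i x z)]
      ring
    rw [pd_add (hA.fun_add hb) (differentiableAt_const _), pd_add hA hb, pd_const, pd_clm incl hx,
      pd_smul (X := fun _ => infVec) hq2 (differentiableAt_const _), pd_const, e2]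
    simp
  have hd : DifferentiableAt ℝ (fun w => phi0 (x w)) z := by
    simp only [phi0_eq]
    exact (hA.fun_add hb).fun_add (differentiableAt_const _)
  have := pd_clm (LinearMap.toContinuousLinearMap (T : (Fin 6 → ℝ) →ₗ[ℝ] (Fin 6 → ℝ))) hd i
  rw [h1, map_add, map_smul] at this
  exact this

theorem pd_pd_phi0 (T : (Fin 6 → ℝ) ≃ₗ[ℝ] (Fin 6 → ℝ)) (hx : ContDiffAt ℝ ∞ x z) (i : Fin 2) :
    pd i (pd i fun w => T (phi0 (x w))) z = T (incl (pd i (pd i x) z)) +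
      (psForm 1 (pd i x z) (pd i x z) + psForm 1 (x z) (pd i (pd i x) z)) • T infVec := by
  have d1 := smoothAt_differentiableAt hx
  have d2 := smoothAt_differentiableAt (contDiffAt_pd hx i)
  have hq : DifferentiableAt ℝ (fun w => psForm 1 (x w) (pd i x w)) z := by
    obtain ⟨D, hD, -⟩ := hasFDerivAt_psForm (s := 1) d1.hasFDerivAt d2.hasFDerivAt
    exact hD.differentiableAt
  let A : (Fin 4 → ℝ) →L[ℝ] (Fin 6 → ℝ) :=
    (LinearMap.toContinuousLinearMap (T : (Fin 6 → ℝ) →ₗ[ℝ] (Fin 6 → ℝ))).comp incl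
  have dA : DifferentiableAt ℝ (fun w => A (pd i x w)) z := A.differentiableAt.comp z d2
  have db : DifferentiableAt ℝ (fun w => psForm 1 (x w) (pd i x w) • T infVec) z :=
    hq.smul_const _
  rw [pd_congr (X' := fun w => A (pd i x w) + psForm 1 (x w) (pd i x w) • T infVec)
    ((eventually_differentiableAt hx).mono fun w hw => pd_phi0 T hw i),
    pd_add dA db, pd_clm A d2,
    pd_smul (X := fun _ => T infVec) hq (differentiableAt_const _), pd_const, pd_psForm d1 d2,
    smul_zero, add_zero]
  rfl

/-- The section φ₀ of the light cone is isometric: the derivatives differ from those of x by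
multiples of the null vertex, which is orthogonal to the image of `incl`. -/
theorem IsO42.form_pd_phi0 (hT : IsO42 T) (hx : DifferentiableAt ℝ x z) (i j : Fin 2) :
    psForm 2 (pd i (fun w => T (phi0 (x w))) z) (pd j (fun w => T (phi0 (x w))) z) =
      psForm 1 (pd i x z) (pd j x z) := by
  rw [pd_phi0 T hx, pd_phi0 T hx]
  simp only [psForm_add_left, psForm_add_right, psForm_smul_left, psForm_smul_right, hT _ _,
    psForm_incl, psForm_incl_infVec, psForm_infVec_infVec, psForm_comm infVec (incl _)]
  ring

/-- A vector normal to the central sphere of a stationary surface is orthogonal to the vertex of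
the light cone at infinity. -/
theorem IsO42.form_infVec_eq_zero (hT : IsO42 T) (hx : ContDiffAt ℝ ∞ x z)
    (hpos : (firstForm 1 x z).PosDef) (hH : meanCurvature 1 x z = 0) {X : ℂ → Fin 6 → ℝ}
    (hX : IsCanon X) {f : ℂ → ℝ} (hf : ContDiffAt ℝ ∞ f z)
    (hfX : ∀ᶠ w in nhds z, T (phi0 (x w)) = f w • X w) {ξ : Fin 6 → ℝ}
    (h0 : psForm 2 ξ (X z) = 0) (h1 : ∀ i, psForm 2 ξ (pd i X z) = 0)
    (h2 : psForm 2 ξ (lap X z) = 0) : psForm 2 ξ (T infVec) = 0 := by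
  have dx := smoothAt_differentiableAt hx
  have df := smoothAt_differentiableAt hf
  have dX := smooth_differentiableAt hX.smooth
  have hconf : firstForm 1 x z = f z ^ 2 • (1 : Matrix (Fin 2) (Fin 2) ℝ) := by
    rw [← hX.unit z, ← firstForm_smul (dX z) df (.of_forall hX.null)]
    ext i j
    simp only [firstForm, Matrix.of_apply]
    rw [← pd_congr hfX, ← pd_congr hfX, hT.form_pd_phi0 dx]
  have hρ : 0 < f z ^ 2 := by
    have := hpos.diag_pos (i := 0)
    rwa [hconf, Matrix.smul_apply, Matrix.one_apply_eq, smul_eq_mul, mul_one] at this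
  rw [meanCurvature_eq hconf] at hH
  have hlap := sub_eq_zero.1 ((smul_eq_zero.1 hH).resolve_left (by positivity))
  have hP : ∀ i, psForm 2 ξ (pd i (fun w => T (phi0 (x w))) z) = 0 := fun i => by
    rw [pd_congr hfX, pd_smul df (dX z), psForm_add_right, psForm_smul_right, psForm_smul_right, h0,
      h1]
    ring
  have hPP : ∀ i, psForm 2 ξ (pd i (pd i fun w => T (phi0 (x w))) z) =
      f z * psForm 2 ξ (pd i (pd i X) z) := fun i => by
    have e : pd i (fun w => T (phi0 (x w))) =ᶠ[nhds z] fun w => pd i f w • X w + f w • pd i X w :=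
      (pd_eventuallyEq hfX i).trans ((eventually_differentiableAt hf).mono fun w hw => by
        rw [pd_smul hw (dX w)])
    have d3 := smoothAt_differentiableAt (contDiffAt_pd hf i)
    have d4 := smooth_differentiableAt (hX.pd_smooth i) z
    rw [pd_congr e, pd_add (d3.fun_smul (dX z)) (df.fun_smul d4), pd_smul d3 (dX z), pd_smul df d4]
    simp only [psForm_add_right, psForm_smul_right, h0, h1]
    ring
  have hsum : psForm 2 ξ (pd 0 (pd 0 fun w => T (phi0 (x w))) z) +
      psForm 2 ξ (pd 1 (pd 1 fun w => T (phi0 (x w))) z) = 0 := by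
    rw [hPP, hPP, ← mul_add, ← psForm_add_right]
    change f z * psForm 2 ξ (lap X z) = 0
    rw [h2, mul_zero]
  have q0 := hP 0
  have q1 := hP 1
  rw [pd_phi0 T dx, psForm_add_right, psForm_smul_right] at q0 q1
  rw [pd_pd_phi0 T hx, pd_pd_phi0 T hx] at hsum
  have hmet : ∀ i, psForm 1 (pd i x z) (pd i x z) = f z ^ 2 := fun i => by
    have := congrFun (congrFun hconf i) i
    simpa [firstForm] using this
  simp only [psForm_add_right, psForm_smul_right, hmet] at hsum
  have hl1 : psForm 2 ξ (T (incl (pd 0 (pd 0 x) z))) + psForm 2 ξ (T (incl (pd 1 (pd 1 x) z))) =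
      psForm 2 ξ (T (incl (lap x z))) := by
    rw [← psForm_add_right, ← map_add, ← map_add]; rfl
  have hl2 : psForm 1 (x z) (pd 0 (pd 0 x) z) + psForm 1 (x z) (pd 1 (pd 1 x) z) =
      psForm 1 (x z) (lap x z) := by
    rw [← psForm_add_right]; rfl
  set a := (f z ^ 2)⁻¹ * psForm 1 (lap x z) (pd 0 x z)
  set b := (f z ^ 2)⁻¹ * psForm 1 (lap x z) (pd 1 x z)
  have hl3 : psForm 2 ξ (T (incl (lap x z))) = a * psForm 2 ξ (T (incl (pd 0 x z))) +
      b * psForm 2 ξ (T (incl (pd 1 x z))) := by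
    rw [hlap]
    simp only [map_add, map_smul, psForm_add_right, psForm_smul_right]
  have hl4 : psForm 1 (x z) (lap x z) = a * psForm 1 (x z) (pd 0 x z) +
      b * psForm 1 (x z) (pd 1 x z) := by
    conv_lhs => rw [hlap]
    simp only [psForm_add_right, psForm_smul_right]
  -- Δ(Tφ₀(x)) is the tangential part of Δx carried along, plus 2f² times the vertex. Removing the
  -- tangential part leaves only the vertex term.
  have key : 2 * f z ^ 2 * psForm 2 ξ (T infVec) = 0 := by
    linear_combination hsum - hl1 - hl3 - (hl2 + hl4) * psForm 2 ξ (T infVec) - a * q0 - b * q1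
  rcases mul_eq_zero.1 key with h | h
  · exact absurd h (by positivity)
  · exact h

end Stationary

/-- A surface in the light cone of a constant null vector is null-umbilic. -/
theorem IsFrame.form_hopf_eq_zero {Y L R : ℂ → Fin 6 → ℝ} (hF : IsFrame Y L R) (hY : IsCanon Y)
    {C : Fin 6 → ℝ} (hC0 : C ≠ 0) (hCC : psForm 2 C C = 0) (h : ∀ z, psForm 2 (Y z) C = 0) (z : ℂ) :
    psForm 2 (hopf Y z) (hopf Y z) = 0 := by
  have hp : ∀ {A : ℂ → Fin 6 → ℝ}, ContDiff ℝ ∞ A → (∀ z, psForm 2 (A z) C = 0) → ∀ i z,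
      psForm 2 (pd i A z) C = 0 := fun {A} hA h0 i z => by
    have h1 : pd i (fun w => psForm 2 (A w) C) z = 0 := by simp only [h0, pd_const]
    rw [pd_psForm (G := fun _ => C) (smooth_differentiableAt hA z) (differentiableAt_const _),
      pd_const, psForm_zero_right, add_zero] at h1
    exact h1
  have h1 := hp hY.smooth h
  have h2 : ∀ i j z, psForm 2 (pd i (pd j Y) z) C = 0 := fun i j =>
    hp (hY.pd_smooth j) (h1 j) i
  have hN : psForm 2 (frameN Y z) C = 0 := by
    simp only [frameN, lap, psForm_add_left, psForm_smul_left, h2, h]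
    ring
  have hzz : psForm 2 (wz (wz (cx Y)) z) (toC C) = 0 := by
    rw [wz_wz_cx hY.smooth]
    simp only [psForm_sub_left, psForm_smul_left, psForm_toC, h2]
    simp
  have ex := (hF.adapted hY z).expand C
  rw [psForm_comm C (Y z), psForm_comm C (frameN Y z), psForm_comm C (pd 0 Y z),
    psForm_comm C (pd 1 Y z), h, hN, h1, h1] at ex
  simp only [neg_zero, zero_smul, zero_add, add_zero] at ex
  rw [hF.form_hopf_hopf hY]
  set u := -psForm 2 C (R z)
  set v := -psForm 2 C (L z)
  -- C is orthogonal to Y, its first derivatives and N, so C = uL + vR; being null, it lies on one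
  -- of the two normal null lines. Its orthogonality to Y_zz then kills λ_L or λ_R.
  have huv : u * v = 0 := by
    rw [ex] at hCC
    simp only [psForm_add_left, psForm_add_right, psForm_smul_left, psForm_smul_right, hF.LL, hF.RR,
      hF.LR, psForm_comm (R z) (L z)] at hCC
    linarith
  have hl : (u : ℂ) * lam Y L z + v * lam Y R z = 0 := by
    rw [ex, toC_add, toC_smul, toC_smul, psForm_add_right, psForm_smul_right, psForm_smul_right] at hzz
    rw [lam, lam]
    simp only [cx]
    linear_combination -hzz
  rcases mul_eq_zero.1 huv with hu | hv
  · have hv : (v : ℂ) ≠ 0 := by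
      intro hv
      apply hC0
      rw [ex, hu, Complex.ofReal_eq_zero.1 hv]
      simp
    rw [hu, Complex.ofReal_zero, zero_mul, zero_add] at hl
    rw [(mul_eq_zero.1 hl).resolve_left hv]
    ring
  · have hu : (u : ℂ) ≠ 0 := by
      intro hu
      apply hC0
      rw [ex, hv, Complex.ofReal_eq_zero.1 hu]
      simp
    rw [hv, Complex.ofReal_zero, zero_mul, add_zero] at hl
    rw [(mul_eq_zero.1 hl).resolve_left hu]
    ring

end

section

/-! ### Null-umbilic Willmore spheres -/

/-- The vanishing of κ passes to the other patch by the transition rule, and to its origin by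
continuity. -/
theorem isTotallyUmbilic_of_hopf {y : OnePoint ℂ → Q41} (hy : IsConformalSpacelike y)
    (h : ∀ Y, IsCanonicalLift 0 y Y → ∀ z, hopf Y z = 0) : IsTotallyUmbilic y := by
  intro i X hX
  fin_cases i
  · exact h X hX
  obtain ⟨Y, hY, hT⟩ := exists_transition' hy hX
  have h1 : Set.EqOn (hopf X) (fun _ => 0) {0}ᶜ := fun w hw => by
    rw [hT.symm.hopf_eq hw, h Y hY, smul_zero]
  exact fun z => congrFun
    (hT.canon'.hopf_smooth.continuous.ext_on (dense_compl_singleton 0) continuous_const h1) z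

theorem IsWillmore.hopf_eq_zero {y : OnePoint ℂ → Q41} (hy : IsConformalSpacelike y)
    (hW : IsWillmore y) {Y L R : ℂ → Fin 6 → ℝ} (hY : IsCanonicalLift 0 y Y) (hF : IsFrame Y L R)
    (h0 : ∀ z, psForm 2 (hopf Y z) (hopf Y z) = 0) :
    (∀ z, hopf Y z = 0) ∧ ∀ z, wz (cx (frameN Y)) z = 0 := by
  obtain ⟨Yt, hYt, hT⟩ := exists_transition hy hY
  exact hF.null_umbilic hT (isEulerLagrange_of_isWillmore hW hY hYt hT hF)
    (isEulerLagrange_of_isWillmore hW hY hYt hT hF.symm) h0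

/-- A null-umbilic Willmore sphere is totally umbilic. -/
theorem IsWillmore.isTotallyUmbilic {y : OnePoint ℂ → Q41} (hy : IsConformalSpacelike y)
    (hW : IsWillmore y) (h0 : IsNullUmbilic y) : IsTotallyUmbilic y :=
  isTotallyUmbilic_of_hopf hy fun Y hY => by
    obtain ⟨L, R, hF⟩ := exists_frame hY.isCanon
    exact (hW.hopf_eq_zero hy hY hF (h0 0 Y hY)).1

theorem willmore_eq_zero {y : OnePoint ℂ → Q41} (hy : IsConformalSpacelike y)
    (h : IsTotallyUmbilic y) : willmore y = 0 := by
  obtain ⟨Y, hY⟩ := exists_canonicalLift hy 0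
  rw [willmore_eq hY.1 fun z => by rw [hY.isCanon.gramDet_eq]; exact one_pos]
  refine MeasureTheory.integral_eq_zero_of_ae (.of_forall fun z => ?_)
  have := hY.isCanon.jetDensity_eq_hopf z
  rw [h 0 Y hY z, psForm_zero_left] at this
  exact_mod_cast this

/-! ### Polar surfaces are not Willmore spheres -/

/-- Differentiating the orthogonality relations shows that dX is orthogonal to Y, dY and N. The
plane spanned by dX then lies in the normal plane of Y, of signature (1,1), although it is positive
definite. -/
theorem IsFrame.not_polar {Y L R X : ℂ → Fin 6 → ℝ} (hF : IsFrame Y L R) (hY : IsCanon Y)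
    (hk : ∀ z, hopf Y z = 0) (hN : ∀ z, wz (cx (frameN Y)) z = 0) (hX : IsCanon X)
    (h0 : ∀ z, psForm 2 (Y z) (X z) = 0) (h1 : ∀ i z, psForm 2 (Y z) (pd i X z) = 0)
    (h2 : ∀ z, psForm 2 (Y z) (lap X z) = 0) : False := by
  have hp : ∀ {A B : ℂ → Fin 6 → ℝ}, ContDiff ℝ ∞ A → ContDiff ℝ ∞ B →
      (∀ z, psForm 2 (A z) (B z) = 0) → ∀ i z,
      psForm 2 (pd i A z) (B z) + psForm 2 (A z) (pd i B z) = 0 := fun {A B} hA hB h i z => by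
    have e : pd i (fun w => psForm 2 (A w) (B w)) z = 0 := by simp only [h, pd_const]
    rwa [pd_psForm (smooth_differentiableAt hA z) (smooth_differentiableAt hB z)] at e
  have h3 : ∀ i z, psForm 2 (pd i Y z) (X z) = 0 := fun i z => by
    have := hp hY.smooth hX.smooth h0 i z
    rwa [h1, add_zero] at this
  have h4 : ∀ i j z, psForm 2 (pd i (pd j Y) z) (X z) + psForm 2 (pd j Y z) (pd i X z) = 0 :=
    fun i j => hp (hY.pd_smooth j) hX.smooth (h3 j) i
  have h5 : ∀ i j z, psForm 2 (pd i Y z) (pd j X z) + psForm 2 (Y z) (pd i (pd j X) z) = 0 :=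
    fun i j => hp hY.smooth (hX.pd_smooth j) (h1 j) i
  -- Since κ = 0, Y_zz is a multiple of Y and hence orthogonal to X. So the Hessian of Y paired with
  -- X is pure trace, and the trace vanishes by the hypothesis on ΔX.
  have hzz : ∀ z, psForm 2 (wz (wz (cx Y)) z) (toC (X z)) = 0 := fun z => by
    have e := hopf_eq_wz Y z
    rw [hk, eq_comm, ← eq_neg_iff_add_eq_zero] at e
    rw [e, psForm_neg_left, psForm_smul_left, cx, psForm_toC, h0]
    simp
  have hre : ∀ z, psForm 2 (pd 0 (pd 0 Y) z) (X z) = psForm 2 (pd 1 (pd 1 Y) z) (X z) ∧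
      psForm 2 (pd 0 (pd 1 Y) z) (X z) = 0 := fun z => by
    have e := hzz z
    rw [wz_wz_cx hY.smooth] at e
    simp only [psForm_sub_left, psForm_smul_left, psForm_toC] at e
    have e1 := congrArg Complex.re e
    have e2 := congrArg Complex.im e
    simp at e1 e2
    exact ⟨by linarith, e2⟩
  have hlap : ∀ z, psForm 2 (pd 0 (pd 0 Y) z) (X z) = 0 ∧ psForm 2 (pd 1 (pd 1 Y) z) (X z) = 0 :=
      fun z => by
    have e := h2 z
    rw [lap, psForm_add_right] at e
    have a := h4 0 0 z
    have b := h4 1 1 z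
    have c := h5 0 0 z
    have d := h5 1 1 z
    have r := (hre z).1
    constructor <;> linarith
  have h6 : ∀ i j z, psForm 2 (pd j Y z) (pd i X z) = 0 := fun i j z => by
    have e : psForm 2 (pd i (pd j Y) z) (X z) = 0 := by
      fin_cases i <;> fin_cases j
      · exact (hlap z).1
      · exact (hre z).2
      · exact (pd_pd_comm hY.smooth.contDiffAt 1 0).symm ▸ (hre z).2
      · exact (hlap z).2
    simpa [e] using h4 i j z
  have hNX : ∀ z, psForm 2 (frameN Y z) (X z) = 0 := fun z => by
    rw [frameN, lap]
    simp only [psForm_add_left, psForm_smul_left, hlap, h0]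
    ring
  have hNd : ∀ i z, pd i (frameN Y) z = 0 := fun i z => by
    have e := hN z
    rw [wz_cx (smooth_differentiableAt hY.frameN_smooth z)] at e
    have e' := (smul_eq_zero.1 e).resolve_left (by norm_num)
    ext k
    have e1 := congrArg Complex.re (congrFun e' k)
    have e2 := congrArg Complex.im (congrFun e' k)
    simp [toC] at e1 e2
    fin_cases i
    · exact e1
    · exact e2
  have h7 : ∀ i z, psForm 2 (frameN Y z) (pd i X z) = 0 := fun i z => by
    have := hp hY.frameN_smooth hX.smooth hNX i z
    rwa [hNd, psForm_zero_left, zero_add] at this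
  have hA := hF.adapted hY 0
  have ex : ∀ i, pd i X 0 = (-psForm 2 (pd i X 0) (R 0)) • L 0 +
      (-psForm 2 (pd i X 0) (L 0)) • R 0 := fun i => by
    have := hA.expand (pd i X 0)
    rw [psForm_comm _ (frameN Y 0), psForm_comm _ (Y 0), psForm_comm _ (pd 0 Y 0),
      psForm_comm _ (pd 1 Y 0), h7, h1, h6, h6] at this
    simpa using this
  have hg : ∀ a b c d : ℝ, psForm 2 (a • L 0 + b • R 0) (c • L 0 + d • R 0) = -(a * d + b * c) := by
    intro a b c d
    simp only [psForm_add_left, psForm_add_right, psForm_smul_left, psForm_smul_right, hF.LL, hF.RR,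
      hF.LR, psForm_comm (R 0) (L 0)]
    ring
  have g00 := hX.form_pd_pd 0 0 0
  have g11 := hX.form_pd_pd 0 1 1
  have g01 := hX.form_pd_pd 0 0 1
  rw [ex 0, hg] at g00
  rw [ex 1, hg] at g11
  rw [ex 0, ex 1, hg] at g01
  simp at g00 g11 g01
  set a := psForm 2 (pd 0 X 0) (R 0)
  set b := psForm 2 (pd 0 X 0) (L 0)
  set c := psForm 2 (pd 1 X 0) (R 0)
  set d := psForm 2 (pd 1 X 0) (L 0)
  have e1 : a * b = -1 / 2 := by linarith
  have e2 : c * d = -1 / 2 := by linarith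
  -- Orthogonality gives ad = -bc, while (ad)(bc) = (ab)(cd) = 1/4.
  have e3 : (a * d) ^ 2 = -(1 / 4) := by
    linear_combination -(a * d) * g01 - (c * d) * e1 + 1 / 2 * e2
  nlinarith [sq_nonneg (a * d)]

theorem contDiff_phi0 : ContDiff ℝ ∞ phi0 := by
  rw [show phi0 = _ from funext phi0_eq]
  exact (incl.contDiff.add (((contDiff_psForm contDiff_id contDiff_id).div_const 2).smul
    contDiff_const)).add contDiff_const

theorem isOpen_chart_zero_notMem {F : Set (OnePoint ℂ)} (hF : F.Finite) :
    IsOpen {z | chart 0 z ∉ F} := by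
  have h : (chart 0 ⁻¹' F).Finite := hF.preimage fun a _ b _ h => by simpa [chart] using h
  exact h.isClosed.isOpen_compl

/-- A polar surface is normal to the central spheres of the stationary surface, hence orthogonal to
its vertex at infinity and null-umbilic. If Willmore, it has κ = 0 and N constant, which contradicts
`IsFrame.not_polar`. -/
theorem not_isPolarOfStationary {y : OnePoint ℂ → Q41} (hy : IsConformalSpacelike y)
    (hW : IsWillmore y) : ¬ IsPolarOfStationary y := by
  rintro ⟨x', ⟨hx', T, F, x, hT, hF, hst, -, hrep, -⟩, hpol⟩
  obtain ⟨Y, hY⟩ := exists_canonicalLift hy 0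
  obtain ⟨X, hX⟩ := exists_canonicalLift hx' 0
  obtain ⟨L, R, hYF⟩ := exists_frame hY.isCanon
  have horth : ∀ z, psForm 2 (Y z) (X z) = 0 ∧ (∀ i, psForm 2 (Y z) (pd i X z) = 0) ∧
      psForm 2 (Y z) (lap X z) = 0 := by
    intro z
    have key : ∀ v, Represents v (y (chart 0 z)) → psForm 2 v (X z) = 0 →
        (∀ i, psForm 2 v (pd i X z) = 0) → psForm 2 v (frameN X z) = 0 →
        psForm 2 (Y z) (X z) = 0 ∧ (∀ i, psForm 2 (Y z) (pd i X z) = 0) ∧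
          psForm 2 (Y z) (lap X z) = 0 := by
      intro v hv h0 h1 h2
      obtain ⟨c, -, hc⟩ := hv.exists_smul (hY.1.2 z)
      have h3 : psForm 2 v (lap X z) = 0 := by
        rw [frameN, psForm_add_right, psForm_smul_right, psForm_smul_right, h0] at h2
        linarith
      simp only [hc, psForm_smul_left, h0, h1, h3, mul_zero]
      exact ⟨trivial, fun _ => trivial, trivial⟩
    rcases hpol with h | h
    · obtain ⟨l, r, hf, hl⟩ := h 0 X hX z
      exact key l hl hf.orthL.1 hf.orthL.2.1 hf.orthL.2.2
    · obtain ⟨l, r, hf, hr⟩ := h 0 X hX z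
      exact key r hr hf.orthR.1 hf.orthR.2.1 hf.orthR.2.2
  set s : Set ℂ := {z | chart 0 z ∉ F}
  have hs : IsOpen s := isOpen_chart_zero_notMem hF
  have hxs : ∀ z ∈ s, ContDiffAt ℝ ∞ (x ∘ chart 0) z := fun z hz =>
    (hst 0).1.contDiffAt (hs.mem_nhds hz)
  have hPs : ∀ z ∈ s, ContDiffAt ℝ ∞ (fun w => T (phi0 ((x ∘ chart 0) w))) z := fun z hz =>
    (LinearMap.toContinuousLinearMap (T : (Fin 6 → ℝ) →ₗ[ℝ] (Fin 6 → ℝ))).contDiff.contDiffAt.comp z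
      (contDiff_phi0.contDiffAt.comp z (hxs z hz))
  obtain ⟨f, hfs, hf⟩ := exists_smooth_factor hPs (fun z _ => hX.1.1.contDiffAt)
    (fun z _ => hX.isCanon.ne_zero z) fun z hz => (hX.1.2 z).exists_smul (hrep _ hz)
  -- Known off the finite set of ends by stationarity, and everywhere by density.
  have hC : ∀ z, psForm 2 (Y z) (T infVec) = 0 := by
    have h1 : Set.EqOn (fun z => psForm 2 (Y z) (T infVec)) (fun _ => 0) s := fun z hz =>
      hT.form_infVec_eq_zero (hxs z hz) ((hst 0).2 z hz).1 ((hst 0).2 z hz).2 hX.isCanon (hfs z hz)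
        (Filter.mem_of_superset (hs.mem_nhds hz) fun w hw => (hf w hw).2) (horth z).1 (horth z).2.1
        (horth z).2.2
    have hd : Dense s := by
      have h : (chart 0 ⁻¹' F).Finite := hF.preimage fun a _ b _ h => by simpa [chart] using h
      exact h.countable.dense_compl ℝ
    exact fun z => congrFun (Continuous.ext_on hd
      (contDiff_psForm hY.1.1 contDiff_const).continuous continuous_const h1) z
  have hC0 : T infVec ≠ 0 := fun h => infVec_ne_zero ((LinearEquiv.map_eq_zero_iff T).1 h)
  obtain ⟨hk, hN⟩ := hW.hopf_eq_zero hy hY hYF fun z =>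
    hYF.form_hopf_eq_zero hY.isCanon hC0 (by rw [hT, psForm_infVec_infVec]) hC z
  exact hYF.not_polar hY.isCanon hk hN hX.isCanon (fun z => (horth z).1) (fun i z => (horth z).2.1 i)
    fun z => (horth z).2.2

end

section

/-! ### Transitivity of `O(4,2)` on null vectors -/

/-- The reflection in the hyperplane orthogonal to a nonisotropic vector. -/
def psReflection (u : Fin 6 → ℝ) (hu : psForm 2 u u ≠ 0) : (Fin 6 → ℝ) ≃ₗ[ℝ] (Fin 6 → ℝ) :=
  LinearEquiv.ofInvolutive
    { toFun := fun v => v - (2 * psForm 2 v u / psForm 2 u u) • u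
      map_add' := fun v w => by rw [psForm_add_left]; module
      map_smul' := fun c v => by rw [psForm_smul_left, RingHom.id_apply]; module }
    (fun v => by
      simp only [LinearMap.coe_mk, AddHom.coe_mk, psForm_sub_left, psForm_smul_left]
      match_scalars
      · ring
      · field_simp
        ring)

theorem psReflection_apply (u : Fin 6 → ℝ) (hu : psForm 2 u u ≠ 0) (v : Fin 6 → ℝ) :
    psReflection u hu v = v - (2 * psForm 2 v u / psForm 2 u u) • u := rfl

theorem isO42_psReflection (u : Fin 6 → ℝ) (hu : psForm 2 u u ≠ 0) : IsO42 (psReflection u hu) := by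
  intro v w
  simp only [psReflection_apply, psForm_sub_left, psForm_sub_right, psForm_smul_left,
    psForm_smul_right, psForm_comm u w]
  field_simp
  ring

theorem IsO42.trans {S T : (Fin 6 → ℝ) ≃ₗ[ℝ] (Fin 6 → ℝ)} (hS : IsO42 S) (hT : IsO42 T) :
    IsO42 (S.trans T) := fun v w => by
  rw [LinearEquiv.trans_apply, LinearEquiv.trans_apply, hT, hS]

/-- The difference a - b is not null, and the reflection in its orthogonal hyperplane exchanges a
and b. -/
theorem exists_isO42_of_form_ne_zero {a b : Fin 6 → ℝ} (ha : psForm 2 a a = 0)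
    (hb : psForm 2 b b = 0) (h : psForm 2 a b ≠ 0) : ∃ T, IsO42 T ∧ T a = b := by
  have hu : psForm 2 (a - b) (a - b) = -2 * psForm 2 a b := by
    simp only [psForm_sub_left, psForm_sub_right, ha, hb, psForm_comm b a]
    ring
  refine ⟨psReflection (a - b) (by rw [hu]; simpa using h), isO42_psReflection _ _, ?_⟩
  rw [psReflection_apply, hu, psForm_sub_right, ha]
  match_scalars <;> field_simp <;> ring

theorem psForm_phi0_phi0 (w : Fin 4 → ℝ) : psForm 2 (phi0 w) (phi0 w) = 0 := by
  rw [psForm_two_six, phi0, psForm_one_four]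
  simp
  ring

/-- Every null vector is the image of the vertex of the light cone at infinity. -/
theorem exists_isO42 {C : Fin 6 → ℝ} (hC0 : C ≠ 0) (hC : psForm 2 C C = 0) :
    ∃ T, IsO42 T ∧ T infVec = C := by
  by_cases h : psForm 2 infVec C = 0
  -- When C is orthogonal to the vertex, two reflections are composed through an intermediate null
  -- vector φ₀(w); every such vector pairs to -1 with the vertex.
  · suffices ∃ w : Fin 4 → ℝ, psForm 2 (phi0 w) C ≠ 0 by
      obtain ⟨w, hw⟩ := this
      have h1 : psForm 2 infVec (phi0 w) ≠ 0 := by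
        have : psForm 2 infVec (phi0 w) = -1 := by
          rw [psForm_two_six, phi0, infVec]
          simp
          ring
        rw [this]
        norm_num
      obtain ⟨S, hS, hS'⟩ := exists_isO42_of_form_ne_zero psForm_infVec_infVec (psForm_phi0_phi0 w) h1
      obtain ⟨T, hT, hT'⟩ := exists_isO42_of_form_ne_zero (psForm_phi0_phi0 w) hC hw
      exact ⟨S.trans T, hS.trans hT, by rw [LinearEquiv.trans_apply, hS', hT']⟩
    have h05 : C 0 = C 5 := by
      rw [psForm_two_six, infVec] at h
      simp at h
      linarith
    have hform : ∀ w : Fin 4 → ℝ, psForm 2 (phi0 w) C =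
        -C 0 + (w 0 * C 1 + w 1 * C 2 + w 2 * C 3 - w 3 * C 4) := by
      intro w
      rw [psForm_two_six, phi0, ← h05]
      simp
      ring
    by_cases h0 : C 0 = 0
    -- This choice turns the pairing into the Euclidean square of the middle coordinates of C.
    · refine ⟨![C 1, C 2, C 3, -C 4], fun hz => hC0 ?_⟩
      have hs : C 1 ^ 2 + C 2 ^ 2 + C 3 ^ 2 + C 4 ^ 2 = 0 := by
        rw [hform, h0] at hz
        simp at hz
        linarith
      ext k
      fin_cases k <;> simp only [Fin.isValue, Fin.reduceFinMk, Pi.zero_apply, ← h05, h0] <;>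
        nlinarith [sq_nonneg (C 1), sq_nonneg (C 2), sq_nonneg (C 3), sq_nonneg (C 4)]
    · exact ⟨0, by rw [hform]; simpa using h0⟩
  · exact exists_isO42_of_form_ne_zero psForm_infVec_infVec hC h

/-! ### The affine chart of a null direction -/

/-- The projection onto the four middle coordinates. -/
def mid : (Fin 6 → ℝ) →L[ℝ] (Fin 4 → ℝ) :=
  LinearMap.toContinuousLinearMap
    { toFun := fun v => ![v 1, v 2, v 3, v 4]
      map_add' := fun x y => by ext i; fin_cases i <;> simp
      map_smul' := fun c x => by ext i; fin_cases i <;> simp }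

theorem mid_apply (v : Fin 6 → ℝ) : mid v = ![v 1, v 2, v 3, v 4] := rfl

theorem psForm_infVec (v : Fin 6 → ℝ) : psForm 2 v infVec = v 0 - v 5 := by
  rw [psForm_two_six, infVec]
  simp

/-- The affine coordinate of `T ∘ φ₀`, extended linearly. -/
def affineMap (T : (Fin 6 → ℝ) ≃ₗ[ℝ] (Fin 6 → ℝ)) : (Fin 6 → ℝ) →L[ℝ] (Fin 4 → ℝ) :=
  mid.comp (LinearMap.toContinuousLinearMap (T.symm : (Fin 6 → ℝ) →ₗ[ℝ] (Fin 6 → ℝ)))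

theorem affineMap_apply (T : (Fin 6 → ℝ) ≃ₗ[ℝ] (Fin 6 → ℝ)) (v : Fin 6 → ℝ) :
    affineMap T v = mid (T.symm v) := rfl

section AffineMap

variable {T : (Fin 6 → ℝ) ≃ₗ[ℝ] (Fin 6 → ℝ)}

theorem IsO42.symm (hT : IsO42 T) : IsO42 T.symm := fun v w => by
  rw [← hT, T.apply_symm_apply, T.apply_symm_apply]

theorem IsO42.form_infVec (hT : IsO42 T) (v : Fin 6 → ℝ) :
    psForm 2 v (T infVec) = T.symm v 0 - T.symm v 5 := by
  rw [← psForm_infVec, ← hT.symm v, T.symm_apply_apply]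

/-- On the hyperplane orthogonal to the vertex the outer coordinates of T⁻¹v agree, so their
contributions cancel and the projection is isometric modulo the vertex. -/
theorem IsO42.psForm_affineMap (hT : IsO42 T) {v w : Fin 6 → ℝ} (hv : psForm 2 v (T infVec) = 0)
    (hw : psForm 2 w (T infVec) = 0) :
    psForm 1 (affineMap T v) (affineMap T w) = psForm 2 v w := by
  rw [hT.form_infVec, sub_eq_zero] at hv hw
  rw [← hT.symm v w, psForm_two_six, psForm_one_four, affineMap_apply, affineMap_apply, mid_apply,
    mid_apply, hv, hw]
  simp
  ring

theorem affineMap_infVec : affineMap T (T infVec) = 0 := by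
  rw [affineMap_apply, T.symm_apply_apply, mid_apply, infVec]
  ext i
  fin_cases i <;> rfl

theorem IsO42.phi0_affineMap (hT : IsO42 T) {v : Fin 6 → ℝ} (hv : psForm 2 v v = 0)
    (h : psForm 2 v (T infVec) = -1) : T (phi0 (affineMap T v)) = v := by
  rw [← hT.symm v v, psForm_two_six] at hv
  rw [hT.form_infVec] at h
  have h5 : T.symm v 5 = T.symm v 0 + 1 := by linarith
  rw [h5] at hv
  rw [← LinearEquiv.eq_symm_apply, phi0, psForm_one_four, affineMap_apply, mid_apply]
  ext k
  fin_cases k <;> simp [h5] <;> linarith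

end AffineMap

end

section

/-! ### Constant null vectors in the central sphere -/

/-- `C` is a constant null vector that lies in all central spheres of the canonical lift `Y`. -/
structure IsDual (Y : ℂ → Fin 6 → ℝ) (C : Fin 6 → ℝ) : Prop where
  canon : IsCanon Y
  ne_zero : C ≠ 0
  null : psForm 2 C C = 0
  eq : ∀ z, C = (-psForm 2 C (frameN Y z)) • Y z + (-psForm 2 C (Y z)) • frameN Y z +
    psForm 2 C (pd 0 Y z) • pd 0 Y z + psForm 2 C (pd 1 Y z) • pd 1 Y z

theorem IsFrame.isDual {Y L R : ℂ → Fin 6 → ℝ} (hF : IsFrame Y L R) (hY : IsCanon Y)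
    {C : Fin 6 → ℝ} (h0 : C ≠ 0) (hC : psForm 2 C C = 0)
    (h : ∀ z, psForm 2 C (L z) = 0 ∧ psForm 2 C (R z) = 0) : IsDual Y C :=
  ⟨hY, h0, hC, fun z => by
    have := (hF.adapted hY z).expand C
    rw [(h z).1, (h z).2] at this
    simpa using this⟩

/-- The central spheres of the canonical lifts over the two patches agree. -/
theorem IsTransition.form_eq_zero {Y Yt : ℂ → Fin 6 → ℝ} (hT : IsTransition Y Yt) {C : Fin 6 → ℝ}
    (hC : IsDual Y C) {z : ℂ} (hz : z ≠ 0) {ξ : Fin 6 → ℝ} (h0 : psForm 2 ξ (Yt z⁻¹) = 0)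
    (h1 : ∀ i, psForm 2 ξ (pd i Yt z⁻¹) = 0) (h2 : psForm 2 ξ (lap Yt z⁻¹) = 0) :
    psForm 2 C ξ = 0 := by
  have t0 : psForm 2 (toC ξ) (cx Yt z⁻¹) = 0 := by rw [cx, psForm_toC, h0, Complex.ofReal_zero]
  have t1 : psForm 2 (toC ξ) (wz (cx Yt) z⁻¹) = 0 := by
    simp only [hT.canon'.wz_eq, psForm_smul_right, psForm_sub_right, psForm_toC, h1]
    simp
  have t2 : psForm 2 (toC ξ) (wzb (cx Yt) z⁻¹) = 0 := by
    simp only [hT.canon'.wzb_eq, psForm_smul_right, psForm_add_right, psForm_toC, h1]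
    simp
  have t3 : psForm 2 (toC ξ) (wzb (wz (cx Yt)) z⁻¹) = 0 := by
    rw [wzb_wz_cx hT.canon'.smooth, psForm_smul_right, psForm_toC, h2]
    simp
  have s0 : psForm 2 (Y z) ξ = 0 := by
    rw [hT.eq z hz, psForm_smul_left, psForm_comm, h0, mul_zero]
  have s1 : psForm 2 (pd 0 Y z) ξ = 0 ∧ psForm 2 (pd 1 Y z) ξ = 0 := by
    have e : psForm 2 (toC ξ) (wz (cx Y) z) = 0 := by
      rw [hT.wz_eq hz]
      simp only [psForm_sub_right, psForm_smul_right, t0, t1]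
      ring
    rw [hT.canon.wz_eq, psForm_smul_right, psForm_sub_right, psForm_smul_right, psForm_toC,
      psForm_toC, psForm_comm ξ, psForm_comm ξ] at e
    have e1 := congrArg Complex.re e
    have e2 := congrArg Complex.im e
    simp at e1 e2
    exact ⟨e1, e2⟩
  have s2 : psForm 2 (lap Y z) ξ = 0 := by
    have e : psForm 2 (toC ξ) (wzb (wz (cx Y)) z) = 0 := by
      rw [hT.wzbwz_eq hz]
      simp only [psForm_sub_right, psForm_add_right, psForm_smul_right, t0, t1, t2, t3]
      ring
    rw [wzb_wz_cx hT.canon.smooth, psForm_smul_right, psForm_toC, psForm_comm ξ] at e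
    simpa using e
  rw [hC.eq z, frameN]
  simp only [psForm_add_left, psForm_smul_left, s0, s1.1, s1.2, s2]
  ring

/-- Central spheres do not depend on the patch where the patches overlap; the point at infinity
follows by continuity of the normal frame. -/
theorem IsDual.transition {Y Yt : ℂ → Fin 6 → ℝ} {C : Fin 6 → ℝ} (hC : IsDual Y C)
    (hT : IsTransition Y Yt) : IsDual Yt C := by
  obtain ⟨L, R, hF⟩ := exists_frame hT.canon'
  have key : ∀ {L R : ℂ → Fin 6 → ℝ}, IsFrame Yt L R → ∀ z, psForm 2 C (L z) = 0 := by
    intro L R hF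
    have h1 : Set.EqOn (fun z => psForm 2 C (L z)) (fun _ => 0) {0}ᶜ := fun z hz => by
      have hz' : z⁻¹ ≠ 0 := inv_ne_zero hz
      exact hT.form_eq_zero hC hz' (by rw [inv_inv, hF.LY]) (fun i => by rw [inv_inv, hF.Lpd])
        (by rw [inv_inv, hF.Llap])
    exact fun z => congrFun (Continuous.ext_on (dense_compl_singleton 0)
      (contDiff_psForm contDiff_const hF.smoothL).continuous continuous_const h1) z
  exact hF.isDual hT.canon' hC.ne_zero hC.null fun z => ⟨key hF z, key hF.symm z⟩

namespace IsDual

variable {Y : ℂ → Fin 6 → ℝ} {C : Fin 6 → ℝ}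

theorem smooth_form (h : IsDual Y C) : ContDiff ℝ ∞ fun z => psForm 2 (Y z) C :=
  contDiff_psForm h.canon.smooth contDiff_const

theorem pd_form {A : ℂ → Fin 6 → ℝ} (hA : ContDiff ℝ ∞ A) (C : Fin 6 → ℝ) (i : Fin 2) (z : ℂ) :
    pd i (fun w => psForm 2 (A w) C) z = psForm 2 (pd i A z) C := by
  rw [pd_psForm (G := fun _ => C) (smooth_differentiableAt hA z) (differentiableAt_const _),
    pd_const, psForm_zero_right, add_zero]

/-- This is ⟨C,C⟩ = 0 written in the central sphere. In particular the gradient of ⟨Y,C⟩ vanishes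
wherever ⟨Y,C⟩ does. -/
theorem grad_sq (h : IsDual Y C) (z : ℂ) :
    psForm 2 (pd 0 Y z) C ^ 2 + psForm 2 (pd 1 Y z) C ^ 2 =
      2 * psForm 2 (Y z) C * psForm 2 (frameN Y z) C := by
  have e : psForm 2 ((-psForm 2 C (frameN Y z)) • Y z + (-psForm 2 C (Y z)) • frameN Y z +
      psForm 2 C (pd 0 Y z) • pd 0 Y z + psForm 2 C (pd 1 Y z) • pd 1 Y z) C = 0 := by
    rw [← h.eq z, h.null]
  simp only [psForm_add_left, psForm_smul_left, psForm_comm C] at e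
  linarith

/-- The zeros of `⟨Y, C⟩` are isolated. -/
theorem eventually_ne (h : IsDual Y C) {z : ℂ} (hz : psForm 2 (Y z) C = 0) :
    ∀ᶠ w in nhdsWithin z {z}ᶜ, psForm 2 (Y w) C ≠ 0 := by
  have hg := h.grad_sq
  have hgr : ∀ w, psForm 2 (Y w) C = 0 → psForm 2 (pd 0 Y w) C = 0 ∧ psForm 2 (pd 1 Y w) C = 0 := by
    intro w hw
    have e := hg w
    rw [hw] at e
    constructor <;> nlinarith [sq_nonneg (psForm 2 (pd 0 Y w) C), sq_nonneg (psForm 2 (pd 1 Y w) C)]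
  set n := psForm 2 (frameN Y z) C with hn
  -- At a zero only the Y-term of the expansion survives. The Hessian of ⟨Y,C⟩ there is then n times
  -- the identity, because ⟨Y, Y_ij⟩ = -δ_ij.
  have hC : C = (-n) • Y z := by
    have e := h.eq z
    rw [psForm_comm C (Y z), hz, psForm_comm C (pd 0 Y z), psForm_comm C (pd 1 Y z),
      (hgr z hz).1, (hgr z hz).2, psForm_comm C] at e
    simpa using e
  have hn0 : n ≠ 0 := by
    rintro h0
    rw [h0] at hC
    exact h.ne_zero (by simpa using hC)
  have hij : ∀ i j, psForm 2 (pd i (pd j Y) z) C = if i = j then n else 0 := by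
    intro i j
    rw [hC, psForm_smul_right, psForm_comm, h.canon.form_self_pdpd]
    split_ifs <;> simp
  set G : ℂ → ℂ := fun w => ((psForm 2 (pd 0 Y w) C : ℝ) : ℂ) +
    Complex.I * ((psForm 2 (pd 1 Y w) C : ℝ) : ℂ) with hG
  have hs : ∀ i, ContDiff ℝ ∞ fun w => psForm 2 (pd i Y w) C := fun i =>
    contDiff_psForm (h.canon.pd_smooth i) contDiff_const
  have hsc : ∀ i, ContDiff ℝ ∞ fun w => ((psForm 2 (pd i Y w) C : ℝ) : ℂ) := fun i =>
    Complex.ofRealCLM.contDiff.comp (hs i)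
  have hGs : ContDiff ℝ ∞ G := (hsc 0).add (contDiff_const.mul (hsc 1))
  have hpd : ∀ i, pd i G z = ((psForm 2 (pd i (pd 0 Y) z) C : ℝ) : ℂ) +
      Complex.I * ((psForm 2 (pd i (pd 1 Y) z) C : ℝ) : ℂ) := by
    intro i
    have d0 := smooth_differentiableAt (hsc 0) z
    have d1 := smooth_differentiableAt (hsc 1) z
    rw [hG, pd_add d0 ((differentiableAt_const _).fun_mul d1), pd_mul (differentiableAt_const _) d1,
      pd_const, pd_ofReal (smooth_differentiableAt (hs 0) z),
      pd_ofReal (smooth_differentiableAt (hs 1) z), pd_form (h.canon.pd_smooth 0),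
      pd_form (h.canon.pd_smooth 1)]
    simp
  have hfd : ∀ v, fderiv ℝ G z v = n * v := by
    intro v
    rw [fderiv_apply_eq_pd, hpd, hpd, hij, hij, hij, hij]
    conv_rhs => rw [← Complex.re_add_im v]
    simp only [if_true, Fin.isValue, zero_ne_one, one_ne_zero, if_false, Complex.ofReal_zero,
      mul_zero, add_zero, zero_add, Complex.real_smul]
    ring
  -- The gradient, packed as the complex function G, has the invertible derivative v ↦ nv, so its
  -- zeros are isolated; every zero of ⟨Y,C⟩ is among them.
  have := (smooth_differentiableAt hGs z).hasFDerivAt.eventually_ne (c := 0)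
    ⟨‖n‖₊⁻¹, (fderiv ℝ G z).antilipschitz_of_bound fun v => by
      rw [hfd, norm_mul, Complex.norm_real, NNReal.coe_inv, coe_nnnorm,
        inv_mul_cancel_left₀ (norm_ne_zero_iff.2 hn0)]⟩
  refine this.mono fun w hw h0 => hw ?_
  simp [hG, hgr w h0]

theorem finite_zeros (h : IsDual Y C) (r : ℝ) : {z | ‖z‖ ≤ r ∧ psForm 2 (Y z) C = 0}.Finite := by
  by_contra hinf
  have hK : IsCompact {z | ‖z‖ ≤ r ∧ psForm 2 (Y z) C = 0} := by
    have : {z | ‖z‖ ≤ r ∧ psForm 2 (Y z) C = 0} =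
        Metric.closedBall 0 r ∩ {z | psForm 2 (Y z) C = 0} := by
      ext z; simp
    rw [this]
    exact (isCompact_closedBall 0 r).inter_right
      (isClosed_eq h.smooth_form.continuous continuous_const)
  obtain ⟨z, hz, hacc⟩ := Set.Infinite.exists_accPt_of_subset_isCompact hinf hK subset_rfl
  exact (accPt_iff_frequently_nhdsNE.1 hacc) ((h.eventually_ne hz.2).mono fun w hw hw' => hw hw'.2)

/-- The lift with `⟨P, C⟩ = -1`. -/
theorem lap_normalized (h : IsDual Y C) {z : ℂ} (hz : psForm 2 (Y z) C ≠ 0) :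
    lap (fun w => (-psForm 2 (Y w) C)⁻¹ • Y w) z = (2 / psForm 2 (Y z) C ^ 2) • C := by
  have hY := h.canon
  set g : ℂ → ℝ := fun w => psForm 2 (Y w) C with hg
  have hgs : ContDiff ℝ ∞ g := h.smooth_form
  have hne : ∀ᶠ w in nhds z, g w ≠ 0 := hgs.continuous.continuousAt.eventually_ne hz
  have dg := smooth_differentiableAt hgs
  have dY := smooth_differentiableAt hY.smooth
  have hgi : ∀ i w, pd i g w = psForm 2 (pd i Y w) C := fun i w => pd_form hY.smooth C i w
  have hgis : ∀ i, ContDiff ℝ ∞ (pd i g) := fun i => contDiff_pd hgs i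
  have hgii : ∀ i w, pd i (pd i g) w = psForm 2 (pd i (pd i Y) w) C := fun i w => by
    rw [show pd i g = fun w => psForm 2 (pd i Y w) C from funext (hgi i), pd_form (hY.pd_smooth i)]
  have hf : ∀ i w, g w ≠ 0 → pd i (fun w => (-g w)⁻¹) w = pd i g w * ((g w)⁻¹ * (g w)⁻¹) := by
    intro i w hw
    have e : (fun w => (-g w)⁻¹) = fun w => (-1 : ℝ) * (g w)⁻¹ := by
      ext w; rw [inv_neg]; ring
    rw [e, pd_mul (differentiableAt_const _) ((dg w).fun_inv hw), pd_const, pd_inv (dg w) hw]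
    field_simp
    ring
  have h1 : ∀ i w, g w ≠ 0 → pd i (fun w => (-g w)⁻¹ • Y w) w =
      (pd i g w * ((g w)⁻¹ * (g w)⁻¹)) • Y w + (-g w)⁻¹ • pd i Y w := by
    intro i w hw
    rw [pd_smul (((dg w).fun_neg).fun_inv (neg_ne_zero.2 hw)) (dY w), hf i w hw]
  have h2 : ∀ i, pd i (pd i fun w => (-g w)⁻¹ • Y w) z =
      (pd i (pd i g) z * (g z)⁻¹ ^ 2 - 2 * pd i g z ^ 2 * (g z)⁻¹ ^ 3) • Y z +
        (2 * pd i g z * (g z)⁻¹ ^ 2) • pd i Y z + (-g z)⁻¹ • pd i (pd i Y) z := by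
    intro i
    have di := (dg z).fun_inv hz
    have dn := ((dg z).fun_neg).fun_inv (neg_ne_zero.2 hz)
    have dgi := smooth_differentiableAt (hgis i) z
    have dYi := smooth_differentiableAt (hY.pd_smooth i) z
    have dm := dgi.fun_mul (di.fun_mul di)
    rw [pd_congr (hne.mono fun w hw => h1 i w hw), pd_add (dm.fun_smul (dY z)) (dn.fun_smul dYi),
      pd_smul dm (dY z), pd_smul dn dYi, hf i z hz, pd_mul dgi (di.fun_mul di), pd_mul di di,
      pd_inv (dg z) hz]
    match_scalars <;> field_simp <;> ring
  have hgrad := h.grad_sq z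
  -- The coefficient q cancels in the end. What remains is the expansion of C in the central sphere,
  -- with `grad_sq` disposing of the squared gradient.
  obtain ⟨q, hlapY⟩ : ∃ q : ℝ, lap Y z = (2 : ℝ) • frameN Y z - q • Y z :=
    ⟨1 / 4 * psForm 2 (lap Y z) (lap Y z), by rw [frameN]; module⟩
  have hlapg : pd 0 (pd 0 g) z + pd 1 (pd 1 g) z = 2 * psForm 2 (frameN Y z) C - q * g z := by
    rw [hgii, hgii, ← psForm_add_left]
    change psForm 2 (lap Y z) C = _
    rw [hlapY, psForm_sub_left, psForm_smul_left, psForm_smul_left]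
  have hsum : lap (fun w => (-g w)⁻¹ • Y w) z =
      ((pd 0 (pd 0 g) z + pd 1 (pd 1 g) z) * (g z)⁻¹ ^ 2 -
        2 * (pd 0 g z ^ 2 + pd 1 g z ^ 2) * (g z)⁻¹ ^ 3) • Y z +
        (2 * pd 0 g z * (g z)⁻¹ ^ 2) • pd 0 Y z + (2 * pd 1 g z * (g z)⁻¹ ^ 2) • pd 1 Y z +
        (-g z)⁻¹ • lap Y z := by
    rw [lap, h2, h2, lap]
    module
  change lap (fun w => (-g w)⁻¹ • Y w) z = (2 / g z ^ 2) • C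
  rw [hsum, hlapg, hgi, hgi, hgrad, hlapY]
  conv_rhs => rw [h.eq z, psForm_comm C, psForm_comm C, psForm_comm C, psForm_comm C]
  change _ = (2 / g z ^ 2) • ((-psForm 2 (frameN Y z) C) • Y z + (-g z) • frameN Y z + _ + _)
  change (_ - 2 * (2 * g z * _) * _) • Y z + _ + _ + _ = _
  have hz' : g z ≠ 0 := hz
  match_scalars <;> field_simp <;> ring

end IsDual

end

section

/-! ### Topology of the two patches -/

theorem continuous_chart (i : Fin 2) : Continuous (chart i) := by
  fin_cases i
  · exact OnePoint.continuous_coe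
  refine continuous_iff_continuousAt.2 fun z => ?_
  by_cases hz : z = 0
  · subst hz
    rw [continuousAt_iff_punctured_nhds]
    have h1 : Filter.Tendsto (fun w : ℂ => ((w⁻¹ : ℂ) : OnePoint ℂ)) (nhdsWithin 0 {0}ᶜ)
        (nhds OnePoint.infty) := by
      refine OnePoint.tendsto_coe_infty.comp ?_
      rw [Filter.coclosedCompact_eq_cocompact, ← Metric.cobounded_eq_cocompact]
      exact Filter.tendsto_inv₀_nhdsNE_zero
    have h2 : chart 1 0 = OnePoint.infty := by simp [chart]
    change Filter.Tendsto (chart 1) _ (nhds (chart 1 0))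
    rw [h2]
    refine h1.congr' ?_
    filter_upwards [self_mem_nhdsWithin] with w hw
    have hw' : w ≠ 0 := hw
    simp [chart, hw']
  · have h1 : ContinuousAt (fun w : ℂ => ((w⁻¹ : ℂ) : OnePoint ℂ)) z :=
      OnePoint.continuous_coe.continuousAt.comp (continuousAt_inv₀ hz)
    refine h1.congr ?_
    filter_upwards [eventually_ne_zero hz] with w hw
    simp [chart, hw]

theorem chart_inv (i : Fin 2) {z : ℂ} (hz : z ≠ 0) : chart (1 - i) z⁻¹ = chart i z := by
  fin_cases i <;> simp [chart, hz]

theorem exists_chart (p : OnePoint ℂ) : ∃ i z, ‖z‖ ≤ 1 ∧ chart i z = p := by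
  induction p using OnePoint.rec with
  | infty => exact ⟨1, 0, by simp, by simp [chart]⟩
  | coe z =>
    rcases le_or_gt ‖z‖ 1 with h | h
    · exact ⟨0, z, h, rfl⟩
    · have hz : z ≠ 0 := by rintro rfl; simp at h; linarith
      exact ⟨1, z⁻¹, by rw [norm_inv]; exact inv_le_one_of_one_le₀ h.le, chart_one_inv hz⟩

/-- Near each time, a `C¹` path runs in one patch, starting in its closed unit disc. -/
theorem IsC1Path.exists_chart {γ : ℝ → OnePoint ℂ} (hγ : IsC1Path γ) (t : ℝ) :
    ∃ (i : Fin 2) (c : ℝ → ℂ), ContDiffAt ℝ 1 c t ∧ ‖c t‖ ≤ 1 ∧ γ =ᶠ[nhds t] chart i ∘ c := by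
  obtain ⟨i, c, hc, h⟩ := hγ t
  -- Inversion maps the outside of the unit disc into it, so estimates are needed on two compact
  -- discs only.
  rcases le_or_gt ‖c t‖ 1 with h1 | h1
  · exact ⟨i, c, hc, h1, h⟩
  · have hz : c t ≠ 0 := by intro h0; rw [h0, norm_zero] at h1; linarith
    refine ⟨1 - i, fun s => (c s)⁻¹, hc.inv hz, ?_, ?_⟩
    · rw [norm_inv]
      exact inv_le_one_of_one_le₀ h1.le
    · filter_upwards [h, hc.continuousAt.eventually_ne hz] with s hs hs0
      rw [hs, Function.comp_apply, Function.comp_apply, chart_inv i hs0]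

/-! ### The stationary surface of a dual vector -/

/-- Some vector that represents a point. -/
def someRep (p : Q41) : Fin 6 → ℝ := (p : ℙ ℝ (Fin 6 → ℝ)).rep

theorem represents_someRep (p : Q41) : Represents (someRep p) p :=
  ⟨Projectivization.rep_nonzero _, by
    rw [Projectivization.submodule_eq]; exact Submodule.mem_span_singleton_self _⟩

/-- The affine coordinate of a point, with respect to `T ∘ φ₀`. -/
def affinePoint (T : (Fin 6 → ℝ) ≃ₗ[ℝ] (Fin 6 → ℝ)) (p : Q41) : Fin 4 → ℝ :=
  affineMap T ((-psForm 2 (someRep p) (T infVec))⁻¹ • someRep p)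

theorem affinePoint_eq (T : (Fin 6 → ℝ) ≃ₗ[ℝ] (Fin 6 → ℝ)) {p : Q41} {v : Fin 6 → ℝ}
    (h : Represents v p) : affinePoint T p = affineMap T ((-psForm 2 v (T infVec))⁻¹ • v) := by
  obtain ⟨c, hc, e⟩ := h.exists_smul (represents_someRep p)
  rw [affinePoint, e, psForm_smul_left, smul_smul, ← mul_neg, mul_inv]
  congr 2
  field_simp

/-- The points sent to the light cone with vertex `C`. -/
def endSet (y : OnePoint ℂ → Q41) (C : Fin 6 → ℝ) : Set (OnePoint ℂ) :=
  {p | psForm 2 (someRep (y p)) C = 0}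

theorem mem_endSet_iff {y : OnePoint ℂ → Q41} {C v : Fin 6 → ℝ} {p : OnePoint ℂ}
    (h : Represents v (y p)) : p ∈ endSet y C ↔ psForm 2 v C = 0 := by
  obtain ⟨c, hc, e⟩ := h.exists_smul (represents_someRep (y p))
  simp [endSet, e, psForm_smul_left, hc]

/-- A point is close to the light cone with vertex `C` if this is small. -/
def endDist (y : OnePoint ℂ → Q41) (C : Fin 6 → ℝ) (p : OnePoint ℂ) : ℝ :=
  psForm 2 (someRep (y p)) C ^ 2 / ∑ k, someRep (y p) k ^ 2

theorem endDist_eq {y : OnePoint ℂ → Q41} {C v : Fin 6 → ℝ} {p : OnePoint ℂ}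
    (h : Represents v (y p)) : endDist y C p = psForm 2 v C ^ 2 / ∑ k, v k ^ 2 := by
  obtain ⟨c, hc, e⟩ := h.exists_smul (represents_someRep (y p))
  have h1 : ∑ k, (c • v) k ^ 2 = c ^ 2 * ∑ k, v k ^ 2 := by
    rw [Finset.mul_sum]
    exact Finset.sum_congr rfl fun k _ => by simp; ring
  rw [endDist, e, h1, psForm_smul_left, mul_pow, mul_div_mul_left _ _ (pow_ne_zero 2 hc)]

section Construction

variable {y : OnePoint ℂ → Q41} {Y : Fin 2 → ℂ → Fin 6 → ℝ}
  {T : (Fin 6 → ℝ) ≃ₗ[ℝ] (Fin 6 → ℝ)}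

theorem chart_mem_endSet_iff {i : Fin 2} {Z : ℂ → Fin 6 → ℝ} (hZ : IsLift i y Z) (C : Fin 6 → ℝ)
    (z : ℂ) : chart i z ∈ endSet y C ↔ psForm 2 (Z z) C = 0 :=
  mem_endSet_iff (hZ.2 z)

/-- The two closed unit discs cover the sphere, and each contains finitely many zeros. -/
theorem finite_endSet {C : Fin 6 → ℝ} (hY : ∀ i, IsLift i y (Y i)) (hC : ∀ i, IsDual (Y i) C) :
    (endSet y C).Finite := by
  refine (Set.finite_iUnion fun i => ((hC i).finite_zeros 1).image (chart i)).subset fun p hp => ?_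
  obtain ⟨i, z, hz, rfl⟩ := exists_chart p
  exact Set.mem_iUnion.2 ⟨i, z, ⟨hz, (chart_mem_endSet_iff (hY i) C z).1 hp⟩, rfl⟩

theorem affinePoint_comp_chart {i : Fin 2} {Z : ℂ → Fin 6 → ℝ} (hZ : IsLift i y Z) :
    (fun p => affinePoint T (y p)) ∘ chart i =
      fun z => affineMap T ((-psForm 2 (Z z) (T infVec))⁻¹ • Z z) :=
  funext fun z => affinePoint_eq T (hZ.2 z)

theorem IsDual.contDiffAt_normalized {Z : ℂ → Fin 6 → ℝ} {C : Fin 6 → ℝ} (h : IsDual Z C) {z : ℂ}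
    (hz : psForm 2 (Z z) C ≠ 0) : ContDiffAt ℝ ∞ (fun w => (-psForm 2 (Z w) C)⁻¹ • Z w) z :=
  ((h.smooth_form.neg.contDiffAt).inv (neg_ne_zero.2 hz)).smul h.canon.smooth.contDiffAt

theorem IsDual.form_pd_normalized {Z : ℂ → Fin 6 → ℝ} {C : Fin 6 → ℝ} (h : IsDual Z C) {z : ℂ}
    (hz : psForm 2 (Z z) C ≠ 0) (i : Fin 2) :
    psForm 2 (pd i (fun w => (-psForm 2 (Z w) C)⁻¹ • Z w) z) C = 0 := by
  have hd := smoothAt_differentiableAt (h.contDiffAt_normalized hz)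
  have e : pd i (fun w => psForm 2 ((-psForm 2 (Z w) C)⁻¹ • Z w) C) z = 0 := by
    rw [pd_congr (X' := fun _ => (-1 : ℝ)), pd_const]
    filter_upwards [h.smooth_form.continuous.continuousAt.eventually_ne hz] with w hw
    rw [psForm_smul_left, inv_neg, neg_mul, inv_mul_cancel₀ hw]
  rwa [pd_psForm (G := fun _ => C) hd (differentiableAt_const _), pd_const, psForm_zero_right,
    add_zero] at e

/-- The normalized lift has constant pairing with the vertex, so its derivatives lie in the
hyperplane on which the affine projection is isometric. -/
theorem IsDual.firstForm_affine (hT : IsO42 T) {Z : ℂ → Fin 6 → ℝ} (h : IsDual Z (T infVec)) {z : ℂ}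
    (hz : psForm 2 (Z z) (T infVec) ≠ 0) :
    firstForm 1 (fun z => affineMap T ((-psForm 2 (Z z) (T infVec))⁻¹ • Z z)) z =
      ((-psForm 2 (Z z) (T infVec))⁻¹ ^ 2) • (1 : Matrix (Fin 2) (Fin 2) ℝ) := by
  have hd := smoothAt_differentiableAt (h.contDiffAt_normalized hz)
  have hf : DifferentiableAt ℝ (fun w => (-psForm 2 (Z w) (T infVec))⁻¹) z :=
    (smooth_differentiableAt h.smooth_form z).fun_neg.fun_inv (neg_ne_zero.2 hz)
  rw [← h.canon.unit z, ← firstForm_smul (smooth_differentiableAt h.canon.smooth z) hf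
    (.of_forall h.canon.null)]
  ext i j
  simp only [firstForm, Matrix.of_apply]
  rw [pd_clm (affineMap T) hd, pd_clm (affineMap T) hd,
    hT.psForm_affineMap (h.form_pd_normalized hz i) (h.form_pd_normalized hz j)]

/-- The Laplacian of the normalized lift is a multiple of the vertex, which the affine projection
kills. -/
theorem IsDual.lap_affine {Z : ℂ → Fin 6 → ℝ} (h : IsDual Z (T infVec)) {z : ℂ}
    (hz : psForm 2 (Z z) (T infVec) ≠ 0) :
    lap (fun z => affineMap T ((-psForm 2 (Z z) (T infVec))⁻¹ • Z z)) z = 0 := by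
  have hs := h.contDiffAt_normalized hz
  have key : ∀ i, pd i (pd i fun z => affineMap T ((-psForm 2 (Z z) (T infVec))⁻¹ • Z z)) z =
      affineMap T (pd i (pd i fun z => (-psForm 2 (Z z) (T infVec))⁻¹ • Z z) z) := fun i => by
    rw [← pd_clm (affineMap T) (smoothAt_differentiableAt (contDiffAt_pd hs i))]
    exact pd_congr ((eventually_differentiableAt hs).mono fun w hw => pd_clm (affineMap T) hw i) i
  rw [lap, key, key, ← map_add]
  change affineMap T (lap _ z) = 0
  rw [h.lap_normalized hz, map_smul, affineMap_infVec, smul_zero]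

theorem isSpacelikeStationary_affinePoint (hT : IsO42 T) (hY : ∀ i, IsLift i y (Y i))
    (hC : ∀ i, IsDual (Y i) (T infVec)) :
    IsSpacelikeStationary (endSet y (T infVec)) fun p => affinePoint T (y p) := by
  intro i
  rw [affinePoint_comp_chart (hY i)]
  have hn : ∀ z, chart i z ∉ endSet y (T infVec) → psForm 2 (Y i z) (T infVec) ≠ 0 := fun z hz =>
    mt (chart_mem_endSet_iff (hY i) _ z).2 hz
  refine ⟨fun z hz => ((affineMap T).contDiff.contDiffAt.comp z
    ((hC i).contDiffAt_normalized (hn z hz))).contDiffWithinAt, fun z hz => ?_⟩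
  have hff := (hC i).firstForm_affine hT (hn z hz)
  constructor
  · rw [hff]
    exact Matrix.PosDef.one.smul (sq_pos_of_ne_zero (inv_ne_zero (neg_ne_zero.2 (hn z hz))))
  · rw [meanCurvature_eq hff, (hC i).lap_affine (hn z hz)]
    simp [psForm_zero_left]

end Construction

end

section

/-! ### Completeness -/

/-- A path along which a function with gradient bounded by the speed diverges has infinite
length. -/
theorem lintegral_speed_eq_top {φ s : ℝ → ℝ} {K : ℝ} (hφ : ContDiff ℝ 1 φ) (hs : Continuous s)
    (hs0 : ∀ t, 0 ≤ s t) (hK : 0 ≤ K) (h : ∀ t, |deriv φ t| ≤ K * s t)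
    (hd : Filter.Tendsto φ Filter.atTop Filter.atBot) :
    ∫⁻ t in Set.Ioi (0 : ℝ), ENNReal.ofReal (s t) = ⊤ := by
  by_contra hne
  have hint : MeasureTheory.IntegrableOn s (Set.Ioi 0) :=
    (MeasureTheory.lintegral_ofReal_ne_top_iff_integrable hs.aestronglyMeasurable
      (.of_forall hs0)).1 hne
  have hcd : Continuous (deriv φ) := hφ.continuous_deriv le_rfl
  -- With finite total length φ would be bounded below, which contradicts its divergence to -∞.
  have key : ∀ t, 0 ≤ t → φ 0 - K * ∫ u in Set.Ioi (0 : ℝ), s u ≤ φ t := by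
    intro t ht
    have h1 : ∫ u in (0 : ℝ)..t, deriv φ u = φ t - φ 0 :=
      intervalIntegral.integral_deriv_eq_sub (fun u _ => hφ.differentiable one_ne_zero u)
        (hcd.intervalIntegrable _ _)
    have h2 : ‖∫ u in (0 : ℝ)..t, deriv φ u‖ ≤ ∫ u in (0 : ℝ)..t, K * s u :=
      intervalIntegral.norm_integral_le_of_norm_le ht (.of_forall fun u _ => h u)
        ((continuous_const.mul hs).intervalIntegrable _ _)
    have h3 : ∫ u in (0 : ℝ)..t, s u ≤ ∫ u in Set.Ioi (0 : ℝ), s u := by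
      rw [intervalIntegral.integral_of_le ht]
      exact MeasureTheory.setIntegral_mono_set hint (.of_forall hs0)
        (Filter.Eventually.of_forall fun u hu => hu.1)
    rw [h1, intervalIntegral.integral_const_mul, Real.norm_eq_abs] at h2
    have h4 := (abs_le.1 h2).1
    have h5 := mul_le_mul_of_nonneg_left h3 hK
    linarith
  obtain ⟨t, ht0, ht⟩ := ((Filter.eventually_ge_atTop (0 : ℝ)).and
    (hd.eventually (Filter.eventually_lt_atBot (φ 0 - K * ∫ u in Set.Ioi (0 : ℝ), s u)))).exists
  exact absurd (key t ht0) (not_le.2 ht)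

/-- The logarithm of the distance to the light cone with vertex `C`, in terms of a lift. -/
def logDist (Z : ℂ → Fin 6 → ℝ) (C : Fin 6 → ℝ) (z : ℂ) : ℝ :=
  2 * Real.log (psForm 2 (Z z) C) - Real.log (∑ k, Z z k ^ 2)

theorem log_endDist {y : OnePoint ℂ → Q41} {Z : ℂ → Fin 6 → ℝ} {i : Fin 2} {C : Fin 6 → ℝ}
    (hZ : IsLift i y Z) {z : ℂ} (hz : psForm 2 (Z z) C ≠ 0) :
    Real.log (endDist y C (chart i z)) = logDist Z C z := by
  rw [endDist_eq (hZ.2 z), Real.log_div (pow_ne_zero 2 hz) (sum_sq_pos (hZ.2 z).1).ne', Real.log_pow,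
    logDist]
  norm_num

namespace IsDual

variable {Z : ℂ → Fin 6 → ℝ} {C : Fin 6 → ℝ}

theorem contDiff_log_sum_sq (h : IsDual Z C) :
    ContDiff ℝ ∞ fun z => Real.log (∑ k, Z z k ^ 2) := by
  have hZ := contDiff_pi.1 h.canon.smooth
  exact (ContDiff.sum fun k _ => (hZ k).pow 2).log fun z => (sum_sq_pos (h.canon.ne_zero z)).ne'

theorem contDiffAt_logDist (h : IsDual Z C) {z : ℂ} (hz : psForm 2 (Z z) C ≠ 0) :
    ContDiffAt ℝ ∞ (logDist Z C) z :=
  (contDiffAt_const.mul (h.smooth_form.contDiffAt.log hz)).sub h.contDiff_log_sum_sq.contDiffAt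

/-- With g = ⟨Z,C⟩ the differential is 2 dg/g minus a smooth term. Multiplied by |g| it is bounded
on the closed disc even near the ends. -/
theorem exists_bound_logDist (h : IsDual Z C) : ∃ K, ∀ z, ‖z‖ ≤ 1 → psForm 2 (Z z) C ≠ 0 →
    ∀ v, |fderiv ℝ (logDist Z C) z v| ≤ K * (|psForm 2 (Z z) C|⁻¹ * ‖v‖) := by
  set g : ℂ → ℝ := fun z => psForm 2 (Z z) C with hg
  set q : ℂ → ℝ := fun z => Real.log (∑ k, Z z k ^ 2) with hq
  have hgs : ContDiff ℝ ∞ g := h.smooth_form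
  have hqs : ContDiff ℝ ∞ q := h.contDiff_log_sum_sq
  have hb : Continuous fun z => 2 * ‖fderiv ℝ g z‖ + |g z| * ‖fderiv ℝ q z‖ :=
    (continuous_const.mul (hgs.continuous_fderiv (by simp)).norm).add
      (hgs.continuous.abs.mul (hqs.continuous_fderiv (by simp)).norm)
  obtain ⟨K, hK⟩ := (isCompact_closedBall (0 : ℂ) 1).bddAbove_image hb.continuousOn
  refine ⟨K, fun z hz hz0 v => ?_⟩
  have hKz : 2 * ‖fderiv ℝ g z‖ + |g z| * ‖fderiv ℝ q z‖ ≤ K :=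
    hK ⟨z, by simpa using hz, rfl⟩
  have hg0 : g z ≠ 0 := hz0
  have hD : HasFDerivAt (logDist Z C) ((2 : ℝ) • ((g z)⁻¹ • fderiv ℝ g z) - fderiv ℝ q z) z :=
    (((smooth_differentiableAt hgs z).hasFDerivAt.log hg0).const_mul 2).sub
      (smooth_differentiableAt hqs z).hasFDerivAt
  have e1 : |fderiv ℝ g z v| ≤ ‖fderiv ℝ g z‖ * ‖v‖ := (fderiv ℝ g z).le_opNorm v
  have e2 : |fderiv ℝ q z v| ≤ ‖fderiv ℝ q z‖ * ‖v‖ := (fderiv ℝ q z).le_opNorm v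
  have hpos : 0 < |g z| := abs_pos.2 hg0
  rw [hD.fderiv]
  change |2 * ((g z)⁻¹ * fderiv ℝ g z v) - fderiv ℝ q z v| ≤ K * (|g z|⁻¹ * ‖v‖)
  calc |2 * ((g z)⁻¹ * fderiv ℝ g z v) - fderiv ℝ q z v|
      ≤ |2 * ((g z)⁻¹ * fderiv ℝ g z v)| + |fderiv ℝ q z v| := abs_sub _ _
    _ = 2 * |g z|⁻¹ * |fderiv ℝ g z v| + |fderiv ℝ q z v| := by
        rw [abs_mul, abs_mul, abs_inv, abs_two]; ring
    _ ≤ 2 * |g z|⁻¹ * (‖fderiv ℝ g z‖ * ‖v‖) + ‖fderiv ℝ q z‖ * ‖v‖ := by gcongr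
    _ = (2 * ‖fderiv ℝ g z‖ + |g z| * ‖fderiv ℝ q z‖) * (|g z|⁻¹ * ‖v‖) := by
        field_simp
    _ ≤ K * (|g z|⁻¹ * ‖v‖) := by gcongr

theorem speed_affine {T : (Fin 6 → ℝ) ≃ₗ[ℝ] (Fin 6 → ℝ)} (hT : IsO42 T) (h : IsDual Z (T infVec))
    {z : ℂ} (hz : psForm 2 (Z z) (T infVec) ≠ 0) (v : ℂ) :
    Real.sqrt (psForm 1
      (fderiv ℝ (fun z => affineMap T ((-psForm 2 (Z z) (T infVec))⁻¹ • Z z)) z v)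
      (fderiv ℝ (fun z => affineMap T ((-psForm 2 (Z z) (T infVec))⁻¹ • Z z)) z v)) =
      |psForm 2 (Z z) (T infVec)|⁻¹ * ‖v‖ := by
  have hf := h.firstForm_affine hT hz
  have e := fun i j => congrFun (congrFun hf i) j
  simp only [firstForm, Matrix.of_apply, Matrix.smul_apply, Matrix.one_apply, smul_eq_mul] at e
  rw [fderiv_apply_eq_pd]
  simp only [psForm_add_left, psForm_add_right, psForm_smul_left, psForm_smul_right, e]
  have hs : ∀ a : ℝ, v.re * (v.re * ((-a)⁻¹ ^ 2 * 1)) + v.im * (v.im * ((-a)⁻¹ ^ 2 * 1)) =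
      (|a|⁻¹ * ‖v‖) ^ 2 := fun a => by
    rw [mul_pow, ← Complex.normSq_eq_norm_sq, Complex.normSq_apply, inv_neg, neg_sq, inv_pow |a|,
      sq_abs]
    ring
  have hn : 0 ≤ |psForm 2 (Z z) (T infVec)|⁻¹ * ‖v‖ := by positivity
  rw [← Real.sqrt_sq hn, ← hs]
  congr 1
  simp

end IsDual

section Complete

variable {y : OnePoint ℂ → Q41} {Y : Fin 2 → ℂ → Fin 6 → ℝ} {C : Fin 6 → ℝ}
  {T : (Fin 6 → ℝ) ≃ₗ[ℝ] (Fin 6 → ℝ)}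

/-- The sets where the distance is at least exp b are compact and avoid the ends, so a divergent
path leaves each of them. -/
theorem tendsto_log_endDist (hY : ∀ i, IsLift i y (Y i)) (hC : ∀ i, IsDual (Y i) C)
    {γ : ℝ → OnePoint ℂ} (hγ : ∀ t, γ t ∉ endSet y C)
    (hd : ∀ K : Set (OnePoint ℂ), IsCompact K → K ⊆ (endSet y C)ᶜ → ∀ᶠ t in Filter.atTop, γ t ∉ K) :
    Filter.Tendsto (fun t => Real.log (endDist y C (γ t))) Filter.atTop Filter.atBot := by
  refine Filter.tendsto_atBot.2 fun b => ?_
  set h : Fin 2 → ℂ → ℝ := fun i z => psForm 2 (Y i z) C ^ 2 / ∑ k, Y i z k ^ 2 with hh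
  have hcont : ∀ i, Continuous (h i) := fun i =>
    ((hC i).smooth_form.continuous.pow 2).div
      (continuous_finsetSum _ fun k _ => ((continuous_apply k).comp (hY i).1.continuous).pow 2)
      fun z => (sum_sq_pos ((hY i).2 z).1).ne'
  have hK : IsCompact (⋃ i, chart i '' (Metric.closedBall 0 1 ∩ {z | Real.exp b ≤ h i z})) :=
    isCompact_iUnion fun i => ((isCompact_closedBall 0 1).inter_right
      (isClosed_le continuous_const (hcont i))).image (continuous_chart i)
  refine (hd _ hK ?_).mono fun t ht => ?_
  · rintro p hp hpF
    obtain ⟨i, z, ⟨-, hz⟩, rfl⟩ := Set.mem_iUnion.1 hp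
    have h0 := (chart_mem_endSet_iff (hY i) C z).1 hpF
    have : Real.exp b ≤ 0 := by simpa [hh, h0] using hz
    exact absurd this (not_le.2 (Real.exp_pos b))
  · obtain ⟨i, z, hz, hp⟩ := exists_chart (γ t)
    have h0 : psForm 2 (Y i z) C ≠ 0 := fun h0 =>
      hγ t (hp ▸ (chart_mem_endSet_iff (hY i) C z).2 h0)
    have h1 : h i z < Real.exp b := by
      by_contra hle
      exact ht (Set.mem_iUnion.2 ⟨i, z, ⟨by simpa using hz, not_lt.1 hle⟩, hp⟩)
    have hpos : 0 < h i z := div_pos (sq_pos_of_ne_zero h0) (sum_sq_pos ((hY i).2 z).1)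
    rw [← hp, endDist_eq ((hY i).2 z)]
    exact ((Real.log_lt_iff_lt_exp hpos).2 h1).le

/-- The logarithm of the distance to the cone of the vertex changes at a rate bounded by the speed
of the path in ℝ⁴₁, and it tends to -∞ along a divergent path. -/
theorem isCompleteSurface_affinePoint (hT : IsO42 T) (hY : ∀ i, IsLift i y (Y i))
    (hC : ∀ i, IsDual (Y i) (T infVec)) :
    IsCompleteSurface (endSet y (T infVec)) fun p => affinePoint T (y p) := by
  intro γ hγ hF hd
  choose K hK using fun i => (hC i).exists_bound_logDist
  set M : ℝ := max 0 (max (K 0) (K 1)) with hM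
  have hKM : ∀ i, K i ≤ M := fun i => by
    fin_cases i
    · exact (le_max_left _ _).trans (le_max_right _ _)
    · exact (le_max_right _ _).trans (le_max_right _ _)
  set x : ℝ → Fin 4 → ℝ := (fun p => affinePoint T (y p)) ∘ γ with hx
  set φ : ℝ → ℝ := fun t => Real.log (endDist y (T infVec) (γ t)) with hφ
  set X : Fin 2 → ℂ → Fin 4 → ℝ := fun i z =>
    affineMap T ((-psForm 2 (Y i z) (T infVec))⁻¹ • Y i z) with hX
  have local_form : ∀ t, ∃ (i : Fin 2) (c : ℝ → ℂ), ContDiffAt ℝ 1 c t ∧ ‖c t‖ ≤ 1 ∧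
      psForm 2 (Y i (c t)) (T infVec) ≠ 0 ∧ x =ᶠ[nhds t] X i ∘ c ∧
      φ =ᶠ[nhds t] logDist (Y i) (T infVec) ∘ c := by
    intro t
    obtain ⟨i, c, hc, hc1, he⟩ := hγ.exists_chart t
    have hne : ∀ s, γ s = chart i (c s) → psForm 2 (Y i (c s)) (T infVec) ≠ 0 := fun s hs h0 =>
      hF s (hs ▸ (chart_mem_endSet_iff (hY i) _ (c s)).2 h0)
    refine ⟨i, c, hc, hc1, hne t he.self_of_nhds, he.mono fun s hs => ?_, he.mono fun s hs => ?_⟩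
    · rw [hx, Function.comp_apply, hs]
      exact congrFun (affinePoint_comp_chart (T := T) (hY i)) (c s)
    · simp only [hφ, hs, Function.comp_apply]
      exact log_endDist (hY i) (hne s hs)
  have hXs : ∀ i z, psForm 2 (Y i z) (T infVec) ≠ 0 → ContDiffAt ℝ ∞ (X i) z := fun i z hz =>
    (affineMap T).contDiff.contDiffAt.comp z ((hC i).contDiffAt_normalized hz)
  have hxs : ContDiff ℝ 1 x := contDiff_iff_contDiffAt.2 fun t => by
    obtain ⟨i, c, hc, -, h0, hx1, -⟩ := local_form t
    exact (((hXs i _ h0).of_le (by simp)).comp t hc).congr_of_eventuallyEq hx1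
  have hφs : ContDiff ℝ 1 φ := contDiff_iff_contDiffAt.2 fun t => by
    obtain ⟨i, c, hc, -, h0, -, hφ1⟩ := local_form t
    exact ((((hC i).contDiffAt_logDist h0).of_le (by simp)).comp t hc).congr_of_eventuallyEq hφ1
  have hdx : Continuous (deriv x) := hxs.continuous_deriv le_rfl
  refine lintegral_speed_eq_top (K := M) hφs ?_ (fun t => Real.sqrt_nonneg _) (le_max_left _ _)
    (fun t => ?_) (tendsto_log_endDist hY hC hF hd)
  · refine Real.continuous_sqrt.comp ?_
    simp only [psForm_one_four]
    have hk := fun k => (continuous_apply k).comp hdx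
    exact ((((hk 0).mul (hk 0)).add ((hk 1).mul (hk 1))).add ((hk 2).mul (hk 2))).sub
      ((hk 3).mul (hk 3))
  · obtain ⟨i, c, hc, hc1, h0, hx1, hφ1⟩ := local_form t
    have hcd : HasDerivAt c (deriv c t) t := (hc.differentiableAt one_ne_zero).hasDerivAt
    have e1 : deriv x t = fderiv ℝ (X i) (c t) (deriv c t) := by
      rw [hx1.deriv_eq]
      exact ((smoothAt_differentiableAt (hXs i _ h0)).hasFDerivAt.comp_hasDerivAt t hcd).deriv
    have e2 : deriv φ t = fderiv ℝ (logDist (Y i) (T infVec)) (c t) (deriv c t) := by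
      rw [hφ1.deriv_eq]
      exact ((smoothAt_differentiableAt
        ((hC i).contDiffAt_logDist h0)).hasFDerivAt.comp_hasDerivAt t hcd).deriv
    rw [e1, e2, (hC i).speed_affine hT h0]
    exact (hK i _ hc1 h0 _).trans (mul_le_mul_of_nonneg_right (hKM i) (by positivity))

end Complete

/-- Every Willmore sphere is the compactification of a complete stationary surface. -/
theorem IsWillmore.isCompactifiedStationary {y : OnePoint ℂ → Q41} (hy : IsConformalSpacelike y)
    (hW : IsWillmore y) : IsCompactifiedStationary y := by
  obtain ⟨Y₀, hY₀⟩ := exists_canonicalLift hy 0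
  obtain ⟨Y₁, hY₁, hYY⟩ := exists_transition hy hY₀
  obtain ⟨L, R, hF⟩ := exists_frame hY₀.isCanon
  obtain ⟨C, hC0, hCC, hC⟩ := hF.exists_dual hYY (isEulerLagrange_of_isWillmore hW hY₀ hY₁ hYY hF)
    (isEulerLagrange_of_isWillmore hW hY₀ hY₁ hYY hF.symm)
  -- The dual vector becomes the image of the vertex of the light cone at infinity, and the ends are
  -- the points that y sends into its cone.
  obtain ⟨T, hT, rfl⟩ := exists_isO42 hC0 hCC
  have hD₀ : IsDual Y₀ (T infVec) := hF.isDual hY₀.isCanon hC0 hCC hC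
  have hD : ∀ i, IsDual ((![Y₀, Y₁] : Fin 2 → ℂ → Fin 6 → ℝ) i) (T infVec) := fun i => by
    fin_cases i
    · exact hD₀
    · exact hD₀.transition hYY
  have hY : ∀ i, IsLift i y ((![Y₀, Y₁] : Fin 2 → ℂ → Fin 6 → ℝ) i) := fun i => by
    fin_cases i
    · exact hY₀.1
    · exact hY₁.1
  refine ⟨hy, T, endSet y (T infVec), fun p => affinePoint T (y p), hT, finite_endSet hY hD,
    isSpacelikeStationary_affinePoint hT hY hD, isCompleteSurface_affinePoint hT hY hD,
    fun p hp => ?_, fun p hp => ?_⟩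
  · have hr := represents_someRep (y p)
    have hp' : psForm 2 (someRep (y p)) (T infVec) ≠ 0 := hp
    change Represents (T (phi0 (affinePoint T (y p)))) (y p)
    rw [affinePoint, hT.phi0_affineMap]
    · exact hr.smul (inv_ne_zero (neg_ne_zero.2 hp'))
    · rw [psForm_smul_left, psForm_smul_right, hr.null, mul_zero, mul_zero]
    · rw [psForm_smul_left, inv_neg, neg_mul, inv_mul_cancel₀ hp']
  · refine ⟨T.symm (someRep (y p)), ?_, ?_⟩
    · have h0 : psForm 2 (someRep (y p)) (T infVec) = 0 := hp
      rw [hT.form_infVec] at h0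
      linarith
    · rw [T.apply_symm_apply]
      exact represents_someRep (y p)

end

end LorentzWillmore

end

theorem theorem6p2 (y : OnePoint ℂ → LorentzWillmore.Q41)
    (hy : LorentzWillmore.IsConformalSpacelike y) (hW : LorentzWillmore.IsWillmore y) :
    (LorentzWillmore.IsCompactifiedStationary y ∨ LorentzWillmore.IsPolarOfStationary y) ∧
    (LorentzWillmore.IsPolarOfStationary y ↔
      LorentzWillmore.IsNullUmbilic y ∧ ¬ LorentzWillmore.IsTotallyUmbilic y) ∧
    (LorentzWillmore.IsPolarOfStationary y → LorentzWillmore.willmore y = 0) ∧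
    (LorentzWillmore.IsNullUmbilic y → LorentzWillmore.willmore y = 0) := by
  -- A Willmore sphere is never of kind (ii), and null-umbilic forces totally umbilic, so both sides
  -- of the equivalence are refuted.
  have hn := LorentzWillmore.not_isPolarOfStationary hy hW
  have hu : LorentzWillmore.IsNullUmbilic y → LorentzWillmore.IsTotallyUmbilic y :=
    hW.isTotallyUmbilic hy
  exact ⟨Or.inl (hW.isCompactifiedStationary hy),
    ⟨fun h => absurd h hn, fun h => absurd (hu h.1) h.2⟩, fun h => absurd h hn,
    fun h => LorentzWillmore.willmore_eq_zero hy (hu h)⟩
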